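/- Identify the unit circle $\mathbb S\subset\mathbb C$ with $\mathbb R/\mathbb Z$ and let $\sigma=\sigma_2:z\mapsto z^2$ (angle doubling). A \emph{quadratic invariant lamination} is an equivalence relation $\sim$ on $\mathbb S$ with closed graph, such that (i) if $t_1\sim t_2$, $t_3\sim t_4$ and $t_2\not\sim t_3$, then the open segments $t_1t_2$ and $t_3t_4$ are disjoint; (ii) all classes are finite (hence totally disconnected); (iii) the $\sigma$-image of a class is a class, and the $\sigma$-preimage of a class splits into at most two classes; (iv) for every class $g$ the map $\sigma:g\to\sigma(g)$ extends to an orientation preserving covering map $F:\mathbb S\to\mathbb S$ with $F^{-1}(\sigma(g))=g$. It is \emph{non-empty} if some class has more than one point. The \emph{leaves} of $\sim$ are the edges of the convex hulls of its classes and the points of $\mathbb S$; a \emph{gap} is the closure of a component of the open unit disk minus the union of all leaves; the \emph{basis} of a gap or leaf $G$ is $G'=G\cap\mathbb S$. Infinite gaps are called \emph{Fatou gaps}. A \emph{hole} of a closed set $A\subset\mathbb S$ is a component $(a,b)$ of $\mathbb S\setminus A$, written as a positively oriented arc. A non-empty closed set $A\subset\mathbb S$ (or its convex hull) is a \emph{periodic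 laminational set} of period $n\ge1$ if $n$ is the least positive integer with $\sigma^n(A)=A$, the convex hulls of $A,\sigma(A),\dots,\sigma^{n-1}(A)$ have pairwise disjoint interiors, and for every $i\ge 0$ and every hole $(a,b)$ of $\sigma^i(A)$ either $\sigma(a)=\sigma(b)$ or $(\sigma(a),\sigma(b))$ is a hole of $\sigma^{i+1}(A)$. It is \emph{rotational} if either $A$ is finite and $\sigma^n$ has no fixed point in $A$, or it is \emph{Siegel}: $A$ is infinite and the monotone degree one map of $\mathbb S$ that collapses precisely the closures of the holes of $A$ semiconjugates $\sigma^n|_A$ to an irrational rotation. It is \emph{invariant} if $n=1$. A non-degenerate gap or leaf of $\sim$ is a periodic (invariant) rotational gap or leaf if its basis is a periodic (invariant) rotational set. Let $G$ be an invariant rotational gap or leaf. If $G$ is finite, its \emph{canonical lamination} is the only quadratic invariant lamination that has a cycle of Fatou gaps attached to the edges of $G$, i.e. a periodic $\sigma$-orbit of Fatou gaps each of which shares an edge with $G$ and lies on the other side of that edge from $G$, such that every edge of $G$ has a gap of the orbit attached to it (a leaf is regarded as having two edges, one for each of its sides). If $G$ is a Siegel gap, its canonical lamination is the only quadratic invariant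 lamination that has $G$ as a gap. \textbf{Proposition.} Let $\sim$ be a non-empty quadratic invariant lamination with at most one periodic rotational gap or leaf. Then $\sim$ has an invariant rotational gap or leaf $G$, and $\sim$ is the canonical lamination of $G$ (in particular, it is the only quadratic invariant lamination with the property that defines the canonical lamination of $G$). -/

import Mathlib

/-!
The unit circle is `UnitAddCircle = ℝ/ℤ`; `pt x = exp (2πix)` is the corresponding point of the
complex plane.  Gaps and leaves are recorded by their bases, that is, by their intersections with
the unit circle; the set itself is the convex hull of its basis.
-/

namespace QuadLam

/-- The point `exp (2πix)` of the unit circle in `ℂ`. -/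
noncomputable def pt (x : UnitAddCircle) : ℂ := (AddCircle.toCircle x : ℂ)

/-- The map `σ_d`, i.e. `z ↦ z ^ d` on the unit circle, in the additive coordinate. -/
def sigma (d : ℕ) (x : UnitAddCircle) : UnitAddCircle := d • x

/-- The convex hull, in the closed unit disk, of a subset of the circle. -/
noncomputable def hull (A : Set UnitAddCircle) : Set ℂ := convexHull ℝ (pt '' A)

/-- The positively oriented arc from `a` to `b` is a hole (complementary component) of the set
`A`, and its endpoints are distinct.  `Set.cIoo a b` is the open positively oriented arc. -/
def IsHole (A : Set UnitAddCircle) (a b : UnitAddCircle) : Prop :=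
  a ∈ A ∧ b ∈ A ∧ a ≠ b ∧ Disjoint (Set.cIoo a b) A

/-- `ab` is an edge of the convex hull of the closed set `A`: a chord that cuts off a hole. -/
def IsEdge (A : Set UnitAddCircle) (a b : UnitAddCircle) : Prop :=
  IsHole A a b ∨ IsHole A b a

/-- A lamination: an equivalence relation on the circle whose graph is closed, whose classes are
pairwise unlinked, and whose classes are totally disconnected. -/
structure IsLamination (r : Setoid UnitAddCircle) : Prop where
  closed : IsClosed {p : UnitAddCircle × UnitAddCircle | r p.1 p.2}
  unlinked : ∀ t₁ t₂ t₃ t₄ : UnitAddCircle, r t₁ t₂ → r t₃ t₄ → ¬ r t₂ t₃ →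
    Disjoint (openSegment ℝ (pt t₁) (pt t₂)) (openSegment ℝ (pt t₃) (pt t₄))
  totallyDisconnected : ∀ g ∈ r.classes, IsTotallyDisconnected g

/-- `F` is an orientation preserving covering map of the circle to itself: it lifts to a strictly
increasing continuous map `f` of the line with `f (x + 1) = f x + k` (the degree is `k`). -/
def IsOrientationPreservingCovering (F : UnitAddCircle → UnitAddCircle) : Prop :=
  ∃ (f : ℝ → ℝ) (k : ℕ), Continuous f ∧ StrictMono f ∧ (∀ x, f (x + 1) = f x + k) ∧
    ∀ x : ℝ, F (x : UnitAddCircle) = (f x : UnitAddCircle)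

/-- A `σ_d`-invariant lamination. -/
structure IsInvariantLamination (d : ℕ) (r : Setoid UnitAddCircle) : Prop
    extends IsLamination r where
  forward : ∀ g ∈ r.classes, sigma d '' g ∈ r.classes
  backward : ∀ g ∈ r.classes,
    {h | h ∈ r.classes ∧ (h ∩ sigma d ⁻¹' g).Nonempty}.encard ≤ d
  covering : ∀ g ∈ r.classes, ∃ F : UnitAddCircle → UnitAddCircle,
    IsOrientationPreservingCovering F ∧ Set.EqOn F (sigma d) g ∧ F ⁻¹' (sigma d '' g) = g
  finite : ∀ g ∈ r.classes, g.Finite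

/-- The (possibly degenerate) chord `ab` is a leaf of `r`. -/
def IsLeaf (r : Setoid UnitAddCircle) (a b : UnitAddCircle) : Prop :=
  a = b ∨ (r a b ∧ IsEdge {x | r a x} a b)

/-- The union of all leaves of `r`. -/
def leafUnion (r : Setoid UnitAddCircle) : Set ℂ :=
  {z | ∃ a b, IsLeaf r a b ∧ z ∈ segment ℝ (pt a) (pt b)}

/-- `G` is a gap of `r`: the closure of a component of the open unit disk minus all leaves. -/
def IsGap (r : Setoid UnitAddCircle) (G : Set ℂ) : Prop :=
  ∃ z ∈ Metric.ball (0 : ℂ) 1 \ leafUnion r,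
    G = closure (connectedComponentIn (Metric.ball (0 : ℂ) 1 \ leafUnion r) z)

/-- `A` is the basis of a gap of `r`. -/
def IsGapBasis (r : Setoid UnitAddCircle) (A : Set UnitAddCircle) : Prop :=
  ∃ G : Set ℂ, IsGap r G ∧ A = {x | pt x ∈ G}

/-- `A` is the basis of a Fatou gap, i.e. of an infinite gap, of `r`. -/
def IsFatouGapBasis (r : Setoid UnitAddCircle) (A : Set UnitAddCircle) : Prop :=
  IsGapBasis r A ∧ A.Infinite

/-- `A` is the set of endpoints of a non-degenerate leaf of `r`. -/
def IsLeafBasis (r : Setoid UnitAddCircle) (A : Set UnitAddCircle) : Prop :=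
  ∃ a b, a ≠ b ∧ IsLeaf r a b ∧ A = {a, b}

/-- `A` is a periodic laminational set for `σ_d`, of minimal period `n`. -/
structure IsPeriodicLaminational (d n : ℕ) (A : Set UnitAddCircle) : Prop where
  nonempty : A.Nonempty
  closed : IsClosed A
  pos : 0 < n
  periodic : (sigma d)^[n] '' A = A
  minimal : ∀ m, 0 < m → m < n → (sigma d)^[m] '' A ≠ A
  disjoint : ∀ i j, i < j → j < n →
    Disjoint (interior (hull ((sigma d)^[i] '' A))) (interior (hull ((sigma d)^[j] '' A)))
  holes : ∀ i a b, IsHole ((sigma d)^[i] '' A) a b →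
    sigma d a = sigma d b ∨ IsHole ((sigma d)^[i + 1] '' A) (sigma d a) (sigma d b)

/-- `ψ` is the projection of the circle that collapses the holes of `A`: a monotone degree one
map, constant on the closure of every hole of `A`, such that distinct points of `A` are identified
only if they are the endpoints of one edge. -/
def IsHoleCollapse (A : Set UnitAddCircle) (ψ : UnitAddCircle → UnitAddCircle) : Prop :=
  (∃ f : ℝ → ℝ, Continuous f ∧ Monotone f ∧ (∀ x, f (x + 1) = f x + 1) ∧
    ∀ x : ℝ, ψ (x : UnitAddCircle) = (f x : UnitAddCircle)) ∧
  (∀ a b, IsHole A a b → ∀ x ∈ Set.cIcc a b, ψ x = ψ a) ∧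
  (∀ x ∈ A, ∀ y ∈ A, ψ x = ψ y → x = y ∨ IsEdge A x y)

/-- The `n`-th iterate of `σ_d` on the infinite set `A` of period `n` is semiconjugate, by the
collapse of the holes of `A`, to an irrational rotation. -/
def IsSiegel (d n : ℕ) (A : Set UnitAddCircle) : Prop :=
  A.Infinite ∧ ∃ (ψ : UnitAddCircle → UnitAddCircle) (τ : ℝ), IsHoleCollapse A ψ ∧ Irrational τ ∧
    ∀ x ∈ A, ψ ((sigma d)^[n] x) = ψ x + (τ : UnitAddCircle)

/-- `A` is a periodic rotational set for `σ_d` of (minimal) period `n`: a finite periodic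
laminational set without refixed points, or a Siegel gap. -/
def IsRotationalSet (d n : ℕ) (A : Set UnitAddCircle) : Prop :=
  IsPeriodicLaminational d n A ∧
    ((A.Finite ∧ ∀ x ∈ A, (sigma d)^[n] x ≠ x) ∨ IsSiegel d n A)

/-- `A` is (the basis of) a gap or a non-degenerate leaf of `r`. -/
def IsGapOrLeaf (r : Setoid UnitAddCircle) (A : Set UnitAddCircle) : Prop :=
  IsGapBasis r A ∨ IsLeafBasis r A

/-- `A` is (the basis of) a periodic rotational gap or leaf of the `σ_d`-invariant lamination
`r`. -/
def IsPeriodicRotationalGapOrLeaf (d : ℕ) (r : Setoid UnitAddCircle)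
    (A : Set UnitAddCircle) : Prop :=
  IsGapOrLeaf r A ∧ ∃ n, IsRotationalSet d n A

/-- `A` is (the basis of) an invariant rotational gap or leaf of `r`. -/
def IsInvariantRotationalGapOrLeaf (d : ℕ) (r : Setoid UnitAddCircle)
    (A : Set UnitAddCircle) : Prop :=
  IsGapOrLeaf r A ∧ IsRotationalSet d 1 A

/-- `r` has a cycle of Fatou gaps attached to the edges of the finite set `A`: a periodic orbit of
Fatou gaps, each of which shares an edge with `A` and lies behind that edge (`IsHole A a b` and
`IsHole W b a` say that `ab` is an edge of both sets and that they lie on opposite sides of it),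
such that each edge of `A` has a gap of the orbit attached to it.  A leaf has two edges, one for
each of its sides. -/
def HasAttachedFatouCycle (d : ℕ) (r : Setoid UnitAddCircle) (A : Set UnitAddCircle) : Prop :=
  ∃ (V : Set UnitAddCircle) (n : ℕ), 0 < n ∧ (sigma d)^[n] '' V = V ∧
    (∀ i, IsFatouGapBasis r ((sigma d)^[i] '' V)) ∧
    (∀ i, ∃ a b, IsHole A a b ∧ IsHole ((sigma d)^[i] '' V) b a) ∧
    (∀ a b, IsHole A a b → ∃ i, IsHole ((sigma d)^[i] '' V) b a)

/-- The property that singles out the canonical lamination of an invariant rotational set `A`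
among the quadratic invariant laminations: if `A` is finite, there is a cycle of Fatou gaps
attached to the edges of `A`; if `A` is infinite (a Siegel gap), then `A` is a gap. -/
def Carries (r : Setoid UnitAddCircle) (A : Set UnitAddCircle) : Prop :=
  (A.Finite → HasAttachedFatouCycle 2 r A) ∧ (A.Infinite → IsGapBasis r A)

/-- `r` is the canonical lamination of `A`: the only quadratic invariant lamination with the above
property. -/
def IsCanonicalLamination (r : Setoid UnitAddCircle) (A : Set UnitAddCircle) : Prop :=
  IsInvariantLamination 2 r ∧ Carries r A ∧
    ∀ s : Setoid UnitAddCircle, IsInvariantLamination 2 s → Carries s A → s = r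

end QuadLam

open Set

namespace QuadLam

/-! ### Arcs and chords of the circle -/

/-! The proof is a renormalization argument. Cut the circle at the fixed point `0`, or take the arc
behind the longest hole of an invariant class. In an affine coordinate on that arc, with values in
`[0, 1]`, the first return of doubling has two expanding branches, `t ↦ N * t` near `0` and `t ↦ N *
(t - δ)` near `1`, where `N = 2 ^ q` and translation by `δ` is the half turn. `Ren` records what the
lamination induces there. A strip pair is an equivalent pair that separates the boundary chord from
its half turn image.

The heart is the dichotomy `Ren.exists_invariant_or_siegel`: a strip pair forces a class fixed by
the return map, or a Siegel gap. Suppose that there is no fixed class. The image of a strip pair is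
then nested strictly inside or strictly outside of it, and extremal choices give a pair `I` that
moves inward and its preimage `O` inside `I` with no pair in between (`Ren.exists_frame`). If `I`
were not a diameter, its successive images, up to the time when they reach `O`, would be disjoint
chords over the two arcs between `I` and `O`; a geometric sum shows that they fill these arcs, so
`I` and `O` lie in one class, which is then fixed (`Frame.length_eq`). Hence `I` is a diameter.
Collapsing everything outside the strip between `I` and `O` gives a monotone degree one map. Were
its translation number rational, every point of its periodic orbits would be repelling on both
sides, which the intermediate value theorem forbids (`Model.irrational`). The translation number is
thus irrational, and the points where the semiconjugacy to the rotation is not locally constant form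
the Siegel set. Its holes are eventually mapped to `O`, so their endpoints are equivalent; a pair
crossing the set would be moved by the almost periodic rotation to pairs linked with itself, against
the finiteness of classes (`SemiModel.not_good`).

At the fixed point, expansion turns any non-trivial pair into a strip pair, so there is a finite
invariant rotational class or an invariant Siegel gap.

Uniqueness in the finite case: the holes of the class form one cycle, and the same renormalization
applies behind its longest edge. A strip pair there would produce a second periodic rotational set,
so there is none. The points whose orbits avoid the middle of the arc then form a Cantor set, which
is the attached Fatou gap, and expansion reduces every equivalence to the known ones
(`Cycle.rel_of_rel`). Conversely, a Fatou gap attached to the longest edge excludes strip pairs in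
any competing lamination, because strip pairs accumulate on that edge.

Uniqueness in the Siegel case: the gap lies in a half circle, equivalent pairs lie over its holes,
and doubling together with the half turn enlarges such pairs until they become the diameter
(`HalfSet.le_of_isFatouGapBasis`). -/

theorem sbtw_coe_iff {s t : ℝ} (h₁ : s < t) (h₂ : t < s + 1) (x : UnitAddCircle) :
    sbtw (s : UnitAddCircle) x (t : UnitAddCircle) ↔
      ∃ z : ℝ, s < z ∧ z < t ∧ (z : UnitAddCircle) = x := by
  obtain ⟨z, hz, rfl⟩ : ∃ z : ℝ, z ∈ Ico s (s + 1) ∧ (z : UnitAddCircle) = x := by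
    have := AddCircle.coe_image_Ico_eq (1 : ℝ) s
    have hx : x ∈ ((↑) : ℝ → AddCircle (1 : ℝ)) '' Ico s (s + 1) := by rw [this]; trivial
    exact hx
  have e1 : toIocMod (zero_lt_one' ℝ) t s = s + 1 := by
    rw [toIocMod_eq_iff]
    exact ⟨⟨by linarith, by linarith⟩, -1, by simp⟩
  -- The order on the circle is defined by representatives in windows that begin at the first point;
  -- with base `t` the point `s` is read as `s + 1`, and only the representative of `z` remains to
  -- be found.
  have key : btw (t : UnitAddCircle) (z : UnitAddCircle) (s : UnitAddCircle) ↔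
      toIcoMod (zero_lt_one' ℝ) t z ≤ s + 1 := by
    rw [← e1]; exact QuotientAddGroup.btw_coe_iff
  rw [sbtw_iff_not_btw, key]
  rcases lt_or_ge z t with hzt | hzt
  · have e2 : toIcoMod (zero_lt_one' ℝ) t z = z + 1 := by
      rw [toIcoMod_eq_iff]
      exact ⟨⟨by linarith [hz.1], by linarith⟩, -1, by simp⟩
    rw [e2]
    constructor
    · intro h; exact ⟨z, by linarith, hzt, rfl⟩
    · rintro ⟨w, hw1, hw2, hw⟩ h
      have : (w : UnitAddCircle) = (z : UnitAddCircle) := hw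
      have h3 := (AddCircle.coe_eq_coe_iff_of_mem_Ico (p := (1 : ℝ)) (a := s)
        ⟨hw1.le, by linarith⟩ hz).1 this
      linarith
  · have e2 : toIcoMod (zero_lt_one' ℝ) t z = z := by
      rw [toIcoMod_eq_iff]
      exact ⟨⟨hzt, by linarith [hz.2]⟩, 0, by simp⟩
    rw [e2]
    constructor
    · intro h; exact absurd hz.2.le h
    · rintro ⟨w, hw1, hw2, hw⟩ h
      have h3 := (AddCircle.coe_eq_coe_iff_of_mem_Ico (p := (1 : ℝ)) (a := s)
        ⟨hw1.le, by linarith⟩ hz).1 hw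
      linarith

theorem coe_eq_iff {x y : ℝ} : (x : UnitAddCircle) = y ↔ ∃ n : ℤ, y = x + n := by
  rw [eq_comm, ← sub_eq_zero, ← AddCircle.coe_sub, AddCircle.coe_eq_zero_iff]
  constructor
  · rintro ⟨n, hn⟩; exact ⟨n, by simp at hn; linarith⟩
  · rintro ⟨n, hn⟩; exact ⟨n, by simp [hn]⟩

theorem coe_add_int (x : ℝ) (n : ℤ) : ((x + n : ℝ) : UnitAddCircle) = x :=
  (coe_eq_iff.2 ⟨n, rfl⟩).symm

theorem coe_add_one (x : ℝ) : ((x + 1 : ℝ) : UnitAddCircle) = x := by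
  simp

theorem exists_lift (x : UnitAddCircle) (s : ℝ) : ∃ z : ℝ, s ≤ z ∧ z < s + 1 ∧ (z : UnitAddCircle) = x := by
  have := AddCircle.coe_image_Ico_eq (1 : ℝ) s
  have hx : x ∈ ((↑) : ℝ → AddCircle (1 : ℝ)) '' Ico s (s + 1) := by rw [this]; trivial
  obtain ⟨z, hz, h⟩ := hx
  exact ⟨z, hz.1, hz.2, h⟩

theorem exists_lift_of_ne {x : UnitAddCircle} {s : ℝ} (h : x ≠ (s : UnitAddCircle)) :
    ∃ z : ℝ, s < z ∧ z < s + 1 ∧ (z : UnitAddCircle) = x := by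
  obtain ⟨z, h1, h2, rfl⟩ := exists_lift x s
  refine ⟨z, lt_of_le_of_ne h1 ?_, h2, rfl⟩
  rintro rfl; exact h rfl

theorem coe_inj_of_lt {x y : ℝ} (h : (x : UnitAddCircle) = y) (h1 : x < y + 1) (h2 : y < x + 1) :
    x = y := by
  obtain ⟨n, hn⟩ := coe_eq_iff.1 h
  have a : (n : ℝ) < 1 := by linarith
  have b : (-1 : ℝ) < n := by linarith
  have a' : n < 1 := by exact_mod_cast a
  have b' : -1 < n := by exact_mod_cast b
  have : n = 0 := by omega
  subst this; simp at hn; exact hn.symm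

theorem coe_ne_of_lt {x y : ℝ} (h1 : x < y) (h2 : y < x + 1) : (x : UnitAddCircle) ≠ y := by
  intro h
  have := coe_inj_of_lt h (by linarith) h2
  linarith

theorem isHole_coe_iff {A : Set UnitAddCircle} {s t : ℝ} (h₁ : s < t) (h₂ : t < s + 1) :
    IsHole A s t ↔ (s : UnitAddCircle) ∈ A ∧ (t : UnitAddCircle) ∈ A ∧
      ∀ z : ℝ, s < z → z < t → (z : UnitAddCircle) ∉ A := by
  unfold IsHole
  constructor
  · rintro ⟨a, b, c, d⟩
    refine ⟨a, b, fun z hz1 hz2 hz => Set.disjoint_left.1 d ?_ hz⟩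
    exact (sbtw_coe_iff h₁ h₂ _).2 ⟨z, hz1, hz2, rfl⟩
  · rintro ⟨a, b, c⟩
    refine ⟨a, b, coe_ne_of_lt h₁ h₂, Set.disjoint_left.2 ?_⟩
    intro x hx hxA
    obtain ⟨z, hz1, hz2, rfl⟩ := (sbtw_coe_iff h₁ h₂ _).1 hx
    exact c z hz1 hz2 hxA

/-- A hole has real representatives of its endpoints less than one turn apart. -/
theorem IsHole.exists_lift {A : Set UnitAddCircle} {a b : UnitAddCircle} (h : IsHole A a b) :
    ∃ s t : ℝ, s < t ∧ t < s + 1 ∧ (s : UnitAddCircle) = a ∧ (t : UnitAddCircle) = b := by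
  obtain ⟨s, -, -, rfl⟩ := QuadLam.exists_lift a 0
  obtain ⟨t, h1, h2, rfl⟩ := exists_lift_of_ne (s := s) (x := b) (Ne.symm h.2.2.1)
  exact ⟨s, t, h1, h2, rfl, rfl⟩

/-- Twice the signed area of the triangle `a b z`. -/
def area (a b z : ℂ) : ℝ := (b - a).re * (z - a).im - (b - a).im * (z - a).re

theorem pt_coe (x : ℝ) : pt x = ⟨Real.cos (2 * Real.pi * x), Real.sin (2 * Real.pi * x)⟩ := by
  unfold pt
  rw [AddCircle.toCircle_apply_mk, Circle.coe_exp]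
  have : 2 * Real.pi / 1 * x = 2 * Real.pi * x := by ring
  rw [this]
  apply Complex.ext
  · rw [Complex.exp_ofReal_mul_I_re]
  · rw [Complex.exp_ofReal_mul_I_im]

theorem norm_pt (x : UnitAddCircle) : ‖pt x‖ = 1 := Circle.norm_coe _

theorem pt_injective : Function.Injective pt := fun _ _ h =>
  AddCircle.injective_toCircle (T := (1 : ℝ)) one_ne_zero (Subtype.ext h)

theorem exists_pt_eq {z : ℂ} (hz : ‖z‖ = 1) : ∃ x, pt x = z := by
  obtain ⟨x, hx⟩ := (AddCircle.homeomorphCircle (one_ne_zero : (1 : ℝ) ≠ 0)).surjective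
    ⟨z, by simp [Submonoid.unitSphere, hz]⟩
  rw [AddCircle.homeomorphCircle_apply] at hx
  exact ⟨x, by unfold pt; rw [hx]⟩

/-- A factorization into sines makes the orientation of three points on the circle a matter of the
order of their lifts. -/
theorem area_pt (a b c : ℝ) : area (pt a) (pt b) (pt c) =
    4 * Real.sin (Real.pi * (b - a)) * Real.sin (Real.pi * (c - b)) *
      Real.sin (Real.pi * (c - a)) := by
  simp only [area, pt_coe, Complex.sub_re, Complex.sub_im]
  rw [Real.cos_sub_cos, Real.sin_sub_sin, Real.cos_sub_cos, Real.sin_sub_sin]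
  have e : Real.sin (Real.pi * (c - b)) = Real.sin (Real.pi * (c + a) - Real.pi * (b + a)) := by
    congr 1; ring
  rw [e, Real.sin_sub]
  have h1 : (2 * Real.pi * b + 2 * Real.pi * a) / 2 = Real.pi * (b + a) := by ring
  have h2 : (2 * Real.pi * b - 2 * Real.pi * a) / 2 = Real.pi * (b - a) := by ring
  have h3 : (2 * Real.pi * c + 2 * Real.pi * a) / 2 = Real.pi * (c + a) := by ring
  have h4 : (2 * Real.pi * c - 2 * Real.pi * a) / 2 = Real.pi * (c - a) := by ring
  rw [h1, h2, h3, h4]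
  ring

theorem sin_pi_mul_pos {x : ℝ} (h0 : 0 < x) (h1 : x < 1) : 0 < Real.sin (Real.pi * x) :=
  Real.sin_pos_of_pos_of_lt_pi (by positivity) (by nlinarith [Real.pi_pos])

theorem area_pt_neg {s c t : ℝ} (h1 : s < c) (h2 : c < t) (h3 : t < s + 1) :
    area (pt s) (pt t) (pt c) < 0 := by
  rw [area_pt]
  have a := sin_pi_mul_pos (x := t - s) (by linarith) (by linarith)
  have b := sin_pi_mul_pos (x := t - c) (by linarith) (by linarith)
  have d := sin_pi_mul_pos (x := c - s) (by linarith) (by linarith)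
  have e : Real.pi * (c - t) = -(Real.pi * (t - c)) := by ring
  rw [e, Real.sin_neg]
  have := mul_pos (mul_pos a b) d
  linarith

theorem area_pt_pos {s c t : ℝ} (h1 : s < t) (h2 : t < c) (h3 : c < s + 1) :
    0 < area (pt s) (pt t) (pt c) := by
  rw [area_pt]
  have a := sin_pi_mul_pos (x := t - s) (by linarith) (by linarith)
  have b := sin_pi_mul_pos (x := c - t) (by linarith) (by linarith)
  have d := sin_pi_mul_pos (x := c - s) (by linarith) (by linarith)
  positivity

theorem area_left (a b : ℂ) : area a b a = 0 := by simp [area]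

theorem area_right (a b : ℂ) : area a b b = 0 := by simp [area]; ring

theorem area_swap (a b z : ℂ) : area b a z = -area a b z := by
  simp [area]; ring

theorem area_combo (a b z w : ℂ) {p q : ℝ} (h : p + q = 1) :
    area a b (p • z + q • w) = p * area a b z + q * area a b w := by
  obtain rfl : q = 1 - p := by linarith
  simp [area]; ring

theorem continuous_area (a b : ℂ) : Continuous (area a b) := by
  unfold area; fun_prop

/-- Linked chords intersect: each has its endpoints strictly on opposite sides of the other, and the
signed areas are the weights of the common point. -/
theorem openSegments_meet {s t s' t' : ℝ} (h1 : s < t) (h2 : t < s') (h3 : s' < t')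
    (h4 : t' < s + 1) :
    ¬ Disjoint (openSegment ℝ (pt s) (pt s')) (openSegment ℝ (pt t) (pt t')) := by
  have hb := area_pt_neg h1 h2 (by linarith : s' < s + 1)
  have hd := area_pt_pos (h1.trans h2) h3 h4
  have hc := area_pt_neg h2 h3 (by linarith : t' < t + 1)
  have ha := area_pt_pos (s := t) (t := t') (c := s + 1) (by linarith) (by linarith) (by linarith)
  rw [coe_add_one] at ha
  generalize pt s = A at *
  generalize pt t = B at *
  generalize pt s' = C at *
  generalize pt t' = D at *
  set α := area B D A
  set γ := area B D C
  set β := area A C B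
  set η := area A C D
  have hsum : α - γ = η - β := by
    simp only [α, β, γ, η, area, Complex.sub_re, Complex.sub_im]; ring
  have hpos : 0 < α - γ := by linarith
  have hpos' : 0 < η - β := by linarith
  intro hdis
  refine Set.disjoint_left.1 hdis
    (?_ : (-γ / (α - γ)) • A + (α / (α - γ)) • C ∈ openSegment ℝ A C) ?_
  · exact ⟨_, _, div_pos (by linarith) hpos, div_pos ha hpos, by field_simp; ring, rfl⟩
  · refine ⟨η / (α - γ), -β / (α - γ), div_pos hd hpos, div_pos (by linarith) hpos, ?_, ?_⟩
    · rw [hsum]; field_simp; ring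
    · have hne : α - γ ≠ 0 := hpos.ne'
      have key : η * B.re + -β * D.re = -γ * A.re + α * C.re ∧
          η * B.im + -β * D.im = -γ * A.im + α * C.im := by
        constructor <;>
        · simp only [α, β, γ, η, area, Complex.sub_re, Complex.sub_im]; ring
      apply Complex.ext
      · simp only [Complex.add_re, Complex.real_smul, Complex.re_ofReal_mul]
        field_simp; linarith [key.1]
      · simp only [Complex.add_im, Complex.real_smul, Complex.im_ofReal_mul]
        field_simp; linarith [key.2]

/-- This is the only form in which unlinkedness of classes enters the dynamics: linked equivalent
pairs belong to one class. -/
theorem IsLamination.trans_of_linked {r : Setoid UnitAddCircle} (hr : IsLamination r)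
    {s t s' t' : ℝ} (h1 : s < t) (h2 : t < s') (h3 : s' < t') (h4 : t' < s + 1)
    (hs : r s s') (ht : r t t') : r s t := by
  by_contra h
  refine openSegments_meet h1 h2 h3 h4 (hr.unlinked _ _ _ _ hs ht ?_)
  exact fun h' => h (r.trans' hs h')

/-! ### Dynamics of an invariant lamination -/

theorem sigma_coe (x : ℝ) : sigma 2 (x : UnitAddCircle) = ((2 * x : ℝ) : UnitAddCircle) := by
  unfold sigma
  rw [two_smul, two_mul, AddCircle.coe_add]

theorem sigma_iterate_coe (n : ℕ) (x : ℝ) :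
    (sigma 2)^[n] (x : UnitAddCircle) = ((2 ^ n * x : ℝ) : UnitAddCircle) := by
  induction n with
  | zero => simp
  | succ n ih => rw [Function.iterate_succ_apply', ih, sigma_coe]; ring_nf

theorem sigma_eq_sigma_iff {x y : ℝ} : sigma 2 (x : UnitAddCircle) = sigma 2 (y : UnitAddCircle) ↔
    (x : UnitAddCircle) = y ∨ (x : UnitAddCircle) = ((y + 1 / 2 : ℝ) : UnitAddCircle) := by
  rw [sigma_coe, sigma_coe]
  constructor
  · intro h
    obtain ⟨n, hn⟩ := coe_eq_iff.1 h
    rcases Int.even_or_odd n with ⟨k, hk⟩ | ⟨k, hk⟩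
    · left; refine coe_eq_iff.2 ⟨k, ?_⟩
      rw [hk] at hn; push_cast at hn; linarith
    · right; refine coe_eq_iff.2 ⟨k + 1, ?_⟩
      rw [hk] at hn; push_cast at hn ⊢; linarith
  · rintro (h | h)
    · obtain ⟨n, hn⟩ := coe_eq_iff.1 h
      exact coe_eq_iff.2 ⟨2 * n, by push_cast; linarith⟩
    · obtain ⟨n, hn⟩ := coe_eq_iff.1 h
      exact coe_eq_iff.2 ⟨2 * n - 1, by push_cast; linarith⟩

theorem continuous_coe_circle : Continuous ((↑) : ℝ → UnitAddCircle) :=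
  AddCircle.continuous_mk' 1

/-- The class of a point. -/
def cls (r : Setoid UnitAddCircle) (x : UnitAddCircle) : Set UnitAddCircle := {y | r x y}

theorem cls_mem_classes (r : Setoid UnitAddCircle) (x : UnitAddCircle) : cls r x ∈ r.classes :=
  ⟨x, by ext y; exact ⟨fun h => r.symm' h, fun h => r.symm' h⟩⟩

theorem cls_eq_of_rel {r : Setoid UnitAddCircle} {x y : UnitAddCircle} (h : r x y) :
    cls r x = cls r y := by
  ext z; exact ⟨fun h' => r.trans' (r.symm' h) h', fun h' => r.trans' h h'⟩

theorem eq_cls_of_mem_classes {r : Setoid UnitAddCircle} {g : Set UnitAddCircle}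
    (hg : g ∈ r.classes) {x : UnitAddCircle} (hx : x ∈ g) : g = cls r x := by
  obtain ⟨y, rfl⟩ := hg
  ext z; exact ⟨fun h => r.trans' hx (r.symm' h), fun h => r.trans' (r.symm' h) hx⟩

namespace IsInvariantLamination

theorem image_cls {r : Setoid UnitAddCircle} (hr : IsInvariantLamination 2 r)
    (x : UnitAddCircle) : sigma 2 '' cls r x = cls r (sigma 2 x) :=
  eq_cls_of_mem_classes (hr.forward _ (cls_mem_classes r x)) ⟨x, r.refl' x, rfl⟩

theorem image_iterate_cls {r : Setoid UnitAddCircle} (hr : IsInvariantLamination 2 r)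
    (n : ℕ) (x : UnitAddCircle) :
    (sigma 2)^[n] '' cls r x = cls r ((sigma 2)^[n] x) := by
  induction n with
  | zero => simp
  | succ n ih => rw [Function.iterate_succ', image_comp, ih, hr.image_cls, Function.comp_apply]

theorem rel_sigma {r : Setoid UnitAddCircle} (hr : IsInvariantLamination 2 r)
    {x y : UnitAddCircle} (h : r x y) : r (sigma 2 x) (sigma 2 y) := by
  have : sigma 2 y ∈ sigma 2 '' cls r x := ⟨y, h, rfl⟩
  rwa [hr.image_cls] at this

theorem rel_iterate {r : Setoid UnitAddCircle} (hr : IsInvariantLamination 2 r)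
    (n : ℕ) {x y : UnitAddCircle} (h : r x y) :
    r ((sigma 2)^[n] x) ((sigma 2)^[n] y) := by
  induction n with
  | zero => exact h
  | succ n ih => rw [Function.iterate_succ_apply', Function.iterate_succ_apply']; exact hr.rel_sigma ih

theorem rel_two_mul {r : Setoid UnitAddCircle} (hr : IsInvariantLamination 2 r)
    {x y : ℝ} (h : r x y) : r (2 * x : ℝ) (2 * y : ℝ) := by
  have := hr.rel_sigma h
  rwa [sigma_coe, sigma_coe] at this

theorem rel_two_pow_mul {r : Setoid UnitAddCircle} (hr : IsInvariantLamination 2 r)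
    (n : ℕ) {x y : ℝ} (h : r x y) : r (2 ^ n * x : ℝ) (2 ^ n * y : ℝ) := by
  have := hr.rel_iterate n h
  rwa [sigma_iterate_coe, sigma_iterate_coe] at this

/-- Since the image of a class is a whole class, the class of `x` contains one of the two preimages
of `2 * y`. -/
theorem rel_or_rel_of_two_mul {r : Setoid UnitAddCircle} (hr : IsInvariantLamination 2 r)
    {x y : ℝ} (h : r (2 * x : ℝ) (2 * y : ℝ)) :
    r x y ∨ r x (y + 1 / 2 : ℝ) := by
  have : ((2 * y : ℝ) : UnitAddCircle) ∈ sigma 2 '' cls r x := by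
    rw [hr.image_cls, sigma_coe]; exact h
  obtain ⟨z, hz, hzy⟩ := this
  obtain ⟨z, -, -, rfl⟩ := exists_lift z 0
  rw [← sigma_coe, sigma_eq_sigma_iff] at hzy
  rcases hzy with e | e
  · left; rw [← e]; exact hz
  · right; rw [← e]; exact hz

theorem finite_cls {r : Setoid UnitAddCircle} (hr : IsInvariantLamination 2 r)
    (x : UnitAddCircle) : (cls r x).Finite := hr.finite _ (cls_mem_classes r x)

/-- The relation is invariant under the half turn. -/
theorem rel_add_half {r : Setoid UnitAddCircle} (hr : IsInvariantLamination 2 r)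
    {x y : ℝ} (h : r x y) : r (x + 1 / 2 : ℝ) (y + 1 / 2 : ℝ) := by
  have h2 : r (2 * (x + 1 / 2) : ℝ) (2 * y : ℝ) := by
    have := hr.rel_two_mul h
    have e : ((2 * (x + 1 / 2) : ℝ) : UnitAddCircle) = ((2 * x : ℝ) : UnitAddCircle) := by
      rw [← coe_add_one (2 * x)]; congr 1; ring
    rwa [e]
  rcases hr.rel_or_rel_of_two_mul h2 with h3 | h3
  swap
  · exact h3
  -- The remaining case is a class with a pair of opposite points. The covering extension takes the
  -- same value at both, so its degree is at least two; hence a second point over the image of `y`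
  -- exists, lies in the class, and can only be the opposite of `y`.
  have hxx : r x (x + 1 / 2 : ℝ) := r.trans' h (r.symm' h3)
  obtain ⟨F, ⟨f, k, fc, fm, fk, hF⟩, hFσ, hFg⟩ := hr.covering _ (cls_mem_classes r (x : UnitAddCircle))
  have e1 : F x = F (x + 1 / 2 : ℝ) := by
    rw [hFσ (r.refl' _), hFσ hxx, sigma_eq_sigma_iff]
    right
    rw [← coe_add_one x]; congr 1; ring
  rw [hF, hF] at e1
  obtain ⟨n, hn⟩ := coe_eq_iff.1 e1
  have l1 := fm (show x < x + 1 / 2 by linarith)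
  have l2 := fm (show x + 1 / 2 < x + 1 by linarith)
  rw [fk] at l2
  have n0 : 0 < n := by
    have : (0 : ℝ) < n := by linarith
    exact_mod_cast this
  have nk : n < k := by
    have : (n : ℝ) < k := by linarith
    exact_mod_cast this
  have k2 : (2 : ℝ) ≤ k := by
    have : 2 ≤ (k : ℤ) := by omega
    exact_mod_cast this
  obtain ⟨y', hy', hfy⟩ : f y + 1 ∈ f '' Icc y (y + 1) := by
    apply intermediate_value_Icc (by linarith) fc.continuousOn
    rw [fk]; constructor <;> linarith
  have hne : y' ≠ y := by rintro rfl; linarith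
  have hne' : y' ≠ y + 1 := by rintro rfl; rw [fk] at hfy; linarith
  have hFe : F y' = F y := by
    rw [hF, hF, hfy, coe_add_one]
  have hyg : (y : UnitAddCircle) ∈ cls r x := h
  have hy'g : (y' : UnitAddCircle) ∈ cls r x := by
    rw [← hFg, mem_preimage, hFe, hFσ hyg]
    exact mem_image_of_mem _ hyg
  rw [hFσ hy'g, hFσ hyg, sigma_eq_sigma_iff] at hFe
  rcases hFe with e | e
  · exact absurd e.symm (coe_ne_of_lt (lt_of_le_of_ne hy'.1 hne.symm) (lt_of_le_of_ne hy'.2 hne'))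
  · rw [← e]; exact r.trans' (r.symm' hxx) hy'g

/-- The image of a hole of a class is a hole of the image class, or is collapsed. -/
theorem isHole_image {r : Setoid UnitAddCircle} (hr : IsInvariantLamination 2 r)
    {g : Set UnitAddCircle} (hg : g ∈ r.classes) {a b : UnitAddCircle}
    (h : IsHole g a b) :
    sigma 2 a = sigma 2 b ∨ IsHole (sigma 2 '' g) (sigma 2 a) (sigma 2 b) := by
  obtain ⟨s, t, h1, h2, rfl, rfl⟩ := h.exists_lift
  rw [isHole_coe_iff h1 h2] at h
  obtain ⟨hs, ht, hno⟩ := h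
  obtain ⟨F, ⟨f, k, fc, fm, fk, hF⟩, hFσ, hFg⟩ := hr.covering _ hg
  have hIVT : ∀ w, f s < w → w < f t → ∃ z, s < z ∧ z < t ∧ f z = w := by
    intro w hw1 hw2
    obtain ⟨z, hz, e⟩ := intermediate_value_Ioo h1.le fc.continuousOn ⟨hw1, hw2⟩
    exact ⟨z, hz.1, hz.2, e⟩
  have hout : ∀ z, s < z → z < t → F z ∉ sigma 2 '' g := by
    intro z hz1 hz2 hz
    exact hno z hz1 hz2 (by rw [← hFg]; exact hz)
  rw [← hFσ hs, ← hFσ ht, hF, hF]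
  have hst := fm h1
  rcases lt_trichotomy (f t) (f s + 1) with hlt | heq | hgt
  · right
    rw [isHole_coe_iff hst hlt, ← hF, ← hF, hFσ hs, hFσ ht]
    refine ⟨mem_image_of_mem _ hs, mem_image_of_mem _ ht, ?_⟩
    intro w hw1 hw2 hw
    obtain ⟨z, hz1, hz2, rfl⟩ := hIVT w hw1 hw2
    exact hout z hz1 hz2 (by rw [hF]; exact hw)
  · left; rw [heq, coe_add_one]
  -- If the lift advanced by more than one turn, it would meet the image of the left endpoint again
  -- inside the hole, and that point would belong to the class.
  · exfalso
    obtain ⟨z, hz1, hz2, e⟩ := hIVT (f s + 1) (by linarith) hgt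
    refine hout z hz1 hz2 ?_
    rw [hF, e, coe_add_one, ← hF, hFσ hs]
    exact mem_image_of_mem _ hs

/-- An iterate that maps a class to itself is injective on it. -/
theorem injOn_of_invariant {r : Setoid UnitAddCircle} (hr : IsInvariantLamination 2 r)
    {g : Set UnitAddCircle} (hg : g ∈ r.classes) {n : ℕ}
    (hn : (sigma 2)^[n] '' g = g) : InjOn (sigma 2)^[n] g := by
  have hf := hr.finite g hg
  exact Finite.injOn_of_encard_image_eq hf (by rw [hn])

/-- A class that contains a pair of opposite points is never periodic. -/
theorem not_rel_iterate_of_rel_add_half {r : Setoid UnitAddCircle} (hr : IsInvariantLamination 2 r)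
    {x : ℝ} (h : r x (x + 1 / 2 : ℝ)) {n : ℕ} (hn : 0 < n) :
    ¬ r x (2 ^ n * x : ℝ) := by
  intro h'
  have hinv : (sigma 2)^[n] '' cls r x = cls r x := by
    rw [hr.image_iterate_cls, sigma_iterate_coe]; exact (cls_eq_of_rel h').symm
  have := hr.injOn_of_invariant (cls_mem_classes r _) hinv (r.refl' _) h ?_
  · exact coe_ne_of_lt (x := x) (y := x + 1 / 2) (by linarith) (by linarith) this
  · obtain ⟨m, rfl⟩ := Nat.exists_eq_succ_of_ne_zero hn.ne'
    rw [Function.iterate_succ_apply, Function.iterate_succ_apply]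
    congr 1
    rw [sigma_eq_sigma_iff]; right
    rw [← coe_add_one x]; congr 1; ring

end IsInvariantLamination

/-! ### Gaps -/

/-- The nearest points of the lifted closed set on either side of `x` bound the hole. -/
theorem exists_hole_of_notMem {B : Set UnitAddCircle} (hB : IsClosed B) (h2 : B.Nontrivial)
    {x : ℝ} (hx : (x : UnitAddCircle) ∉ B) :
    ∃ s t : ℝ, s < x ∧ x < t ∧ t < s + 1 ∧ (s : UnitAddCircle) ∈ B ∧ (t : UnitAddCircle) ∈ B ∧
      ∀ z : ℝ, s < z → z < t → (z : UnitAddCircle) ∉ B := by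
  set C : Set ℝ := {z | (z : UnitAddCircle) ∈ B} with hC
  have hCc : IsClosed C := hB.preimage continuous_coe_circle
  obtain ⟨b, hb, b', hb', hbb⟩ := h2
  obtain ⟨y, hy1, hy2, rfl⟩ := exists_lift b x
  have hyC : y ∈ C := hb
  have hyC' : y - 1 ∈ C := by
    change ((y - 1 : ℝ) : UnitAddCircle) ∈ B
    rw [← coe_add_one (y - 1), sub_add_cancel]; exact hb
  have n1 : (C ∩ Iic x).Nonempty := ⟨y - 1, hyC', by simp; linarith⟩
  have n2 : (C ∩ Ici x).Nonempty := ⟨y, hyC, hy1⟩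
  have c1 : IsClosed (C ∩ Iic x) := hCc.inter isClosed_Iic
  have c2 : IsClosed (C ∩ Ici x) := hCc.inter isClosed_Ici
  have bd1 : BddAbove (C ∩ Iic x) := ⟨x, fun z hz => hz.2⟩
  have bd2 : BddBelow (C ∩ Ici x) := ⟨x, fun z hz => hz.2⟩
  have m1 := c1.csSup_mem n1 bd1
  have m2 := c2.csInf_mem n2 bd2
  set s := sSup (C ∩ Iic x)
  set t := sInf (C ∩ Ici x)
  have hno : ∀ z : ℝ, s < z → z < t → (z : UnitAddCircle) ∉ B := by
    intro z hz1 hz2 hz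
    rcases le_total z x with h | h
    · exact absurd (le_csSup bd1 ⟨hz, h⟩) (not_le.2 hz1)
    · exact absurd (csInf_le bd2 ⟨hz, h⟩) (not_le.2 hz2)
  have hsx : s < x := lt_of_le_of_ne m1.2 (by intro h; exact hx (h ▸ m1.1))
  have hxt : x < t := lt_of_le_of_ne m2.2 (by intro h; exact hx (h ▸ m2.1))
  refine ⟨s, t, hsx, hxt, ?_, m1.1, m2.1, hno⟩
  -- A gap of a full turn in the lift would leave only one point in the set.
  by_contra hcon
  push Not at hcon
  have hall : ∀ c ∈ B, c = (s : UnitAddCircle) := by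
    intro c hc
    by_contra hne
    obtain ⟨z, h1, h2, rfl⟩ := exists_lift_of_ne hne
    exact hno z h1 (by linarith) hc
  exact hbb ((hall _ hb).trans (hall _ hb').symm)

/-- The set `B` has points strictly on both sides of the chord `xy`. -/
def Crosses (B : Set UnitAddCircle) (x y : UnitAddCircle) : Prop :=
  (∃ p ∈ B, p ∈ cIoo x y) ∧ ∃ p ∈ B, p ∈ cIoo y x

theorem Crosses.symm {B : Set UnitAddCircle} {x y : UnitAddCircle} (h : Crosses B x y) :
    Crosses B y x := ⟨h.2, h.1⟩

theorem mem_cIoo_coe_swap {s t : ℝ} (h1 : s < t) (h2 : t < s + 1) (x : UnitAddCircle) :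
    x ∈ cIoo (t : UnitAddCircle) (s : UnitAddCircle) ↔
      ∃ z : ℝ, t < z ∧ z < s + 1 ∧ (z : UnitAddCircle) = x := by
  rw [← coe_add_one s]
  exact sbtw_coe_iff h2 (by linarith) x

theorem crosses_coe_iff {B : Set UnitAddCircle} {s t : ℝ} (h1 : s < t) (h2 : t < s + 1) :
    Crosses B s t ↔ (∃ z : ℝ, s < z ∧ z < t ∧ (z : UnitAddCircle) ∈ B) ∧
      ∃ z : ℝ, t < z ∧ z < s + 1 ∧ (z : UnitAddCircle) ∈ B := by
  unfold Crosses
  constructor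
  · rintro ⟨⟨p, hp, h⟩, q, hq, h'⟩
    obtain ⟨z, a, b, rfl⟩ := (sbtw_coe_iff h1 h2 p).1 h
    obtain ⟨w, c, d, rfl⟩ := (mem_cIoo_coe_swap h1 h2 q).1 h'
    exact ⟨⟨z, a, b, hp⟩, w, c, d, hq⟩
  · rintro ⟨⟨z, a, b, hp⟩, w, c, d, hq⟩
    exact ⟨⟨_, hp, (sbtw_coe_iff h1 h2 _).2 ⟨z, a, b, rfl⟩⟩,
      _, hq, (mem_cIoo_coe_swap h1 h2 _).2 ⟨w, c, d, rfl⟩⟩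

theorem area_neg_of_mem_cIoo {x y p : UnitAddCircle} (hxy : x ≠ y) (hp : p ∈ cIoo x y) :
    area (pt x) (pt y) (pt p) < 0 := by
  obtain ⟨s, -, -, rfl⟩ := exists_lift x 0
  obtain ⟨t, h1, h2, rfl⟩ := exists_lift_of_ne hxy.symm
  obtain ⟨z, a, b, rfl⟩ := (sbtw_coe_iff h1 h2 p).1 hp
  exact area_pt_neg a b h2

theorem area_pos_of_mem_cIoo {x y p : UnitAddCircle} (hxy : x ≠ y) (hp : p ∈ cIoo y x) :
    0 < area (pt x) (pt y) (pt p) := by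
  have := area_neg_of_mem_cIoo hxy.symm hp
  rw [area_swap] at this; linarith

theorem area_pt_nonneg_of_notMem {x y p : UnitAddCircle} (hxy : x ≠ y) (hp : p ∉ cIoo x y) :
    0 ≤ area (pt x) (pt y) (pt p) := by
  have h : p ∈ cIcc y x := by rw [← compl_cIoo]; exact hp
  obtain ⟨s, -, -, rfl⟩ := exists_lift x 0
  obtain ⟨t, h1, h2, rfl⟩ := exists_lift_of_ne hxy.symm
  by_cases e1 : p = (s : UnitAddCircle)
  · rw [e1, area_left]
  by_cases e2 : p = (t : UnitAddCircle)
  · rw [e2, area_right]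
  obtain ⟨z, h3, h4, rfl⟩ := exists_lift_of_ne e1
  rcases lt_trichotomy z t with h5 | h5 | h5
  · exact absurd ((sbtw_coe_iff h1 h2 _).2 ⟨z, h3, h5, rfl⟩) hp
  · exact absurd (by rw [h5]) e2
  · exact (area_pt_pos h1 h5 h4).le

theorem convex_area_nonneg (a b : ℂ) : Convex ℝ {z | 0 ≤ area a b z} := by
  intro z hz w hw p q hp hq hpq
  change 0 ≤ area a b _
  rw [area_combo _ _ _ _ hpq]
  have : 0 ≤ area a b z := hz
  have : 0 ≤ area a b w := hw
  positivity

theorem area_nonneg_of_mem_hull {B : Set UnitAddCircle} {a b z : ℂ}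
    (h : ∀ p ∈ B, 0 ≤ area a b (pt p)) (hz : z ∈ hull B) : 0 ≤ area a b z := by
  have : hull B ⊆ {z | 0 ≤ area a b z} :=
    convexHull_min (by rintro _ ⟨p, hp, rfl⟩; exact h p hp) (convex_area_nonneg a b)
  exact this hz

/-- An interior point can be moved a little against the inner normal `Complex.I * (b - a)` without
leaving the set, and this lowers the signed area linearly. -/
theorem area_pos_of_mem_interior {K : Set ℂ} {a b z : ℂ} (hab : a ≠ b)
    (h : ∀ z ∈ K, 0 ≤ area a b z) (hz : z ∈ interior K) : 0 < area a b z := by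
  by_contra hcon
  have h0 : area a b z ≤ 0 := not_lt.1 hcon
  have hc : Continuous (fun ε : ℝ => z - (ε : ℂ) * (Complex.I * (b - a))) := by fun_prop
  have hev : ∀ᶠ ε : ℝ in nhds (0 : ℝ), z - (ε : ℂ) * (Complex.I * (b - a)) ∈ K := by
    have : interior K ∈ nhds (z - ((0 : ℝ) : ℂ) * (Complex.I * (b - a))) := by
      simpa using isOpen_interior.mem_nhds hz
    exact (hc.continuousAt.eventually this).mono fun ε hε => interior_subset hε
  obtain ⟨δ, hδ, hball⟩ := Metric.eventually_nhds_iff.1 hev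
  have hmem := h _ (hball (y := δ / 2) (by simp [abs_of_pos hδ]; linarith))
  have e : area a b (z - ((δ / 2 : ℝ) : ℂ) * (Complex.I * (b - a))) =
      area a b z - δ / 2 * ((b - a).re ^ 2 + (b - a).im ^ 2) := by
    simp [area]; ring
  have hpos : 0 < (b - a).re ^ 2 + (b - a).im ^ 2 := by
    by_contra hneg
    have h1 : (b - a).re = 0 := by nlinarith [sq_nonneg (b - a).re, sq_nonneg (b - a).im]
    have h2 : (b - a).im = 0 := by nlinarith [sq_nonneg (b - a).re, sq_nonneg (b - a).im]
    exact hab (sub_eq_zero.1 (Complex.ext h1 h2)).symm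
  rw [e] at hmem
  nlinarith [mul_pos hδ hpos]

theorem mem_segment_of_area_eq_zero {a b z : ℂ} (ha : ‖a‖ = 1) (hb : ‖b‖ = 1) (hab : a ≠ b)
    (hz : ‖z‖ < 1) (h : area a b z = 0) : z ∈ segment ℝ a b := by
  have hsq : ∀ w : ℂ, ‖w‖ ^ 2 = w.re ^ 2 + w.im ^ 2 := by
    intro w; rw [← Complex.normSq_eq_norm_sq, Complex.normSq_apply]; ring
  have ha' := hsq a
  have hb' := hsq b
  have hz' := hsq z
  rw [ha] at ha'
  rw [hb] at hb'
  have hz'' : z.re ^ 2 + z.im ^ 2 < 1 := by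
    rw [← hz']; nlinarith [norm_nonneg z]
  set u := b.re - a.re with hu
  set v := b.im - a.im with hv
  have hpos : 0 < u ^ 2 + v ^ 2 := by
    by_contra hneg
    have h1 : u = 0 := by nlinarith [sq_nonneg u, sq_nonneg v]
    have h2 : v = 0 := by nlinarith [sq_nonneg u, sq_nonneg v]
    exact hab (Complex.ext (by linarith) (by linarith))
  have h' : u * (z.im - a.im) - v * (z.re - a.re) = 0 := by
    simpa [area] using h
  set τ := (u * (z.re - a.re) + v * (z.im - a.im)) / (u ^ 2 + v ^ 2) with hτ
  have e1 : z.re = a.re + τ * u := by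
    rw [hτ]; field_simp
    linear_combination (-v) * h'
  have e2 : z.im = a.im + τ * v := by
    rw [hτ]; field_simp
    linear_combination u * h'
  have hin : 0 < τ * (1 - τ) := by
    -- On the line through two points of the unit circle the squared norm is this quadratic in the
    -- parameter, so it is below one exactly between them.
    have : z.re ^ 2 + z.im ^ 2 = 1 - τ * (1 - τ) * (u ^ 2 + v ^ 2) := by
      rw [e1, e2]
      have hbr : b.re = a.re + u := by rw [hu]; ring
      have hbi : b.im = a.im + v := by rw [hv]; ring
      rw [hbr, hbi] at hb'
      linear_combination (-(1 - τ)) * ha' - τ * hb'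
    nlinarith
  have t0 : 0 < τ := by
    by_contra hn
    nlinarith
  have t1 : τ < 1 := by
    by_contra hn
    nlinarith
  refine ⟨1 - τ, τ, by linarith, t0.le, by ring, ?_⟩
  apply Complex.ext
  · simp [e1, hu]; ring
  · simp [e2, hv]; ring

/-- The open triangle lies in the hull: the signed areas of the three subtriangles, divided by the
whole area, are barycentric coordinates. -/
theorem interior_hull_nonempty {B : Set UnitAddCircle} {x y z : ℝ} (h1 : x < y) (h2 : y < z)
    (h3 : z < x + 1) (hx : (x : UnitAddCircle) ∈ B) (hy : (y : UnitAddCircle) ∈ B)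
    (hz : (z : UnitAddCircle) ∈ B) : (interior (hull B)).Nonempty := by
  have ha : pt x ∈ hull B := subset_convexHull ℝ _ (mem_image_of_mem _ hx)
  have hb : pt y ∈ hull B := subset_convexHull ℝ _ (mem_image_of_mem _ hy)
  have hc : pt z ∈ hull B := subset_convexHull ℝ _ (mem_image_of_mem _ hz)
  have hpos := area_pt_pos h1 h2 h3
  generalize pt x = a at *
  generalize pt y = b at *
  generalize pt z = c at *
  set O : Set ℂ := {w | 0 < area b c w} ∩ {w | 0 < area c a w} ∩ {w | 0 < area a b w} with hO
  have hOo : IsOpen O :=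
    ((isOpen_lt continuous_const (continuous_area _ _)).inter
      (isOpen_lt continuous_const (continuous_area _ _))).inter
      (isOpen_lt continuous_const (continuous_area _ _))
  have hOsub : O ⊆ hull B := by
    rintro w ⟨⟨w1, w2⟩, w3⟩
    change 0 < area b c w at w1
    change 0 < area c a w at w2
    change 0 < area a b w at w3
    have hs : area b c w + area c a w + area a b w = area a b c := by
      simp only [area, Complex.sub_re, Complex.sub_im]; ring
    have hne : area a b c ≠ 0 := hpos.ne'
    have hconv : Convex ℝ (hull B) := convex_convexHull ℝ _
    have key := hconv.sum_mem (t := Finset.univ)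
      (w := ![area b c w / area a b c, area c a w / area a b c, area a b w / area a b c])
      (z := ![a, b, c]) (by intro i _; fin_cases i <;> simp <;> positivity)
      (by simp [Fin.sum_univ_three]; field_simp; linarith)
      (by intro i _; fin_cases i <;> simp [ha, hb, hc])
    have e : w = ∑ i, (![area b c w / area a b c, area c a w / area a b c,
        area a b w / area a b c] : Fin 3 → ℝ) i • (![a, b, c] : Fin 3 → ℂ) i := by
      rw [Fin.sum_univ_three]
      apply Complex.ext
      · simp only [Matrix.cons_val_zero, Matrix.cons_val_one, Matrix.cons_val, Complex.add_re,
          Complex.real_smul, Complex.re_ofReal_mul]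
        field_simp
        simp only [area, Complex.sub_re, Complex.sub_im]; ring
      · simp only [Matrix.cons_val_zero, Matrix.cons_val_one, Matrix.cons_val, Complex.add_im,
          Complex.real_smul, Complex.im_ofReal_mul]
        field_simp
        simp only [area, Complex.sub_re, Complex.sub_im]; ring
    rw [e]; exact key
  refine ⟨(1 / 3 : ℝ) • a + (1 / 3 : ℝ) • b + (1 / 3 : ℝ) • c, interior_maximal hOsub hOo ?_⟩
  have e1 : ∀ p q : ℂ, area p q ((1 / 3 : ℝ) • a + (1 / 3 : ℝ) • b + (1 / 3 : ℝ) • c) =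
      1 / 3 * area p q a + 1 / 3 * area p q b + 1 / 3 * area p q c := by
    intro p q; simp [area]; ring
  have e2 : area b c a = area a b c := by simp [area]; ring
  have e3 : area c a b = area a b c := by simp [area]; ring
  refine ⟨⟨?_, ?_⟩, ?_⟩
  · change 0 < area b c _
    rw [e1, area_left, area_right, e2]; linarith
  · change 0 < area c a _
    rw [e1, area_left, area_right, e3]; linarith
  · change 0 < area a b _
    rw [e1, area_left, area_right]; linarith

theorem hull_subset_closedBall (B : Set UnitAddCircle) : hull B ⊆ Metric.closedBall 0 1 :=
  convexHull_min (by rintro _ ⟨p, -, rfl⟩; simp [norm_pt]) (convex_closedBall _ _)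

theorem interior_hull_subset_ball (B : Set UnitAddCircle) : interior (hull B) ⊆ Metric.ball 0 1 := by
  have := interior_mono (hull_subset_closedBall B)
  rwa [interior_closedBall _ one_ne_zero] at this

/-- A preconnected part of the open disk that avoids a chord lies on one side of it. -/
theorem area_pos_of_isPreconnected {a b : UnitAddCircle} (hab : a ≠ b) {W : Set ℂ}
    (hW : IsPreconnected W) (hball : W ⊆ Metric.ball 0 1)
    (hseg : Disjoint W (segment ℝ (pt a) (pt b))) {w z : ℂ} (hw : w ∈ W) (hz : z ∈ W)
    (h : 0 < area (pt a) (pt b) w) : 0 < area (pt a) (pt b) z := by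
  by_contra hcon
  have him := hW.image _ (continuous_area (pt a) (pt b)).continuousOn
  have h0 : (0 : ℝ) ∈ area (pt a) (pt b) '' W :=
    him.Icc_subset (mem_image_of_mem _ hz) (mem_image_of_mem _ hw) ⟨not_lt.1 hcon, h.le⟩
  obtain ⟨y, hy, hy0⟩ := h0
  refine Set.disjoint_left.1 hseg hy (mem_segment_of_area_eq_zero (norm_pt a) (norm_pt b) ?_ ?_ hy0)
  · exact fun e => hab (pt_injective e)
  · simpa using hball hy

/-- A point of the open disk lies between two points of the circle on any given line direction. -/
theorem exists_mem_openSegment_pt {z d : ℂ} (hz : ‖z‖ < 1) (hd : d ≠ 0) :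
    ∃ x y : UnitAddCircle, ∃ t₁ t₂ : ℝ, pt x = z + t₁ • d ∧ pt y = z + t₂ • d ∧
      z ∈ segment ℝ (pt x) (pt y) ∧ x ≠ y := by
  have hcont : Continuous (fun t : ℝ => ‖z + t • d‖) := by fun_prop
  have hdn : 0 < ‖d‖ := norm_pos_iff.2 hd
  have hbig : ∀ t : ℝ, |t| = 2 / ‖d‖ → 1 ≤ ‖z + t • d‖ := by
    intro t ht
    have h1 : ‖t • d‖ = 2 := by rw [norm_smul, Real.norm_eq_abs, ht]; field_simp
    have h2 := norm_sub_norm_le (t • d) (-z)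
    rw [norm_neg, h1, sub_neg_eq_add, add_comm] at h2
    linarith
  have hp : 0 < 2 / ‖d‖ := by positivity
  obtain ⟨t₂, ht₂, e₂⟩ := intermediate_value_Icc hp.le hcont.continuousOn
    (show (1 : ℝ) ∈ Icc (‖z + (0 : ℝ) • d‖) (‖z + (2 / ‖d‖) • d‖) from
      ⟨by simpa using hz.le, hbig _ (abs_of_pos hp)⟩)
  obtain ⟨t₁, ht₁, e₁⟩ := intermediate_value_Icc' (neg_nonpos.2 hp.le) hcont.continuousOn
    (show (1 : ℝ) ∈ Icc (‖z + (0 : ℝ) • d‖) (‖z + (-(2 / ‖d‖)) • d‖) from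
      ⟨by simpa using hz.le, hbig _ (by rw [abs_neg, abs_of_pos hp])⟩)
  have t2pos : 0 < t₂ := lt_of_le_of_ne ht₂.1 (by rintro rfl; simp at e₂; linarith)
  have t1neg : t₁ < 0 := lt_of_le_of_ne ht₁.2 (by rintro rfl; simp at e₁; linarith)
  obtain ⟨x, hx⟩ := exists_pt_eq e₁
  obtain ⟨y, hy⟩ := exists_pt_eq e₂
  refine ⟨x, y, t₁, t₂, hx, hy, ?_, ?_⟩
  · rw [hx, hy]
    have hpos : 0 < t₂ - t₁ := by linarith
    refine ⟨t₂ / (t₂ - t₁), -t₁ / (t₂ - t₁), by positivity, div_nonneg (by linarith) hpos.le,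
      by field_simp; ring, ?_⟩
    have h1 : t₂ / (t₂ - t₁) + -t₁ / (t₂ - t₁) = 1 := by field_simp; ring
    have h2 : t₂ / (t₂ - t₁) * t₁ + -t₁ / (t₂ - t₁) * t₂ = 0 := by field_simp; ring
    calc (t₂ / (t₂ - t₁)) • (z + t₁ • d) + (-t₁ / (t₂ - t₁)) • (z + t₂ • d)
        = (t₂ / (t₂ - t₁) + -t₁ / (t₂ - t₁)) • z +
          (t₂ / (t₂ - t₁) * t₁ + -t₁ / (t₂ - t₁) * t₂) • d := by module
      _ = z := by rw [h1, h2]; simp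
  · rintro rfl
    rw [hx] at hy
    have : (t₂ - t₁) • d = 0 := by
      rw [sub_smul]; exact sub_eq_zero.2 (add_left_cancel hy).symm
    rcases smul_eq_zero.1 this with h | h
    · linarith
    · exact hd h

theorem IsLeaf.segment_subset {r : Setoid UnitAddCircle} {a b : UnitAddCircle} (h : IsLeaf r a b) :
    segment ℝ (pt a) (pt b) ⊆ leafUnion r := fun _ hz => ⟨a, b, h, hz⟩

/-- A closed set is the basis of a gap if its edges are leaves and no leaf crosses it. -/
theorem isGapBasis_of_leaves {r : Setoid UnitAddCircle} {B : Set UnitAddCircle} (hB : IsClosed B)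
    {x y z : ℝ} (h1 : x < y) (h2 : y < z)
    (h3 : z < x + 1) (hx : (x : UnitAddCircle) ∈ B) (hy : (y : UnitAddCircle) ∈ B)
    (hz : (z : UnitAddCircle) ∈ B)
    (hleaf : ∀ a b, IsHole B a b → IsLeaf r a b)
    (hnc : ∀ a b, a ≠ b → IsLeaf r a b → ¬ Crosses B a b) : IsGapBasis r B := by
  obtain ⟨z₀, hz₀⟩ := interior_hull_nonempty h1 h2 h3 hx hy hz
  have hB2 : B.Nontrivial := ⟨_, hx, _, hy, coe_ne_of_lt h1 (by linarith)⟩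
  have hconv : Convex ℝ (hull B) := convex_convexHull ℝ _
  set U := interior (hull B) with hU
  set Ω := Metric.ball (0 : ℂ) 1 \ leafUnion r with hΩ
  have hside : ∀ a b, IsHole B a b → ∀ w ∈ hull B, 0 ≤ area (pt a) (pt b) w := by
    intro a b hab w hw
    refine area_nonneg_of_mem_hull (fun p hp => area_pt_nonneg_of_notMem hab.2.2.1 ?_) hw
    exact fun hpab => Set.disjoint_left.1 hab.2.2.2 hpab hp
  have hUΩ : U ⊆ Ω := by
    intro w hw
    have hwb := interior_hull_subset_ball B hw
    refine ⟨hwb, ?_⟩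
    rintro ⟨a, b, hab, hwab⟩
    by_cases e : a = b
    · subst e
      rw [segment_same, mem_singleton_iff] at hwab
      rw [hwab] at hwb
      simp [norm_pt] at hwb
    · have hpne : pt a ≠ pt b := fun h => e (pt_injective h)
      have harea : area (pt a) (pt b) w = 0 := by
        obtain ⟨p, q, -, -, hpq, rfl⟩ := hwab
        rw [area_combo _ _ _ _ hpq, area_left, area_right]; ring
      have hn := hnc a b e hab
      have hor : (∀ p ∈ B, p ∉ cIoo a b) ∨ (∀ p ∈ B, p ∉ cIoo b a) := by
        by_contra hcon
        push Not at hcon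
        exact hn ⟨hcon.1, hcon.2⟩
      rcases hor with h | h
      · have := area_pos_of_mem_interior hpne (fun v hv => area_nonneg_of_mem_hull
          (fun p hp => area_pt_nonneg_of_notMem e (h p hp)) hv) hw
        linarith
      · have := area_pos_of_mem_interior hpne.symm (fun v hv => area_nonneg_of_mem_hull
          (fun p hp => area_pt_nonneg_of_notMem (Ne.symm e) (h p hp)) hv) hw
        rw [area_swap] at this
        linarith
  set W := connectedComponentIn Ω z₀ with hW
  have hUW : U ⊆ W :=
    hconv.interior.isPreconnected.subset_connectedComponentIn hz₀ hUΩ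
  have hWΩ : W ⊆ Ω := connectedComponentIn_subset _ _
  have hWpre : IsPreconnected W := isPreconnected_connectedComponentIn
  have hWpos : ∀ a b, IsHole B a b → ∀ w ∈ W, 0 < area (pt a) (pt b) w := by
    intro a b hab w hw
    refine area_pos_of_isPreconnected hab.2.2.1 hWpre (fun v hv => (hWΩ hv).1) ?_ (hUW hz₀) hw ?_
    · refine Set.disjoint_left.2 fun v hv hv' => (hWΩ hv).2 ((hleaf a b hab).segment_subset hv')
    · exact area_pos_of_mem_interior (fun h => hab.2.2.1 (pt_injective h)) (hside a b hab) hz₀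
  -- A point `w` of the component outside the hull is separated from it by a linear functional. The
  -- level line through `w` meets the circle in two points that lie in one and the same hole of `B`;
  -- so `w` lies behind the edge of that hole, although the component lies in front of every edge.
  have hWK : W ⊆ closure (hull B) := by
    intro w hw
    by_contra hwK
    obtain ⟨f, u, hf1, hf2⟩ := geometric_hahn_banach_closed_point hconv.closure isClosed_closure hwK
    have hBf : ∀ p ∈ hull B, f p < u := fun p hp => hf1 p (subset_closure hp)
    set d : ℂ := ⟨-f Complex.I, f 1⟩ with hd
    have hfv : ∀ v : ℂ, f v = v.re * f 1 + v.im * f Complex.I := by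
      intro v
      conv_lhs => rw [← Complex.re_add_im v]
      have e1 : ((v.re : ℂ) + v.im * Complex.I) = v.re • (1 : ℂ) + v.im • Complex.I := by simp
      rw [e1, map_add, map_smul, map_smul]; simp
    have hfd : f d = 0 := by rw [hfv]; simp [hd]; ring
    have hd0 : d ≠ 0 := by
      intro h0
      have e1 : f Complex.I = 0 := by have := congrArg Complex.re h0; simpa [hd] using this
      have e2 : f 1 = 0 := by have := congrArg Complex.im h0; simpa [hd] using this
      have e3 : ∀ v, f v = 0 := fun v => by rw [hfv, e1, e2]; ring
      have := hBf _ (interior_subset hz₀)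
      rw [e3] at this hf2
      linarith
    obtain ⟨p, q, t₁, t₂, hp, hq, hwpq, hpq⟩ :=
      exists_mem_openSegment_pt (z := w) (by simpa using (hWΩ hw).1) hd0
    have hfp : f (pt p) = f w := by rw [hp, map_add, map_smul, hfd]; simp
    have hfq : f (pt q) = f w := by rw [hq, map_add, map_smul, hfd]; simp
    have hpB : p ∉ B := fun h => by
      have := hBf _ (subset_convexHull ℝ _ (mem_image_of_mem _ h)); linarith
    have hqB : q ∉ B := fun h => by
      have := hBf _ (subset_convexHull ℝ _ (mem_image_of_mem _ h)); linarith
    obtain ⟨p', -, -, rfl⟩ := exists_lift p 0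
    obtain ⟨s, t, hsp, hpt, hts, hs, ht, hst⟩ := exists_hole_of_notMem hB hB2 hpB
    have hole : IsHole B s t := (isHole_coe_iff (hsp.trans hpt) hts).2 ⟨hs, ht, hst⟩
    obtain ⟨q', hq1, hq2, rfl⟩ := exists_lift_of_ne (s := s) (x := q) (fun h => hqB (h ▸ hs))
    -- Were the two points in different holes, the level chord would cross the edge of the first
    -- hole, where the functional is too small.
    have hqt : q' < t := by
      by_contra hcon
      have hqt : t < q' := lt_of_le_of_ne (not_lt.1 hcon) (by rintro rfl; exact hqB ht)
      refine openSegments_meet hsp hpt hqt hq2 (Set.disjoint_left.2 ?_)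
      rintro v hv ⟨α, β, -, -, hαβ, rfl⟩
      have hv' : (α • pt p' + β • pt q') ∈ hull B :=
        hconv.segment_subset (subset_convexHull ℝ _ (mem_image_of_mem _ hs))
          (subset_convexHull ℝ _ (mem_image_of_mem _ ht)) (openSegment_subset_segment _ _ _ hv)
      have := hBf _ hv'
      rw [map_add, map_smul, map_smul, hfp, hfq, ← add_smul, hαβ, one_smul] at this
      linarith
    have ap := area_pt_neg hsp hpt hts
    have aq := area_pt_neg hq1 hqt hts
    have aw := hWpos _ _ hole w hw
    obtain ⟨α, β, hα, hβ, hαβ, rfl⟩ := hwpq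
    rw [area_combo _ _ _ _ hαβ] at aw
    nlinarith
  have hcl : closure W = closure (hull B) := by
    apply Subset.antisymm
    · exact closure_minimal hWK isClosed_closure
    · rw [← hconv.closure_interior_eq_closure_of_nonempty_interior ⟨z₀, hz₀⟩]
      exact closure_mono hUW
  refine ⟨closure W, ⟨z₀, hUΩ hz₀, rfl⟩, ?_⟩
  rw [hcl]
  ext p
  refine ⟨fun hp => subset_closure (subset_convexHull ℝ _ (mem_image_of_mem _ hp)), fun hp => ?_⟩
  by_contra hpB
  obtain ⟨p', -, -, rfl⟩ := exists_lift p 0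
  obtain ⟨s, t, hsp, hpt, hts, hs, ht, hst⟩ := exists_hole_of_notMem hB hB2 hpB
  have hole : IsHole B s t := (isHole_coe_iff (hsp.trans hpt) hts).2 ⟨hs, ht, hst⟩
  have ap := area_pt_neg hsp hpt hts
  have : closure (hull B) ⊆ {v | 0 ≤ area (pt s) (pt t) v} :=
    closure_minimal (hside _ _ hole) (isClosed_le continuous_const (continuous_area _ _))
  have := this hp
  simp only [mem_ofPred_eq] at this
  linarith

/-- A closed set is the basis of a gap if the endpoints of its holes are equivalent and no pair of
equivalent points crosses it. -/
theorem isGapBasis_of_rel {r : Setoid UnitAddCircle} {B : Set UnitAddCircle} (hB : IsClosed B)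
    {x y z : ℝ} (h1 : x < y) (h2 : y < z)
    (h3 : z < x + 1) (hx : (x : UnitAddCircle) ∈ B) (hy : (y : UnitAddCircle) ∈ B)
    (hz : (z : UnitAddCircle) ∈ B)
    (hhole : ∀ a b, IsHole B a b → r a b)
    (hnc : ∀ a b, a ≠ b → r a b → ¬ Crosses B a b) : IsGapBasis r B := by
  refine isGapBasis_of_leaves hB h1 h2 h3 hx hy hz (fun a b hab => Or.inr ⟨hhole a b hab, ?_⟩) ?_
  -- If the chord is not an edge of its class, the class has points on both sides of it, and these
  -- form an equivalent pair that crosses `B`.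
  · by_contra hcon
    have hr := hhole a b hab
    obtain ⟨s, t, hst, hts, rfl, rfl⟩ := hab.exists_lift
    unfold IsEdge at hcon
    push Not at hcon
    obtain ⟨c1, c2⟩ := hcon
    rw [isHole_coe_iff hst hts] at c1
    rw [← coe_add_one s, isHole_coe_iff hts (by linarith), coe_add_one] at c2
    simp only [mem_ofPred_eq, r.refl', hr, true_and, not_forall, not_not] at c1 c2
    obtain ⟨p, p1, p2, hp⟩ := c1
    obtain ⟨q, q1, q2, hq⟩ := c2
    refine hnc p q (coe_ne_of_lt (by linarith) (by linarith)) (r.trans' (r.symm' hp) hq) ?_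
    rw [crosses_coe_iff (by linarith) (by linarith)]
    exact ⟨⟨t, p2, q1, hab.2.1⟩, s + 1, by linarith, by linarith, by rw [coe_add_one]; exact hab.1⟩
  · rintro a b hab (h | h)
    · exact absurd h hab
    · exact hnc a b hab h.1

theorem IsGap.one_sided {r : Setoid UnitAddCircle} {G : Set ℂ} {z₀ : ℂ}
    (hz₀ : z₀ ∈ Metric.ball (0 : ℂ) 1 \ leafUnion r)
    (hG : G = closure (connectedComponentIn (Metric.ball (0 : ℂ) 1 \ leafUnion r) z₀))
    {a b : UnitAddCircle} (hab : a ≠ b) (h : IsLeaf r a b) (hpos : 0 < area (pt a) (pt b) z₀) :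
    ∀ z ∈ G, 0 ≤ area (pt a) (pt b) z := by
  set W := connectedComponentIn (Metric.ball (0 : ℂ) 1 \ leafUnion r) z₀ with hW
  have hWΩ := connectedComponentIn_subset (Metric.ball (0 : ℂ) 1 \ leafUnion r) z₀
  have hsub : W ⊆ {z | 0 ≤ area (pt a) (pt b) z} := by
    intro w hw
    refine (area_pos_of_isPreconnected hab isPreconnected_connectedComponentIn
      (fun v hv => (hWΩ hv).1) ?_ (mem_connectedComponentIn hz₀) hw hpos).le
    exact Set.disjoint_left.2 fun v hv hv' => (hWΩ hv).2 (h.segment_subset hv')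
  rw [hG]
  exact closure_minimal hsub (isClosed_le continuous_const (continuous_area _ _))

theorem area_ne_zero_of_notMem_leafUnion {r : Setoid UnitAddCircle} {z₀ : ℂ}
    (hz₀ : z₀ ∈ Metric.ball (0 : ℂ) 1 \ leafUnion r)
    {a b : UnitAddCircle} (hab : a ≠ b) (h : IsLeaf r a b) : area (pt a) (pt b) z₀ ≠ 0 :=
  fun h0 => hz₀.2 (h.segment_subset (mem_segment_of_area_eq_zero (norm_pt a) (norm_pt b)
    (fun e => hab (pt_injective e)) (by simpa using hz₀.1) h0))

theorem IsLeaf.symm {r : Setoid UnitAddCircle} {a b : UnitAddCircle} (h : IsLeaf r a b) :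
    IsLeaf r b a := by
  rcases h with h | ⟨h, h'⟩
  · exact Or.inl h.symm
  · refine Or.inr ⟨r.symm' h, ?_⟩
    have e : {x | r b x} = {x | r a x} := (cls_eq_of_rel h).symm
    rw [e]; exact Or.symm h'

theorem IsGapBasis.not_crosses_leaf {r : Setoid UnitAddCircle} {B : Set UnitAddCircle}
    (hB : IsGapBasis r B) {a b : UnitAddCircle} (hab : a ≠ b) (h : IsLeaf r a b) :
    ¬ Crosses B a b := by
  obtain ⟨G, ⟨z₀, hz₀, hG⟩, rfl⟩ := hB
  rintro ⟨⟨p, hp, hpab⟩, q, hq, hqab⟩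
  have np := area_neg_of_mem_cIoo hab hpab
  have nq := area_pos_of_mem_cIoo hab hqab
  rcases lt_or_gt_of_ne (area_ne_zero_of_notMem_leafUnion hz₀ hab h) with h0 | h0
  · have := IsGap.one_sided hz₀ hG hab.symm h.symm (by rw [area_swap]; linarith) _ hq
    rw [area_swap] at this; linarith
  · have := IsGap.one_sided hz₀ hG hab h h0 _ hp
    linarith

/-- A point of a hole of a gap is cut off from the gap by a leaf. -/
theorem IsGapBasis.exists_rel_around {r : Setoid UnitAddCircle} {B : Set UnitAddCircle}
    (hB : IsGapBasis r B) {s t x : ℝ} (hs : (s : UnitAddCircle) ∈ B)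
    (ht : (t : UnitAddCircle) ∈ B) (hno : ∀ z : ℝ, s < z → z < t → (z : UnitAddCircle) ∉ B)
    (hsx : s < x) (hxt : x < t) :
    ∃ c d : ℝ, s ≤ c ∧ c < x ∧ x < d ∧ d ≤ t ∧ r c d := by
  obtain ⟨G, ⟨z₀, hz₀, hG⟩, rfl⟩ := hB
  have hxB : pt x ∉ G := hno x hsx hxt
  -- Otherwise the radial segment from the base point to `x` would stay in the component, and `x`
  -- would lie in its closure.
  have hmeet : ∃ τ : ℝ, 0 < τ ∧ τ < 1 ∧ (1 - τ) • z₀ + τ • pt x ∈ leafUnion r := by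
    by_contra hcon
    push Not at hcon
    apply hxB
    have hz1 : ‖z₀‖ < 1 := by simpa using hz₀.1
    set f : ℝ → ℂ := fun τ => (1 - τ) • z₀ + τ • pt x with hf
    have hfc : Continuous f := by rw [hf]; fun_prop
    have hsub : f '' Ico 0 1 ⊆ Metric.ball (0 : ℂ) 1 \ leafUnion r := by
      rintro _ ⟨τ, ⟨h0, h1⟩, rfl⟩
      rcases h0.eq_or_lt with rfl | h0
      · simpa [hf] using hz₀
      refine ⟨?_, hcon τ h0 h1⟩
      rw [Metric.mem_ball, dist_zero_right]
      calc ‖f τ‖ ≤ ‖(1 - τ) • z₀‖ + ‖τ • pt x‖ := norm_add_le _ _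
        _ = (1 - τ) * ‖z₀‖ + τ := by
          rw [norm_smul, norm_smul, norm_pt, Real.norm_eq_abs, Real.norm_eq_abs,
            abs_of_pos (by linarith), abs_of_pos h0, mul_one]
        _ < 1 := by nlinarith
    have hW := ((isPreconnected_Ico (a := (0 : ℝ)) (b := 1)).image f
      hfc.continuousOn).subset_connectedComponentIn (x := z₀)
      ⟨0, ⟨le_refl _, zero_lt_one⟩, by simp [hf]⟩ hsub
    rw [hG]
    refine closure_mono hW ?_
    have : f 1 ∈ closure (f '' Ico 0 1) := by
      apply image_closure_subset_closure_image hfc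
      refine mem_image_of_mem _ ?_
      rw [closure_Ico (zero_ne_one)]; exact ⟨zero_le_one, le_refl _⟩
    simpa [hf] using this
  obtain ⟨τ, h0, h1, a, b, hab, hτ⟩ := hmeet
  have hz1 : ‖z₀‖ < 1 := by simpa using hz₀.1
  have hne : a ≠ b := by
    rintro rfl
    rw [segment_same, mem_singleton_iff] at hτ
    have e : ‖(1 - τ) • z₀ + τ • pt x‖ = 1 := by rw [hτ, norm_pt]
    have : ‖(1 - τ) • z₀ + τ • pt x‖ ≤ (1 - τ) * ‖z₀‖ + τ := by
      refine (norm_add_le _ _).trans_eq ?_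
      rw [norm_smul, norm_smul, norm_pt, Real.norm_eq_abs, Real.norm_eq_abs,
            abs_of_pos (by linarith), abs_of_pos h0, mul_one]
    nlinarith
  have main : ∀ a b, a ≠ b → IsLeaf r a b →
      (1 - τ) • z₀ + τ • pt x ∈ segment ℝ (pt a) (pt b) → 0 < area (pt a) (pt b) z₀ →
      ∃ c d : ℝ, s ≤ c ∧ c < x ∧ x < d ∧ d ≤ t ∧ r c d := by
    intro a b hne hab hτ hpos
    have harea : area (pt a) (pt b) ((1 - τ) • z₀ + τ • pt x) = 0 := by
      obtain ⟨p, q, -, -, hpq, e⟩ := hτ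
      rw [← e, area_combo _ _ _ _ hpq, area_left, area_right]; ring
    rw [area_combo _ _ _ _ (by ring)] at harea
    have hxneg : area (pt a) (pt b) (pt x) < 0 := by
      by_contra hge
      have := mul_pos (sub_pos.2 h1) hpos
      have := mul_nonneg h0.le (not_lt.1 hge)
      linarith
    have hG' := IsGap.one_sided hz₀ hG hne hab hpos
    have hxa : (x : UnitAddCircle) ∈ cIoo a b := by
      by_contra hcon
      have := area_pt_nonneg_of_notMem hne hcon
      linarith
    obtain ⟨c', -, -, hc'⟩ := exists_lift a 0
    subst hc'
    obtain ⟨d', hd1, hd2, hd'⟩ := exists_lift_of_ne hne.symm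
    subst hd'
    obtain ⟨x', hx1, hx2, hx'⟩ := (sbtw_coe_iff hd1 hd2 _).1 hxa
    obtain ⟨n, hn⟩ := coe_eq_iff.1 hx'
    have hc : ((c' + n : ℝ) : UnitAddCircle) = c' := coe_add_int _ _
    have hd : ((d' + n : ℝ) : UnitAddCircle) = d' := coe_add_int _ _
    have hB : ∀ z : ℝ, (z : UnitAddCircle) ∈ {x | pt x ∈ G} → ¬ (c' + n < z ∧ z < d' + n) := by
      rintro z hz ⟨hz1, hz2⟩
      have := area_pt_neg hz1 hz2 (by linarith)
      rw [hc, hd] at this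
      have := hG' _ hz
      linarith
    refine ⟨c' + n, d' + n, ?_, by linarith, by linarith, ?_, ?_⟩
    · by_contra hcon
      exact hB s hs ⟨by linarith, by linarith⟩
    · by_contra hcon
      exact hB t ht ⟨by linarith, by linarith⟩
    · rw [hc, hd]
      rcases hab with h | h
      · exact absurd h hne
      · exact h.1
  rcases lt_or_gt_of_ne (area_ne_zero_of_notMem_leafUnion hz₀ hne hab) with hlt | hgt
  · exact main b a hne.symm hab.symm (by rwa [segment_symm]) (by rw [area_swap]; linarith)
  · exact main a b hne hab hτ hgt

theorem IsLamination.isClosed_lift {r : Setoid UnitAddCircle} (hr : IsLamination r) :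
    IsClosed {p : ℝ × ℝ | r (p.1 : UnitAddCircle) (p.2 : UnitAddCircle)} := by
  have : Continuous (fun p : ℝ × ℝ => ((p.1 : UnitAddCircle), (p.2 : UnitAddCircle))) :=
    (continuous_coe_circle.comp continuous_fst).prodMk (continuous_coe_circle.comp continuous_snd)
  exact hr.closed.preimage this

/-- The endpoints of a hole of a gap are equivalent. -/
theorem IsGapBasis.rel_of_isHole {r : Setoid UnitAddCircle} (hr : IsLamination r)
    {B : Set UnitAddCircle} (hB : IsGapBasis r B) {a b : UnitAddCircle} (h : IsHole B a b) :
    r a b := by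
  obtain ⟨s, t, h1, h2, rfl, rfl⟩ := h.exists_lift
  rw [isHole_coe_iff h1 h2] at h
  obtain ⟨hs, ht, hno⟩ := h
  obtain ⟨x, hsx, hxt⟩ := exists_between h1
  -- By closedness of the graph there is a longest equivalent pair around `x` within the hole. If it
  -- stopped short of an endpoint, the leaf cutting off that end would contain it or be linked with
  -- it, and give a longer pair.
  set S : Set (ℝ × ℝ) := (Icc s x ×ˢ Icc x t) ∩ {p | r (p.1 : UnitAddCircle) (p.2 : UnitAddCircle)}
  have hS : IsCompact S := (isCompact_Icc.prod isCompact_Icc).inter_right hr.isClosed_lift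
  have hSn : S.Nonempty := ⟨(x, x), ⟨⟨hsx.le, le_refl _⟩, le_refl _, hxt.le⟩, r.refl' _⟩
  obtain ⟨⟨y, y'⟩, ⟨⟨hy, hy'⟩, hyr⟩, hmax⟩ := hS.exists_isMaxOn hSn
    (f := fun p => p.2 - p.1) (by fun_prop)
  simp only at hy hy'
  have hyr : r y y' := hyr
  have hmax' : ∀ c d : ℝ, s ≤ c → c ≤ x → x ≤ d → d ≤ t → r c d → d - c ≤ y' - y :=
    fun c d h1 h2 h3 h4 h5 => hmax (show (c, d) ∈ S from ⟨⟨⟨h1, h2⟩, h3, h4⟩, h5⟩)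
  have hys : y = s := by
    by_contra hne
    have hlt : s < y := lt_of_le_of_ne hy.1 (Ne.symm hne)
    obtain ⟨c, d, h3, h4, h5, h6, h7⟩ := hB.exists_rel_around hs ht hno hlt (by linarith [hy.2])
    rcases le_or_gt y' d with hd | hd
    · have := hmax' c d h3 (by linarith [hy.2]) (by linarith [hy'.1]) h6 h7
      linarith
    · have hcy := hr.trans_of_linked h4 h5 hd (by linarith [hy'.2]) h7 hyr
      have := hmax' c y' h3 (by linarith [hy.2]) hy'.1 hy'.2 (r.trans' hcy hyr)
      linarith
  have hyt : y' = t := by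
    by_contra hne
    have hlt : y' < t := lt_of_le_of_ne hy'.2 hne
    obtain ⟨c, d, h3, h4, h5, h6, h7⟩ := hB.exists_rel_around hs ht hno (by linarith [hy'.1]) hlt
    rcases le_or_gt c y with hd | hd
    · have := hmax' c d h3 (by linarith [hy.2]) (by linarith [hy'.1]) h6 h7
      linarith
    · have hcy := hr.trans_of_linked hd h4 h5 (by linarith) hyr h7
      have := hmax' y d hy.1 hy.2 (by linarith [hy'.1]) h6 (r.trans' hcy h7)
      linarith
  rw [← hys, ← hyt]; exact hyr

/-- No pair of equivalent points crosses an infinite gap. -/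
theorem IsFatouGapBasis.not_crosses {r : Setoid UnitAddCircle}
    (hfin : ∀ x, (cls r x).Finite)
    {B : Set UnitAddCircle} (hB : IsFatouGapBasis r B) {a b : UnitAddCircle} (hab : a ≠ b)
    (h : r a b) : ¬ Crosses B a b := by
  have hclosed : IsClosed (cls r a) := (hfin a).isClosed
  have hnt : (cls r a).Nontrivial := ⟨a, r.refl' a, b, h, hab⟩
  -- When a pair crosses the gap, each point of the gap outside the class lies in a hole of the
  -- class, and the edge of that hole is a leaf crossing the gap. So the whole infinite gap would
  -- lie in a finite class.
  have key : ∀ s t : ℝ, s < t → t < s + 1 → (s : UnitAddCircle) ∈ cls r a →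
      (t : UnitAddCircle) ∈ cls r a → Crosses B s t →
      ∀ z : ℝ, s < z → z < t → (z : UnitAddCircle) ∈ B → (z : UnitAddCircle) ∈ cls r a := by
    intro s t h1 h2 hs ht hc z hz1 hz2 hzB
    by_contra hz
    obtain ⟨s', t', h3, h4, h5, h6, h7, h8⟩ := exists_hole_of_notMem hclosed hnt hz
    have hss : s ≤ s' := by
      by_contra hcon; exact h8 s (by linarith) (by linarith) hs
    have htt : t' ≤ t := by
      by_contra hcon; exact h8 t (by linarith) (by linarith) ht
    have hhole : IsHole (cls r a) s' t' := (isHole_coe_iff (h3.trans h4) h5).2 ⟨h6, h7, h8⟩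
    have hleaf : IsLeaf r s' t' := by
      refine Or.inr ⟨r.trans' (r.symm' h6) h7, Or.inl ?_⟩
      have : {x | r (s' : UnitAddCircle) x} = cls r a := (cls_eq_of_rel h6).symm
      rw [this]; exact hhole
    refine hB.1.not_crosses_leaf (coe_ne_of_lt (h3.trans h4) h5) hleaf ?_
    rw [crosses_coe_iff (h3.trans h4) h5]
    refine ⟨⟨z, h3, h4, hzB⟩, ?_⟩
    obtain ⟨-, w, hw1, hw2, hwB⟩ := (crosses_coe_iff h1 h2).1 hc
    exact ⟨w, by linarith, by linarith, hwB⟩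
  intro hc
  obtain ⟨s, -, -, rfl⟩ := exists_lift a 0
  obtain ⟨t, h1, h2, rfl⟩ := exists_lift_of_ne hab.symm
  apply hB.2
  refine (hfin s).subset fun p hp => ?_
  by_cases e : p = (s : UnitAddCircle)
  · rw [e]; exact r.refl' _
  obtain ⟨z, hz1, hz2, rfl⟩ := exists_lift_of_ne e
  rcases lt_trichotomy z t with hzt | hzt | hzt
  · exact key s t h1 h2 (r.refl' _) h hc z hz1 hzt hp
  · rw [hzt]; exact h
  · refine key t (s + 1) h2 (by linarith) h (by rw [coe_add_one]; exact r.refl' _) ?_ z hzt hz2 hp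
    rw [coe_add_one]; exact hc.symm

/-! ### Renormalization

Behind the longest edge of an invariant class (or behind the fixed point `0`), the return map is
`x ↦ N * x` near the left end and `y ↦ N * (y - δ)` near the right end of the interval `[0, 1]`. -/

/-- An equivalence relation on the line with the properties of a lamination and its return map in
the coordinate of the interval behind an edge; `x ↦ x + δ` is the half turn. -/
structure Ren (N δ : ℝ) (R : ℝ → ℝ → Prop) : Prop where
  two_le : 2 ≤ N
  mul_delta : N * δ = N - 1
  equiv : Equivalence R
  closed : IsClosed {p : ℝ × ℝ | R p.1 p.2}
  linked : ∀ {s t s' t' : ℝ}, 0 ≤ s → s < t → t < s' → s' < t' → t' ≤ 1 → R s s' → R t t' → R s t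
  finite : ∀ x, {t | t ∈ Icc (0 : ℝ) 1 ∧ R x t}.Finite
  zero_one : R 0 1
  boundary : ∀ t, 0 < t → t < 1 → ¬ R 0 t
  mul : ∀ {x y}, R x y → R (N * x) (N * y)
  shift : ∀ x, R x (x + (N - 1))
  add : ∀ {x y}, R x y → R (x + δ) (y + δ)
  add_twice : ∀ x, R x (x + 2 * δ)
  pull : ∀ {x y}, x ∈ Icc 0 (1 - δ) → y ∈ Icc 0 (1 - δ) → R (N * x) (N * y) →
    R x y ∨ R x (y + δ)
  aperiodic : ∀ {x}, R x (x + δ) → ∀ k : ℕ, 0 < k → ¬ R x (N ^ k * x)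

/-- An equivalent pair that separates the edge from its half turn image. -/
structure StripPair (δ : ℝ) (R : ℝ → ℝ → Prop) (x y : ℝ) : Prop where
  pos : 0 < x
  lt_left : x < 1 - δ
  lt_right : δ < y
  lt_one : y < 1
  rel : R x y

namespace Ren

variable {N δ : ℝ} {R : ℝ → ℝ → Prop}

theorem mul_one_sub (H : Ren N δ R) : N * (1 - δ) = 1 := by linarith [H.mul_delta]

theorem half_le (H : Ren N δ R) : 1 / 2 ≤ δ := by nlinarith [H.mul_one_sub, H.two_le]

theorem lt_one (H : Ren N δ R) : δ < 1 := by nlinarith [H.mul_one_sub, H.two_le]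

theorem symm (H : Ren N δ R) {x y : ℝ} (h : R x y) : R y x := H.equiv.symm h

theorem trans (H : Ren N δ R) {x y z : ℝ} (h : R x y) (h' : R y z) : R x z := H.equiv.trans h h'

theorem add_sub (H : Ren N δ R) {x y : ℝ} (h : R x y) : R (x + δ) (y - δ) := by
  have h1 := H.add_twice (y - δ)
  have e : y - δ + 2 * δ = y + δ := by ring
  rw [e] at h1
  exact H.trans (H.add h) (H.symm h1)

theorem sub_sub (H : Ren N δ R) {x y : ℝ} (h : R x y) : R (x - δ) (y - δ) := by
  have h1 := H.add_twice (x - δ)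
  have e : x - δ + 2 * δ = x + δ := by ring
  rw [e] at h1
  exact H.trans h1 (H.add_sub h)

theorem mul_shift (H : Ren N δ R) (y : ℝ) : R (N * (y - δ)) (N * y) := by
  have h1 := H.shift (N * (y - δ))
  have e : N * (y - δ) + (N - 1) = N * y := by linarith [H.mul_delta]
  rwa [e] at h1

theorem mul_right (H : Ren N δ R) {x y : ℝ} (h : R x y) : R (N * x) (N * (y - δ)) :=
  H.trans (H.mul h) (H.symm (H.mul_shift y))

theorem mul_both (H : Ren N δ R) {x y : ℝ} (h : R x y) : R (N * (x - δ)) (N * (y - δ)) :=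
  H.trans (H.mul_shift x) (H.mul_right h)

theorem eq_of_rel_zero (H : Ren N δ R) {t : ℝ} (h0 : 0 ≤ t) (h1 : t ≤ 1) (h : R 0 t) :
    t = 0 ∨ t = 1 := by
  by_contra hcon
  push Not at hcon
  exact H.boundary t (lt_of_le_of_ne h0 (Ne.symm hcon.1)) (lt_of_le_of_ne h1 hcon.2) h

theorem eq_of_rel_one (H : Ren N δ R) {t : ℝ} (h0 : 0 ≤ t) (h1 : t ≤ 1) (h : R t 1) :
    t = 0 ∨ t = 1 :=
  H.eq_of_rel_zero h0 h1 (H.trans H.zero_one (H.symm h))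

theorem rel_inner (H : Ren N δ R) : R (1 - δ) δ := by
  have := H.add_sub H.zero_one
  rw [zero_add] at this
  exact H.symm this

/-- On the boundary of the strip only the edge and its half turn image occur, because the class of
the edge has no point strictly inside the interval. -/
theorem strip_cases (H : Ren N δ R) {x y : ℝ} (h : R x y) (hx0 : 0 ≤ x) (hx1 : x ≤ 1 - δ)
    (hy0 : δ ≤ y) (hy1 : y ≤ 1) :
    StripPair δ R x y ∨ (x = 0 ∧ y = 1) ∨ (x = 1 - δ ∧ y = δ) := by
  have hδ := H.half_le
  have hδ1 := H.lt_one
  rcases hx0.eq_or_lt with rfl | hx0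
  · rcases H.eq_of_rel_zero (by linarith) hy1 h with e | e
    · linarith
    · exact Or.inr (Or.inl ⟨rfl, e⟩)
  rcases hy1.eq_or_lt with rfl | hy1
  · rcases H.eq_of_rel_one hx0.le (by linarith) h with e | e <;> linarith
  have hs := H.add_sub h
  rcases hx1.eq_or_lt with rfl | hx1
  · have e : 1 - δ + δ = 1 := by ring
    rw [e] at hs
    rcases H.eq_of_rel_one (by linarith) (by linarith) (H.symm hs) with e | e
    · exact Or.inr (Or.inr ⟨rfl, by linarith⟩)
    · linarith
  rcases hy0.eq_or_lt with rfl | hy0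
  · rw [sub_self] at hs
    rcases H.eq_of_rel_zero (by linarith) (by linarith) (H.symm hs) with e | e <;> linarith
  exact Or.inl ⟨hx0, hx1, hy0, hy1, h⟩

theorem StripPair.sib (H : Ren N δ R) {x y : ℝ} (h : StripPair δ R x y) :
    StripPair δ R (y - δ) (x + δ) :=
  ⟨by linarith [h.lt_right], by linarith [h.lt_one], by linarith [h.pos], by linarith [h.lt_left],
    H.symm (H.add_sub h.rel)⟩

/-- If no class is invariant, then the image of a strip pair lies strictly inside or strictly
outside of it. -/
theorem in_or_out (H : Ren N δ R) (hA : ∀ x, 0 < x → x < 1 - δ → ¬ R x (N * x)) {x y : ℝ}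
    (h : StripPair δ R x y) :
    (N * x < y ∧ x < N * (y - δ)) ∨ (y < N * x ∧ N * (y - δ) < x) := by
  have hN := H.two_le
  have h1 := H.mul_one_sub
  have hδ := H.half_le
  obtain ⟨hx0, hx1, hy0, hy1, hxy⟩ := h
  have himg := H.mul_right hxy
  have hne := hA x hx0 hx1
  have a1 : x < N * x := by nlinarith
  have a2 : N * x < 1 := by nlinarith
  have b1 : 0 < N * (y - δ) := by nlinarith
  have b2 : N * (y - δ) < y := by nlinarith
  -- The left end moves right and the right end moves left. Every position other than nested makes
  -- the pair meet or link its image, so that both lie in one class, against `hA`.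
  rcases lt_trichotomy (N * x) y with hl | he | hg
  · left
    refine ⟨hl, ?_⟩
    by_contra hcon
    rcases (not_lt.1 hcon).eq_or_lt with e | e
    · rw [e] at himg; exact hne (H.symm himg)
    · have := H.linked b1.le e a1 hl hy1.le (H.symm himg) hxy
      exact hne (H.trans (H.symm this) (H.symm himg))
  · exact absurd (he ▸ hxy) hne
  · right
    refine ⟨hg, ?_⟩
    by_contra hcon
    rcases (not_lt.1 hcon).eq_or_lt with e | e
    · rw [← e] at himg; exact hne (H.symm himg)
    · have := H.linked hx0.le e b2 hg a2.le hxy (H.symm himg)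
      exact hne (H.trans this (H.symm himg))

theorem isCompact_pairs (H : Ren N δ R) {a b c d : ℝ} :
    IsCompact ((Icc a b ×ˢ Icc c d) ∩ {p : ℝ × ℝ | R p.1 p.2}) :=
  (isCompact_Icc.prod isCompact_Icc).inter_right H.closed

/-- There is a strip pair of length at most `δ` whose image lies inside of it. -/
theorem exists_in_pair (H : Ren N δ R) (hA : ∀ x, 0 < x → x < 1 - δ → ¬ R x (N * x))
    (hS : ∃ x y, StripPair δ R x y) :
    ∃ x y, StripPair δ R x y ∧ y - x ≤ δ ∧ N * x < y ∧ x < N * (y - δ) := by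
  have hN := H.two_le
  have hm := H.mul_one_sub
  have hδ := H.half_le
  have hδ1 := H.lt_one
  -- The lengths of a strip pair and of its half turn image add up to `2 * δ`, so one of them has
  -- length at most `δ`.
  obtain ⟨a, b, hab, hlen⟩ : ∃ x y, StripPair δ R x y ∧ y - x ≤ δ := by
    obtain ⟨x, y, h⟩ := hS
    rcases le_total (y - x) δ with hl | hl
    · exact ⟨x, y, h, hl⟩
    · exact ⟨_, _, StripPair.sib H h, by linarith⟩
  set S := ((Icc 0 (1 - δ) ×ˢ Icc δ 1) ∩ {p : ℝ × ℝ | R p.1 p.2}) ∩ {p : ℝ × ℝ | p.2 - p.1 ≤ δ}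
  have hSc : IsCompact S := H.isCompact_pairs.inter_right
    (isClosed_le (by fun_prop) continuous_const)
  obtain ⟨⟨x, y⟩, ⟨⟨⟨hx, hy⟩, hxy⟩, hxyδ⟩, hmax⟩ := hSc.exists_isMaxOn
    (f := fun p => p.2 - p.1)
    ⟨(a, b), ⟨⟨⟨⟨hab.pos.le, hab.lt_left.le⟩, hab.lt_right.le, hab.lt_one.le⟩, hab.rel⟩, hlen⟩⟩
    (by fun_prop)
  have hxy : R x y := hxy
  have hxyδ : y - x ≤ δ := hxyδ
  have hmax' : ∀ c d, StripPair δ R c d → d - c ≤ δ → d - c ≤ y - x := fun c d h h' =>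
    hmax (show (c, d) ∈ S from ⟨⟨⟨⟨h.pos.le, h.lt_left.le⟩, h.lt_right.le, h.lt_one.le⟩, h.rel⟩, h'⟩)
  have hge := hmax' a b hab hlen
  have hp : StripPair δ R x y := by
    rcases H.strip_cases hxy hx.1 hx.2 hy.1 hy.2 with h | ⟨e1, e2⟩ | ⟨e1, e2⟩
    · exact h
    · linarith
    · linarith [hab.lt_left, hab.lt_right]
  refine ⟨x, y, hp, hxyδ, ?_⟩
  rcases H.in_or_out hA hp with h | ⟨h1, h2⟩
  · exact h
  exfalso
  have p0 := hp.pos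
  have p1 := hp.lt_left
  have p2 := hp.lt_right
  have p3 := hp.lt_one
  -- The longest such pair cannot move outward: its image would be longer, hence longer than `δ`,
  -- and then the half turn image of that image is a competitor that is too long.
  have himg : StripPair δ R (N * (y - δ)) (N * x) :=
    ⟨by nlinarith, by linarith, by linarith, by nlinarith, H.symm (H.mul_right hxy)⟩
  have hlong : δ < N * x - N * (y - δ) := by
    by_contra hcon
    have := hmax' _ _ himg (not_lt.1 hcon)
    linarith
  have := hmax' _ _ (StripPair.sib H himg) (by linarith)
  nlinarith [H.mul_delta]

end Ren

/-! ### Frames: an inward pair and its preimage with nothing in between -/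

/-- A strip pair `I = (x₁, y₁)` whose image lies inside of it, such that the only strip pairs
between `I` and its preimage pair `O` inside of it are `I` and `O`. -/
structure Frame (N δ : ℝ) (R : ℝ → ℝ → Prop) (x₁ y₁ : ℝ) : Prop where
  pair : StripPair δ R x₁ y₁
  length_le : y₁ - x₁ ≤ δ
  left_lt : N * x₁ < y₁
  lt_right : x₁ < N * (y₁ - δ)
  opp : R (y₁ * (1 - δ)) (x₁ * (1 - δ) + δ)
  only : ∀ x y, R x y → x₁ ≤ x → x ≤ y₁ * (1 - δ) → x₁ * (1 - δ) + δ ≤ y → y ≤ y₁ →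
    (x = x₁ ∧ y = y₁) ∨ (x = y₁ * (1 - δ) ∧ y = x₁ * (1 - δ) + δ)

namespace Ren

variable {N δ : ℝ} {R : ℝ → ℝ → Prop}

/-- Two extremal choices: `I` is the shortest inward pair of length at most `δ`, so every other
strip pair inside it moves outward; the longest outward pair inside `I` must be `O`, since its image
is at least as close to `I` as allowed. -/
theorem exists_frame (H : Ren N δ R) (hA : ∀ x, 0 < x → x < 1 - δ → ¬ R x (N * x))
    (hS : ∃ x y, StripPair δ R x y) : ∃ x₁ y₁, Frame N δ R x₁ y₁ := by
  have hN := H.two_le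
  have hm := H.mul_one_sub
  have hδ := H.half_le
  have hδ1 := H.lt_one
  obtain ⟨a, b, hab, hlen, hin1, hin2⟩ := H.exists_in_pair hA hS
  set S := ((Icc 0 (1 - δ) ×ˢ Icc δ 1) ∩ {p : ℝ × ℝ | R p.1 p.2}) ∩
    ({p : ℝ × ℝ | p.2 - p.1 ≤ δ} ∩ ({p : ℝ × ℝ | N * p.1 ≤ p.2} ∩ {p : ℝ × ℝ | p.1 ≤ N * (p.2 - δ)}))
  have hSc : IsCompact S := H.isCompact_pairs.inter_right
    ((isClosed_le (by fun_prop) continuous_const).inter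
      ((isClosed_le (by fun_prop) (by fun_prop)).inter (isClosed_le (by fun_prop) (by fun_prop))))
  obtain ⟨⟨x, y⟩, ⟨⟨⟨hx, hy⟩, hxy⟩, hxyδ, hxy1, hxy2⟩, hmin⟩ := hSc.exists_isMinOn
    (f := fun p => p.2 - p.1)
    ⟨(a, b), ⟨⟨⟨⟨hab.pos.le, hab.lt_left.le⟩, hab.lt_right.le, hab.lt_one.le⟩, hab.rel⟩,
      hlen, hin1.le, hin2.le⟩⟩ (by fun_prop)
  have hxy : R x y := hxy
  replace hxyδ : y - x ≤ δ := hxyδ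
  replace hxy1 : N * x ≤ y := hxy1
  replace hxy2 : x ≤ N * (y - δ) := hxy2
  have hmin' : ∀ c d, StripPair δ R c d → d - c ≤ δ → N * c < d → c < N * (d - δ) →
      y - x ≤ d - c := fun c d h h' h'' h''' =>
    hmin (show (c, d) ∈ S from ⟨⟨⟨⟨h.pos.le, h.lt_left.le⟩, h.lt_right.le, h.lt_one.le⟩, h.rel⟩,
      h', h''.le, h'''.le⟩)
  have hp : StripPair δ R x y := by
    rcases H.strip_cases hxy hx.1 hx.2 hy.1 hy.2 with h | ⟨e1, e2⟩ | ⟨e1, e2⟩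
    · exact h
    · linarith
    · rw [e1, e2, hm] at hxy1; linarith
  have ⟨p0, p1, p2, p3, _⟩ := hp
  obtain ⟨hl, hr⟩ : N * x < y ∧ x < N * (y - δ) := by
    rcases H.in_or_out hA hp with h | h
    · exact h
    · linarith [h.1]
  set x' := y * (1 - δ) with hx'
  set y' := x * (1 - δ) + δ with hy'
  have ex : N * x' = y := by rw [hx']; linear_combination y * hm
  have ey : N * (y' - δ) = x := by rw [hy']; linear_combination x * hm
  have hxx' : x < x' := by nlinarith
  have hx'1 : x' < 1 - δ := by nlinarith
  have hy'δ : δ < y' := by nlinarith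
  have hy'y : y' < y := by nlinarith
  have hopp : R x' y' := by
    have h0 : R (N * x') (N * (x * (1 - δ))) := by
      -- The preimage of `I` under both branches is wanted. If the pullback instead joined two
      -- points near the left end, it would be linked with `I`, and mapping forward would give a
      -- fixed class.
      have : N * (x * (1 - δ)) = x := by linear_combination x * hm
      rw [ex, this]; exact H.symm hxy
    rcases H.pull ⟨by linarith, hx'1.le⟩ ⟨by nlinarith, by nlinarith⟩ h0 with h | h
    · exfalso
      have hlt : x * (1 - δ) < x := by nlinarith
      have := H.linked (by nlinarith) hlt hxx' (by linarith) p3.le (H.symm h) hxy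
      have h2 : R x x' := H.trans (H.symm this) (H.symm h)
      have h3 := H.mul h2
      rw [ex] at h3
      exact hA x p0 p1 (H.trans hxy (H.symm h3))
    · exact h
  have hopp' : StripPair δ R x' y' := ⟨by linarith, hx'1, hy'δ, by linarith, hopp⟩
  -- Minimality of `I`: an inward pair inside it cannot be shorter.
  have out_of : ∀ c d, StripPair δ R c d → x ≤ c → d ≤ y → x ≠ c ∨ d ≠ y →
      d < N * c ∧ N * (d - δ) < c := by
    intro c d h h1 h2 hne
    rcases H.in_or_out hA h with h' | h'
    · exfalso
      have := hmin' c d h (by linarith) h'.1 h'.2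
      rcases hne with hne | hne
      · exact hne (by linarith)
      · exact hne (by linarith)
    · exact h'
  set S₂ := ((Icc x (1 - δ) ×ˢ Icc δ y) ∩ {p : ℝ × ℝ | R p.1 p.2}) ∩
    ({p : ℝ × ℝ | p.2 ≤ N * p.1} ∩ {p : ℝ × ℝ | N * (p.2 - δ) ≤ p.1})
  have hSc₂ : IsCompact S₂ := H.isCompact_pairs.inter_right
    ((isClosed_le (by fun_prop) (by fun_prop)).inter (isClosed_le (by fun_prop) (by fun_prop)))
  obtain ⟨⟨x₂, y₂⟩, ⟨⟨⟨hx2, hy2⟩, hxy2r⟩, ho1, ho2⟩, hmax⟩ := hSc₂.exists_isMaxOn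
    (f := fun p => p.2 - p.1)
    ⟨(x', y'), ⟨⟨⟨⟨hxx'.le, hx'1.le⟩, hy'δ.le, hy'y.le⟩, hopp⟩,
      by change y' ≤ N * x'; rw [ex]; exact hy'y.le,
      by change N * (y' - δ) ≤ x'; rw [ey]; exact hxx'.le⟩⟩ (by fun_prop)
  have hxy2r : R x₂ y₂ := hxy2r
  replace ho1 : y₂ ≤ N * x₂ := ho1
  replace ho2 : N * (y₂ - δ) ≤ x₂ := ho2
  replace hx2 : x₂ ∈ Icc x (1 - δ) := hx2
  replace hy2 : y₂ ∈ Icc δ y := hy2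
  have hmax' : ∀ c d, StripPair δ R c d → x ≤ c → d ≤ y → d ≤ N * c → N * (d - δ) ≤ c →
      d - c ≤ y₂ - x₂ := fun c d h h1 h2 h3 h4 =>
    hmax (show (c, d) ∈ S₂ from ⟨⟨⟨⟨h1, h.lt_left.le⟩, h.lt_right.le, h2⟩, h.rel⟩, h3, h4⟩)
  have hge := hmax' _ _ hopp' hxx'.le hy'y.le (by rw [ex]; exact hy'y.le) (by rw [ey]; exact hxx'.le)
  have hp2 : StripPair δ R x₂ y₂ := by
    rcases H.strip_cases hxy2r (by linarith [hx2.1]) hx2.2 hy2.1 (by linarith [hy2.2]) with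
      h | ⟨e1, e2⟩ | ⟨e1, e2⟩
    · exact h
    · linarith [hx2.1]
    · linarith
  -- If the longest outward pair did not enclose `O` at this end, it would be linked with `O`, and
  -- joining the outer endpoints would give a longer outward pair. The other end is symmetric.
  have hx2' : x₂ ≤ x' := by
    by_contra hcon
    have hlt := not_le.1 hcon
    have hxr := H.linked (by linarith) hlt (by linarith [hx2.2]) (by linarith) hp2.lt_one.le
      hopp hxy2r
    have hnew : StripPair δ R x' y₂ :=
      ⟨by linarith, hx'1, hp2.lt_right, hp2.lt_one, H.trans hxr hxy2r⟩
    have ho := out_of _ _ hnew hxx'.le hy2.2 (Or.inl hxx'.ne)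
    have := hmax' _ _ hnew hxx'.le hy2.2 ho.1.le ho.2.le
    linarith
  have hy2' : y' ≤ y₂ := by
    by_contra hcon
    have hlt := not_le.1 hcon
    have hxr := H.linked (by linarith [hx2.1]) (by linarith : x₂ < x')
      (by linarith [hy2.1] : x' < y₂) hlt (by linarith) hxy2r hopp
    have hnew : StripPair δ R x₂ y' :=
      ⟨hp2.pos, hp2.lt_left, hy'δ, by linarith, H.trans hxr hopp⟩
    have ho := out_of _ _ hnew hx2.1 hy'y.le (Or.inr hy'y.ne)
    have := hmax' _ _ hnew hx2.1 hy'y.le ho.1.le ho.2.le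
    linarith
  have himg : StripPair δ R (N * (y₂ - δ)) (N * x₂) :=
    ⟨by nlinarith, by linarith [hp2.lt_left], by linarith [hp2.lt_right], by nlinarith,
      H.symm (H.mul_right hxy2r)⟩
  have i1 : x ≤ N * (y₂ - δ) := by rw [← ey]; nlinarith
  have i2 : N * x₂ ≤ y := by rw [← ex]; nlinarith
  -- The image of the longest outward pair still lies inside `I`; unless it is `I`, it moves outward
  -- and is longer, a contradiction.
  have heq : x = N * (y₂ - δ) ∧ N * x₂ = y := by
    by_contra hcon
    have hne : x ≠ N * (y₂ - δ) ∨ N * x₂ ≠ y := by tauto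
    have ho := out_of _ _ himg i1 i2 hne
    have := hmax' _ _ himg i1 i2 ho.1.le ho.2.le
    rcases H.in_or_out hA hp2 with h | h <;> linarith [h.1, h.2]
  have ex2 : x₂ = x' := by
    have : N * x₂ = N * x' := by rw [ex]; exact heq.2
    exact mul_left_cancel₀ (by linarith) this
  have ey2 : y₂ = y' := by
    have : N * (y₂ - δ) = N * (y' - δ) := by rw [ey]; exact heq.1.symm
    have := mul_left_cancel₀ (by linarith : N ≠ 0) this
    linarith
  refine ⟨x, y, ⟨hp, hxyδ, hl, hr, hopp, ?_⟩⟩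
  intro c d hcd h1 h2 h3 h4
  have hcp : StripPair δ R c d := ⟨by linarith, by linarith, by linarith, by linarith, hcd⟩
  by_cases hne : x ≠ c ∨ d ≠ y
  · right
    have ho := out_of _ _ hcp h1 h4 hne
    have := hmax' _ _ hcp h1 h4 ho.1.le ho.2.le
    rw [ex2, ey2] at this
    constructor <;> linarith
  · left
    push Not at hne
    exact ⟨hne.1.symm, hne.2⟩

end Ren

namespace Ren

variable {N δ : ℝ} {R : ℝ → ℝ → Prop}

theorem mul_cancel (H : Ren N δ R) (w : ℝ) : N * (w * (1 - δ)) = w := by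
  linear_combination w * H.mul_one_sub

theorem le_mul_iff (H : Ren N δ R) {a w : ℝ} : a ≤ w * (1 - δ) ↔ N * a ≤ w := by
  have hN : 0 < N := by linarith [H.two_le]
  rw [← mul_le_mul_iff_right₀ hN, H.mul_cancel]

theorem lt_mul_iff (H : Ren N δ R) {a w : ℝ} : a < w * (1 - δ) ↔ N * a < w := by
  have hN : 0 < N := by linarith [H.two_le]
  rw [← mul_lt_mul_iff_right₀ hN, H.mul_cancel]

theorem mul_le_iff (H : Ren N δ R) {a w : ℝ} : w * (1 - δ) ≤ a ↔ w ≤ N * a := by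
  have hN : 0 < N := by linarith [H.two_le]
  rw [← mul_le_mul_iff_right₀ hN, H.mul_cancel]

theorem mul_lt_iff (H : Ren N δ R) {a w : ℝ} : w * (1 - δ) < a ↔ w < N * a := by
  have hN : 0 < N := by linarith [H.two_le]
  rw [← mul_lt_mul_iff_right₀ hN, H.mul_cancel]

theorem mul_mono (H : Ren N δ R) {a b : ℝ} (h : a ≤ b) : N * a ≤ N * b :=
  mul_le_mul_of_nonneg_left h (by linarith [H.two_le])

theorem mul_strictMono (H : Ren N δ R) {a b : ℝ} (h : a < b) : N * a < N * b :=
  mul_lt_mul_of_pos_left h (by linarith [H.two_le])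

theorem div_mono (H : Ren N δ R) {a b : ℝ} (h : a ≤ b) : a * (1 - δ) ≤ b * (1 - δ) :=
  mul_le_mul_of_nonneg_right h (by linarith [H.lt_one])

end Ren

/-! ### The gap between the two edges of a frame -/

namespace Frame

variable {N δ : ℝ} {R : ℝ → ℝ → Prop} {x₁ y₁ : ℝ}

/-- Pulling back may produce the half turn partner of the expected point. Such a pair is linked with
`I` or touches it, so both points lie in the class of `I` and are equivalent anyway; `pull_right`
and `pull_opp` use the same argument. -/
theorem pull_left (hF : Frame N δ R x₁ y₁) (H : Ren N δ R) {x y : ℝ} (hx : x ∈ Icc x₁ (1 - δ))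
    (hy : y ∈ Icc x₁ (1 - δ)) (h : R (N * x) (N * y)) : R x y := by
  have hδ := H.half_le
  obtain ⟨p0, p1, p2, p3, hI⟩ := hF.pair
  have hlen := hF.length_le
  have aux : ∀ a b, a ∈ Icc x₁ (1 - δ) → b ∈ Icc x₁ (1 - δ) → R a (b + δ) → R x₁ a := by
    intro a b ha hb hab
    rcases ha.1.eq_or_lt with e | e
    · rw [← e]; exact H.equiv.refl _
    rcases (show y₁ ≤ b + δ by linarith [hb.1]).eq_or_lt with e' | e'
    · rw [← e'] at hab; exact H.trans hI (H.symm hab)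
    · exact H.linked p0.le e (by linarith [ha.2]) e' (by linarith [hb.2]) hI hab
  rcases H.pull ⟨by linarith [hx.1], hx.2⟩ ⟨by linarith [hy.1], hy.2⟩ h with h | h
  · exact h
  · have h' := H.add_sub h
    rw [add_sub_cancel_right] at h'
    exact H.trans (H.symm (aux x y hx hy h)) (aux y x hy hx (H.symm h'))

theorem pull_right (hF : Frame N δ R x₁ y₁) (H : Ren N δ R) {x y : ℝ} (hx : x ∈ Icc δ y₁)
    (hy : y ∈ Icc δ y₁) (h : R (N * (x - δ)) (N * (y - δ))) : R x y := by
  have hδ := H.half_le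
  obtain ⟨p0, p1, p2, p3, hI⟩ := hF.pair
  have hlen := hF.length_le
  have aux : ∀ a b, a ∈ Icc δ y₁ → b ∈ Icc δ y₁ → R a (b - δ) → R x₁ a := by
    intro a b ha hb hab
    rcases ha.2.eq_or_lt with e | e
    · rw [e]; exact hI
    rcases (show b - δ ≤ x₁ by linarith [hb.2]).eq_or_lt with e' | e'
    · rw [e'] at hab; exact H.symm hab
    · have := H.linked (by linarith [hb.1]) e' (by linarith [ha.1]) e p3.le (H.symm hab) hI
      exact H.trans (H.symm this) (H.symm hab)
  rcases H.pull ⟨by linarith [hx.1], by linarith [hx.2]⟩ ⟨by linarith [hy.1], by linarith [hy.2]⟩ h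
    with h | h
  · have := H.add h
    rwa [sub_add_cancel, sub_add_cancel] at this
  · rw [sub_add_cancel] at h
    have h' := H.add_sub h
    rw [sub_add_cancel] at h'
    exact H.trans (H.symm (aux x y hx hy h')) (aux y x hy hx (H.symm h))

theorem pull_opp (hF : Frame N δ R x₁ y₁) (H : Ren N δ R) {x y : ℝ} (hx : x ∈ Icc x₁ (1 - δ))
    (hy : y ∈ Icc δ y₁) (h : R (N * x) (N * (y - δ))) : R x y := by
  have hδ := H.half_le
  obtain ⟨p0, p1, p2, p3, hI⟩ := hF.pair
  have hlen := hF.length_le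
  rcases H.pull ⟨by linarith [hx.1], hx.2⟩ ⟨by linarith [hy.1], by linarith [hy.2]⟩ h
    with h | h
  swap
  · rwa [sub_add_cancel] at h
  have h' := H.add h
  rw [sub_add_cancel] at h'
  have c1 : R x₁ x := by
    rcases hx.1.eq_or_lt with e | e
    · rw [← e]; exact H.equiv.refl _
    rcases (show y - δ ≤ x₁ by linarith [hy.2]).eq_or_lt with e' | e'
    · rw [e'] at h; exact H.symm h
    · have := H.linked (by linarith [hy.1]) e' e (by linarith [hx.2]) p3.le (H.symm h) hI
      exact H.trans (H.symm this) (H.symm h)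
  have c2 : R x₁ y := by
    rcases hy.2.eq_or_lt with e | e
    · rw [e]; exact hI
    rcases (show y₁ ≤ x + δ by linarith [hx.1]).eq_or_lt with e' | e'
    · rw [← e'] at h'; exact H.trans hI h'
    · exact H.linked p0.le (by linarith [hy.1]) e e' (by linarith [hx.2]) hI (H.symm h')
  exact H.trans (H.symm c1) c2

/-- The basis of the gap between the two edges of the frame. -/
def basis (δ : ℝ) (R : ℝ → ℝ → Prop) (x₁ y₁ : ℝ) : Set ℝ :=
  {t | ((x₁ ≤ t ∧ t ≤ y₁ * (1 - δ)) ∨ (x₁ * (1 - δ) + δ ≤ t ∧ t ≤ y₁)) ∧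
    ∀ s s', R s s' → s < t → t < s' →
      ¬ ((x₁ ≤ s ∧ s' ≤ y₁ * (1 - δ)) ∨ (x₁ * (1 - δ) + δ ≤ s ∧ s' ≤ y₁))}

theorem facts (hF : Frame N δ R x₁ y₁) (H : Ren N δ R) :
    x₁ < y₁ * (1 - δ) ∧ y₁ * (1 - δ) < 1 - δ ∧ δ < x₁ * (1 - δ) + δ ∧ x₁ * (1 - δ) + δ < y₁ ∧
      N * (y₁ * (1 - δ)) = y₁ ∧ N * (x₁ * (1 - δ) + δ - δ) = x₁ ∧ x₁ < N * x₁ ∧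
      N * (y₁ - δ) < y₁ ∧ N * (y₁ - δ) ≤ N * x₁ := by
  have hN := H.two_le
  have hm := H.mul_one_sub
  have hδ := H.half_le
  have hδ1 := H.lt_one
  obtain ⟨p0, p1, p2, p3, hI⟩ := hF.pair
  have hlen := hF.length_le
  have hl := hF.left_lt
  have hr := hF.lt_right
  have ex : N * (y₁ * (1 - δ)) = y₁ := by linear_combination y₁ * hm
  have ey : N * (x₁ * (1 - δ) + δ - δ) = x₁ := by linear_combination x₁ * hm
  refine ⟨by nlinarith, by nlinarith, by nlinarith, by nlinarith, ex, ey, by nlinarith,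
    by nlinarith, by nlinarith⟩

theorem left_mem (hF : Frame N δ R x₁ y₁) (H : Ren N δ R) : x₁ ∈ basis δ R x₁ y₁ := by
  obtain ⟨f1, f2, f3, f4, -⟩ := hF.facts H
  have hδ := H.half_le
  refine ⟨Or.inl ⟨le_refl _, f1.le⟩, ?_⟩
  rintro s s' - h1 h2 (⟨h3, -⟩ | ⟨h3, -⟩) <;> linarith

theorem right_mem (hF : Frame N δ R x₁ y₁) (H : Ren N δ R) : y₁ ∈ basis δ R x₁ y₁ := by
  obtain ⟨f1, f2, f3, f4, -⟩ := hF.facts H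
  have hδ := H.half_le
  refine ⟨Or.inr ⟨f4.le, le_refl _⟩, ?_⟩
  rintro s s' - h1 h2 (⟨-, h3⟩ | ⟨-, h3⟩) <;> linarith

theorem exists_pair_of_notMem (hF : Frame N δ R x₁ y₁) (H : Ren N δ R) {t : ℝ}
    (h1 : x₁ ≤ t) (h2 : t ≤ y₁) (h : t ∉ basis δ R x₁ y₁) :
    ∃ s s', R s s' ∧ x₁ ≤ s ∧ s < t ∧ t < s' ∧ s' ≤ y₁ ∧ ¬ (s = x₁ ∧ s' = y₁) := by
  obtain ⟨f1, f2, f3, f4, -⟩ := hF.facts H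
  have hδ := H.half_le
  by_cases hΓ : (x₁ ≤ t ∧ t ≤ y₁ * (1 - δ)) ∨ (x₁ * (1 - δ) + δ ≤ t ∧ t ≤ y₁)
  · have : ¬ ∀ s s', R s s' → s < t → t < s' →
      ¬ ((x₁ ≤ s ∧ s' ≤ y₁ * (1 - δ)) ∨ (x₁ * (1 - δ) + δ ≤ s ∧ s' ≤ y₁)) := fun hh => h ⟨hΓ, hh⟩
    push Not at this
    obtain ⟨s, s', hss, hs, hs', hor⟩ := this
    rcases hor with ⟨a, b⟩ | ⟨a, b⟩
    · exact ⟨s, s', hss, a, hs, hs', by linarith, fun hh => by linarith [hh.2]⟩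
    · exact ⟨s, s', hss, by linarith, hs, hs', b, fun hh => by linarith [hh.1]⟩
  · push Not at hΓ
    refine ⟨_, _, hF.opp, f1.le, hΓ.1 h1, ?_, f4.le, fun hh => by linarith [hh.1]⟩
    by_contra hcon
    linarith [hΓ.2 (not_lt.1 hcon)]

/-- A pair that hides the image of `t` pulls back to a pair that hides `t`, or to a pair between `I`
and `O`; the latter is excluded by `Frame.only`. -/
theorem mul_mem_basis (hF : Frame N δ R x₁ y₁) (H : Ren N δ R) {t : ℝ}
    (ht : t ∈ basis δ R x₁ y₁) (htx : t ≤ y₁ * (1 - δ)) : N * t ∈ basis δ R x₁ y₁ := by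
  obtain ⟨f1, f2, f3, f4, ex, ey, fx, fy, fxy⟩ := hF.facts H
  have hN := H.two_le
  have hδ := H.half_le
  have hδ1 := H.lt_one
  have hm := H.mul_one_sub
  have ht1 : x₁ ≤ t := by rcases ht.1 with h | h <;> linarith [h.1]
  by_contra hcon
  have hNt1 : N * x₁ ≤ N * t := H.mul_mono ht1
  have hNt2 : N * t ≤ y₁ := H.le_mul_iff.1 htx
  obtain ⟨s, s', hss, hs1, hs2, hs3, hs4, hne⟩ :=
    hF.exists_pair_of_notMem H (by linarith) hNt2 hcon
  have e := H.mul_cancel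
  have hs'1 : t < s' * (1 - δ) := H.lt_mul_iff.2 hs3
  have hs'2 : s' * (1 - δ) ≤ y₁ * (1 - δ) := H.div_mono hs4
  rcases le_or_gt (N * x₁) s with hα | hβ
  · have hsl : x₁ ≤ s * (1 - δ) := H.le_mul_iff.2 hα
    have hst : s * (1 - δ) < t := H.mul_lt_iff.2 hs2
    have := hF.pull_left H (x := s * (1 - δ)) (y := s' * (1 - δ)) ⟨hsl, by linarith⟩
      ⟨by linarith, by linarith⟩ (by rw [e, e]; exact hss)
    exact ht.2 _ _ this hst hs'1 (Or.inl ⟨hsl, hs'2⟩)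
  · have hcd := H.mul_right hF.pair.rel
    -- If `s` lies strictly over the image of `I`, the pair is linked with that image and `s` may be
    -- replaced by its left end; so the opposite branch applies to `w`.
    obtain ⟨w, hw1, hw2, hw3, hws⟩ : ∃ w, x₁ ≤ w ∧ w ≤ N * (y₁ - δ) ∧ (w = x₁ → s = x₁) ∧ R w s' := by
      rcases le_or_gt s (N * (y₁ - δ)) with h | h
      · exact ⟨s, hs1, h, id, hss⟩
      · refine ⟨N * (y₁ - δ), hF.lt_right.le, le_refl _, fun h' => by linarith [hF.lt_right], ?_⟩
        have := H.linked (by linarith [hF.pair.pos, hF.lt_right]) h hβ (by linarith)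
          (by linarith [hF.pair.lt_one]) (H.symm hcd) hss
        exact H.trans this hss
    have hy2 : x₁ * (1 - δ) + δ ≤ w * (1 - δ) + δ := by linarith [H.div_mono hw1]
    have hy1 : w * (1 - δ) + δ ≤ y₁ := by linarith [H.mul_le_iff.2 hw2]
    have hop := hF.pull_opp H (x := s' * (1 - δ)) (y := w * (1 - δ) + δ)
      ⟨by linarith, by linarith⟩ ⟨by linarith, hy1⟩
      (by rw [add_sub_cancel_right, e, e]; exact H.symm hws)
    rcases hF.only _ _ hop (by linarith) hs'2 hy2 hy1 with ⟨h1, -⟩ | ⟨h1, h2⟩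
    · linarith
    · have e1 : s' = y₁ := mul_right_cancel₀ (by linarith : (1 - δ) ≠ 0) h1
      have e2 : w = x₁ := mul_right_cancel₀ (by linarith : (1 - δ) ≠ 0) (add_right_cancel h2)
      exact hne ⟨hw3 e2, e1⟩

theorem mul_sub_mem_basis (hF : Frame N δ R x₁ y₁) (H : Ren N δ R) {t : ℝ}
    (ht : t ∈ basis δ R x₁ y₁) (hty : x₁ * (1 - δ) + δ ≤ t) : N * (t - δ) ∈ basis δ R x₁ y₁ := by
  obtain ⟨f1, f2, f3, f4, ex, ey, fx, fy, fxy⟩ := hF.facts H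
  have hN := H.two_le
  have hδ := H.half_le
  have hδ1 := H.lt_one
  have hm := H.mul_one_sub
  have ht1 : t ≤ y₁ := by rcases ht.1 with h | h <;> linarith [h.2]
  by_contra hcon
  have hNt1 : N * (t - δ) ≤ N * (y₁ - δ) := H.mul_mono (by linarith)
  have hNt2 : x₁ ≤ N * (t - δ) := H.mul_le_iff.1 (by linarith)
  obtain ⟨s, s', hss, hs1, hs2, hs3, hs4, hne⟩ :=
    hF.exists_pair_of_notMem H hNt2 (by linarith) hcon
  have e := H.mul_cancel
  have hst : s * (1 - δ) + δ < t := by linarith [H.mul_lt_iff.2 hs2]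
  have hsl : x₁ * (1 - δ) + δ ≤ s * (1 - δ) + δ := by linarith [H.div_mono hs1]
  rcases le_or_gt s' (N * (y₁ - δ)) with hα | hβ
  · have hs'1 : t < s' * (1 - δ) + δ := by linarith [H.lt_mul_iff.2 hs3]
    have hs'2 : s' * (1 - δ) + δ ≤ y₁ := by linarith [H.mul_le_iff.2 hα]
    have := hF.pull_right H (x := s * (1 - δ) + δ) (y := s' * (1 - δ) + δ)
      ⟨by linarith, by linarith⟩ ⟨by linarith, by linarith⟩
      (by rw [add_sub_cancel_right, add_sub_cancel_right, e, e]; exact hss)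
    exact ht.2 _ _ this hst hs'1 (Or.inr ⟨hsl, hs'2⟩)
  · have hcd := H.mul_right hF.pair.rel
    obtain ⟨w, hw1, hw2, hw3, hws⟩ : ∃ w, w ≤ y₁ ∧ N * x₁ ≤ w ∧ (w = y₁ → s' = y₁) ∧ R s w := by
      rcases le_or_gt (N * x₁) s' with h | h
      · exact ⟨s', hs4, h, id, hss⟩
      · refine ⟨N * x₁, hF.left_lt.le, le_refl _, fun h' => by linarith [hF.left_lt], ?_⟩
        have := H.linked (by linarith [hF.pair.pos]) (by linarith) hβ h
          (by linarith [hF.pair.lt_one, hF.left_lt]) hss (H.symm hcd)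
        exact H.trans this (H.symm hcd)
    have hx2 : w * (1 - δ) ≤ y₁ * (1 - δ) := H.div_mono hw1
    have hx1 : x₁ ≤ w * (1 - δ) := H.le_mul_iff.2 hw2
    have hop := hF.pull_opp H (x := w * (1 - δ)) (y := s * (1 - δ) + δ)
      ⟨hx1, by linarith⟩ ⟨by linarith, by linarith⟩
      (by rw [add_sub_cancel_right, e, e]; exact H.symm hws)
    rcases hF.only _ _ hop hx1 hx2 hsl (by linarith) with ⟨-, h1⟩ | ⟨h1, h2⟩
    · linarith
    · have e1 : w = y₁ := mul_right_cancel₀ (by linarith : (1 - δ) ≠ 0) h1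
      have e2 : s = x₁ := mul_right_cancel₀ (by linarith : (1 - δ) ≠ 0) (add_right_cancel h2)
      exact hne ⟨e2, hw3 e1⟩

end Frame

/-! ### The tiling argument: the edge of a frame is a diameter -/

/-- Pairwise disjoint bounded open intervals inside two intervals have total length at most the
sum of the lengths of these. -/
theorem sum_length_le {ι : Type*} (s : Finset ι) (c d : ι → ℝ) {a b a' b' : ℝ} (hab : a ≤ b)
    (hab' : a' ≤ b') (hcd : ∀ i ∈ s, c i ≤ d i)
    (hsub : ∀ i ∈ s, Ioo (c i) (d i) ⊆ Icc a b ∪ Icc a' b')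
    (hdis : ∀ i ∈ s, ∀ j ∈ s, i ≠ j → Disjoint (Ioo (c i) (d i)) (Ioo (c j) (d j))) :
    ∑ i ∈ s, (d i - c i) ≤ (b - a) + (b' - a') := by
  have h1 : MeasureTheory.volume (⋃ i ∈ s, Ioo (c i) (d i)) =
      ∑ i ∈ s, MeasureTheory.volume (Ioo (c i) (d i)) :=
    MeasureTheory.measure_biUnion_finset (fun i hi j hj hij => hdis i hi j hj hij)
      fun i _ => measurableSet_Ioo
  have h2 : MeasureTheory.volume (⋃ i ∈ s, Ioo (c i) (d i)) ≤
      MeasureTheory.volume (Icc a b) + MeasureTheory.volume (Icc a' b') :=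
    (MeasureTheory.measure_mono (iUnion₂_subset hsub)).trans (MeasureTheory.measure_union_le _ _)
  rw [h1] at h2
  simp only [Real.volume_Ioo, Real.volume_Icc] at h2
  rw [← ENNReal.ofReal_sum_of_nonneg (fun i hi => by linarith [hcd i hi]),
    ← ENNReal.ofReal_add (by linarith) (by linarith)] at h2
  exact (ENNReal.ofReal_le_ofReal_iff (by linarith)).1 h2

namespace Frame

variable {N δ : ℝ} {R : ℝ → ℝ → Prop} {x₁ y₁ : ℝ}

/-- The return map of the frame. -/
noncomputable def ret (N δ m : ℝ) (t : ℝ) : ℝ := if t ≤ m then N * t else N * (t - δ)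

theorem ret_mem (hF : Frame N δ R x₁ y₁) (H : Ren N δ R) {t : ℝ} (ht : t ∈ basis δ R x₁ y₁) :
    ret N δ (y₁ * (1 - δ)) t ∈ basis δ R x₁ y₁ := by
  unfold ret
  split_ifs with h
  · exact hF.mul_mem_basis H ht h
  · exact hF.mul_sub_mem_basis H ht (by rcases ht.1 with h' | h' <;> linarith [h'.1, h'.2])

/-- Two points lie in the same of the two arcs between the edges of the frame. -/
def Same (δ x₁ y₁ c d : ℝ) : Prop :=
  (x₁ ≤ c ∧ d ≤ y₁ * (1 - δ)) ∨ (x₁ * (1 - δ) + δ ≤ c ∧ d ≤ y₁)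

/-- The third clause keeps the image from being `I` itself, which `Frame.only` would otherwise
allow. -/
theorem ret_sub_ret (hF : Frame N δ R x₁ y₁) (H : Ren N δ R) {c d : ℝ} (hcd : c ≤ d)
    (h : Same δ x₁ y₁ c d) (hR : R c d) :
    ret N δ (y₁ * (1 - δ)) d - ret N δ (y₁ * (1 - δ)) c = N * (d - c) ∧
      R (ret N δ (y₁ * (1 - δ)) c) (ret N δ (y₁ * (1 - δ)) d) ∧
      (x₁ < ret N δ (y₁ * (1 - δ)) c ∨ ret N δ (y₁ * (1 - δ)) d < y₁) := by
  obtain ⟨f1, f2, f3, f4, ex, ey, fx, fy, fxy⟩ := hF.facts H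
  have hδ := H.half_le
  unfold ret
  rcases h with h | h
  · rw [if_pos h.2, if_pos (hcd.trans h.2)]
    exact ⟨by ring, H.mul hR, Or.inl (by linarith [H.mul_mono h.1])⟩
  · rw [if_neg (by linarith), if_neg (by linarith)]
    exact ⟨by ring, H.mul_both hR,
      Or.inr (by linarith [H.mul_mono (show d - δ ≤ y₁ - δ by linarith [h.2])])⟩

/-- If no class is invariant, the edge of the frame is critical. -/
theorem length_eq (hF : Frame N δ R x₁ y₁) (H : Ren N δ R)
    (hA : ∀ x, 0 < x → x < 1 - δ → ¬ R x (N * x)) : y₁ - x₁ = δ := by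
  by_contra hne
  have hlt : y₁ - x₁ < δ := lt_of_le_of_ne hF.length_le hne
  obtain ⟨f1, f2, f3, f4, ex, ey, fx, fy, fxy⟩ := hF.facts H
  obtain ⟨p0, p1, p2, p3, hI⟩ := hF.pair
  have hδ := H.half_le
  have hN := H.two_le
  have hm := H.mul_one_sub
  set m := y₁ * (1 - δ) with hmdef
  set f := ret N δ m with hf
  set c : ℕ → ℝ := fun k => f^[k] (N * (y₁ - δ)) with hc
  set d : ℕ → ℝ := fun k => f^[k] (N * x₁) with hd
  set L := N * (δ - (y₁ - x₁)) with hL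
  have hLpos : 0 < L := mul_pos (by linarith) (by linarith)
  have hcs : ∀ k, c (k + 1) = f (c k) := fun k => Function.iterate_succ_apply' _ _ _
  have hds : ∀ k, d (k + 1) = f (d k) := fun k => Function.iterate_succ_apply' _ _ _
  have hcB : ∀ k, c k ∈ basis δ R x₁ y₁ := by
    intro k
    induction k with
    | zero => exact hF.mul_sub_mem_basis H (hF.right_mem H) f4.le
    | succ k ih => rw [hcs]; exact hF.ret_mem H ih
  have hdB : ∀ k, d k ∈ basis δ R x₁ y₁ := by
    intro k
    induction k with
    | zero => exact hF.mul_mem_basis H (hF.left_mem H) f1.le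
    | succ k ih => rw [hds]; exact hF.ret_mem H ih
  have key : ∀ k, (∀ j < k, Same δ x₁ y₁ (c j) (d j)) → d k - c k = N ^ k * L ∧ R (c k) (d k) ∧
      (x₁ < c k ∨ d k < y₁) := by
    intro k
    induction k with
    | zero =>
      intro _
      refine ⟨?_, H.symm (H.mul_right hI), Or.inl hF.lt_right⟩
      simp only [hc, hd, Function.iterate_zero, id, hL]; ring
    | succ k ih =>
      intro hj
      obtain ⟨h1, h2, -⟩ := ih fun j hjk => hj j (by omega)
      have hpos : 0 ≤ N ^ k * L := by positivity
      obtain ⟨a1, a2, a3⟩ := hF.ret_sub_ret H (by linarith) (hj k (by omega)) h2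
      rw [hcs, hds]
      refine ⟨?_, a2, a3⟩
      rw [a1, h1]; ring
  have hin : ∀ t ∈ basis δ R x₁ y₁, x₁ ≤ t ∧ t ≤ y₁ := by
    intro t ht
    rcases ht.1 with h | h <;> constructor <;> linarith [h.1, h.2]
  -- The image chords grow by the factor `N` while both ends lie in the same arc of the frame, so at
  -- some time they straddle. By `Frame.only` the straddling chord is `O`.
  obtain ⟨K, hK, hKmin⟩ : ∃ K, ¬ Same δ x₁ y₁ (c K) (d K) ∧
      ∀ j < K, Same δ x₁ y₁ (c j) (d j) := by
    have : ∃ K, ¬ Same δ x₁ y₁ (c K) (d K) := by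
      by_contra hcon
      push Not at hcon
      obtain ⟨n, hn⟩ := pow_unbounded_of_one_lt (1 / L) (by linarith : 1 < N)
      have h1 := (key n fun j _ => hcon j).1
      rw [div_lt_iff₀ hLpos] at hn
      linarith [(hin _ (hdB n)).2, (hin _ (hcB n)).1]
    classical
    exact ⟨Nat.find this, Nat.find_spec this, fun j hj => not_not.1 (Nat.find_min this hj)⟩
  obtain ⟨hlenK, hRK, hnotI⟩ := key K hKmin
  have hposN : ∀ k, 0 < N ^ k * L := fun k => by positivity
  have hO : c K = m ∧ d K = x₁ * (1 - δ) + δ := by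
    have hlt' : c K < d K := by linarith [hposN K]
    have hcl : x₁ ≤ c K ∧ c K ≤ m := by
      rcases (hcB K).1 with h | h
      · exact h
      · exact absurd (Or.inr ⟨h.1, (hin _ (hdB K)).2⟩) hK
    have hdr : x₁ * (1 - δ) + δ ≤ d K ∧ d K ≤ y₁ := by
      rcases (hdB K).1 with h | h
      · exact absurd (Or.inl ⟨hcl.1, h.2⟩) hK
      · exact h
    rcases hF.only _ _ hRK hcl.1 hcl.2 hdr.1 hdr.2 with h | h
    · rcases hnotI with h' | h' <;> linarith [h.1, h.2]
    · exact h
  -- the tiles before time `K` are disjoint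
  have hdisj : ∀ i < K, ∀ j < K, i ≠ j → Disjoint (Ioo (c i) (d i)) (Ioo (c j) (d j)) := by
    -- All endpoints belong to the basis, so none of them lies strictly under a tile; overlapping
    -- tiles therefore coincide, and equal lengths mean equal times.
    have aux : ∀ i < K, ∀ j, c j ≤ c i ∨ d i ≤ c j := by
      intro i hi j
      by_contra hcon
      push Not at hcon
      exact (hcB j).2 _ _ (key i fun l hl => hKmin l (by omega)).2.1 hcon.1 hcon.2 (hKmin i hi)
    have aux' : ∀ i < K, ∀ j, d j ≤ c i ∨ d i ≤ d j := by
      intro i hi j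
      by_contra hcon
      push Not at hcon
      exact (hdB j).2 _ _ (key i fun l hl => hKmin l (by omega)).2.1 hcon.1 hcon.2 (hKmin i hi)
    intro i hi j hj hij
    rw [Set.disjoint_left]
    rintro t ⟨h1, h2⟩ ⟨h3, h4⟩
    have l1 := (key i fun l hl => hKmin l (by omega)).1
    have l2 := (key j fun l hl => hKmin l (by omega)).1
    have e1 : c i = c j := by
      rcases aux i hi j with h | h <;> rcases aux j hj i with h' | h' <;> linarith
    have e2 : d i = d j := by
      rcases aux' i hi j with h | h <;> rcases aux' j hj i with h' | h' <;> linarith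
    have e3 : N ^ i * L = N ^ j * L := by rw [← l1, ← l2, e1, e2]
    exact hij (pow_right_injective₀ (by linarith) (by linarith) (mul_right_cancel₀ hLpos.ne' e3))
  have hsubset : ∀ i < K, Ioo (c i) (d i) ⊆ Icc x₁ m ∪ Icc (x₁ * (1 - δ) + δ) y₁ := by
    intro i hi t ht
    rcases hKmin i hi with h | h
    · exact Or.inl ⟨by linarith [ht.1, h.1], by linarith [ht.2, h.2]⟩
    · exact Or.inr ⟨by linarith [ht.1, h.1], by linarith [ht.2, h.2]⟩
  -- Since the image at time `K` has the length of `O`, the geometric sum of the earlier lengths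
  -- equals the total length of the two arcs.
  have hsum : ∑ i ∈ Finset.range K, (d i - c i) = (m - x₁) + (y₁ - (x₁ * (1 - δ) + δ)) := by
    have h1 : ∑ i ∈ Finset.range K, (d i - c i) = ∑ i ∈ Finset.range K, N ^ i * L :=
      Finset.sum_congr rfl fun i hi =>
        (key i fun l hl => hKmin l (by have := Finset.mem_range.1 hi; omega)).1
    have h2 : (∑ i ∈ Finset.range K, N ^ i) * (N - 1) = N ^ K - 1 := geom_sum_mul N K
    rw [h1, ← Finset.sum_mul]
    rw [hO.1, hO.2] at hlenK
    have hN1 : N - 1 ≠ 0 := by linarith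
    apply mul_right_cancel₀ hN1
    have h3 := H.mul_delta
    calc (∑ i ∈ Finset.range K, N ^ i) * L * (N - 1)
        = ((∑ i ∈ Finset.range K, N ^ i) * (N - 1)) * L := by ring
      _ = N ^ K * L - L := by rw [h2]; ring
      _ = _ := by rw [← hlenK, hmdef, hL]; linear_combination (y₁ - x₁) * h3
  -- hence the left arc is covered by tiles
  have hrel : R x₁ m := by
    set T := Icc x₁ m ∩ {t | R x₁ t}
    have hT : IsCompact T := isCompact_Icc.inter_right
      (H.closed.preimage (by fun_prop : Continuous fun t : ℝ => (x₁, t)))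
    obtain ⟨t, ⟨⟨ht1, ht2⟩, ht3⟩, hmax⟩ := hT.exists_isMaxOn (f := id)
      ⟨x₁, ⟨le_refl _, f1.le⟩, H.equiv.refl _⟩ continuousOn_id
    have ht3 : R x₁ t := ht3
    have hmax' : ∀ s, t < s → s ≤ m → ¬ R x₁ s := fun s h1 h2 h3 => by
      have : s ≤ t := hmax (show s ∈ T from ⟨⟨by linarith, h2⟩, h3⟩)
      linarith
    rcases ht2.eq_or_lt with h | htm
    · rw [← h]; exact ht3
    exfalso
    have hsep : ∀ i < K, d i ≤ t ∨ t < c i := by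
      intro i hi
      by_contra hcon
      push Not at hcon
      have hRi := (key i fun l hl => hKmin l (by omega)).2.1
      rcases hKmin i hi with h | h
      · apply hmax' (d i) hcon.1 h.2
        rcases h.1.eq_or_lt with e | e
        · rw [e]; exact hRi
        rcases hcon.2.eq_or_lt with e' | e'
        · rw [e'] at hRi; exact H.trans ht3 hRi
        · exact H.trans (H.linked p0.le e e' hcon.1 (by linarith) ht3 hRi) hRi
      · linarith [h.1]
    -- If the class of `x₁` stopped at `t` before the end of the arc, a small interval after `t`
    -- would meet no tile, and the tiles together with it would be too long.
    obtain ⟨e, he1, he2, he3⟩ : ∃ e, t < e ∧ e ≤ m ∧ ∀ i < K, d i ≤ t ∨ e ≤ c i := by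
      have hev : ∀ᶠ e in nhdsWithin t (Ioi t), ∀ i ∈ Finset.range K, d i ≤ t ∨ e ≤ c i := by
        rw [Filter.eventually_all_finset]
        intro i hi
        rcases hsep i (Finset.mem_range.1 hi) with h | h
        · exact Filter.Eventually.of_forall fun _ => Or.inl h
        · filter_upwards [Ioo_mem_nhdsGT h] with e he using Or.inr he.2.le
      obtain ⟨e, ⟨he, he'⟩⟩ := (hev.and (Ioo_mem_nhdsGT htm)).exists
      exact ⟨e, he'.1, he'.2.le, fun i hi => he i (Finset.mem_range.2 hi)⟩
    have := sum_length_le (Finset.range (K + 1)) (fun i => if i < K then c i else t)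
      (fun i => if i < K then d i else e) f1.le f4.le ?_ ?_ ?_
    · rw [Finset.sum_range_succ, if_neg (lt_irrefl _), if_neg (lt_irrefl _)] at this
      have h2 : ∑ i ∈ Finset.range K, ((if i < K then d i else e) - (if i < K then c i else t)) =
          ∑ i ∈ Finset.range K, (d i - c i) :=
        Finset.sum_congr rfl fun i hi => by simp [Finset.mem_range.1 hi]
      rw [h2, hsum] at this
      linarith
    · intro i _
      split_ifs with h
      · linarith [(key i fun l hl => hKmin l (by omega)).1, hposN i]
      · exact he1.le
    · intro i _
      split_ifs with h
      · exact hsubset i h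
      · exact fun s hs => Or.inl ⟨by linarith [hs.1], by linarith [hs.2]⟩
    · intro i hi j hj hij
      have hi := Finset.mem_range.1 hi
      have hj := Finset.mem_range.1 hj
      have aux : ∀ i < K, Disjoint (Ioo (c i) (d i)) (Ioo t e) := by
        intro i hi
        rw [Set.disjoint_left]
        rintro s ⟨h1, h2⟩ ⟨h3, h4⟩
        rcases he3 i hi with h | h <;> linarith
      split_ifs with h h' h'
      · exact hdisj i h j h' hij
      · exact aux i h
      · exact (aux j h').symm
      · omega
  -- The arc from `I` to `O` now lies over one class, and mapping it forward makes the class of `I`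
  -- fixed.
  have := H.mul hrel
  rw [ex] at this
  exact hA x₁ p0 p1 (H.trans hI (H.symm this))

end Frame

/-! ### Degree one maps with irrational translation number -/

/-- A monotone continuous map of a fundamental interval that moves the right end by one more
extends to a degree one map of the line. -/
theorem exists_circleDeg1Lift (g : ℝ → ℝ) (u : ℝ) (hmono : MonotoneOn g (Icc u (u + 1)))
    (hcont : ContinuousOn g (Icc u (u + 1))) (hg : g (u + 1) = g u + 1) :
    ∃ F : CircleDeg1Lift, Continuous F ∧ ∀ t ∈ Icc u (u + 1), F t = g t := by
  have hmem : ∀ t : ℝ, u + Int.fract (t - u) ∈ Icc u (u + 1) := fun t =>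
    ⟨by linarith [Int.fract_nonneg (t - u)], by linarith [Int.fract_lt_one (t - u)]⟩
  have hl : u ∈ Icc u (u + 1) := ⟨le_refl _, by linarith⟩
  have hr : u + 1 ∈ Icc u (u + 1) := ⟨by linarith, le_refl _⟩
  have hmon : Monotone fun t : ℝ => g (u + Int.fract (t - u)) + ⌊t - u⌋ := by
    intro s t hst
    dsimp only
    have hfl : ⌊s - u⌋ ≤ ⌊t - u⌋ := Int.floor_mono (by linarith)
    rcases hfl.eq_or_lt with h | h
    · have : g (u + Int.fract (s - u)) ≤ g (u + Int.fract (t - u)) := by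
        apply hmono (hmem s) (hmem t)
        simp only [Int.fract, h]; linarith
      rw [h]; linarith
    · have h1 := hmono (hmem s) hr (hmem s).2
      have h2 := hmono hl (hmem t) (hmem t).1
      have h3 : (⌊s - u⌋ : ℝ) + 1 ≤ ⌊t - u⌋ := by exact_mod_cast h
      linarith
  let F : CircleDeg1Lift := ⟨⟨fun t => g (u + Int.fract (t - u)) + ⌊t - u⌋, hmon⟩, fun t => by
    have : t + 1 - u = (t - u) + 1 := by ring
    simp only [this, Int.fract_add_one, Int.floor_add_one]
    push_cast; ring⟩
  have hF : ∀ t ∈ Icc u (u + 1), F t = g t := by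
    intro t ht
    change g (u + Int.fract (t - u)) + ⌊t - u⌋ = g t
    rcases ht.2.eq_or_lt with rfl | h
    · have : u + 1 - u = (1 : ℝ) := by ring
      rw [this, Int.fract_one, Int.floor_one, hg]; simp
    · have h0 : ⌊t - u⌋ = 0 := Int.floor_eq_zero_iff.2 ⟨by linarith [ht.1], by linarith⟩
      simp only [Int.fract, h0]
      simp
  refine ⟨F, ?_, hF⟩
  rw [CircleDeg1Lift.continuous_iff_surjective]
  intro y
  obtain ⟨t, ht, hty⟩ : ∃ t ∈ Icc u (u + 1), g t = g u + Int.fract (y - g u) := by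
    have := intermediate_value_Icc (by linarith : u ≤ u + 1) hcont
    exact this ⟨by linarith [Int.fract_nonneg (y - g u)],
      by linarith [Int.fract_lt_one (y - g u)]⟩
  refine ⟨t + ⌊y - g u⌋, ?_⟩
  rw [CircleDeg1Lift.map_add_int, hF t ht, hty]
  linarith [Int.fract_add_floor (y - g u)]

/-- A continuous degree one map with irrational translation number is semiconjugate to a
translation. -/
theorem exists_semiconj_of_irrational (F : CircleDeg1Lift) (hF : Continuous F)
    (hirr : Irrational F.translationNumber) :
    ∃ Ψ : CircleDeg1Lift, Continuous Ψ ∧ ∀ t, Ψ (F t) = Ψ t + F.translationNumber := by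
  set τ := F.translationNumber with hτ
  have hbd : ∀ t (k : ℕ), (F ^ k) t - k * τ ≤ ⌈t⌉ + 1 ∧ ⌊t⌋ - 1 ≤ (F ^ k) t - k * τ := by
    intro t k
    have h := F.dist_pow_map_zero_mul_translationNumber_le k
    rw [Real.dist_eq, abs_le] at h
    have h1 := (F ^ k).map_le_of_map_zero t
    have h2 := (F ^ k).le_map_of_map_zero t
    constructor <;> linarith [h.1, h.2]
  have hb1 : ∀ t, Filter.IsBoundedUnder (· ≤ ·) Filter.atTop fun k : ℕ => (F ^ k) t - k * τ :=
    fun t => Filter.isBoundedUnder_of ⟨_, fun k => (hbd t k).1⟩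
  have hb2 : ∀ t, Filter.IsBoundedUnder (· ≥ ·) Filter.atTop fun k : ℕ => (F ^ k) t - k * τ :=
    fun t => Filter.isBoundedUnder_of ⟨_, fun k => (hbd t k).2⟩
  have hb3 : ∀ t, Filter.IsCoboundedUnder (· ≤ ·) Filter.atTop
    fun k : ℕ => (F ^ k) t - k * τ := fun t => (hb2 t).isCoboundedUnder_le
  -- The deviation of the orbit from the translation is bounded, so its upper limit exists. It is
  -- monotone in `t`, commutes with integer translations, and conjugates `F` to the translation by
  -- `τ`.
  set Φ : ℝ → ℝ := fun t => Filter.limsup (fun k : ℕ => (F ^ k) t - k * τ) Filter.atTop with hΦ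
  have hmono : Monotone Φ := fun s t hst => Filter.limsup_le_limsup
    (Filter.Eventually.of_forall fun k => by linarith [(F ^ k).mono hst]) (hb3 s) (hb1 t)
  have hone : ∀ t, Φ (t + 1) = Φ t + 1 := by
    intro t
    have := limsup_add_const Filter.atTop (fun k : ℕ => (F ^ k) t - k * τ) 1 (hb1 t) (hb3 t)
    simp only [hΦ]
    rw [← this]
    congr 1
    ext k
    rw [CircleDeg1Lift.map_add_one]; ring
  have hsemi : ∀ t, Φ (F t) = Φ t + τ := by
    intro t
    have h1 := limsup_add_const Filter.atTop (fun k : ℕ => (F ^ (k + 1)) t - (k + 1 : ℕ) * τ) τ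
      (Filter.isBoundedUnder_of ⟨_, fun k => (hbd t (k + 1)).1⟩)
      (Filter.IsBoundedUnder.isCoboundedUnder_le
        (Filter.isBoundedUnder_of ⟨_, fun k => (hbd t (k + 1)).2⟩))
    have h2 : Filter.limsup (fun k : ℕ => (F ^ (k + 1)) t - (k + 1 : ℕ) * τ) Filter.atTop = Φ t :=
      Filter.limsup_nat_add (fun k : ℕ => (F ^ k) t - k * τ) 1
    rw [← h2, ← h1]
    simp only [hΦ]
    congr 1
    ext k
    rw [pow_succ, CircleDeg1Lift.mul_apply]; push_cast; ring
  let Ψ : CircleDeg1Lift := ⟨⟨Φ, hmono⟩, hone⟩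
  refine ⟨Ψ, ?_, hsemi⟩
  have hsurj := F.continuous_iff_surjective.1 hF
  have hnat : ∀ k : ℕ, ∀ t, ∃ s, Ψ s = Ψ t + k * τ := by
    intro k
    induction k with
    | zero => exact fun t => ⟨t, by simp⟩
    | succ k ih =>
      intro t
      obtain ⟨s, hs⟩ := ih t
      exact ⟨F s, by rw [show Ψ (F s) = Ψ s + τ from hsemi s, hs]; push_cast; ring⟩
  have hneg : ∀ k : ℕ, ∀ t, ∃ s, Ψ s = Ψ t - k * τ := by
    intro k
    induction k with
    | zero => exact fun t => ⟨t, by simp⟩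
    | succ k ih =>
      intro t
      obtain ⟨s, hs⟩ := ih t
      obtain ⟨w, rfl⟩ := hsurj s
      refine ⟨w, ?_⟩
      have : Ψ (F w) = Ψ w + τ := hsemi w
      push_cast; linarith
  have hint : ∀ k m : ℤ, ∃ s, Ψ s = Ψ 0 + (k * τ + m) := by
    intro k m
    obtain ⟨s, hs⟩ : ∃ s, Ψ s = Ψ 0 + k * τ := by
      obtain ⟨n, rfl | rfl⟩ := k.eq_nat_or_neg
      · simpa using hnat n 0
      · obtain ⟨s, hs⟩ := hneg n 0
        exact ⟨s, by rw [hs]; push_cast; ring⟩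
    exact ⟨s + m, by rw [CircleDeg1Lift.map_add_int, hs]; ring⟩
  -- A monotone function with dense range is continuous. The range is invariant under translation by
  -- `τ`, in both directions because `F` is surjective, and by `1`, so it contains a translate of a
  -- dense subgroup.
  apply Ψ.monotone.continuous_of_denseRange
  have hd : Dense (AddSubgroup.closure {τ, 1} : Set ℝ) := by
    rw [dense_addSubgroupClosure_pair_iff, div_one]; exact hirr
  have hd' := (Homeomorph.addLeft (Ψ 0)).surjective.denseRange.dense_image
    (Homeomorph.addLeft (Ψ 0)).continuous hd
  refine hd'.mono ?_
  rintro _ ⟨y, hy, rfl⟩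
  obtain ⟨k, m, hkm⟩ := AddSubgroup.mem_closure_pair.1 hy
  obtain ⟨s, hs⟩ := hint k m
  refine ⟨s, ?_⟩
  rw [hs, ← hkm]
  simp

/-- The positive multiples of an irrational number come arbitrarily close to the integers from
above. -/
theorem exists_fract_mul_lt {τ : ℝ} (hτ : Irrational τ) {ε : ℝ} (hε : 0 < ε) :
    ∃ k : ℕ, 0 < k ∧ 0 < Int.fract (k * τ) ∧ Int.fract (k * τ) < ε := by
  have hd : Dense (AddSubgroup.closure {τ, 1} : Set ℝ) := by
    rw [dense_addSubgroupClosure_pair_iff, div_one]; exact hτ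
  obtain ⟨y, hy, hy0, hy1⟩ := hd.exists_between (show 0 < min ε 1 by positivity)
  obtain ⟨k, m, hkm⟩ := AddSubgroup.mem_closure_pair.1 hy
  have hkm : (k : ℝ) * τ + m = y := by simpa using hkm
  have hyε := lt_of_lt_of_le hy1 (min_le_left _ _)
  have hy1' := lt_of_lt_of_le hy1 (min_le_right _ _)
  have hfr : Int.fract ((k : ℝ) * τ) = y :=
    Int.fract_eq_iff.2 ⟨hy0.le, hy1', -m, by push_cast; linarith⟩
  obtain ⟨n, rfl | rfl⟩ := k.eq_nat_or_neg
  · rcases Nat.eq_zero_or_pos n with rfl | hn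
    · simp at hfr; linarith
    · rw [Int.cast_natCast] at hfr
      exact ⟨n, hn, by rw [hfr]; exact hy0, by rw [hfr]; exact hyε⟩
  · have hn : 0 < n := by
      rcases Nat.eq_zero_or_pos n with rfl | hn
      · simp at hfr; linarith
      · exact hn
    -- A negative multiple close to an integer from above is a positive multiple close from below;
    -- repeating it as often as fits into one turn leaves a remainder below `y`.
    set j := ⌊1 / y⌋₊ with hj
    have hj1 : (j : ℝ) ≤ 1 / y := Nat.floor_le (by positivity)
    have hj2 : 1 / y < j + 1 := Nat.lt_floor_add_one _
    rw [le_div_iff₀ hy0] at hj1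
    rw [div_lt_iff₀ hy0] at hj2
    have hjpos : 0 < j := by
      rcases Nat.eq_zero_or_pos j with h | h
      · rw [h] at hj2; norm_num at hj2; linarith
      · exact h
    push_cast at hkm
    have hfr' : Int.fract (((j * n : ℕ) : ℝ) * τ) = 1 - j * y := by
      refine Int.fract_eq_iff.2 ⟨by linarith, by nlinarith [(Nat.cast_pos (α := ℝ)).2 hjpos],
        j * m - 1, ?_⟩
      push_cast
      linear_combination (-(j : ℝ)) * hkm
    refine ⟨j * n, Nat.mul_pos hjpos hn, ?_, by rw [hfr']; linarith⟩
    refine lt_of_le_of_ne (Int.fract_nonneg _) (Ne.symm ?_)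
    intro h0
    rw [Int.fract_eq_iff] at h0
    obtain ⟨-, -, z, hz⟩ := h0
    have : Irrational (((j * n : ℕ) : ℝ) * τ) := hτ.natCast_mul (Nat.mul_pos hjpos hn).ne'
    exact this ⟨z, by push_cast at hz ⊢; linarith⟩

/-! ### The monotone model of the return map and its translation number -/

/-- The monotone degree one map that agrees with the return map between the critical edge and its
preimage, and collapses the two arcs behind them. -/
structure Model (N δ u : ℝ) (F : CircleDeg1Lift) : Prop where
  two_le : 2 ≤ N
  mul_one_sub : N * (1 - δ) = 1
  pos : 0 < u
  lt_left : u < 1 - δ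
  mul_lt : N * u < u + δ
  cont : Continuous F
  left : ∀ t ∈ Icc u (1 - δ), F t = N * t
  middle : ∀ t ∈ Icc (1 - δ) δ, F t = 1
  right : ∀ t ∈ Icc δ (u + δ), F t = N * (t - δ) + 1
  outer : ∀ t ∈ Icc (u + δ) (u + 1), F t = N * u + 1

theorem exists_model {N δ u : ℝ} (hN : 2 ≤ N) (hm : N * (1 - δ) = 1) (hu : 0 < u)
    (hu1 : u < 1 - δ) (hmul : N * u < u + δ) : ∃ F, Model N δ u F := by
  have hδ : 1 / 2 ≤ δ := by nlinarith
  have hδ1 : δ < 1 := by nlinarith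
  have hNu : 0 < N * u := mul_pos (by linarith) hu
  have hmono : ∀ {a b : ℝ}, a ≤ b → N * a ≤ N * b := fun h =>
    mul_le_mul_of_nonneg_left h (by linarith)
  have hNδ : N * δ = N - 1 := by linarith
  -- The two affine branches, each cut off where its flat piece begins, are glued by one formula, so
  -- that monotonicity and continuity are immediate.
  set g : ℝ → ℝ := fun t => max (min (N * t) 1) (min (N * (t - δ) + 1) (N * u + 1)) with hg
  have hgm : Monotone g := by
    intro s t hst
    have h1 := hmono hst
    have h2 := hmono (show s - δ ≤ t - δ by linarith)
    exact max_le_max (min_le_min h1 le_rfl) (min_le_min (by linarith) le_rfl)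
  have hgc : Continuous g := by fun_prop
  have g1 : ∀ t ∈ Icc u (1 - δ), g t = N * t := by
    intro t ht
    have h1 := hmono ht.2
    have h2 := hmono ht.1
    have h3 : N * (t - δ) = N * t - (N - 1) := by rw [mul_sub, hNδ]
    simp only [hg]
    rw [min_eq_left (by linarith), max_eq_left]
    exact (min_le_left _ _).trans (by linarith)
  have g2 : ∀ t ∈ Icc (1 - δ) δ, g t = 1 := by
    intro t ht
    have h1 := hmono ht.1
    have h2 := hmono (show t - δ ≤ 0 by linarith [ht.2])
    simp only [hg]
    rw [min_eq_right (by linarith), max_eq_left]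
    exact (min_le_left _ _).trans (by linarith)
  have g3 : ∀ t ∈ Icc δ (u + δ), g t = N * (t - δ) + 1 := by
    intro t ht
    have h1 := hmono (show 0 ≤ t - δ by linarith [ht.1])
    have h2 := hmono (show t - δ ≤ u by linarith [ht.2])
    simp only [hg]
    rw [min_eq_left (show N * (t - δ) + 1 ≤ N * u + 1 by linarith), max_eq_right]
    exact (min_le_right _ _).trans (by linarith)
  have g4 : ∀ t ∈ Icc (u + δ) (u + 1), g t = N * u + 1 := by
    intro t ht
    have h1 := hmono (show u ≤ t - δ by linarith [ht.1])
    simp only [hg]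
    rw [min_eq_right (show N * u + 1 ≤ N * (t - δ) + 1 by linarith), max_eq_right]
    exact (min_le_right _ _).trans (by linarith)
  obtain ⟨F, hF, hFg⟩ := exists_circleDeg1Lift g u (hgm.monotoneOn _) hgc.continuousOn (by
    rw [g4 _ ⟨by linarith, le_rfl⟩, g1 _ ⟨le_rfl, hu1.le⟩])
  refine ⟨F, hN, hm, hu, hu1, hmul, hF, ?_, ?_, ?_, ?_⟩
  · intro t ht; rw [hFg t ⟨ht.1, by linarith [ht.2]⟩, g1 t ht]
  · intro t ht; rw [hFg t ⟨by linarith [ht.1], by linarith [ht.2]⟩, g2 t ht]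
  · intro t ht; rw [hFg t ⟨by linarith [ht.1], by linarith [ht.2]⟩, g3 t ht]
  · intro t ht; rw [hFg t ⟨by linarith [ht.1], by linarith [ht.2]⟩, g4 t ht]

namespace Model

variable {N δ u : ℝ} {F : CircleDeg1Lift}

theorem half_le (M : Model N δ u F) : 1 / 2 ≤ δ := by nlinarith [M.mul_one_sub, M.two_le]

theorem lt_one (M : Model N δ u F) : δ < 1 := by nlinarith [M.mul_one_sub, M.two_le]

/-- The two closed arcs that are collapsed, with all their translates. -/
def flat (δ u : ℝ) : Set ℝ := {t | ∃ n : ℤ, t - n ∈ Icc (1 - δ) δ ∪ Icc (u + δ) (u + 1)}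

theorem eq_or (M : Model N δ u F) (t : ℝ) :
    t ∈ flat δ u ∨ ∃ n : ℤ, t - n ∈ Ioo u (1 - δ) ∪ Ioo δ (u + δ) := by
  have hδ := M.half_le
  have e : t - (⌊t - u⌋ : ℤ) = u + Int.fract (t - u) := by
    linarith [Int.fract_add_floor (t - u)]
  have h0 := Int.fract_nonneg (t - u)
  have h1 := Int.fract_lt_one (t - u)
  rcases h0.eq_or_lt with h | h
  · refine Or.inl ⟨⌊t - u⌋ - 1, Or.inr ⟨?_, ?_⟩⟩ <;> push_cast <;> linarith [M.lt_one]
  by_cases h2 : u + Int.fract (t - u) < 1 - δ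
  · exact Or.inr ⟨⌊t - u⌋, Or.inl ⟨by linarith, by linarith⟩⟩
  by_cases h3 : u + Int.fract (t - u) ≤ δ
  · exact Or.inl ⟨⌊t - u⌋, Or.inl ⟨by linarith, by linarith⟩⟩
  by_cases h4 : u + Int.fract (t - u) < u + δ
  · exact Or.inr ⟨⌊t - u⌋, Or.inr ⟨by linarith, by linarith⟩⟩
  · exact Or.inl ⟨⌊t - u⌋, Or.inr ⟨by linarith, by linarith⟩⟩

theorem eventually_affine (M : Model N δ u F) {z : ℝ} (hz : z ∉ flat δ u) :
    ∀ᶠ t in nhds z, F t = F z + N * (t - z) := by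
  have hF : ∀ (t : ℝ) (n : ℤ), F t = F (t - n) + n := fun t n => by
    rw [CircleDeg1Lift.map_sub_int]; ring
  rcases M.eq_or z with h | ⟨n, h | h⟩
  · exact absurd h hz
  · have : ∀ᶠ t in nhds z, t - (n : ℝ) ∈ Ioo u (1 - δ) :=
      (continuous_sub_right (n : ℝ)).continuousAt.eventually_mem (isOpen_Ioo.mem_nhds h)
    filter_upwards [this] with t ht
    rw [hF t n, hF z n, M.left _ (Ioo_subset_Icc_self ht), M.left _ (Ioo_subset_Icc_self h)]
    ring
  · have : ∀ᶠ t in nhds z, t - (n : ℝ) ∈ Ioo δ (u + δ) :=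
      (continuous_sub_right (n : ℝ)).continuousAt.eventually_mem (isOpen_Ioo.mem_nhds h)
    filter_upwards [this] with t ht
    rw [hF t n, hF z n, M.right _ (Ioo_subset_Icc_self ht), M.right _ (Ioo_subset_Icc_self h)]
    ring

theorem eventually_affine_pow (M : Model N δ u F) {z : ℝ} (n : ℕ)
    (hz : ∀ j < n, (F ^ j) z ∉ flat δ u) :
    ∀ᶠ t in nhds z, (F ^ n) t = (F ^ n) z + N ^ n * (t - z) := by
  induction n with
  | zero => exact Filter.Eventually.of_forall fun t => by simp
  | succ n ih =>
    have h1 := ih fun j hj => hz j (by omega)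
    have h2 : ∀ᶠ t in nhds z, F ((F ^ n) t) = F ((F ^ n) z) + N * ((F ^ n) t - (F ^ n) z) :=
      (F.continuous_pow M.cont n).continuousAt.eventually (M.eventually_affine (hz n (by omega)))
    filter_upwards [h1, h2] with t ht1 ht2
    rw [pow_succ' F, CircleDeg1Lift.mul_apply, CircleDeg1Lift.mul_apply, ht2, ht1]
    ring

/-- If the orbit of the critical value stays strictly between the endpoints of the critical edge,
the translation number is irrational. -/
theorem irrational (M : Model N δ u F)
    (horb : ∀ k : ℕ, ∃ t ∈ Ioo u (u + δ), ∃ n : ℤ, (F ^ k) (N * u) = t + n) :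
    Irrational F.translationNumber := by
  have hN := M.two_le
  have hδ := M.half_le
  have hδ1 := M.lt_one
  have hu := M.pos
  rw [irrational_iff_ne_rational]
  intro m n hn hτ
  obtain ⟨m, n, hn, hτ⟩ : ∃ (m : ℤ) (n : ℕ), 0 < n ∧ F.translationNumber = m / n := by
    obtain ⟨k, rfl | rfl⟩ := n.eq_nat_or_neg
    · exact ⟨m, k, Nat.pos_of_ne_zero (by rintro rfl; simp at hn), by simpa using hτ⟩
    · refine ⟨-m, k, Nat.pos_of_ne_zero (by rintro rfl; simp at hn), ?_⟩
      rw [hτ]; push_cast; rw [div_neg, neg_div]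
  obtain ⟨x, hx⟩ := (F.translationNumber_eq_rat_iff M.cont hn).1 hτ
  -- the orbit of a periodic point avoids the collapsed arcs
  have havoid : ∀ z, (F ^ n) z = z + m → ∀ j, (F ^ j) z ∉ flat δ u := by
    intro z hz
    -- A periodic point in the outer flat arc would be mapped to the critical value, whose orbit
    -- would return to that arc after `n - 1` steps, against `horb`. The middle flat arc is mapped
    -- to `1`, inside the outer one.
    have houter : ∀ j (i : ℤ), (F ^ j) z - i ∉ Icc (u + δ) (u + 1) := by
      intro j i hi
      have h1 : (F ^ (j + 1)) z = N * u + (1 + i : ℤ) := by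
        rw [pow_succ' F, CircleDeg1Lift.mul_apply]
        have := M.outer _ hi
        rw [CircleDeg1Lift.map_sub_int] at this
        push_cast; linarith
      have h2 : (F ^ (n - 1)) ((F ^ (j + 1)) z) = (F ^ j) z + m := by
        rw [← CircleDeg1Lift.mul_apply, ← pow_add, show n - 1 + (j + 1) = j + n by omega, pow_add,
          CircleDeg1Lift.mul_apply, hz, CircleDeg1Lift.map_add_int]
      obtain ⟨t, ht, k, hk⟩ := horb (n - 1)
      rw [h1, CircleDeg1Lift.map_add_int, hk] at h2
      have h3 : (F ^ j) z - i = t + ((k + 1 - m : ℤ) : ℝ) := by push_cast at h2 ⊢; linarith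
      rw [h3] at hi
      have ha : (0 : ℝ) < ((k + 1 - m : ℤ) : ℝ) := by linarith [hi.1, ht.2]
      have hb : ((k + 1 - m : ℤ) : ℝ) < 1 := by linarith [hi.2, ht.1]
      have ha' : 0 < k + 1 - m := by exact_mod_cast ha
      have hb' : k + 1 - m < 1 := by exact_mod_cast hb
      omega
    rintro j ⟨i, hi | hi⟩
    · apply houter (j + 1) i
      rw [pow_succ' F, CircleDeg1Lift.mul_apply]
      have := M.middle _ hi
      rw [CircleDeg1Lift.map_sub_int] at this
      rw [this]
      exact ⟨by linarith [M.lt_left], by linarith⟩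
    · exact houter j i hi
  have hloc : ∀ z, (F ^ n) z = z + m → ∀ᶠ t in nhds z, (F ^ n) t - t - m = (N ^ n - 1) * (t - z) := by
    intro z hz
    filter_upwards [M.eventually_affine_pow n fun j _ => havoid z hz j] with t ht
    rw [ht, hz]; ring
  have hNn : 0 < N ^ n - 1 := by
    have : 1 < N ^ n := one_lt_pow₀ (by linarith) hn.ne'
    linarith
  -- Near each zero this displacement has slope `N ^ n - 1`, which is positive. Between two zeros a
  -- full turn apart it would have to cross zero downward.
  set g : ℝ → ℝ := fun t => (F ^ n) t - t - m with hg
  have hgc : Continuous g := ((F.continuous_pow M.cont n).sub continuous_id).sub continuous_const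
  have hright : ∀ z, g z = 0 → ∀ᶠ t in nhdsWithin z (Ioi z), 0 < g t := by
    intro z hz
    have := hloc z (by simp only [hg] at hz; linarith)
    filter_upwards [this.filter_mono nhdsWithin_le_nhds, self_mem_nhdsWithin] with t ht ht'
    simp only [hg]
    rw [ht]; exact mul_pos hNn (by linarith [show z < t from ht'])
  have hleft : ∀ z, g z = 0 → ∀ᶠ t in nhdsWithin z (Iio z), g t < 0 := by
    intro z hz
    have := hloc z (by simp only [hg] at hz; linarith)
    filter_upwards [this.filter_mono nhdsWithin_le_nhds, self_mem_nhdsWithin] with t ht ht'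
    simp only [hg]
    rw [ht]; exact mul_neg_of_pos_of_neg hNn (by linarith [show t < z from ht'])
  have hgx : g x = 0 := by simp only [hg]; linarith
  have hgx1 : g (x + 1) = 0 := by
    simp only [hg] at hgx ⊢; rw [CircleDeg1Lift.map_add_one]; linarith
  obtain ⟨a, ha1, ha2, hga⟩ : ∃ a, x < a ∧ a < x + 1 ∧ g a < 0 := by
    obtain ⟨a, h1, h2⟩ := ((hleft _ hgx1).and (Ioo_mem_nhdsLT (show x < x + 1 by linarith))).exists
    exact ⟨a, h2.1, h2.2, h1⟩
  -- the last zero before `a`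
  set S := Icc x a ∩ {t | 0 ≤ g t}
  have hS : IsCompact S := isCompact_Icc.inter_right (isClosed_le continuous_const hgc)
  obtain ⟨w, ⟨⟨hw1, hw2⟩, hw3⟩, hmax⟩ := hS.exists_isMaxOn (f := id)
    ⟨x, ⟨le_rfl, ha1.le⟩, hgx.ge⟩ continuousOn_id
  have hw3 : 0 ≤ g w := hw3
  have hwa : w < a := lt_of_le_of_ne hw2 (by rintro rfl; linarith)
  have hafter : ∀ t, w < t → t ≤ a → g t < 0 := by
    intro t h1 h2
    by_contra hcon
    have : t ≤ w := hmax (show t ∈ S from ⟨⟨by linarith, h2⟩, not_lt.1 hcon⟩)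
    linarith
  have hw0 : g w = 0 := by
    apply le_antisymm _ hw3
    have h1 : Filter.Tendsto g (nhdsWithin w (Ioi w)) (nhds (g w)) :=
      hgc.continuousAt.continuousWithinAt
    refine le_of_tendsto h1 ?_
    filter_upwards [Ioo_mem_nhdsGT hwa] with t ht using (hafter t ht.1 ht.2.le).le
  obtain ⟨t, h1, h2⟩ := ((hright _ hw0).and (Ioo_mem_nhdsGT hwa)).exists
  linarith [hafter t h2.1 h2.2.le]

end Model

namespace Frame

variable {N δ : ℝ} {R : ℝ → ℝ → Prop} {x₁ y₁ : ℝ}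

/-- The orbit of the critical value stays strictly between the endpoints of the critical edge. -/
theorem orbit_mem (hF : Frame N δ R x₁ y₁) (H : Ren N δ R) (hcrit : y₁ = x₁ + δ)
    {F : CircleDeg1Lift} (M : Model N δ x₁ F) (k : ℕ) :
    ∃ t ∈ Ioo x₁ (x₁ + δ), ∃ n : ℤ, (F ^ k) (N * x₁) = t + n := by
  obtain ⟨f1, f2, f3, f4, ex, ey, fx, fy, fxy⟩ := hF.facts H
  have hδ := H.half_le
  -- The orbit is followed inside the basis together with its equivalence to the powers `N ^ (k + 1)
  -- * x₁`. Reaching an end of `I` would make the critical class periodic, which `Ren.aperiodic`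
  -- excludes.
  suffices h : ∃ t ∈ basis δ R x₁ y₁, (∃ n : ℤ, (F ^ k) (N * x₁) = t + n) ∧
      R t (N ^ (k + 1) * x₁) by
    obtain ⟨t, ht, hn, hR⟩ := h
    refine ⟨t, ?_, hn⟩
    have hcr : R x₁ (x₁ + δ) := hcrit ▸ hF.pair.rel
    have hap := H.aperiodic hcr (k + 1) (by omega)
    have h1 : x₁ ≤ t ∧ t ≤ x₁ + δ := by
      rw [← hcrit]; rcases ht.1 with h | h <;> constructor <;> linarith [h.1, h.2]
    refine ⟨lt_of_le_of_ne h1.1 ?_, lt_of_le_of_ne h1.2 ?_⟩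
    · rintro rfl; exact hap hR
    · rintro rfl; exact hap (H.trans hcr hR)
  induction k with
  | zero =>
    exact ⟨N * x₁, hF.mul_mem_basis H (hF.left_mem H) f1.le, ⟨0, by simp⟩, by
      rw [zero_add, pow_one]; exact H.equiv.refl _⟩
  | succ k ih =>
    obtain ⟨t, ht, ⟨n, hn⟩, hR⟩ := ih
    have e : N ^ (k + 1 + 1) * x₁ = N * (N ^ (k + 1) * x₁) := by ring
    rcases ht.1 with h | h
    · refine ⟨N * t, hF.mul_mem_basis H ht h.2, ⟨n, ?_⟩, by rw [e]; exact H.mul hR⟩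
      rw [pow_succ' F, CircleDeg1Lift.mul_apply, hn, CircleDeg1Lift.map_add_int,
        M.left t ⟨h.1, by linarith [h.2]⟩]
    · refine ⟨N * (t - δ), hF.mul_sub_mem_basis H ht h.1, ⟨n + 1, ?_⟩, ?_⟩
      · rw [pow_succ' F, CircleDeg1Lift.mul_apply, hn, CircleDeg1Lift.map_add_int,
          M.right t ⟨by linarith [h.1], by linarith [h.2]⟩]
        push_cast; ring
      · rw [e]; exact H.trans (H.mul_shift t) (H.mul hR)

end Frame

/-! ### The Siegel set as the support of the semiconjugacy -/

/-- The points at which a monotone degree one map is not locally constant. -/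
def supp (Ψ : CircleDeg1Lift) : Set ℝ := {t | ∀ s s', s < t → t < s' → Ψ s ≠ Ψ s'}

theorem supp_add_int {Ψ : CircleDeg1Lift} {t : ℝ} (ht : t ∈ supp Ψ) (n : ℤ) : t + n ∈ supp Ψ := by
  intro s s' h1 h2 h
  apply ht (s - n) (s' - n) (by linarith) (by linarith)
  rw [CircleDeg1Lift.map_sub_int, CircleDeg1Lift.map_sub_int, h]

theorem supp_sub_int {Ψ : CircleDeg1Lift} {t : ℝ} (ht : t ∈ supp Ψ) (n : ℤ) : t - n ∈ supp Ψ := by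
  have := supp_add_int ht (-n)
  rwa [Int.cast_neg, ← sub_eq_add_neg] at this

theorem isClosed_supp (Ψ : CircleDeg1Lift) : IsClosed (supp Ψ) := by
  rw [← isOpen_compl_iff, isOpen_iff_mem_nhds]
  intro t ht
  simp only [supp, mem_compl_iff, mem_ofPred_eq] at ht
  push Not at ht
  obtain ⟨s, s', h1, h2, h⟩ := ht
  filter_upwards [Ioo_mem_nhds h1 h2] with w hw hw'
  exact hw' s s' hw.1 hw.2 h

theorem lt_of_mem_supp {Ψ : CircleDeg1Lift} {t s s' : ℝ} (ht : t ∈ supp Ψ) (h1 : s < t)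
    (h2 : t < s') : Ψ s < Ψ s' :=
  lt_of_le_of_ne (Ψ.mono (by linarith)) (ht s s' h1 h2)

/-- Off the support the map is locally constant, so its derivative vanishes and the mean value
theorem applies. -/
theorem eq_of_disjoint_supp {Ψ : CircleDeg1Lift} (hΨ : Continuous Ψ) {a b : ℝ} (hab : a ≤ b)
    (h : ∀ t, a < t → t < b → t ∉ supp Ψ) : Ψ a = Ψ b := by
  rcases hab.eq_or_lt with rfl | hab
  · rfl
  have hd : ∀ t ∈ Ioo a b, HasDerivAt Ψ 0 t := by
    intro t ht
    have := h t ht.1 ht.2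
    simp only [supp, mem_ofPred_eq] at this
    push Not at this
    obtain ⟨s, s', h1, h2, h3⟩ := this
    refine (hasDerivAt_const t (Ψ s)).congr_of_eventuallyEq ?_
    filter_upwards [Ioo_mem_nhds h1 h2] with w hw
    exact le_antisymm (by rw [h3]; exact Ψ.mono hw.2.le) (Ψ.mono hw.1.le)
  obtain ⟨c, hc, hc'⟩ := exists_deriv_eq_slope Ψ hab hΨ.continuousOn
    fun t ht => (hd t ht).differentiableAt.differentiableWithinAt
  rw [(hd c hc).deriv, eq_comm, div_eq_zero_iff] at hc'
  rcases hc' with h | h <;> linarith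

/-- A monotone model with irrational translation number and its semiconjugacy. -/
structure SemiModel (N δ u τ : ℝ) (F Ψ : CircleDeg1Lift) : Prop extends Model N δ u F where
  irr : Irrational τ
  contΨ : Continuous Ψ
  semi : ∀ t, Ψ (F t) = Ψ t + τ

namespace SemiModel

variable {N δ u τ : ℝ} {F Ψ : CircleDeg1Lift}

theorem psi_eq_of_map_eq (M : SemiModel N δ u τ F Ψ) {a b : ℝ} (h : F a = F b) : Ψ a = Ψ b := by
  have h1 := M.semi a
  have h2 := M.semi b
  rw [h] at h1; linarith

theorem psi_outer (M : SemiModel N δ u τ F Ψ) {t : ℝ} (ht : t ∈ Icc (u + δ) (u + 1)) :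
    Ψ t = Ψ (u + δ) :=
  M.psi_eq_of_map_eq (by rw [M.outer t ht, M.outer _ ⟨le_rfl, by linarith [M.toModel.lt_one]⟩])

theorem psi_middle (M : SemiModel N δ u τ F Ψ) {t : ℝ} (ht : t ∈ Icc (1 - δ) δ) : Ψ t = Ψ δ :=
  M.psi_eq_of_map_eq (by rw [M.middle t ht, M.middle _ ⟨by linarith [M.toModel.half_le], le_rfl⟩])

theorem psi_right (M : SemiModel N δ u τ F Ψ) : Ψ (u + δ) = Ψ u + 1 := by
  rw [← M.psi_outer (t := u + 1) ⟨by linarith [M.toModel.lt_one], le_rfl⟩,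
    CircleDeg1Lift.map_add_one]

/-- The middle flat arc is mapped to `1`, which lies in the outer flat arc. -/
theorem psi_delta (M : SemiModel N δ u τ F Ψ) : Ψ δ + τ = Ψ (u + δ) := by
  have hδ := M.toModel.half_le
  rw [← M.semi, M.middle δ ⟨by linarith, le_rfl⟩]
  exact M.psi_outer ⟨by linarith [M.lt_left], by linarith [M.pos]⟩

theorem psi_pow (M : SemiModel N δ u τ F Ψ) (k : ℕ) (t : ℝ) : Ψ ((F ^ k) t) = Ψ t + k * τ := by
  induction k with
  | zero => simp
  | succ k ih => rw [pow_succ' F, CircleDeg1Lift.mul_apply, M.semi, ih]; push_cast; ring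

/-- A fibre over a value that is not taken on a flat arc lies within a single expanding branch. -/
theorem expand (M : SemiModel N δ u τ F Ψ) {a b : ℝ} (hab : a ≤ b) (h : Ψ a = Ψ b)
    (h1 : ∀ n : ℤ, Ψ a ≠ Ψ (u + δ) + n) (h2 : ∀ n : ℤ, Ψ a ≠ Ψ δ + n) :
    F b - F a = N * (b - a) := by
  have hδ := M.toModel.half_le
  have hF : ∀ (t : ℝ) (n : ℤ), F t = F (t - n) + n := fun t n => by
    rw [CircleDeg1Lift.map_sub_int]; ring
  have hΨ : ∀ (t : ℝ) (n : ℤ), Ψ t = Ψ (t - n) + n := fun t n => by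
    rw [CircleDeg1Lift.map_sub_int]; ring
  rcases M.toModel.eq_or a with ⟨n, hn | hn⟩ | ⟨n, hn | hn⟩
  · exact absurd (by rw [hΨ a n, M.psi_middle hn]) (h2 n)
  · exact absurd (by rw [hΨ a n, M.psi_outer hn]) (h1 n)
  · have hb : b - n < 1 - δ := by
      by_contra hcon
      have e1 := Ψ.mono hn.2.le
      have e2 := Ψ.mono (not_lt.1 hcon)
      apply h2 n
      rw [← M.psi_middle (t := 1 - δ) ⟨le_rfl, by linarith⟩]
      linarith [hΨ a n, hΨ b n]
    rw [hF a n, hF b n, M.left _ (Ioo_subset_Icc_self hn), M.left _ ⟨by linarith [hn.1], hb.le⟩]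
    ring
  · have hb : b - n < u + δ := by
      by_contra hcon
      have e1 := Ψ.mono hn.2.le
      have e2 := Ψ.mono (not_lt.1 hcon)
      apply h1 n
      linarith [hΨ a n, hΨ b n]
    rw [hF a n, hF b n, M.right _ (Ioo_subset_Icc_self hn), M.right _ ⟨by linarith [hn.1], hb.le⟩]
    ring

/-- A fibre whose orbit avoids the flat values would be stretched by `N` at each step, although no
fibre is longer than a full turn. -/
theorem eq_of_psi_eq (M : SemiModel N δ u τ F Ψ) {a b : ℝ} (hab : a ≤ b) (h : Ψ a = Ψ b)
    (h1 : ∀ (k : ℕ) (n : ℤ), Ψ a + k * τ ≠ Ψ (u + δ) + n)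
    (h2 : ∀ (k : ℕ) (n : ℤ), Ψ a + k * τ ≠ Ψ δ + n) : a = b := by
  have hN := M.two_le
  have hlen : ∀ k : ℕ, (F ^ k) b - (F ^ k) a = N ^ k * (b - a) := by
    intro k
    induction k with
    | zero => simp
    | succ k ih =>
      have := M.expand ((F ^ k).mono hab) (by rw [M.psi_pow, M.psi_pow, h])
        (by rw [M.psi_pow]; exact h1 k) (by rw [M.psi_pow]; exact h2 k)
      rw [pow_succ' F, CircleDeg1Lift.mul_apply, CircleDeg1Lift.mul_apply, this, ih]; ring
  by_contra hne
  have hpos : 0 < b - a := sub_pos.2 (lt_of_le_of_ne hab hne)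
  obtain ⟨k, hk⟩ := pow_unbounded_of_one_lt (1 / (b - a)) (by linarith : 1 < N)
  rw [div_lt_iff₀ hpos, ← hlen k] at hk
  have h3 := Ψ.mono (show (F ^ k) a + 1 ≤ (F ^ k) b by linarith)
  rw [CircleDeg1Lift.map_add_one, M.psi_pow, M.psi_pow, h] at h3
  linarith

/-- The fibre over the next value is a single point, since by irrationality its orbit never returns
to a flat value. Hence the fibre of the outer arc is mapped to one point and cannot extend into the
neighbouring branches, where the map is strictly increasing. -/
theorem fiber_outer (M : SemiModel N δ u τ F Ψ) {s : ℝ} (hs : Ψ s = Ψ (u + δ)) :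
    u + δ ≤ s ∧ s ≤ u + 1 := by
  have hδ := M.toModel.half_le
  have hδ1 := M.toModel.lt_one
  have hu := M.pos
  have hu1 := M.lt_left
  have hN := M.two_le
  have hirr : ∀ (k : ℕ) (n : ℤ), ((k : ℝ) + 1) * τ ≠ n := by
    intro k n h
    have : Irrational (((k + 1 : ℕ) : ℝ) * τ) := M.irr.natCast_mul (by omega)
    exact this ⟨n, by push_cast; exact h.symm⟩
  have key : ∀ a b, a ≤ b → Ψ a = Ψ (u + δ) + τ → Ψ b = Ψ (u + δ) + τ → a = b := by
    intro a b hab ha hb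
    apply M.eq_of_psi_eq hab (by rw [ha, hb])
    · intro k n h
      exact hirr k n (by linarith)
    · intro k n h
      have := M.psi_delta
      apply hirr (k + 1) n
      push_cast; linarith
  have h1 : ∀ s, Ψ s = Ψ (u + δ) → F s = N * u + 1 := by
    intro s hs
    have e1 : Ψ (F s) = Ψ (u + δ) + τ := by rw [M.semi, hs]
    have e2 : Ψ (N * u + 1) = Ψ (u + δ) + τ := by
      rw [← M.outer (u + δ) ⟨le_rfl, by linarith⟩, M.semi]
    rcases le_total (F s) (N * u + 1) with h | h
    · exact key _ _ h e1 e2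
    · exact (key _ _ h e2 e1).symm
  constructor
  · by_contra hcon
    push Not at hcon
    set s' := max s δ
    have hs' : s' < u + δ := max_lt hcon (by linarith)
    have e : Ψ s' = Ψ (u + δ) := le_antisymm (Ψ.mono hs'.le) (by rw [← hs]; exact Ψ.mono (le_max_left _ _))
    have := h1 s' e
    rw [M.right s' ⟨le_max_right _ _, hs'.le⟩] at this
    have : N * (s' - δ) = N * u := by linarith
    have := mul_left_cancel₀ (by linarith : N ≠ 0) this
    linarith
  · by_contra hcon
    push Not at hcon
    set s' := min s (1 - δ + 1)
    have hs' : u + 1 < s' := lt_min hcon (by linarith)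
    have e0 : Ψ (u + 1) = Ψ (u + δ) := M.psi_outer ⟨by linarith, le_rfl⟩
    have e : Ψ s' = Ψ (u + δ) :=
      le_antisymm (by rw [← hs]; exact Ψ.mono (min_le_left _ _)) (by rw [← e0]; exact Ψ.mono hs'.le)
    have h2 := h1 s' e
    have h3 : F s' = F (s' - 1) + 1 := by rw [← CircleDeg1Lift.map_add_one, sub_add_cancel]
    rw [h3, M.left (s' - 1) ⟨by linarith, by linarith [min_le_right s (1 - δ + 1)]⟩] at h2
    have : N * (s' - 1) = N * u := by linarith
    have := mul_left_cancel₀ (by linarith : N ≠ 0) this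
    linarith

theorem fiber_left (M : SemiModel N δ u τ F Ψ) {s : ℝ} (hs : Ψ s = Ψ u) : s ≤ u := by
  have := (M.fiber_outer (s := s + 1) (by rw [CircleDeg1Lift.map_add_one, hs, M.psi_right])).2
  linarith

theorem opp_lt (M : SemiModel N δ u τ F Ψ) : u < (u + δ) * (1 - δ) ∧ (u + δ) * (1 - δ) < 1 - δ ∧
    δ < u * (1 - δ) + δ ∧ u * (1 - δ) + δ < u + δ ∧ N * ((u + δ) * (1 - δ)) = u + δ ∧
    N * (u * (1 - δ)) = u := by
  have hN := M.two_le
  have hm := M.mul_one_sub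
  have hu := M.pos
  have hu1 := M.lt_left
  have hmul := M.mul_lt
  have e1 : N * ((u + δ) * (1 - δ)) = u + δ := by linear_combination (u + δ) * hm
  have e2 : N * (u * (1 - δ)) = u := by linear_combination u * hm
  have hδ1 := M.toModel.lt_one
  refine ⟨?_, ?_, ?_, ?_, e1, e2⟩
  · by_contra hcon
    have := mul_le_mul_of_nonneg_left (not_lt.1 hcon) (by linarith : 0 ≤ N)
    linarith
  · nlinarith
  · nlinarith
  · nlinarith [M.toModel.half_le]

theorem psi_opp (M : SemiModel N δ u τ F Ψ) :
    Ψ ((u + δ) * (1 - δ)) = Ψ δ ∧ Ψ (u * (1 - δ) + δ) = Ψ δ := by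
  obtain ⟨h1, h2, h3, h4, e1, e2⟩ := M.opp_lt
  have hd := M.psi_delta
  constructor
  · have := M.semi ((u + δ) * (1 - δ))
    rw [M.left _ ⟨h1.le, h2.le⟩, e1] at this
    linarith
  · have := M.semi (u * (1 - δ) + δ)
    rw [M.right _ ⟨h3.le, h4.le⟩, add_sub_cancel_right, e2, CircleDeg1Lift.map_add_one,
      ← M.psi_right] at this
    linarith

/-- The image of this fibre lies in the outer fibre, whose preimages under the two branches begin at
the endpoints of `O`. -/
theorem fiber_middle (M : SemiModel N δ u τ F Ψ) {s : ℝ} (hs : Ψ s = Ψ δ) :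
    (u + δ) * (1 - δ) ≤ s ∧ s ≤ u * (1 - δ) + δ := by
  obtain ⟨h1, h2, h3, h4, e1, e2⟩ := M.opp_lt
  have hN := M.two_le
  obtain ⟨k1, k2⟩ := M.fiber_outer (s := F s) (by rw [M.semi, hs, M.psi_delta])
  constructor
  · by_contra hcon
    push Not at hcon
    have hs' : max s u < (u + δ) * (1 - δ) := max_lt hcon h1
    have k3 := F.mono (le_max_left s u)
    rw [M.left _ ⟨le_max_right _ _, by linarith⟩] at k3
    have := mul_lt_mul_of_pos_left hs' (by linarith : 0 < N)
    linarith
  · by_contra hcon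
    push Not at hcon
    have hs' : u * (1 - δ) + δ < min s (u + δ) := lt_min hcon h4
    have k3 := F.mono (min_le_left s (u + δ))
    rw [M.right _ ⟨by linarith, min_le_right _ _⟩] at k3
    have := mul_lt_mul_of_pos_left (show u * (1 - δ) < min s (u + δ) - δ by linarith)
      (by linarith : 0 < N)
    linarith

theorem map_mem_supp (M : SemiModel N δ u τ F Ψ) {t : ℝ} (ht : t ∈ supp Ψ) : F t ∈ supp Ψ := by
  intro s s' h1 h2 h
  obtain ⟨a, rfl⟩ := F.continuous_iff_surjective.1 M.cont s
  obtain ⟨b, rfl⟩ := F.continuous_iff_surjective.1 M.cont s'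
  refine ht a b (F.monotone.reflect_lt h1) (F.monotone.reflect_lt h2) ?_
  rw [M.semi, M.semi] at h
  linarith

/-- Of the two extreme preimages of `t` one lies in the support: if the semiconjugacy were constant
near both, it would be constant near `t` as well. -/
theorem exists_mem_supp (M : SemiModel N δ u τ F Ψ) {t : ℝ} (ht : t ∈ supp Ψ) :
    ∃ y ∈ supp Ψ, F y = t := by
  obtain ⟨y, hy⟩ := F.continuous_iff_surjective.1 M.cont t
  have hbd : ∀ z, F z = t → y - 1 ≤ z ∧ z ≤ y + 1 := by
    intro z hz
    constructor
    · by_contra hcon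
      have := F.mono (show z + 1 ≤ y by linarith)
      rw [CircleDeg1Lift.map_add_one] at this
      linarith
    · by_contra hcon
      have := F.mono (show y + 1 ≤ z by linarith)
      rw [CircleDeg1Lift.map_add_one] at this
      linarith
  have hcpt : IsCompact (Icc (y - 1) (y + 1) ∩ {z | F z = t}) :=
    isCompact_Icc.inter_right (isClosed_eq M.cont continuous_const)
  have hne : (Icc (y - 1) (y + 1) ∩ {z | F z = t}).Nonempty := ⟨y, hbd y hy, hy⟩
  obtain ⟨y₀, ⟨-, h0⟩, hmin⟩ := hcpt.exists_isMinOn (f := id) hne continuousOn_id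
  obtain ⟨y₁, ⟨-, h1⟩, hmax⟩ := hcpt.exists_isMaxOn (f := id) hne continuousOn_id
  have h0 : F y₀ = t := h0
  have h1 : F y₁ = t := h1
  by_contra hcon
  push Not at hcon
  have n0 : y₀ ∉ supp Ψ := fun h => hcon y₀ h h0
  have n1 : y₁ ∉ supp Ψ := fun h => hcon y₁ h h1
  simp only [supp, mem_ofPred_eq] at n0 n1
  push Not at n0 n1
  obtain ⟨s, s', hs, hs', hss⟩ := n0
  obtain ⟨a, b, ha, hb, hab⟩ := n1
  have hFs : F s < t := by
    refine lt_of_le_of_ne (by rw [← h0]; exact F.mono hs.le) fun h => ?_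
    have : y₀ ≤ s := hmin (show s ∈ _ from ⟨hbd s h, h⟩)
    linarith
  have hFb : t < F b := by
    refine lt_of_le_of_ne (by rw [← h1]; exact F.mono hb.le) fun h => ?_
    have : b ≤ y₁ := hmax (show b ∈ _ from ⟨hbd b h.symm, h.symm⟩)
    linarith
  have e1 : Ψ s = Ψ y₀ := le_antisymm (Ψ.mono hs.le) (by rw [hss]; exact Ψ.mono hs'.le)
  have e2 : Ψ b = Ψ y₁ := le_antisymm (by rw [← hab]; exact Ψ.mono ha.le) (Ψ.mono hb.le)
  have e3 : Ψ y₀ = Ψ y₁ := M.psi_eq_of_map_eq (by rw [h0, h1])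
  exact ht _ _ hFs hFb (by rw [M.semi, M.semi, e1, e2, e3])

theorem right_mem (M : SemiModel N δ u τ F Ψ) : u + δ ∈ supp Ψ := by
  intro s s' h1 h2 h
  have e : Ψ s = Ψ (u + δ) := le_antisymm (Ψ.mono h1.le) (by rw [h]; exact Ψ.mono h2.le)
  linarith [(M.fiber_outer e).1]

theorem left_mem (M : SemiModel N δ u τ F Ψ) : u ∈ supp Ψ := by
  intro s s' h1 h2 h
  have e : Ψ s' = Ψ u := le_antisymm (by rw [← h]; exact Ψ.mono h1.le) (Ψ.mono h2.le)
  linarith [M.fiber_left e]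

/-- The basis of the Siegel gap in the coordinate of the renormalization. -/
def siegel (δ u : ℝ) (Ψ : CircleDeg1Lift) : Set ℝ := Icc u (u + δ) ∩ supp Ψ

theorem mem_siegel (M : SemiModel N δ u τ F Ψ) {t : ℝ} (ht : t ∈ supp Ψ) (h1 : u ≤ t)
    (h2 : t < u + 1) : t ∈ siegel δ u Ψ := by
  refine ⟨⟨h1, ?_⟩, ht⟩
  by_contra hcon
  push Not at hcon
  exact ht (u + δ) (u + 1) hcon h2 (M.psi_outer ⟨by linarith [M.toModel.lt_one], le_rfl⟩).symm

theorem siegel_cases (M : SemiModel N δ u τ F Ψ) {t : ℝ} (ht : t ∈ siegel δ u Ψ) :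
    (u ≤ t ∧ t ≤ 1 - δ) ∨ (δ ≤ t ∧ t ≤ u + δ) := by
  by_contra hcon
  have h1 := ht.1.1
  have h2 := ht.1.2
  have h3 : 1 - δ < t := by by_contra h; exact hcon (Or.inl ⟨h1, not_lt.1 h⟩)
  have h4 : t < δ := by by_contra h; exact hcon (Or.inr ⟨not_lt.1 h, h2⟩)
  exact ht.2 _ _ h3 h4 (M.psi_middle ⟨le_rfl, by linarith⟩)

theorem mul_mem (M : SemiModel N δ u τ F Ψ) {t : ℝ} (ht : t ∈ siegel δ u Ψ) (h : t ≤ 1 - δ) :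
    N * t ∈ siegel δ u Ψ := by
  have hN := M.two_le
  have h1 := mul_le_mul_of_nonneg_left h (by linarith : 0 ≤ N)
  rw [M.mul_one_sub] at h1
  have h2 := mul_le_mul_of_nonneg_left ht.1.1 (by linarith : 0 ≤ N)
  have := M.map_mem_supp ht.2
  rw [M.left t ⟨ht.1.1, h⟩] at this
  exact M.mem_siegel this (by nlinarith [M.pos]) (by linarith [M.pos])

theorem mul_sub_mem (M : SemiModel N δ u τ F Ψ) {t : ℝ} (ht : t ∈ siegel δ u Ψ) (h : δ ≤ t) :
    N * (t - δ) ∈ siegel δ u Ψ := by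
  have hN := M.two_le
  have hu := M.pos
  have hu1 := M.lt_left
  have h1 := mul_nonneg (by linarith : 0 ≤ N) (by linarith : 0 ≤ t - δ)
  have h2 := mul_le_mul_of_nonneg_left (show t - δ ≤ u by linarith [ht.1.2]) (by linarith : 0 ≤ N)
  have h3 := M.map_mem_supp ht.2
  rw [M.right t ⟨h, ht.1.2⟩] at h3
  have h4 := supp_sub_int h3 1
  rw [Int.cast_one, add_sub_cancel_right] at h4
  refine M.mem_siegel h4 ?_ (by linarith [M.mul_lt, M.toModel.lt_one])
  by_contra hcon
  push Not at hcon
  refine h3 (u + δ) (u + 1) (by linarith) (by linarith) ?_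
  exact (M.psi_outer ⟨by linarith [M.toModel.lt_one], le_rfl⟩).symm

theorem siegel_surj (M : SemiModel N δ u τ F Ψ) {t : ℝ} (ht : t ∈ siegel δ u Ψ) :
    ∃ s ∈ siegel δ u Ψ, (s ≤ 1 - δ ∧ N * s = t) ∨ (δ ≤ s ∧ N * (s - δ) = t) := by
  have hN := M.two_le
  have hu := M.pos
  have hu1 := M.lt_left
  have hδ1 := M.toModel.lt_one
  have hmul := M.mul_lt
  obtain ⟨y, hy, hyt⟩ := M.exists_mem_supp ht.2
  set n := ⌊y - u⌋
  have hf0 := Int.fract_nonneg (y - u)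
  have hf1 := Int.fract_lt_one (y - u)
  have hfr := Int.fract_add_floor (y - u)
  have hs : y - n ∈ siegel δ u Ψ :=
    M.mem_siegel (supp_sub_int hy n) (by linarith) (by linarith)
  refine ⟨y - n, hs, ?_⟩
  have hFs : F (y - n) = t - n := by rw [CircleDeg1Lift.map_sub_int, hyt]
  have t1 := ht.1.1
  have t2 := ht.1.2
  rcases M.siegel_cases hs with h | h
  · refine Or.inl ⟨h.2, ?_⟩
    rw [M.left _ h] at hFs
    have h1 := mul_le_mul_of_nonneg_left h.2 (by linarith : 0 ≤ N)
    rw [M.mul_one_sub] at h1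
    have h2 : 0 < N * (y - n) := mul_pos (by linarith) (by linarith [h.1])
    have a1 : (n : ℝ) < 1 := by linarith
    have a2 : (-1 : ℝ) < n := by linarith
    have b1 : n < 1 := by exact_mod_cast a1
    have b2 : -1 < n := by exact_mod_cast a2
    have : n = 0 := by omega
    rw [hFs, this]; simp
  · refine Or.inr ⟨h.1, ?_⟩
    rw [M.right _ h] at hFs
    have h1 := mul_nonneg (by linarith : 0 ≤ N) (by linarith [h.1] : 0 ≤ y - n - δ)
    have h2 := mul_le_mul_of_nonneg_left (show y - n - δ ≤ u by linarith [h.2]) (by linarith : 0 ≤ N)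
    have a1 : (n : ℝ) < 0 := by linarith
    have a2 : (-2 : ℝ) < n := by linarith
    have b1 : n < 0 := by exact_mod_cast a1
    have b2 : -2 < n := by exact_mod_cast a2
    have : n = -1 := by omega
    rw [this] at hFs ⊢
    push_cast at hFs ⊢
    linarith

theorem psi_mul (M : SemiModel N δ u τ F Ψ) {t : ℝ} (h1 : u ≤ t) (h2 : t ≤ 1 - δ) :
    Ψ (N * t) = Ψ t + τ := by rw [← M.left t ⟨h1, h2⟩, M.semi]

theorem psi_mul_sub (M : SemiModel N δ u τ F Ψ) {t : ℝ} (h1 : δ ≤ t) (h2 : t ≤ u + δ) :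
    Ψ (N * (t - δ)) + 1 = Ψ t + τ := by
  rw [← M.semi, M.right t ⟨h1, h2⟩, CircleDeg1Lift.map_add_one]

/-- The forward orbit of `u` stays in the set, and its values modulo integers are distinct multiples
of the irrational `τ`, up to a constant. -/
theorem siegel_infinite (M : SemiModel N δ u τ F Ψ) : (siegel δ u Ψ).Infinite := by
  have h : ∀ k : ℕ, ∃ t ∈ siegel δ u Ψ, ∃ n : ℤ, Ψ t = Ψ u + k * τ + n := by
    intro k
    induction k with
    | zero =>
      exact ⟨u, ⟨⟨le_rfl, by linarith [M.toModel.half_le]⟩, M.left_mem⟩, 0, by simp⟩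
    | succ k ih =>
      obtain ⟨t, ht, n, hn⟩ := ih
      rcases M.siegel_cases ht with h | h
      · refine ⟨_, M.mul_mem ht h.2, n, ?_⟩
        rw [M.psi_mul h.1 h.2, hn]; push_cast; ring
      · refine ⟨_, M.mul_sub_mem ht h.1, n - 1, ?_⟩
        have := M.psi_mul_sub h.1 h.2
        push_cast; linarith
  choose t ht n hn using h
  refine infinite_of_injective_forall_mem (f := t) ?_ ht
  intro i j hij
  by_contra hne
  have e := hn i
  rw [hij, hn j] at e
  have hz : ((j : ℤ) - i : ℤ) ≠ 0 := by omega
  have : Irrational ((((j : ℤ) - i : ℤ) : ℝ) * τ) := M.irr.intCast_mul hz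
  exact this ⟨n i - n j, by push_cast; linarith⟩

end SemiModel

/-! ### The Siegel set is bounded by equivalent pairs and crossed by none -/

namespace SemiModel

variable {N δ u τ : ℝ} {F Ψ : CircleDeg1Lift} {R : ℝ → ℝ → Prop}

/-- The endpoints of a hole of the Siegel set are equivalent. -/
theorem rel_of_hole (M : SemiModel N δ u τ F Ψ) (H : Ren N δ R) (hF : Frame N δ R u (u + δ))
    {a b : ℝ} (ha : a ∈ siegel δ u Ψ) (hb : b ∈ siegel δ u Ψ) (hab : a < b)
    (hno : ∀ t, a < t → t < b → t ∉ siegel δ u Ψ) : R a b := by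
  have hN := M.two_le
  have hδ := M.toModel.half_le
  have hψ : Ψ a = Ψ b := eq_of_disjoint_supp M.contΨ hab.le fun t h1 h2 h =>
    hno t h1 h2 ⟨⟨by linarith [ha.1.1], by linarith [hb.1.2]⟩, h⟩
  obtain ⟨n, hn⟩ := pow_unbounded_of_one_lt (1 / (b - a)) (by linarith : 1 < N)
  rw [div_lt_iff₀ (by linarith)] at hn
  clear hno
  induction n generalizing a b with
  | zero =>
    linarith [ha.1.1, hb.1.2, M.toModel.lt_one, pow_zero N ▸ hn]
  | succ n ih =>
    -- A hole over the value of the middle arc is bounded by the ends of `O`. Any other hole lies in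
    -- one branch, where its image is `N` times longer, so the induction ends.
    by_cases hd : Ψ a = Ψ δ
    · obtain ⟨a1, a2⟩ := M.fiber_middle hd
      obtain ⟨b1, b2⟩ := M.fiber_middle (hψ ▸ hd)
      obtain ⟨e1, e2⟩ := M.psi_opp
      have ea : a = (u + δ) * (1 - δ) := by
        by_contra hne
        exact ha.2 _ b (lt_of_le_of_ne a1 (Ne.symm hne)) hab (by rw [e1, ← hψ, hd])
      have eb : b = u * (1 - δ) + δ := by
        by_contra hne
        exact hb.2 a _ hab (lt_of_le_of_ne b2 hne) (by rw [e2, hd])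
      rw [ea, eb]; exact hF.opp
    have hpow : N ^ (n + 1) * (b - a) = N ^ n * (N * b - N * a) := by ring
    rcases M.siegel_cases ha with h | h <;> rcases M.siegel_cases hb with h' | h'
    · refine hF.pull_left H h h' (ih (M.mul_mem ha h.2) (M.mul_mem hb h'.2)
        (H.mul_strictMono hab) ?_ (by rw [← hpow]; exact hn))
      rw [M.psi_mul h.1 h.2, M.psi_mul h'.1 h'.2, hψ]
    · exfalso
      apply hd
      have e1 := M.psi_middle (t := 1 - δ) ⟨le_rfl, by linarith⟩
      exact le_antisymm (by rw [← e1]; exact Ψ.mono h.2) (by rw [hψ]; exact Ψ.mono h'.1)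
    · rcases (show a = b ∨ a = δ from by
        rcases eq_or_ne a δ with e | e
        · exact Or.inr e
        · left
          have : δ < a := lt_of_le_of_ne h.1 (Ne.symm e)
          linarith [h'.2]) with e | e
      · linarith
      · rw [e] at hd; exact absurd rfl hd
    · refine hF.pull_right H h h' (ih (M.mul_sub_mem ha h.1) (M.mul_sub_mem hb h'.1)
        (H.mul_strictMono (by linarith)) ?_ ?_)
      · have := M.psi_mul_sub h.1 h.2
        have := M.psi_mul_sub h'.1 h'.2
        linarith
      · have : N * (b - δ) - N * (a - δ) = N * b - N * a := by ring
        rw [this, ← hpow]; exact hn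

/-- The return map. -/
noncomputable def step (N δ t : ℝ) : ℝ := if t ≤ 1 - δ then N * t else N * (t - δ)

/-- A pair whose images under the semiconjugacy differ. -/
structure Good (δ u : ℝ) (R : ℝ → ℝ → Prop) (Ψ : CircleDeg1Lift) (x y : ℝ) : Prop where
  memx : x ∈ Icc u (u + δ)
  memy : y ∈ Icc u (u + δ)
  rel : R x y
  ne : ∀ n : ℤ, Ψ y ≠ Ψ x + n

theorem Good.symm (H : Ren N δ R) {x y : ℝ} (h : Good δ u R Ψ x y) : Good δ u R Ψ y x :=
  ⟨h.memy, h.memx, H.symm h.rel, fun n hn => h.ne (-n) (by push_cast; linarith)⟩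

/-- The half turn carries a point of the class of the inner edge outside of the middle to an
interior point equivalent to the boundary, or beyond the reach of the boundary class. -/
theorem mem_of_rel_inner (H : Ren N δ R) {z : ℝ} (h0 : 0 ≤ z) (h1 : z ≤ 1) (h : R (1 - δ) z) :
    z ∈ Icc (1 - δ) δ := by
  have hδ := H.half_le
  have hδ1 := H.lt_one
  constructor
  · by_contra hcon
    push Not at hcon
    have := H.add h
    rw [sub_add_cancel] at this
    rcases H.eq_of_rel_one (by linarith) (by linarith) (H.symm this) with e | e <;> linarith
  · by_contra hcon
    push Not at hcon
    have := H.sub_sub (H.trans (H.symm H.rel_inner) h)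
    rw [sub_self] at this
    exact H.boundary _ (by linarith) (by linarith) this

/-- A point in the middle has its class in the middle, where the semiconjugacy is constant. -/
theorem notMem_middle (M : SemiModel N δ u τ F Ψ) (H : Ren N δ R) {x y : ℝ}
    (h : Good δ u R Ψ x y) : x ∉ Ioo (1 - δ) δ := by
  have hδ := H.half_le
  have hu := M.pos
  have hu1 := M.lt_left
  rintro ⟨h1, h2⟩
  have hy : y ∈ Icc (1 - δ) δ := by
    rcases lt_or_ge y (1 - δ) with hl | hl
    · refine mem_of_rel_inner H (by linarith [h.memy.1]) (by linarith [h.memy.2]) (H.symm ?_)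
      exact H.linked (by linarith [h.memy.1]) hl h1 h2 H.lt_one.le (H.symm h.rel) H.rel_inner
    rcases lt_or_ge δ y with hr | hr
    · refine mem_of_rel_inner H (by linarith [h.memy.1]) (by linarith [h.memy.2]) ?_
      exact H.trans (H.linked (by linarith) h1 h2 hr (by linarith [h.memy.2]) H.rel_inner h.rel) h.rel
    · exact ⟨hl, hr⟩
  apply h.ne 0
  rw [M.psi_middle hy, M.psi_middle ⟨h1.le, h2.le⟩]; simp

theorem step_spec (M : SemiModel N δ u τ F Ψ) {x : ℝ} (hx : x ∈ Icc u (u + δ))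
    (hm : x ∉ Ioo (1 - δ) δ) : 0 ≤ step N δ x ∧ step N δ x ≤ 1 ∧
      ∃ n : ℤ, Ψ (step N δ x) = Ψ x + τ + n := by
  have hN := M.two_le
  have hu := M.pos
  have hone := M.mul_one_sub
  unfold step
  split_ifs with h
  · refine ⟨mul_nonneg (by linarith) (by linarith [hx.1]), ?_, 0, ?_⟩
    · rw [← hone]; exact mul_le_mul_of_nonneg_left h (by linarith)
    · rw [M.psi_mul hx.1 h]; simp
  · have hδx : δ ≤ x := by
      by_contra hcon
      exact hm ⟨not_le.1 h, not_le.1 hcon⟩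
    refine ⟨mul_nonneg (by linarith) (by linarith), ?_, -1, ?_⟩
    · rw [← hone]; exact mul_le_mul_of_nonneg_left (by linarith [hx.2, M.lt_left]) (by linarith)
    · have := M.psi_mul_sub hδx hx.2
      push_cast; linarith

theorem rel_step (H : Ren N δ R) (x : ℝ) : R (step N δ x) (N * x) := by
  unfold step
  split_ifs
  · exact H.equiv.refl _
  · exact H.mul_shift x

theorem good_step (M : SemiModel N δ u τ F Ψ) (H : Ren N δ R) {x y : ℝ}
    (h : Good δ u R Ψ x y) : R (step N δ x) (step N δ y) ∧
      ∀ n : ℤ, Ψ (step N δ y) ≠ Ψ (step N δ x) + n := by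
  refine ⟨H.trans (rel_step H x) (H.trans (H.mul h.rel) (H.symm (rel_step H y))), ?_⟩
  intro n hn
  obtain ⟨-, -, i, hi⟩ := M.step_spec h.memx (M.notMem_middle H h)
  obtain ⟨-, -, j, hj⟩ := M.step_spec h.memy (M.notMem_middle H (Good.symm H h))
  apply h.ne (n + i - j)
  push_cast; linarith

/-- A pair with one end beyond the critical edge is linked with that edge or touches it. -/
theorem rel_of_outside (M : SemiModel N δ u τ F Ψ) (H : Ren N δ R) (hI : R u (u + δ)) {z w : ℝ}
    (hz : z ∈ Icc u (u + δ)) (h0 : 0 ≤ w) (h1 : w ≤ 1) (hw : w ∉ Icc u (u + δ)) (h : R z w) :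
    R u z := by
  have hu := M.pos
  rcases hz.1.eq_or_lt with e | e
  · rw [e]; exact H.equiv.refl _
  rcases hz.2.eq_or_lt with e' | e'
  · rw [e']; exact hI
  rcases lt_or_ge w u with hl | hl
  · have := H.linked h0 hl e e' (by linarith [M.lt_left]) (H.symm h) hI
    exact H.trans (H.symm this) (H.symm h)
  · have : u + δ < w := by
      by_contra hcon
      exact hw ⟨hl, not_lt.1 hcon⟩
    exact H.linked hu.le e e' this h1 hI h

theorem psi_of_outside (M : SemiModel N δ u τ F Ψ) {w : ℝ} (h0 : 0 ≤ w) (h1 : w ≤ 1)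
    (hw : w ∉ Icc u (u + δ)) : ∃ n : ℤ, Ψ w = Ψ u + n := by
  have hu := M.pos
  rcases lt_or_ge w u with hl | hl
  · refine ⟨0, ?_⟩
    have := M.psi_outer (t := w + 1) ⟨by linarith [M.lt_left], by linarith⟩
    rw [CircleDeg1Lift.map_add_one, M.psi_right] at this
    push_cast; linarith
  · have : u + δ < w := by
      by_contra hcon
      exact hw ⟨hl, not_lt.1 hcon⟩
    refine ⟨1, ?_⟩
    rw [M.psi_outer (t := w) ⟨this.le, by linarith⟩, M.psi_right]
    simp

/-- A pair that stays good forever contradicts the finiteness of classes. -/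
theorem not_good (M : SemiModel N δ u τ F Ψ) (H : Ren N δ R) (hI : R u (u + δ)) {x y : ℝ}
    (hg : Good δ u R Ψ x y) (hx : x < u + δ) (hy : y < u + δ)
    (hesc : ∀ j : ℕ, Good δ u R Ψ ((step N δ)^[j] x) ((step N δ)^[j] y) →
      ¬ R u ((step N δ)^[j + 1] x)) : False := by
  have hu := M.pos
  have hu1 := M.lt_left
  -- A pair could stop being good only by leaving the interval. If one end leaves, the pair belongs
  -- to the critical class; if both leave, their values differ by an integer.
  have hgood : ∀ j : ℕ, Good δ u R Ψ ((step N δ)^[j] x) ((step N δ)^[j] y) := by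
    intro j
    induction j with
    | zero => exact hg
    | succ j ih =>
      have hn := hesc j ih
      obtain ⟨hR, hne⟩ := M.good_step H ih
      obtain ⟨a0, a1, -⟩ := M.step_spec ih.memx (M.notMem_middle H ih)
      obtain ⟨b0, b1, -⟩ := M.step_spec ih.memy (M.notMem_middle H (Good.symm H ih))
      rw [Function.iterate_succ_apply'] at hn ⊢
      rw [Function.iterate_succ_apply']
      set x' := step N δ ((step N δ)^[j] x)
      set y' := step N δ ((step N δ)^[j] y)
      by_cases hx' : x' ∈ Icc u (u + δ)
      · by_cases hy' : y' ∈ Icc u (u + δ)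
        · exact ⟨hx', hy', hR, hne⟩
        · exact absurd (M.rel_of_outside H hI hx' b0 b1 hy' hR) hn
      · by_cases hy' : y' ∈ Icc u (u + δ)
        · exact absurd (H.trans (M.rel_of_outside H hI hy' a0 a1 hx' (H.symm hR)) (H.symm hR)) hn
        · obtain ⟨i, hi⟩ := M.psi_of_outside a0 a1 hx'
          obtain ⟨k, hk⟩ := M.psi_of_outside b0 b1 hy'
          exact absurd (by rw [hk, hi]; push_cast; ring) (hne (k - i))
  -- reorder the pair
  obtain ⟨x, y, hxy, hx, hy, hgood⟩ : ∃ x y, x < y ∧ x < u + δ ∧ y < u + δ ∧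
      ∀ j : ℕ, Good δ u R Ψ ((step N δ)^[j] x) ((step N δ)^[j] y) := by
    rcases lt_trichotomy x y with h | h | h
    · exact ⟨x, y, h, hx, hy, hgood⟩
    · exact absurd (by rw [h]; simp) (hg.ne 0)
    · exact ⟨y, x, h, hy, hx, fun j => Good.symm H (hgood j)⟩
  have hg : Good δ u R Ψ x y := hgood 0
  have hrot : ∀ z, (∀ j : ℕ, (step N δ)^[j] z ∈ Icc u (u + δ) ∧
      (step N δ)^[j] z ∉ Ioo (1 - δ) δ) →
      ∀ k : ℕ, ∃ n : ℤ, Ψ ((step N δ)^[k] z) = Ψ z + k * τ + n := by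
    intro z hz k
    induction k with
    | zero => exact ⟨0, by simp⟩
    | succ k ih =>
      obtain ⟨n, hn⟩ := ih
      obtain ⟨-, -, m, hm⟩ := M.step_spec (hz k).1 (hz k).2
      refine ⟨n + m, ?_⟩
      rw [Function.iterate_succ_apply', hm, hn]; push_cast; ring
  have hlow : Ψ u ≤ Ψ x := Ψ.mono hg.memx.1
  have hψxy : Ψ x < Ψ y := lt_of_le_of_ne (Ψ.mono hxy.le) fun h => hg.ne 0 (by rw [h]; simp)
  have hψy : Ψ y < Ψ u + 1 := by
    rw [← M.psi_right]
    refine lt_of_le_of_ne (Ψ.mono hy.le) fun h => ?_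
    linarith [(M.fiber_outer h).1]
  -- The class of `x` is finite, so the values taken on it above that of `x` keep a positive
  -- distance.
  obtain ⟨η, hη, hηmin⟩ : ∃ η > 0, ∀ t ∈ Icc (0 : ℝ) 1, R x t → Ψ x < Ψ t → η < Ψ t - Ψ x := by
    have hfin := (H.finite x)
    have hev : ∀ᶠ η in nhdsWithin (0 : ℝ) (Ioi 0),
        ∀ t ∈ {t | t ∈ Icc (0 : ℝ) 1 ∧ R x t}, Ψ x < Ψ t → η < Ψ t - Ψ x := by
      rw [Filter.eventually_all_finite hfin]
      intro t _
      by_cases hlt : Ψ x < Ψ t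
      · filter_upwards [Ioo_mem_nhdsGT (sub_pos.2 hlt)] with η h _ using h.2
      · exact Filter.Eventually.of_forall fun _ h => absurd h hlt
    obtain ⟨η, h1, h2⟩ := (hev.and self_mem_nhdsWithin).exists
    exact ⟨η, h2, fun t ht hR => h1 t ⟨ht, hR⟩⟩
  obtain ⟨k, -, he0, he⟩ := exists_fract_mul_lt M.irr
    (show 0 < min η (min (Ψ y - Ψ x) (Ψ u + 1 - Ψ y)) by
      refine lt_min hη (lt_min ?_ ?_) <;> linarith)
  set e := Int.fract ((k : ℝ) * τ) with hedef
  have he1 := lt_of_lt_of_le he (min_le_left _ _)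
  have he2 := lt_of_lt_of_le he ((min_le_right _ _).trans (min_le_left _ _))
  have he3 := lt_of_lt_of_le he ((min_le_right _ _).trans (min_le_right _ _))
  have hshift : ∀ z, (∀ j : ℕ, (step N δ)^[j] z ∈ Icc u (u + δ) ∧
      (step N δ)^[j] z ∉ Ioo (1 - δ) δ) → Ψ u ≤ Ψ z → Ψ z + e < Ψ u + 1 →
      Ψ ((step N δ)^[k] z) = Ψ z + e := by
    intro z hz h1 h2
    obtain ⟨n, hn⟩ := hrot z hz k
    have hfl := Int.fract_add_floor ((k : ℝ) * τ)
    have b1 := Ψ.mono (hz k).1.1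
    have b2 := Ψ.mono (hz k).1.2
    rw [M.psi_right] at b2
    have hn' : Ψ ((step N δ)^[k] z) = Ψ z + e + ((⌊(k : ℝ) * τ⌋ + n : ℤ) : ℝ) := by
      rw [hn]; push_cast; linarith
    have c1 : ((⌊(k : ℝ) * τ⌋ + n : ℤ) : ℝ) < 1 := by linarith
    have c2 : (-1 : ℝ) < ((⌊(k : ℝ) * τ⌋ + n : ℤ) : ℝ) := by linarith
    have d1 : ⌊(k : ℝ) * τ⌋ + n < 1 := by exact_mod_cast c1
    have d2 : -1 < ⌊(k : ℝ) * τ⌋ + n := by exact_mod_cast c2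
    have : ⌊(k : ℝ) * τ⌋ + n = 0 := by omega
    rw [hn', this]; simp
  have hX := hshift x (fun j => ⟨(hgood j).memx, M.notMem_middle H (hgood j)⟩) hlow (by linarith)
  have hY := hshift y (fun j => ⟨(hgood j).memy, M.notMem_middle H (Good.symm H (hgood j))⟩)
    (by linarith) (by linarith)
  have hgk := hgood k
  have l1 : x < (step N δ)^[k] x := Ψ.monotone.reflect_lt (by linarith)
  have l2 : (step N δ)^[k] x < y := Ψ.monotone.reflect_lt (by linarith)
  have l3 : y < (step N δ)^[k] y := Ψ.monotone.reflect_lt (by linarith)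
  -- The rotation by the small amount `e` moves both ends to the right by less than their distance,
  -- so the moved pair is linked with the original one. This puts a point of the class of `x` closer
  -- in value than `η` allows.
  have hlink := H.linked (by linarith [hg.memx.1]) l1 l2 l3 (by linarith [hgk.memy.2]) hg.rel hgk.rel
  have := hηmin _ ⟨by linarith [hgk.memx.1], by linarith [hgk.memx.2]⟩ hlink (by linarith)
  linarith

/-- The class of the critical edge consists of its endpoints. -/
theorem eq_of_rel_left (M : SemiModel N δ u τ F Ψ) (H : Ren N δ R) (hI : R u (u + δ)) {z : ℝ}
    (h0 : 0 ≤ z) (h1 : z ≤ 1) (h : R u z) : z = u ∨ z = u + δ := by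
  have hδ := H.half_le
  have hu := M.pos
  have hu1 := M.lt_left
  have key : ∀ z, u < z → z < u + δ → ¬ R u z := by
    intro z hz1 hz2 hR
    have hg : Good δ u R Ψ u z := by
      refine ⟨⟨le_rfl, by linarith⟩, ⟨hz1.le, hz2.le⟩, hR, fun n hn => ?_⟩
      have a1 := Ψ.mono hz1.le
      have a2 : Ψ z < Ψ u + 1 := by
        rw [← M.psi_right]
        refine lt_of_le_of_ne (Ψ.mono hz2.le) fun h => ?_
        linarith [(M.fiber_outer h).1]
      have a3 : Ψ u < Ψ z := lt_of_le_of_ne a1 fun h => by linarith [M.fiber_left h.symm]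
      have c1 : (n : ℝ) < 1 := by linarith
      have c2 : (0 : ℝ) < n := by linarith
      have d1 : n < 1 := by exact_mod_cast c1
      have d2 : 0 < n := by exact_mod_cast c2
      omega
    refine M.not_good H hI hg (by linarith) hz2 fun j _ hj => ?_
    -- The orbit of `u` under the return map follows the powers of `N` up to equivalence, so a
    -- return to its own class contradicts `Ren.aperiodic`.
    have hit : ∀ j : ℕ, R ((step N δ)^[j] u) (N ^ j * u) := by
      intro j
      induction j with
      | zero => simpa using H.equiv.refl u
      | succ j ih =>
        rw [Function.iterate_succ_apply']
        have e : N ^ (j + 1) * u = N * (N ^ j * u) := by ring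
        rw [e]
        exact H.trans (rel_step H _) (H.mul ih)
    exact H.aperiodic hI (j + 1) (by omega) (H.trans hj (hit (j + 1)))
  rcases lt_trichotomy z u with h' | h' | h'
  · exfalso
    exact key (z + δ) (by linarith) (by linarith) (H.trans hI (H.add h))
  · exact Or.inl h'
  rcases lt_trichotomy z (u + δ) with h'' | h'' | h''
  · exact absurd h (key z h' h'')
  · exact Or.inr h''
  · exfalso
    have := H.sub_sub (H.trans (H.symm hI) h)
    rw [add_sub_cancel_right] at this
    exact key (z - δ) (by linarith) (by linarith) this

/-- Equivalent points do not cross the Siegel set. -/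
theorem not_crosses (M : SemiModel N δ u τ F Ψ) (H : Ren N δ R) (hI : R u (u + δ)) {x y a b : ℝ}
    (h0 : 0 ≤ x) (h1 : y ≤ 1) (hR : R x y) (ha : a ∈ siegel δ u Ψ) (hxa : x < a) (hay : a < y)
    (hb : b ∈ siegel δ u Ψ) (hbxy : b < x ∨ y < b) : False := by
  have hδ := H.half_le
  have hu := M.pos
  have hu1 := M.lt_left
  by_cases hx : x ∈ Icc u (u + δ)
  · by_cases hy : y ∈ Icc u (u + δ)
    · by_cases hC : R u x
      · rcases M.eq_of_rel_left H hI h0 (by linarith) hC with e | e <;>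
        rcases M.eq_of_rel_left H hI (by linarith) h1 (H.trans hC hR) with e' | e' <;>
        rcases hbxy with h | h <;> linarith [hb.1.1, hb.1.2]
      have hx' : x < u + δ := by linarith [hy.2]
      have hy' : y < u + δ := by
        refine lt_of_le_of_ne hy.2 fun e => hC ?_
        rw [e] at hR; exact H.trans hI (H.symm hR)
      have hlt : Ψ x < Ψ y := lt_of_mem_supp ha.2 hxa hay
      have hg : Good δ u R Ψ x y := by
        refine ⟨hx, hy, hR, fun n hn => ?_⟩
        have a1 := Ψ.mono hx.1
        have a2 : Ψ y < Ψ u + 1 := by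
          rw [← M.psi_right]
          refine lt_of_le_of_ne (Ψ.mono hy'.le) fun h => ?_
          linarith [(M.fiber_outer h).1]
        have c1 : (n : ℝ) < 1 := by linarith
        have c2 : (0 : ℝ) < n := by linarith
        have d1 : n < 1 := by exact_mod_cast c1
        have d2 : 0 < n := by exact_mod_cast c2
        omega
      -- Escape through the critical class is impossible: that class has only the two endpoints of
      -- the edge, whose values differ by an integer.
      refine M.not_good H hI hg hx' hy' fun j hj hRj => ?_
      obtain ⟨hR', hne'⟩ := M.good_step H hj
      obtain ⟨a0, a1, -⟩ := M.step_spec hj.memx (M.notMem_middle H hj)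
      obtain ⟨b0, b1, -⟩ := M.step_spec hj.memy (M.notMem_middle H (Good.symm H hj))
      rw [Function.iterate_succ_apply'] at hRj
      have hr := M.psi_right
      rcases M.eq_of_rel_left H hI a0 a1 hRj with e | e <;>
      rcases M.eq_of_rel_left H hI b0 b1 (H.trans hRj hR') with e' | e' <;> rw [e, e'] at hne'
      · exact hne' 0 (by simp)
      · exact hne' 1 (by rw [hr]; simp)
      · exact hne' (-1) (by rw [hr]; simp)
      · exact hne' 0 (by simp)
    · have := H.trans (M.rel_of_outside H hI hx (by linarith) h1 hy hR) hR
      rcases M.eq_of_rel_left H hI (by linarith) h1 this with e | e <;>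
        exact hy (by rw [e]; constructor <;> linarith)
  · by_cases hy : y ∈ Icc u (u + δ)
    · have := H.trans (M.rel_of_outside H hI hy h0 (by linarith) hx (H.symm hR)) (H.symm hR)
      rcases M.eq_of_rel_left H hI h0 (by linarith) this with e | e <;>
        exact hx (by rw [e]; constructor <;> linarith)
    · have hx' : x < u := by
        by_contra hcon
        exact hx ⟨not_lt.1 hcon, by linarith [ha.1.2]⟩
      have hy' : u + δ < y := by
        by_contra hcon
        exact hy ⟨by linarith [ha.1.1], not_lt.1 hcon⟩
      rcases hbxy with h | h <;> linarith [hb.1.1, hb.1.2]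

end SemiModel

/-- A renormalization with a strip pair has an invariant class, or an invariant Siegel set. -/
theorem Ren.exists_invariant_or_siegel {N δ : ℝ} {R : ℝ → ℝ → Prop} (H : Ren N δ R)
    (hS : ∃ x y, StripPair δ R x y) :
    (∃ x, 0 < x ∧ x < 1 - δ ∧ R x (N * x)) ∨
      ∃ u τ F Ψ, SemiModel N δ u τ F Ψ ∧ Frame N δ R u (u + δ) := by
  by_cases hA : ∃ x, 0 < x ∧ x < 1 - δ ∧ R x (N * x)
  · exact Or.inl hA
  push Not at hA
  right
  obtain ⟨x₁, y₁, hF⟩ := H.exists_frame hA hS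
  have hcrit : y₁ = x₁ + δ := by linarith [hF.length_eq H hA]
  obtain ⟨F, M⟩ := exists_model H.two_le H.mul_one_sub hF.pair.pos hF.pair.lt_left
    (by rw [← hcrit]; exact hF.left_lt)
  have hirr := M.irrational fun k => hF.orbit_mem H hcrit M k
  obtain ⟨Ψ, hΨ, hsemi⟩ := exists_semiconj_of_irrational F M.cont hirr
  exact ⟨x₁, _, F, Ψ, ⟨M, hirr, hΨ, hsemi⟩, hcrit ▸ hF⟩

/-! ### The renormalization induced on the long arc of a cycle -/

/-- A cycle of arcs `2 ^ i * (a, a + κ)`, `1 ≤ i ≤ q`, whose endpoints are equivalent and which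
are unions of classes.  The last of these arcs, which begins at `a`, is the one that contains a
half circle.  For `q = 1` it is the complement of the fixed point. -/
structure Cycle (r : Setoid UnitAddCircle) (q : ℕ) (a κ : ℝ) : Prop where
  inv : IsInvariantLamination 2 r
  pos : 0 < q
  kap : κ * (2 ^ q - 1) = 1 / 2
  per : ∃ n : ℤ, 2 ^ q * a = a + n
  ends : r (2 * a : ℝ) (2 * (a + κ) : ℝ)
  stay : ∀ i, 1 ≤ i → i ≤ q → ∀ t : ℝ, 0 < t → t < 1 → ∀ y : UnitAddCircle,
    r (2 ^ i * (a + κ * t) : ℝ) y → ∃ t' : ℝ, 0 < t' ∧ t' < 1 ∧ y = (2 ^ i * (a + κ * t') : ℝ)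
  disj : ∀ i j, 1 ≤ i → i < j → j ≤ q → ∀ t t' : ℝ, 0 < t → t < 1 → 0 < t' → t' < 1 →
    ((2 ^ i * (a + κ * t) : ℝ) : UnitAddCircle) ≠ (2 ^ j * (a + κ * t') : ℝ)

/-- The coordinate of the long arc. -/
def emb (q : ℕ) (a κ t : ℝ) : ℝ := a + κ * (2 ^ q * t)

/-- The expansion rate of the half turn image of the return map: the half turn in the coordinate
of the long arc. -/
noncomputable def halfTurn (q : ℕ) : ℝ := 1 - (2 ^ q)⁻¹

/-- The relation in the coordinate of the long arc. -/
def Cycle.rel (r : Setoid UnitAddCircle) (q : ℕ) (a κ t t' : ℝ) : Prop :=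
  r (emb q a κ t : ℝ) (emb q a κ t' : ℝ)

namespace Cycle

variable {r : Setoid UnitAddCircle} {q : ℕ} {a κ : ℝ}

theorem two_le (C : Cycle r q a κ) : (2 : ℝ) ≤ 2 ^ q := by
  calc (2 : ℝ) = 2 ^ 1 := (pow_one 2).symm
    _ ≤ 2 ^ q := pow_le_pow_right₀ (by norm_num) C.pos

theorem kap_pos (C : Cycle r q a κ) : 0 < κ := by
  have := C.two_le
  have := C.kap
  by_contra hcon
  nlinarith

theorem kap_le (C : Cycle r q a κ) : κ ≤ 1 / 2 := by
  nlinarith [C.two_le, C.kap, C.kap_pos]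

theorem mul_kap (C : Cycle r q a κ) : 2 ^ q * κ = κ + 1 / 2 := by linarith [C.kap]

theorem mul_delta (q : ℕ) : (2 : ℝ) ^ q * halfTurn q = 2 ^ q - 1 := by
  unfold halfTurn
  rw [mul_sub, mul_one, mul_inv_cancel₀ (by positivity)]

theorem mul_one_sub (q : ℕ) : (2 : ℝ) ^ q * (1 - halfTurn q) = 1 := by
  linarith [mul_delta q]

/-- Doubling the width of a shorter arc gives at most the width of the long arc, which is less than
a full turn when `q` is at least two. -/
theorem kap_lt_of_lt (C : Cycle r q a κ) {i : ℕ} (hi : i < q) (h1 : 1 ≤ i) :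
    2 ^ i * κ < 1 / 2 := by
  have h2 : (2 : ℝ) ^ (i + 1) ≤ 2 ^ q := pow_le_pow_right₀ (by norm_num) hi
  have h3 : (2 : ℝ) ^ 2 ≤ 2 ^ q := pow_le_pow_right₀ (by norm_num) (by omega)
  have hk := C.kap_pos
  have : κ < 1 / 2 := by nlinarith [C.kap]
  have h4 := mul_le_mul_of_nonneg_right h2 hk.le
  rw [pow_succ] at h4
  linarith [C.mul_kap]

theorem emb_eq (C : Cycle r q a κ) (t : ℝ) : emb q a κ t = a + (κ + 1 / 2) * t := by
  unfold emb; rw [← C.mul_kap]; ring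

theorem coe_arc (C : Cycle r q a κ) (t : ℝ) :
    ((2 ^ q * (a + κ * t) : ℝ) : UnitAddCircle) = (emb q a κ t : ℝ) := by
  obtain ⟨n, hn⟩ := C.per
  rw [← coe_add_int (emb q a κ t) n]
  congr 1
  unfold emb; rw [mul_add, hn]; ring

theorem two_pow_mul_emb (i : ℕ) (t : ℝ) :
    2 ^ i * emb q a κ t = 2 ^ i * (a + κ * (2 ^ q * t)) := rfl

theorem emb_mul (C : Cycle r q a κ) (t : ℝ) :
    ((emb q a κ (2 ^ q * t) : ℝ) : UnitAddCircle) = (2 ^ q * emb q a κ t : ℝ) :=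
  (C.coe_arc _).symm

theorem emb_add_delta (C : Cycle r q a κ) (t : ℝ) :
    emb q a κ (t + halfTurn q) = emb q a κ t + 1 / 2 := by
  unfold emb
  rw [mul_add, mul_delta]
  linear_combination C.kap

theorem emb_add_shift (C : Cycle r q a κ) (t : ℝ) :
    ((emb q a κ (t + (2 ^ q - 1)) : ℝ) : UnitAddCircle) = (emb q a κ t : ℝ) := by
  obtain ⟨k, rfl⟩ : ∃ k, q = k + 1 := ⟨q - 1, by have := C.pos; omega⟩
  rw [eq_comm, coe_eq_iff]
  refine ⟨2 ^ k, ?_⟩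
  unfold emb
  push_cast
  linear_combination (2 ^ (k + 1)) * C.kap

/-- Right endpoints: the arcs of the cycle in the coordinate of the return map. -/
theorem arc_mul_sub (C : Cycle r q a κ) {i : ℕ} (hi : 1 ≤ i) (t : ℝ) :
    ((2 ^ i * emb q a κ t : ℝ) : UnitAddCircle) =
      (2 ^ i * (a + κ * (2 ^ q * (t - halfTurn q))) : ℝ) := by
  obtain ⟨k, rfl⟩ : ∃ k, i = k + 1 := ⟨i - 1, by omega⟩
  rw [eq_comm, coe_eq_iff]
  refine ⟨2 ^ k, ?_⟩
  unfold emb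
  rw [mul_sub, mul_delta]
  push_cast
  linear_combination (2 ^ (k + 1)) * C.kap

theorem rel_ends (C : Cycle r q a κ) {i : ℕ} (hi : 1 ≤ i) :
    r (2 ^ i * a : ℝ) (2 ^ i * (a + κ) : ℝ) := by
  obtain ⟨k, rfl⟩ : ∃ k, i = k + 1 := ⟨i - 1, by omega⟩
  have := C.inv.rel_two_pow_mul k C.ends
  rwa [← mul_assoc, ← mul_assoc, ← pow_succ] at this

theorem rel_arc_of_endpoint (C : Cycle r q a κ) {i : ℕ} (hi : 1 ≤ i) {s t : ℝ}
    (hs : s = 0 ∨ s = 1) (ht : t = 0 ∨ t = 1) :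
    r (2 ^ i * (a + κ * s) : ℝ) (2 ^ i * (a + κ * t) : ℝ) := by
  have h := C.rel_ends hi
  rcases hs with rfl | rfl <;> rcases ht with rfl | rfl
  · exact r.refl' _
  · simpa using h
  · simpa using r.symm' h
  · exact r.refl' _

/-- The shorter arcs fit into a half circle, so the opposite of a point of such an arc cannot be
joined to an interior point by a class that stays in the open arc; only the end pair needs a
separate look. -/
theorem rel_of_rel_succ (C : Cycle r q a κ) {i : ℕ} (hi : 1 ≤ i) (hiq : i < q) {s t : ℝ}
    (hs : s ∈ Icc (0 : ℝ) 1) (ht : t ∈ Icc (0 : ℝ) 1)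
    (h : r (2 ^ (i + 1) * (a + κ * s) : ℝ) (2 ^ (i + 1) * (a + κ * t) : ℝ)) :
    r (2 ^ i * (a + κ * s) : ℝ) (2 ^ i * (a + κ * t) : ℝ) := by
  have hlt := C.kap_lt_of_lt hiq hi
  have hk := C.kap_pos
  have hno : ∀ s t : ℝ, 0 < s → s < 1 → t ∈ Icc (0 : ℝ) 1 →
      ¬ r (2 ^ i * (a + κ * s) : ℝ) (2 ^ i * (a + κ * t) + 1 / 2 : ℝ) := by
    intro s t h0 h1 ht hst
    obtain ⟨t', h0', h1', ht'⟩ := C.stay i hi hiq.le s h0 h1 _ hst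
    rw [coe_eq_iff] at ht'
    obtain ⟨n, hn⟩ := ht'
    have hp : (0 : ℝ) < 2 ^ i * κ := by positivity
    have e : 2 ^ i * κ * (t' - t) = 1 / 2 + n := by linear_combination hn
    have b1 : 2 ^ i * κ * (t' - t) < 1 / 2 := by nlinarith [ht.1]
    have b2 : -(1 / 2) < 2 ^ i * κ * (t' - t) := by nlinarith [ht.2]
    have c1 : (n : ℝ) < 0 := by linarith
    have c2 : (-1 : ℝ) < n := by linarith
    have d1 : n < 0 := by exact_mod_cast c1
    have d2 : -1 < n := by exact_mod_cast c2
    omega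
  have h' : r (2 * (2 ^ i * (a + κ * s)) : ℝ) (2 * (2 ^ i * (a + κ * t)) : ℝ) := by
    rw [← mul_assoc, ← mul_assoc, ← pow_succ']; exact h
  rcases C.inv.rel_or_rel_of_two_mul h' with h1 | h1
  · exact h1
  by_cases hs' : s = 0 ∨ s = 1
  · by_cases ht' : t = 0 ∨ t = 1
    · exact C.rel_arc_of_endpoint hi hs' ht'
    · push Not at ht'
      have h2 := C.inv.rel_add_half h1
      have e : ((2 ^ i * (a + κ * t) + 1 / 2 + 1 / 2 : ℝ) : UnitAddCircle) =
          (2 ^ i * (a + κ * t) : ℝ) := by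
        rw [add_assoc, show (1 / 2 + 1 / 2 : ℝ) = 1 by norm_num, coe_add_one]
      rw [e] at h2
      exact absurd (r.symm' h2) (hno t s (lt_of_le_of_ne ht.1 (Ne.symm ht'.1))
        (lt_of_le_of_ne ht.2 ht'.2) hs)
  · push Not at hs'
    exact absurd h1 (hno s t (lt_of_le_of_ne hs.1 (Ne.symm hs'.1)) (lt_of_le_of_ne hs.2 hs'.2) ht)

theorem rel_one_of_rel (C : Cycle r q a κ) {i : ℕ} (hi : 1 ≤ i) (hiq : i ≤ q) {s t : ℝ}
    (hs : s ∈ Icc (0 : ℝ) 1) (ht : t ∈ Icc (0 : ℝ) 1)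
    (h : r (2 ^ i * (a + κ * s) : ℝ) (2 ^ i * (a + κ * t) : ℝ)) :
    r (2 * (a + κ * s) : ℝ) (2 * (a + κ * t) : ℝ) := by
  induction i with
  | zero => omega
  | succ i ih =>
    rcases Nat.eq_zero_or_pos i with rfl | hi'
    · simpa using h
    · exact ih hi' (by omega) (C.rel_of_rel_succ hi' (by omega) hs ht h)

/-- The relation on all arcs of the cycle is the same in their affine coordinates. -/
theorem rel_arc_iff (C : Cycle r q a κ) {i : ℕ} (hi : 1 ≤ i) (hiq : i ≤ q) {s t : ℝ}
    (hs : s ∈ Icc (0 : ℝ) 1) (ht : t ∈ Icc (0 : ℝ) 1) :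
    r (2 ^ i * (a + κ * s) : ℝ) (2 ^ i * (a + κ * t) : ℝ) ↔ Cycle.rel r q a κ s t := by
  unfold Cycle.rel
  rw [← C.coe_arc, ← C.coe_arc]
  have aux : ∀ j, 1 ≤ j → r (2 * (a + κ * s) : ℝ) (2 * (a + κ * t) : ℝ) →
      r (2 ^ j * (a + κ * s) : ℝ) (2 ^ j * (a + κ * t) : ℝ) := by
    intro j hj h
    obtain ⟨k, rfl⟩ : ∃ k, j = k + 1 := ⟨j - 1, by omega⟩
    have := C.inv.rel_two_pow_mul k h
    rwa [← mul_assoc, ← mul_assoc, ← pow_succ] at this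
  exact ⟨fun h => aux q C.pos (C.rel_one_of_rel hi hiq hs ht h),
    fun h => aux i hi (C.rel_one_of_rel C.pos le_rfl hs ht h)⟩

theorem emb_lt (C : Cycle r q a κ) {s t : ℝ} (h : s < t) : emb q a κ s < emb q a κ t := by
  rw [C.emb_eq, C.emb_eq]
  have := mul_lt_mul_of_pos_left h (by linarith [C.kap_pos] : 0 < κ + 1 / 2)
  linarith

theorem emb_sub_le (C : Cycle r q a κ) {s t : ℝ} (h : s ≤ t) :
    emb q a κ t - emb q a κ s ≤ t - s := by
  rw [C.emb_eq, C.emb_eq]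
  nlinarith [C.kap_le]

/-- A class that meets the open long arc stays in it. -/
theorem stay_emb (C : Cycle r q a κ) {t : ℝ} (h0 : 0 < t) (h1 : t < 1) {y : UnitAddCircle}
    (h : r (emb q a κ t : ℝ) y) : ∃ t' : ℝ, 0 < t' ∧ t' < 1 ∧ y = (emb q a κ t' : ℝ) := by
  rw [← C.coe_arc] at h
  obtain ⟨t', a0, a1, e⟩ := C.stay q C.pos le_rfl t h0 h1 y h
  exact ⟨t', a0, a1, by rw [e, C.coe_arc]⟩

/-- The branches of the return map are inverted by passing to the first arc, which carries the same
relation as the long arc by `Cycle.rel_arc_iff`, and taking a single preimage under doubling there.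
-/
theorem ren (C : Cycle r q a κ) : Ren (2 ^ q) (halfTurn q) (Cycle.rel r q a κ) where
  two_le := C.two_le
  mul_delta := mul_delta q
  equiv := ⟨fun _ => r.refl' _, fun h => r.symm' h, fun h h' => r.trans' h h'⟩
  closed := by
    have hc : Continuous fun p : ℝ × ℝ => (emb q a κ p.1, emb q a κ p.2) := by
      unfold emb; fun_prop
    exact C.inv.isClosed_lift.preimage hc
  linked := by
    intro s t s' t' h0 h1 h2 h3 h4 hs ht
    -- For `q = 1` the ends of the arc are the same point of the circle, so the full width is
    -- treated apart from genuinely linked pairs.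
    by_cases hst : s = 0 ∧ t' = 1
    · exfalso
      obtain ⟨rfl, rfl⟩ := hst
      obtain ⟨z, z0, z1, hz⟩ := C.stay_emb (by linarith : 0 < s') h3 (r.symm' hs)
      have e1 := C.emb_lt z0
      have e2 := C.emb_sub_le z0.le
      exact coe_ne_of_lt e1 (by linarith) hz
    · have hlt : t' - s < 1 := by
        by_contra hcon
        exact hst ⟨by linarith, by linarith⟩
      have := C.emb_sub_le (show s ≤ t' by linarith)
      exact C.inv.trans_of_linked (C.emb_lt h1) (C.emb_lt h2) (C.emb_lt h3) (by linarith) hs ht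
  finite := by
    intro x
    have hfin := C.inv.finite_cls (emb q a κ x : ℝ)
    have hco : ∀ y : UnitAddCircle,
        {t | t ∈ Icc (0 : ℝ) 1 ∧ ((emb q a κ t : ℝ) : UnitAddCircle) = y}.Finite := by
      intro y
      have hsub : {t | t ∈ Ico (0 : ℝ) 1 ∧ ((emb q a κ t : ℝ) : UnitAddCircle) = y}.Subsingleton := by
        rintro s ⟨hs, hs'⟩ t ⟨ht, ht'⟩
        have key : ∀ s t : ℝ, s ∈ Ico (0 : ℝ) 1 → t ∈ Ico (0 : ℝ) 1 →
            ((emb q a κ s : ℝ) : UnitAddCircle) = (emb q a κ t : ℝ) → ¬ s < t := by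
          intro s t hs ht h hlt
          have := C.emb_sub_le hlt.le
          exact coe_ne_of_lt (C.emb_lt hlt) (by linarith [hs.1, ht.2]) h
        rcases lt_trichotomy s t with h | h | h
        · exact absurd h (key s t hs ht (hs'.trans ht'.symm))
        · exact h
        · exact absurd h (key t s ht hs (ht'.trans hs'.symm))
      refine (hsub.finite.union (finite_singleton 1)).subset ?_
      rintro t ⟨ht, ht'⟩
      rcases ht.2.eq_or_lt with h | h
      · exact Or.inr h
      · exact Or.inl ⟨⟨ht.1, h⟩, ht'⟩
    refine (hfin.biUnion fun y _ => hco y).subset ?_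
    rintro t ⟨ht, h⟩
    exact mem_biUnion (show ((emb q a κ t : ℝ) : UnitAddCircle) ∈ cls r (emb q a κ x : ℝ) from h)
      ⟨ht, rfl⟩
  zero_one := by
    have := C.rel_arc_of_endpoint C.pos (Or.inl rfl) (Or.inr rfl) (s := 0) (t := 1)
    rwa [C.coe_arc, C.coe_arc] at this
  boundary := by
    intro t h0 h1 h
    obtain ⟨z, z0, z1, hz⟩ := C.stay_emb h0 h1 (r.symm' h)
    have e1 := C.emb_lt z0
    have e2 := C.emb_sub_le z0.le
    exact coe_ne_of_lt e1 (by linarith) hz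
  mul := by
    intro x y h
    have := C.inv.rel_two_pow_mul q h
    unfold Cycle.rel
    rwa [C.emb_mul, C.emb_mul]
  shift := fun x => by
    unfold Cycle.rel
    rw [C.emb_add_shift]
  add := by
    intro x y h
    unfold Cycle.rel
    rw [C.emb_add_delta, C.emb_add_delta]
    exact C.inv.rel_add_half h
  add_twice := by
    intro x
    unfold Cycle.rel
    rw [show x + 2 * halfTurn q = x + halfTurn q + halfTurn q by ring, C.emb_add_delta,
      C.emb_add_delta, add_assoc, show (1 / 2 + 1 / 2 : ℝ) = 1 by norm_num, coe_add_one]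
  pull := by
    intro x y hx hy h
    have hmem : ∀ x ∈ Icc 0 (1 - halfTurn q), 2 ^ q * x ∈ Icc (0 : ℝ) 1 := by
      intro x hx
      refine ⟨mul_nonneg (by positivity) hx.1, ?_⟩
      rw [← mul_one_sub q]
      exact mul_le_mul_of_nonneg_left hx.2 (by positivity)
    have h1 := (C.rel_arc_iff le_rfl C.pos (hmem x hx) (hmem y hy)).2 h
    rw [pow_one] at h1
    unfold Cycle.rel
    rw [C.emb_add_delta]
    exact C.inv.rel_or_rel_of_two_mul h1
  aperiodic := by
    intro x h k hk h'
    unfold Cycle.rel at h h'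
    rw [C.emb_add_delta] at h
    have e : ∀ k : ℕ, ((emb q a κ ((2 ^ q) ^ k * x) : ℝ) : UnitAddCircle) =
        (2 ^ (q * k) * emb q a κ x : ℝ) := by
      intro k
      induction k with
      | zero => simp
      | succ k ih =>
        have e1 : (2 ^ q) ^ (k + 1) * x = 2 ^ q * ((2 ^ q) ^ k * x) := by ring
        rw [e1, C.emb_mul, ← sigma_iterate_coe, ih, sigma_iterate_coe]
        congr 1
        ring
    rw [e] at h'
    exact C.inv.not_rel_iterate_of_rel_add_half h (Nat.mul_pos C.pos hk) h'

end Cycle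

/-! ### Sets placed in the arcs: holes, gaps and periodicity -/

theorem disjoint_interior_hull {s t : UnitAddCircle} (hst : s ≠ t) {A B : Set UnitAddCircle}
    (hA : ∀ p ∈ A, p ∉ cIoo t s) (hB : ∀ p ∈ B, p ∉ cIoo s t) :
    Disjoint (interior (hull A)) (interior (hull B)) := by
  rw [Set.disjoint_left]
  intro z hzA hzB
  have hne : pt s ≠ pt t := fun e => hst (pt_injective e)
  have h1 : 0 < area (pt t) (pt s) z := area_pos_of_mem_interior hne.symm
    (fun w hw => area_nonneg_of_mem_hull
      (fun p hp => area_pt_nonneg_of_notMem hst.symm (hA p hp)) hw) hzA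
  have h2 : 0 < area (pt s) (pt t) z := area_pos_of_mem_interior hne
    (fun w hw => area_nonneg_of_mem_hull
      (fun p hp => area_pt_nonneg_of_notMem hst (hB p hp)) hw) hzB
  rw [area_swap] at h1
  linarith

theorem exists_lift_of_mem_cIcc {s t : ℝ} (h1 : s < t) (h2 : t < s + 1) {x : UnitAddCircle}
    (hx : x ∈ cIcc (s : UnitAddCircle) (t : UnitAddCircle)) :
    ∃ z : ℝ, s ≤ z ∧ z ≤ t ∧ (z : UnitAddCircle) = x := by
  obtain ⟨z, hz1, hz2, rfl⟩ := exists_lift x s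
  refine ⟨z, hz1, ?_, rfl⟩
  by_contra hcon
  have : (z : UnitAddCircle) ∈ (cIcc (s : UnitAddCircle) (t : UnitAddCircle))ᶜ := by
    rw [Set.compl_cIcc]
    exact (mem_cIoo_coe_swap h1 h2 _).2 ⟨z, not_le.1 hcon, hz2, rfl⟩
  exact this hx

/-- The holes of an affinely embedded subset of an interval. -/
theorem isHole_affine_iff {S : Set ℝ} {u v b c : ℝ} (hS : S ⊆ Icc u v) (hu : u ∈ S) (hv : v ∈ S)
    (huv : u < v) (hc : 0 < c) (hlen : c * (v - u) < 1) {α β : UnitAddCircle} :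
    IsHole ((fun t : ℝ => ((b + c * t : ℝ) : UnitAddCircle)) '' S) α β ↔
      (∃ s ∈ S, ∃ t ∈ S, s < t ∧ (∀ z ∈ S, z ≤ s ∨ t ≤ z) ∧ α = (b + c * s : ℝ) ∧
        β = (b + c * t : ℝ)) ∨ (α = (b + c * v : ℝ) ∧ β = (b + c * u : ℝ)) := by
  have hmono : ∀ {s t : ℝ}, s < t → b + c * s < b + c * t := fun h => by
    linarith [mul_lt_mul_of_pos_left h hc]
  have hmono' : ∀ {s t : ℝ}, s ≤ t → b + c * s ≤ b + c * t := fun h => by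
    linarith [mul_le_mul_of_nonneg_left h hc.le]
  have hlt : ∀ {s t : ℝ}, s ∈ S → t ∈ S → b + c * t < b + c * s + 1 := fun hs ht => by
    have h1 := hmono' (hS ht).2
    have h2 := hmono' (hS hs).1
    linarith
  constructor
  · rintro h
    obtain ⟨s, hs, es⟩ := h.1
    obtain ⟨t, ht, et⟩ := h.2.1
    simp only at es et
    rcases lt_trichotomy s t with hst | hst | hst
    · left
      refine ⟨s, hs, t, ht, hst, ?_, es.symm, et.symm⟩
      rw [← es, ← et, isHole_coe_iff (hmono hst) (hlt hs ht)] at h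
      intro z hz
      by_contra hcon
      push Not at hcon
      exact h.2.2 _ (hmono hcon.1) (hmono hcon.2) ⟨z, hz, rfl⟩
    · exact absurd (by rw [← es, ← et, hst]) h.2.2.1
    · right
      rw [← es, ← et, ← coe_add_one (b + c * t),
        isHole_coe_iff (hlt ht hs) (by linarith [hmono hst])] at h
      have e1 : s = v := by
        by_contra hne
        exact h.2.2 _ (hmono (lt_of_le_of_ne (hS hs).2 hne)) (hlt ht hv) ⟨v, hv, rfl⟩
      have e2 : t = u := by
        by_contra hne
        refine h.2.2 (b + c * u + 1) (hlt hu hs) ?_ ⟨u, hu, ?_⟩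
        · linarith [hmono (lt_of_le_of_ne (hS ht).1 (Ne.symm hne))]
        · exact (coe_add_one _).symm
      rw [← es, ← et, e1, e2]
      exact ⟨rfl, rfl⟩
  · rintro (⟨s, hs, t, ht, hst, hno, rfl, rfl⟩ | ⟨rfl, rfl⟩)
    · rw [isHole_coe_iff (hmono hst) (hlt hs ht)]
      refine ⟨⟨s, hs, rfl⟩, ⟨t, ht, rfl⟩, ?_⟩
      rintro z hz1 hz2 ⟨w, hw, ew⟩
      simp only at ew
      rcases hno w hw with h | h
      · have h1 := hmono' h
        have h2 := hlt hw ht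
        exact coe_ne_of_lt (show b + c * w < z by linarith) (by linarith) ew
      · have h1 := hmono' h
        have h2 := hlt hs hw
        exact coe_ne_of_lt (show z < b + c * w by linarith) (by linarith) ew.symm
    · rw [← coe_add_one (b + c * u), isHole_coe_iff (hlt hu hv) (by linarith [hmono huv])]
      refine ⟨⟨v, hv, rfl⟩, ⟨u, hu, (coe_add_one _).symm⟩, ?_⟩
      rintro z hz1 hz2 ⟨w, hw, ew⟩
      simp only at ew
      have h1 := hmono' (hS hw).2
      have h2 := hmono' (hS hw).1
      exact coe_ne_of_lt (show b + c * w < z by linarith) (by linarith) ew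

theorem isClosed_affine_image {S : Set ℝ} (hS : IsCompact S) (b c : ℝ) :
    IsClosed ((fun t : ℝ => ((b + c * t : ℝ) : UnitAddCircle)) '' S) :=
  (hS.image (continuous_coe_circle.comp (by fun_prop))).isClosed

/-- Three points of a set in cyclic order, unless it has only two points. -/
theorem exists_three_lifts {B : Set UnitAddCircle} {a b c : UnitAddCircle} (ha : a ∈ B)
    (hb : b ∈ B) (hc : c ∈ B) (hab : a ≠ b) (hac : a ≠ c) (hbc : b ≠ c) :
    ∃ x y z : ℝ, x < y ∧ y < z ∧ z < x + 1 ∧ (x : UnitAddCircle) ∈ B ∧ (y : UnitAddCircle) ∈ B ∧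
      (z : UnitAddCircle) ∈ B := by
  obtain ⟨x, -, -, rfl⟩ := exists_lift a 0
  obtain ⟨y, hy1, hy2, rfl⟩ := exists_lift_of_ne (Ne.symm hab)
  obtain ⟨z, hz1, hz2, rfl⟩ := exists_lift_of_ne (Ne.symm hac)
  rcases lt_trichotomy y z with h | h | h
  · exact ⟨x, y, z, hy1, h, hz2, ha, hb, hc⟩
  · exact absurd (by rw [h]) hbc
  · exact ⟨x, z, y, hz1, h, hy2, ha, hc, hb⟩

/-- A finite class with more than one point is a gap or a leaf. -/
theorem isGapOrLeaf_cls {r : Setoid UnitAddCircle} (hr : IsLamination r) {x : UnitAddCircle}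
    (hfin : (cls r x).Finite) (hnt : (cls r x).Nontrivial) : IsGapOrLeaf r (cls r x) := by
  obtain ⟨a, ha, b, hb, hab⟩ := hnt
  have hcls : ∀ y ∈ cls r x, cls r x = cls r y := fun y hy => cls_eq_of_rel hy
  by_cases h3 : ∃ c ∈ cls r x, a ≠ c ∧ b ≠ c
  · left
    obtain ⟨c, hc, hac, hbc⟩ := h3
    obtain ⟨p, q, w, h1, h2, h3, hp, hq, hw⟩ := exists_three_lifts ha hb hc hab hac hbc
    refine isGapBasis_of_leaves hfin.isClosed h1 h2 h3 hp hq hw ?_ ?_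
    · intro c d h
      right
      have e := hcls c h.1
      refine ⟨?_, Or.inl ?_⟩
      · have := h.2.1; rw [e] at this; exact this
      · rw [e] at h; exact h
    · rintro c d hcd (h | ⟨h, hedge⟩) hcr
      · exact hcd h
      obtain ⟨s, -, -, rfl⟩ := exists_lift c 0
      obtain ⟨t, ht1, ht2, rfl⟩ := exists_lift_of_ne (Ne.symm hcd)
      rw [crosses_coe_iff ht1 ht2] at hcr
      obtain ⟨⟨z, hz1, hz2, hz⟩, w, hw1, hw2, hw⟩ := hcr
      have hzw : r (z : UnitAddCircle) (w : UnitAddCircle) := r.trans' (r.symm' hz) hw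
      have hsz := hr.trans_of_linked hz1 hz2 hw1 hw2 h hzw
      rcases hedge with he | he
      · rw [isHole_coe_iff ht1 ht2] at he
        exact he.2.2 z hz1 hz2 hsz
      · rw [← coe_add_one s, isHole_coe_iff (by linarith) (by linarith)] at he
        refine he.2.2 w hw1 hw2 ?_
        have := r.trans' hsz hzw
        rw [coe_add_one]
        exact this
  · right
    push Not at h3
    refine ⟨a, b, hab, Or.inr ⟨?_, Or.inl ?_⟩, ?_⟩
    · exact r.trans' (r.symm' ha) hb
    · have e : {y | r a y} = cls r x := (hcls a ha).symm
      rw [e]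
      obtain ⟨s, -, -, rfl⟩ := exists_lift a 0
      obtain ⟨t, ht1, ht2, rfl⟩ := exists_lift_of_ne (Ne.symm hab)
      rw [isHole_coe_iff ht1 ht2]
      refine ⟨ha, hb, fun z hz1 hz2 hz => ?_⟩
      have h1 : (s : UnitAddCircle) ≠ z := coe_ne_of_lt hz1 (by linarith)
      exact coe_ne_of_lt hz2 (by linarith) (h3 z hz h1).symm
    · ext c
      constructor
      · intro hc
        by_cases h : a = c
        · exact Or.inl h.symm
        · exact Or.inr (h3 c hc h).symm
      · rintro (rfl | rfl)
        · exact ha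
        · exact hb

namespace Cycle

variable {r : Setoid UnitAddCircle} {q : ℕ} {a κ : ℝ}

/-- A subset of the interval `[0, 1]` placed into the `i`-th arc of the cycle. -/
def place (i : ℕ) (a κ : ℝ) (S : Set ℝ) : Set UnitAddCircle :=
  (fun t : ℝ => ((2 ^ i * a + 2 ^ i * κ * t : ℝ) : UnitAddCircle)) '' S

theorem width_pos (C : Cycle r q a κ) (i : ℕ) : 0 < 2 ^ i * κ := by
  have := C.kap_pos
  positivity

theorem width_le (C : Cycle r q a κ) {i : ℕ} (hi : i ≤ q) : 2 ^ i * κ ≤ κ + 1 / 2 := by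
  rw [← C.mul_kap]
  exact mul_le_mul_of_nonneg_right (pow_le_pow_right₀ (by norm_num) hi) C.kap_pos.le

theorem arc_eq (i : ℕ) (a κ t : ℝ) : 2 ^ i * (a + κ * t) = 2 ^ i * a + 2 ^ i * κ * t := by ring

theorem place_eq_emb (C : Cycle r q a κ) (S : Set ℝ) :
    place q a κ S = (fun t : ℝ => ((emb q a κ t : ℝ) : UnitAddCircle)) '' S := by
  unfold place
  congr 1
  ext t
  rw [← C.coe_arc, arc_eq]

theorem image_place (i j : ℕ) (a κ : ℝ) (S : Set ℝ) :
    (sigma 2)^[j] '' place i a κ S = place (i + j) a κ S := by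
  unfold place
  rw [image_image]
  congr 1
  ext t
  rw [sigma_iterate_coe]
  congr 1
  ring

theorem isClosed_place (i : ℕ) (a κ : ℝ) {S : Set ℝ} (hS : IsCompact S) :
    IsClosed (place i a κ S) := isClosed_affine_image hS _ _

/-- An open arc of the cycle is disjoint from the other closed arcs. -/
theorem arc_ne (C : Cycle r q a κ) {i j : ℕ} (hi : 1 ≤ i) (hiq : i ≤ q) (hj : 1 ≤ j) (hjq : j ≤ q)
    (hij : i ≠ j) {t t' : ℝ} (h0 : 0 < t) (h1 : t < 1) (ht' : t' ∈ Icc (0 : ℝ) 1) :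
    ((2 ^ i * a + 2 ^ i * κ * t : ℝ) : UnitAddCircle) ≠ (2 ^ j * a + 2 ^ j * κ * t' : ℝ) := by
  have hdis : ∀ t t' : ℝ, 0 < t → t < 1 → 0 < t' → t' < 1 →
      ((2 ^ i * a + 2 ^ i * κ * t : ℝ) : UnitAddCircle) ≠ (2 ^ j * a + 2 ^ j * κ * t' : ℝ) := by
    intro t t' a0 a1 b0 b1
    rcases lt_or_gt_of_ne hij with h | h
    · have := C.disj i j hi h hjq t t' a0 a1 b0 b1
      rwa [arc_eq, arc_eq] at this
    · have := C.disj j i hj h hiq t' t b0 b1 a0 a1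
      rw [arc_eq, arc_eq] at this
      exact this.symm
  intro h
  rw [coe_eq_iff] at h
  obtain ⟨n, hn⟩ := h
  have hwi := C.width_pos i
  have hwj := C.width_pos j
  set ρ := (2 ^ j * κ) / (2 ^ i * κ) with hρ
  have hρpos : 0 < ρ := div_pos hwj hwi
  have hρ' : 2 ^ i * κ * ρ = 2 ^ j * κ := by rw [hρ]; field_simp
  have key : ∀ η : ℝ, 0 < t + ρ * η → t + ρ * η < 1 → 0 < t' + η → t' + η < 1 → False := by
    intro η a0 a1 b0 b1
    apply hdis _ _ a0 a1 b0 b1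
    rw [coe_eq_iff]
    exact ⟨n, by linear_combination hn - η * hρ'⟩
  set m := min t (1 - t) with hm
  have hmpos : 0 < m := lt_min h0 (by linarith)
  have hm1 : m ≤ t := min_le_left _ _
  have hm2 : m ≤ 1 - t := min_le_right _ _
  set η := min (m / (2 * ρ)) (1 / 2) with hη
  have hηpos : 0 < η := lt_min (by positivity) (by norm_num)
  have hη1 : ρ * η ≤ m / 2 := by
    calc ρ * η ≤ ρ * (m / (2 * ρ)) := mul_le_mul_of_nonneg_left (min_le_left _ _) hρpos.le
      _ = m / 2 := by field_simp
  have hη2 : η ≤ 1 / 2 := min_le_right _ _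
  have hη0 : 0 < ρ * η := mul_pos hρpos hηpos
  rcases le_total t' (1 / 2) with h | h
  · rcases h.eq_or_lt with e | e
    · exact key 0 (by simpa using h0) (by simpa using h1) (by linarith) (by linarith)
    · exact key η (by linarith) (by linarith) (by linarith [ht'.1]) (by linarith)
  · rcases h.eq_or_lt with e | e
    · exact key 0 (by simpa using h0) (by simpa using h1) (by linarith) (by linarith)
    · exact key (-η) (by linarith) (by linarith) (by linarith) (by linarith [ht'.2])

theorem disjoint_hulls (C : Cycle r q a κ) {i j : ℕ} (hi : 1 ≤ i) (hj : 1 ≤ j)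
    (hjq : j ≤ q) (hij : i ≠ j) (hiq : i < q) {S S' : Set ℝ} (hS : S ⊆ Icc 0 1)
    (hS' : S' ⊆ Icc 0 1) :
    Disjoint (interior (hull (place i a κ S))) (interior (hull (place j a κ S'))) := by
  have hw := C.width_pos i
  have hw1 := C.kap_lt_of_lt hiq hi
  have h1 : 2 ^ i * a + 2 ^ i * κ * 0 < 2 ^ i * a + 2 ^ i * κ * 1 := by linarith
  have h2 : 2 ^ i * a + 2 ^ i * κ * 1 < 2 ^ i * a + 2 ^ i * κ * 0 + 1 := by linarith
  refine disjoint_interior_hull (coe_ne_of_lt h1 h2) ?_ ?_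
  · rintro _ ⟨t, ht, rfl⟩ hp
    obtain ⟨z, hz1, hz2, hz⟩ := (mem_cIoo_coe_swap h1 h2 _).1 hp
    have b1 := mul_le_mul_of_nonneg_left (hS ht).1 hw.le
    have b2 := mul_le_mul_of_nonneg_left (hS ht).2 hw.le
    exact coe_ne_of_lt (show 2 ^ i * a + 2 ^ i * κ * t < z by linarith) (by linarith) hz.symm
  · rintro _ ⟨t, ht, rfl⟩ hp
    obtain ⟨z, hz1, hz2, hz⟩ := (sbtw_coe_iff h1 h2 _).1 hp
    set w := (z - 2 ^ i * a) / (2 ^ i * κ) with hwdef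
    have hzw : z = 2 ^ i * a + 2 ^ i * κ * w := by
      rw [hwdef, mul_div_assoc', mul_div_cancel_left₀ _ hw.ne']; ring
    have w0 : 0 < w := div_pos (by linarith) hw
    have w1 : w < 1 := by rw [hwdef, div_lt_one hw]; linarith
    rw [hzw] at hz
    exact C.arc_ne hi hiq.le hj hjq hij w0 w1 (hS' ht) hz

/-- One point in the open long arc separates the set from its intermediate images, because open arcs
of the cycle miss the other closed arcs; this gives the minimality of the period. -/
theorem isPeriodicLaminational (C : Cycle r q a κ) {A : Set UnitAddCircle} (hA : IsClosed A)
    (hq : (sigma 2)^[q] '' A = A)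
    (hsub : ∀ i, 1 ≤ i → i ≤ q → ∃ S ⊆ Icc (0 : ℝ) 1, (sigma 2)^[i] '' A = place i a κ S)
    (hopen : ∃ t : ℝ, 0 < t ∧ t < 1 ∧ ((emb q a κ t : ℝ) : UnitAddCircle) ∈ A)
    (hholes : ∀ i, i < q → ∀ α β, IsHole ((sigma 2)^[i] '' A) α β →
      sigma 2 α = sigma 2 β ∨ IsHole ((sigma 2)^[i + 1] '' A) (sigma 2 α) (sigma 2 β)) :
    IsPeriodicLaminational 2 q A := by
  refine ⟨?_, hA, C.pos, hq, ?_, ?_, ?_⟩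
  · obtain ⟨t, -, -, ht⟩ := hopen
    exact ⟨_, ht⟩
  · intro m hm hmq h
    obtain ⟨t, h0, h1, ht⟩ := hopen
    obtain ⟨S, hS, e⟩ := hsub m hm hmq.le
    rw [← h, e] at ht
    obtain ⟨t', ht', e'⟩ := ht
    simp only at e'
    rw [← C.coe_arc, arc_eq] at e'
    exact C.arc_ne C.pos le_rfl hm hmq.le (by omega) h0 h1 (hS ht') e'.symm
  · intro i j hij hjq
    obtain ⟨S, hS, e⟩ := hsub j (by omega) hjq.le
    rw [e]
    rcases Nat.eq_zero_or_pos i with rfl | hi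
    · obtain ⟨S', hS', e'⟩ := hsub q C.pos le_rfl
      rw [Function.iterate_zero, image_id, ← hq, e']
      exact (C.disjoint_hulls (by omega) C.pos le_rfl (by omega) hjq hS hS').symm
    · obtain ⟨S', hS', e'⟩ := hsub i hi (by omega)
      rw [e']
      exact C.disjoint_hulls hi (by omega) hjq.le (by omega) (by omega) hS' hS
  · have hmul : ∀ k, (sigma 2)^[q * k] '' A = A := by
      intro k
      induction k with
      | zero => simp
      | succ k ih => rw [Nat.mul_succ, Function.iterate_add, image_comp, hq, ih]
    have hmod : ∀ i, (sigma 2)^[i] '' A = (sigma 2)^[i % q] '' A := by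
      intro i
      conv_lhs => rw [← Nat.mod_add_div i q, Function.iterate_add, image_comp, hmul]
    have hsucc : ∀ i, (sigma 2)^[i + 1] '' A = sigma 2 '' ((sigma 2)^[i] '' A) := by
      intro i
      rw [Function.iterate_succ', image_comp]
    intro i α β h
    rw [hmod] at h
    have := hholes (i % q) (Nat.mod_lt _ C.pos) α β h
    rwa [hsucc, ← hmod, ← hsucc] at this

/-- Equivalent points do not cross a set in an arc of the cycle if they do not in its
coordinate. -/
theorem not_crosses_place (C : Cycle r q a κ) {i : ℕ} (hi : 1 ≤ i) (hiq : i ≤ q) {S : Set ℝ}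
    (hS : S ⊆ Icc 0 1)
    (hnc : ∀ x y, 0 ≤ x → x < y → y ≤ 1 → Cycle.rel r q a κ x y → ∀ s ∈ S, x < s → s < y →
      ∀ t ∈ S, x ≤ t ∧ t ≤ y) {α β : UnitAddCircle} (hne : α ≠ β) (h : r α β) :
    ¬ Crosses (place i a κ S) α β := by
  have hw := C.width_pos i
  have hw1 : 2 ^ i * κ ≤ 1 := by linarith [C.width_le hiq, C.kap_le]
  set e : ℝ → ℝ := fun t => 2 ^ i * a + 2 ^ i * κ * t with he
  have hmono : ∀ {s t : ℝ}, s < t → e s < e t := fun h => by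
    have := mul_lt_mul_of_pos_left h hw
    simp only [he]; linarith
  have hmono' : ∀ {s t : ℝ}, s ≤ t → e s ≤ e t := fun h => by
    have := mul_le_mul_of_nonneg_left h hw.le
    simp only [he]; linarith
  have hinv : ∀ z : ℝ, ∃ w, z = e w := fun z =>
    ⟨(z - 2 ^ i * a) / (2 ^ i * κ), by
      simp only [he]; rw [mul_div_assoc', mul_div_cancel_left₀ _ hw.ne']; ring⟩
  have he1 : e 1 ≤ e 0 + 1 := by simp only [he]; linarith
  -- Pairs inside the open arc are compared in its coordinate. By `Cycle.stay` every other pair has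
  -- both ends outside of the open arc, and such a pair cannot separate points of the arc.
  have core : ∀ s t : ℝ, 0 < s → t < 1 → s < t → r (e s : ℝ) (e t : ℝ) →
      ¬ Crosses (place i a κ S) (e s : ℝ) (e t : ℝ) := by
    intro s t h0 h1 hst hr hcr
    have hlt : e t < e s + 1 := by linarith [hmono h0, hmono h1]
    rw [crosses_coe_iff (hmono hst) hlt] at hcr
    obtain ⟨⟨z, hz1, hz2, x, hx, hxz⟩, z', hz1', hz2', y, hy, hyz⟩ := hcr
    simp only at hxz hyz
    change ((e x : ℝ) : UnitAddCircle) = _ at hxz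
    change ((e y : ℝ) : UnitAddCircle) = _ at hyz
    have hrel : Cycle.rel r q a κ s t := by
      rw [← C.rel_arc_iff hi hiq ⟨h0.le, by linarith⟩ ⟨by linarith, h1.le⟩, arc_eq, arc_eq]
      exact hr
    have x0 := hmono' (hS hx).1
    have x1 := hmono' (hS hx).2
    have exz : e x = z := coe_inj_of_lt hxz (by linarith [hmono h0]) (by linarith [hmono h1])
    have sx : s < x := by
      by_contra hcon
      linarith [hmono' (not_lt.1 hcon)]
    have xt : x < t := by
      by_contra hcon
      linarith [hmono' (not_lt.1 hcon)]
    obtain ⟨y1, y2⟩ := hnc s t h0.le hst h1.le hrel x hx sx xt y hy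
    have := hmono' y1
    have := hmono' y2
    exact coe_ne_of_lt (show e y < z' by linarith) (by linarith) hyz
  have core' : ∀ s t : ℝ, 0 < s → s < 1 → 0 < t → t < 1 → (e s : UnitAddCircle) ≠ (e t : ℝ) →
      r (e s : ℝ) (e t : ℝ) → ¬ Crosses (place i a κ S) (e s : ℝ) (e t : ℝ) := by
    intro s t s0 s1 t0 t1 hne hr
    rcases lt_trichotomy s t with h | h | h
    · exact core s t s0 t1 h hr
    · exact absurd (by rw [h]) hne
    · exact fun hcr => core t s t0 s1 h (r.symm' hr) hcr.symm
  have hstay : ∀ t : ℝ, 0 < t → t < 1 → ∀ y : UnitAddCircle, r (e t : ℝ) y →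
      ∃ t' : ℝ, 0 < t' ∧ t' < 1 ∧ y = (e t' : ℝ) := by
    intro t h0 h1 y hy
    obtain ⟨t', a0, a1, ey⟩ := C.stay i hi hiq t h0 h1 y (by rw [arc_eq]; exact hy)
    rw [arc_eq] at ey
    exact ⟨t', a0, a1, ey⟩
  by_cases hα : ∃ s : ℝ, 0 < s ∧ s < 1 ∧ α = (e s : ℝ)
  · obtain ⟨s, s0, s1, rfl⟩ := hα
    obtain ⟨t, t0, t1, rfl⟩ := hstay s s0 s1 β h
    exact core' s t s0 s1 t0 t1 hne h
  by_cases hβ : ∃ s : ℝ, 0 < s ∧ s < 1 ∧ β = (e s : ℝ)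
  · obtain ⟨s, s0, s1, rfl⟩ := hβ
    obtain ⟨t, t0, t1, rfl⟩ := hstay s s0 s1 α (r.symm' h)
    exact core' t s t0 t1 s0 s1 hne h
  have hlift : ∀ γ : UnitAddCircle, (¬ ∃ s : ℝ, 0 < s ∧ s < 1 ∧ γ = (e s : ℝ)) →
      ∃ z : ℝ, e 1 ≤ z ∧ z ≤ e 0 + 1 ∧ (z : UnitAddCircle) = γ := by
    intro γ hγ
    obtain ⟨z, hz1, hz2, hz⟩ := exists_lift γ (e 0)
    rcases hz1.eq_or_lt with h | h
    · exact ⟨e 0 + 1, he1, le_rfl, by rw [coe_add_one, h, hz]⟩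
    · refine ⟨z, ?_, hz2.le, hz⟩
      by_contra hcon
      obtain ⟨w, rfl⟩ := hinv z
      apply hγ
      refine ⟨w, ?_, ?_, hz.symm⟩
      · by_contra hw
        linarith [hmono' (not_lt.1 hw)]
      · by_contra hw
        linarith [hmono' (not_lt.1 hw)]
  have outer : ∀ z z' : ℝ, e 1 ≤ z → z < z' → z' ≤ e 0 + 1 →
      ¬ Crosses (place i a κ S) (z : UnitAddCircle) (z' : UnitAddCircle) := by
    intro z z' h1 h2 h3 hcr
    rw [crosses_coe_iff h2 (by linarith [hmono zero_lt_one])] at hcr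
    obtain ⟨⟨w, hw1, hw2, x, hx, hxw⟩, -⟩ := hcr
    simp only at hxw
    change ((e x : ℝ) : UnitAddCircle) = _ at hxw
    have x0 := hmono' (hS hx).1
    have x1 := hmono' (hS hx).2
    exact coe_ne_of_lt (show e x < w by linarith) (by linarith) hxw
  obtain ⟨z, z1, z2, rfl⟩ := hlift α hα
  obtain ⟨z', z1', z2', rfl⟩ := hlift β hβ
  rcases lt_trichotomy z z' with h | h | h
  · exact outer z z' z1 h z2'
  · exact absurd (by rw [h]) hne
  · exact fun hcr => outer z' z z1' h z2 hcr.symm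

/-- A gap in an arc of the cycle. -/
theorem isGapBasis_place (C : Cycle r q a κ) {i : ℕ} (hi : 1 ≤ i) (hiq : i ≤ q) {S : Set ℝ}
    (hcpt : IsCompact S) {u v w : ℝ} (hS : S ⊆ Icc u v) (hu0 : 0 ≤ u) (hv1 : v ≤ 1) (hu : u ∈ S)
    (hv : v ∈ S) (hw : w ∈ S) (huw : u < w) (hwv : w < v) (hlen : 2 ^ i * κ * (v - u) < 1)
    (huvR : Cycle.rel r q a κ u v)
    (hhole : ∀ s ∈ S, ∀ t ∈ S, s < t → (∀ z ∈ S, z ≤ s ∨ t ≤ z) → Cycle.rel r q a κ s t)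
    (hnc : ∀ x y, 0 ≤ x → x < y → y ≤ 1 → Cycle.rel r q a κ x y → ∀ s ∈ S, x < s → s < y →
      ∀ t ∈ S, x ≤ t ∧ t ≤ y) : IsGapBasis r (place i a κ S) := by
  have hw0 := C.width_pos i
  have hS' : S ⊆ Icc 0 1 := fun t ht => ⟨by linarith [(hS ht).1], by linarith [(hS ht).2]⟩
  have m1 := mul_lt_mul_of_pos_left huw hw0
  have m2 := mul_lt_mul_of_pos_left hwv hw0
  refine isGapBasis_of_rel (isClosed_place i a κ hcpt)
    (x := 2 ^ i * a + 2 ^ i * κ * u) (y := 2 ^ i * a + 2 ^ i * κ * w)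
    (z := 2 ^ i * a + 2 ^ i * κ * v) (by linarith) (by linarith) (by linarith)
    ⟨u, hu, rfl⟩ ⟨w, hw, rfl⟩ ⟨v, hv, rfl⟩ ?_ ?_
  · intro α β h
    rcases (isHole_affine_iff hS hu hv (by linarith) hw0 hlen).1 h with
      ⟨s, hs, t, ht, hst, hno, rfl, rfl⟩ | ⟨rfl, rfl⟩
    · rw [← arc_eq, ← arc_eq, C.rel_arc_iff hi hiq (hS' hs) (hS' ht)]
      exact hhole s hs t ht hst hno
    · rw [← arc_eq, ← arc_eq, C.rel_arc_iff hi hiq (hS' hv) (hS' hu)]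
      exact C.ren.symm huvR
  · exact fun α β hne h => C.not_crosses_place hi hiq hS' hnc hne h

end Cycle

/-! ### Rotational sets in the long arc: fixed classes and Siegel gaps -/

theorem exists_circle_map (f : CircleDeg1Lift) :
    ∃ ψ : UnitAddCircle → UnitAddCircle, ∀ x : ℝ, ψ x = (f x : ℝ) := by
  choose z hz1 hz2 hz using fun x : UnitAddCircle => exists_lift x 0
  refine ⟨fun x => (f (z x) : ℝ), fun x => ?_⟩
  obtain ⟨n, hn⟩ := coe_eq_iff.1 (hz x)
  dsimp only
  rw [coe_eq_iff]
  refine ⟨n, ?_⟩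
  conv_lhs => rw [hn]
  rw [CircleDeg1Lift.map_add_int]

namespace SemiModel

variable {N δ u τ : ℝ} {F Ψ : CircleDeg1Lift}

theorem isCompact_siegel (δ u : ℝ) (Ψ : CircleDeg1Lift) : IsCompact (siegel δ u Ψ) :=
  isCompact_Icc.inter_right (isClosed_supp Ψ)

/-- Neighbours stay neighbours because the return map is onto the set, increasing on each branch,
and the right branch has its image below that of the left one. -/
theorem consecutive_left (M : SemiModel N δ u τ F Ψ) {s t : ℝ} (hs : s ∈ siegel δ u Ψ)
    (hno : ∀ z ∈ siegel δ u Ψ, z ≤ s ∨ t ≤ z) :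
    ∀ z ∈ siegel δ u Ψ, z ≤ N * s ∨ N * t ≤ z := by
  have hN : 0 ≤ N := by linarith [M.two_le]
  intro z hz
  obtain ⟨w, hw, ⟨h1, rfl⟩ | ⟨h1, rfl⟩⟩ := M.siegel_surj hz
  · rcases hno w hw with h | h
    · exact Or.inl (mul_le_mul_of_nonneg_left h hN)
    · exact Or.inr (mul_le_mul_of_nonneg_left h hN)
  · exact Or.inl (mul_le_mul_of_nonneg_left (by linarith [hw.1.2, hs.1.1]) hN)

theorem consecutive_right (M : SemiModel N δ u τ F Ψ) {s t : ℝ} (ht : t ∈ siegel δ u Ψ)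
    (hno : ∀ z ∈ siegel δ u Ψ, z ≤ s ∨ t ≤ z) :
    ∀ z ∈ siegel δ u Ψ, z ≤ N * (s - δ) ∨ N * (t - δ) ≤ z := by
  have hN : 0 ≤ N := by linarith [M.two_le]
  intro z hz
  obtain ⟨w, hw, ⟨h1, rfl⟩ | ⟨h1, rfl⟩⟩ := M.siegel_surj hz
  · exact Or.inr (mul_le_mul_of_nonneg_left (by linarith [hw.1.1, ht.1.2]) hN)
  · rcases hno w hw with h | h
    · exact Or.inl (mul_le_mul_of_nonneg_left (by linarith) hN)
    · exact Or.inr (mul_le_mul_of_nonneg_left (by linarith) hN)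

theorem left_mem_siegel (M : SemiModel N δ u τ F Ψ) : u ∈ siegel δ u Ψ :=
  ⟨⟨le_rfl, by linarith [M.toModel.half_le]⟩, M.left_mem⟩

theorem right_mem_siegel (M : SemiModel N δ u τ F Ψ) : u + δ ∈ siegel δ u Ψ :=
  ⟨⟨by linarith [M.toModel.half_le], le_rfl⟩, M.right_mem⟩

/-- The hole that contains the middle is stretched over the complement: surjectivity forces its ends
to the extreme points of the set. -/
theorem consecutive_middle (M : SemiModel N δ u τ F Ψ) {s t : ℝ} (hs : s ∈ siegel δ u Ψ)
    (ht : t ∈ siegel δ u Ψ) (hno : ∀ z ∈ siegel δ u Ψ, z ≤ s ∨ t ≤ z) (h1 : 1 - δ < t)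
    (h2 : s < δ) : s ≤ 1 - δ ∧ δ ≤ t ∧ N * s = u + δ ∧ N * (t - δ) = u := by
  have hN : 0 ≤ N := by linarith [M.two_le]
  have hs1 : s ≤ 1 - δ := by
    rcases M.siegel_cases hs with h | h
    · exact h.2
    · linarith [h.1]
  have ht1 : δ ≤ t := by
    rcases M.siegel_cases ht with h | h
    · linarith [h.2]
    · exact h.1
  have hmul := M.mul_lt
  have hu : u < N * u := by nlinarith [M.pos, M.two_le]
  refine ⟨hs1, ht1, le_antisymm (M.mul_mem hs hs1).1.2 ?_, le_antisymm ?_ (M.mul_sub_mem ht ht1).1.1⟩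
  · obtain ⟨w, hw, ⟨h3, h4⟩ | ⟨h3, h4⟩⟩ := M.siegel_surj M.right_mem_siegel
    · rcases hno w hw with h | h
      · rw [← h4]; exact mul_le_mul_of_nonneg_left h hN
      · linarith
    · have := mul_le_mul_of_nonneg_left (show w - δ ≤ u by linarith [hw.1.2]) hN
      linarith
  · obtain ⟨w, hw, ⟨h3, h4⟩ | ⟨h3, h4⟩⟩ := M.siegel_surj M.left_mem_siegel
    · have := mul_le_mul_of_nonneg_left hw.1.1 hN
      linarith
    · rcases hno w hw with h | h
      · linarith
      · calc N * (t - δ) ≤ N * (w - δ) := mul_le_mul_of_nonneg_left (by linarith) hN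
          _ = u := h4

end SemiModel

namespace Cycle

variable {r : Setoid UnitAddCircle} {q : ℕ} {a κ : ℝ}

theorem arc_mul (i : ℕ) (t : ℝ) :
    ((2 ^ i * emb q a κ t : ℝ) : UnitAddCircle) = (2 ^ i * a + 2 ^ i * κ * (2 ^ q * t) : ℝ) := by
  rw [two_pow_mul_emb, arc_eq]

theorem arc_mul_sub' (C : Cycle r q a κ) {i : ℕ} (hi : 1 ≤ i) (t : ℝ) :
    ((2 ^ i * emb q a κ t : ℝ) : UnitAddCircle) =
      (2 ^ i * a + 2 ^ i * κ * (2 ^ q * (t - halfTurn q)) : ℝ) := by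
  rw [C.arc_mul_sub hi, arc_eq]

/-- An invariant class of the return map is a rotational gap or leaf. -/
theorem isRotationalSet_cls (C : Cycle r q a κ) {x : ℝ} (hx0 : 0 < x) (hx1 : x < 1 - halfTurn q)
    (hR : Cycle.rel r q a κ x (2 ^ q * x)) :
    IsRotationalSet 2 q (cls r (emb q a κ x : ℝ)) ∧
      IsGapOrLeaf r (cls r (emb q a κ x : ℝ)) ∧
      (sigma 2)^[q] '' cls r (emb q a κ x : ℝ) = cls r (emb q a κ x : ℝ) ∧
      ∀ p ∈ cls r (emb q a κ x : ℝ), ∃ t : ℝ, 0 < t ∧ t < 1 ∧ p = (emb q a κ t : ℝ) := by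
  have H := C.ren
  have hN := C.two_le
  have hδ := H.half_le
  have hδ1 := H.lt_one
  have hone := mul_one_sub q
  have hdel := mul_delta q
  set δ := halfTurn q
  set G := cls r (emb q a κ x : ℝ) with hG
  have hxN : x < 2 ^ q * x := by nlinarith
  have hxN1 : 2 ^ q * x < 1 := by rw [← hone]; exact mul_lt_mul_of_pos_left hx1 (by linarith)
  -- No point of the class lies in the middle, since the class would then contain the inner edge or
  -- be linked with it. So each point is governed by one of the two branches.
  have hpts : ∀ p ∈ G, ∃ t : ℝ, ((0 < t ∧ t < 1 - δ) ∨ (δ < t ∧ t < 1)) ∧ p = (emb q a κ t : ℝ) := by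
    intro p hp
    obtain ⟨t, h0, h1, rfl⟩ := C.stay_emb hx0 (by linarith) hp
    refine ⟨t, ?_, rfl⟩
    have hxt : Cycle.rel r q a κ x t := hp
    by_contra hcon
    have c1 : 1 - δ ≤ t := by by_contra h; exact hcon (Or.inl ⟨h0, not_le.1 h⟩)
    have c2 : t ≤ δ := by by_contra h; exact hcon (Or.inr ⟨not_le.1 h, h1⟩)
    have hrel : Cycle.rel r q a κ x (1 - δ) := by
      rcases c1.eq_or_lt with e | e
      · rw [e]; exact hxt
      rcases c2.eq_or_lt with e' | e'
      · rw [e'] at hxt; exact H.trans hxt (H.symm H.rel_inner)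
      · exact H.linked hx0.le hx1 e e' hδ1.le hxt H.rel_inner
    have := (SemiModel.mem_of_rel_inner H hx0.le (by linarith) (H.symm hrel)).1
    linarith
  have hmem : ∀ t : ℝ, 0 < t → t < 1 - δ → 2 ^ q * t ∈ Icc (0 : ℝ) 1 := fun t h0 h1 =>
    ⟨by positivity, by rw [← hone]; exact (mul_lt_mul_of_pos_left h1 (by linarith)).le⟩
  have hmem' : ∀ t : ℝ, δ < t → t < 1 → 2 ^ q * (t - δ) ∈ Icc (0 : ℝ) 1 := fun t h0 h1 =>
    hmem (t - δ) (by linarith) (by linarith)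
  have hq : (sigma 2)^[q] '' G = G := by
    rw [hG, C.inv.image_iterate_cls, sigma_iterate_coe, ← C.emb_mul]
    exact (cls_eq_of_rel hR).symm
  have hfin : G.Finite := C.inv.finite_cls _
  have hsucc : ∀ i, (sigma 2)^[i + 1] '' G = sigma 2 '' ((sigma 2)^[i] '' G) := by
    intro i
    rw [Function.iterate_succ', image_comp]
  refine ⟨⟨C.isPeriodicLaminational hfin.isClosed hq ?_ ⟨x, hx0, by linarith, r.refl' _⟩ ?_,
    Or.inl ⟨hfin, ?_⟩⟩, ?_, hq, ?_⟩
  · intro i hi hiq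
    refine ⟨{s | s ∈ Icc (0 : ℝ) 1 ∧
      ((2 ^ i * a + 2 ^ i * κ * s : ℝ) : UnitAddCircle) ∈ (sigma 2)^[i] '' G}, fun s hs => hs.1, ?_⟩
    ext p
    constructor
    · intro hp
      obtain ⟨p₀, hp₀, rfl⟩ := hp
      obtain ⟨t, ht, rfl⟩ := hpts p₀ hp₀
      rcases ht with ht | ht
      · have e := sigma_iterate_coe i (emb q a κ t)
        rw [arc_mul] at e
        exact ⟨2 ^ q * t, ⟨hmem t ht.1 ht.2, by rw [← e]; exact ⟨_, hp₀, rfl⟩⟩, e.symm⟩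
      · have e := sigma_iterate_coe i (emb q a κ t)
        rw [C.arc_mul_sub' hi] at e
        exact ⟨2 ^ q * (t - δ), ⟨hmem' t ht.1 ht.2, by rw [← e]; exact ⟨_, hp₀, rfl⟩⟩, e.symm⟩
    · rintro ⟨s, hs, rfl⟩
      exact hs.2
  · intro i _ α β h
    have hcl : (sigma 2)^[i] '' G ∈ r.classes := by
      rw [hG, C.inv.image_iterate_cls]; exact cls_mem_classes _ _
    rw [hsucc]
    exact C.inv.isHole_image hcl h
  -- The left branch strictly increases the coordinate and the right branch strictly decreases it,
  -- so no point is refixed.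
  · intro p hp
    obtain ⟨t, ht, rfl⟩ := hpts p hp
    rw [sigma_iterate_coe]
    rcases ht with ht | ht
    · rw [← C.emb_mul]
      have h1 : t < 2 ^ q * t := by nlinarith [ht.1]
      have h2 := C.emb_sub_le h1.le
      exact (coe_ne_of_lt (C.emb_lt h1) (by linarith [(hmem t ht.1 ht.2).2, ht.1])).symm
    · rw [C.arc_mul_sub C.pos, C.coe_arc]
      have h1 : 2 ^ q * (t - δ) < t := by nlinarith [ht.2]
      have h2 := C.emb_sub_le h1.le
      exact coe_ne_of_lt (C.emb_lt h1) (by linarith [(hmem' t ht.1 ht.2).1, ht.2])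
  · have h2 := C.emb_sub_le hxN.le
    exact isGapOrLeaf_cls C.inv.toIsLamination hfin ⟨_, r.refl' _, _, hR,
      coe_ne_of_lt (C.emb_lt hxN) (by linarith)⟩
  · intro p hp
    obtain ⟨t, ht, rfl⟩ := hpts p hp
    refine ⟨t, ?_, ?_, rfl⟩ <;> rcases ht with ht | ht <;> linarith [ht.1, ht.2]

variable {u τ : ℝ} {F Ψ : CircleDeg1Lift}

theorem image_siegel (C : Cycle r q a κ) (M : SemiModel (2 ^ q) (halfTurn q) u τ F Ψ) {i : ℕ}
    (hi : 1 ≤ i) : (sigma 2)^[i] '' place q a κ (SemiModel.siegel (halfTurn q) u Ψ) =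
      place i a κ (SemiModel.siegel (halfTurn q) u Ψ) := by
  rw [C.place_eq_emb, image_image]
  ext p
  constructor
  · rintro ⟨t, ht, rfl⟩
    dsimp only
    rw [sigma_iterate_coe]
    rcases M.siegel_cases ht with h | h
    · rw [arc_mul]; exact ⟨_, M.mul_mem ht h.2, rfl⟩
    · rw [C.arc_mul_sub' hi]; exact ⟨_, M.mul_sub_mem ht h.1, rfl⟩
  · rintro ⟨s, hs, rfl⟩
    obtain ⟨w, hw, ⟨h1, rfl⟩ | ⟨h1, rfl⟩⟩ := M.siegel_surj hs
    · exact ⟨w, hw, by dsimp only; rw [sigma_iterate_coe, arc_mul]⟩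
    · exact ⟨w, hw, by dsimp only; rw [sigma_iterate_coe, C.arc_mul_sub' hi]⟩

theorem siegel_subset (M : SemiModel (2 ^ q) (halfTurn q) u τ F Ψ) :
    SemiModel.siegel (halfTurn q) u Ψ ⊆ Icc 0 1 := fun t ht =>
  ⟨by linarith [ht.1.1, M.pos], by linarith [ht.1.2, M.lt_left]⟩

theorem siegel_length (C : Cycle r q a κ) {i : ℕ} (hi : i ≤ q) :
    2 ^ i * κ * (u + halfTurn q - u) < 1 := by
  have h1 := C.width_le hi
  have h2 := C.ren.lt_one
  have h3 := C.kap_le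
  have h4 := C.ren.half_le
  rw [add_sub_cancel_left]
  have h5 := C.width_pos i
  nlinarith

theorem isHole_siegel (C : Cycle r q a κ) (M : SemiModel (2 ^ q) (halfTurn q) u τ F Ψ) {i : ℕ}
    (hi : i ≤ q) {α β : UnitAddCircle} :
    IsHole (place i a κ (SemiModel.siegel (halfTurn q) u Ψ)) α β ↔
      (∃ s ∈ SemiModel.siegel (halfTurn q) u Ψ, ∃ t ∈ SemiModel.siegel (halfTurn q) u Ψ, s < t ∧
        (∀ z ∈ SemiModel.siegel (halfTurn q) u Ψ, z ≤ s ∨ t ≤ z) ∧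
        α = (2 ^ i * a + 2 ^ i * κ * s : ℝ) ∧ β = (2 ^ i * a + 2 ^ i * κ * t : ℝ)) ∨
      (α = (2 ^ i * a + 2 ^ i * κ * (u + halfTurn q) : ℝ) ∧ β = (2 ^ i * a + 2 ^ i * κ * u : ℝ)) :=
  isHole_affine_iff inter_subset_left M.left_mem_siegel M.right_mem_siegel
    (by linarith [C.ren.half_le]) (C.width_pos i) (C.siegel_length hi)

theorem isPeriodicLaminational_siegel (C : Cycle r q a κ)
    (M : SemiModel (2 ^ q) (halfTurn q) u τ F Ψ) :
    IsPeriodicLaminational 2 q (place q a κ (SemiModel.siegel (halfTurn q) u Ψ)) := by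
  have hδ := C.ren.half_le
  refine C.isPeriodicLaminational (isClosed_place _ _ _ (SemiModel.isCompact_siegel _ _ _))
    (C.image_siegel M C.pos) (fun i hi _ => ⟨_, siegel_subset M, C.image_siegel M hi⟩)
    ⟨u, M.pos, by linarith [M.lt_left], by
      rw [C.place_eq_emb]; exact ⟨u, M.left_mem_siegel, rfl⟩⟩ ?_
  intro i hiq α β h
  rw [C.image_siegel M (by omega : 1 ≤ i + 1)]
  rcases Nat.eq_zero_or_pos i with rfl | hi
  · rw [Function.iterate_zero, image_id, C.isHole_siegel M le_rfl] at h
    have hsig : ∀ t : ℝ, sigma 2 ((2 ^ q * a + 2 ^ q * κ * t : ℝ) : UnitAddCircle) =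
        (2 ^ 1 * emb q a κ t : ℝ) := by
      intro t
      rw [← arc_eq, C.coe_arc, sigma_coe, pow_one]
    rcases h with ⟨s, hs, t, ht, hst, hno, rfl, rfl⟩ | ⟨rfl, rfl⟩
    · right
      rw [hsig, hsig, zero_add, C.isHole_siegel M (by omega)]
      have hN := C.two_le
      rcases le_or_gt t (1 - halfTurn q) with h1 | h1
      · left
        exact ⟨_, M.mul_mem hs (by linarith), _, M.mul_mem ht h1,
          mul_lt_mul_of_pos_left hst (by linarith), M.consecutive_left hs hno,
          arc_mul _ _, arc_mul _ _⟩
      rcases le_or_gt (halfTurn q) s with h2 | h2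
      · left
        exact ⟨_, M.mul_sub_mem hs h2, _, M.mul_sub_mem ht (by linarith),
          mul_lt_mul_of_pos_left (by linarith) (by linarith), M.consecutive_right ht hno,
          C.arc_mul_sub' le_rfl _, C.arc_mul_sub' le_rfl _⟩
      · right
        obtain ⟨-, -, e1, e2⟩ := M.consecutive_middle hs ht hno h1 h2
        exact ⟨by rw [arc_mul, e1], by rw [C.arc_mul_sub' le_rfl, e2]⟩
    · left
      rw [hsig, hsig, C.arc_mul_sub' le_rfl, arc_mul, add_sub_cancel_right]
  · rw [C.image_siegel M hi, C.isHole_siegel M hiq.le] at h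
    right
    rw [C.isHole_siegel M hiq]
    have hsig : ∀ t : ℝ, sigma 2 ((2 ^ i * a + 2 ^ i * κ * t : ℝ) : UnitAddCircle) =
        (2 ^ (i + 1) * a + 2 ^ (i + 1) * κ * t : ℝ) := by
      intro t
      rw [sigma_coe]; congr 1; ring
    rcases h with ⟨s, hs, t, ht, hst, hno, rfl, rfl⟩ | ⟨rfl, rfl⟩
    · exact Or.inl ⟨s, hs, t, ht, hst, hno, hsig s, hsig t⟩
    · exact Or.inr ⟨hsig _, hsig _⟩

theorem isSiegel (C : Cycle r q a κ) (M : SemiModel (2 ^ q) (halfTurn q) u τ F Ψ) :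
    IsSiegel 2 q (place q a κ (SemiModel.siegel (halfTurn q) u Ψ)) := by
  have hδ := C.ren.half_le
  have hu := M.pos
  have hu1 := M.lt_left
  have hk := C.kap_pos
  have hk1 := C.kap_le
  set δ := halfTurn q
  set S := SemiModel.siegel δ u Ψ with hSdef
  have hw : 0 < κ + 1 / 2 := by linarith
  -- The semiconjugacy is transported to the circle coordinate; beyond the end of the long arc,
  -- where the quotient exceeds one, it is continued as a constant.
  set g : ℝ → ℝ := fun s => Ψ (min ((s - a) / (κ + 1 / 2)) 1) with hg
  have hgm : Monotone g := fun s t hst => Ψ.mono (min_le_min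
    (div_le_div_of_nonneg_right (by linarith) hw.le) le_rfl)
  have hgc : Continuous g := M.contΨ.comp (by fun_prop)
  have hg0 : g (a + 1) = g a + 1 := by
    simp only [hg]
    have e : a + 1 - a = (1 : ℝ) := by ring
    rw [sub_self, zero_div, min_eq_left (by norm_num : (0 : ℝ) ≤ 1), e,
      min_eq_right (by rw [le_div_iff₀ hw]; linarith)]
    rw [← CircleDeg1Lift.map_add_one, zero_add]
  obtain ⟨f, hfc, hf⟩ := exists_circleDeg1Lift g a (hgm.monotoneOn _) hgc.continuousOn hg0
  have hfe : ∀ t ∈ Icc (0 : ℝ) 1, f (emb q a κ t) = Ψ t := by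
    intro t ht
    rw [C.emb_eq, hf _ ⟨by nlinarith [ht.1], by nlinarith [ht.1, ht.2]⟩]
    simp only [hg]
    have e : (a + (κ + 1 / 2) * t - a) / (κ + 1 / 2) = t := by
      rw [add_sub_cancel_left, mul_div_cancel_left₀ _ hw.ne']
    rw [e, min_eq_left ht.2]
  obtain ⟨ψ, hψ⟩ := exists_circle_map f
  have hS01 : S ⊆ Icc 0 1 := siegel_subset M
  have hplace : ∀ t : ℝ, ((2 ^ q * a + 2 ^ q * κ * t : ℝ) : UnitAddCircle) = (emb q a κ t : ℝ) :=
    fun t => by rw [← arc_eq, C.coe_arc]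
  have hψe : ∀ t ∈ Icc (0 : ℝ) 1, ψ (emb q a κ t : ℝ) = (Ψ t : ℝ) := fun t ht => by
    rw [hψ, hfe t ht]
  have huS := M.left_mem_siegel
  have hvS := M.right_mem_siegel
  have embInj : ∀ s ∈ S, ∀ t ∈ S, s < t → emb q a κ s < emb q a κ t ∧
      emb q a κ t < emb q a κ s + 1 := by
    intro s hs t ht hst
    refine ⟨C.emb_lt hst, ?_⟩
    linarith [C.emb_sub_le hst.le, hs.1.1, ht.1.2]
  refine ⟨?_, ψ, τ, ⟨⟨f, hfc, f.monotone, f.map_add_one, hψ⟩, ?_, ?_⟩, M.irr, ?_⟩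
  · rw [C.place_eq_emb]
    refine M.siegel_infinite.image fun s hs t ht h => ?_
    rcases lt_trichotomy s t with hst | hst | hst
    · exact absurd h (coe_ne_of_lt (embInj s hs t ht hst).1 (embInj s hs t ht hst).2)
    · exact hst
    · exact absurd h.symm (coe_ne_of_lt (embInj t ht s hs hst).1 (embInj t ht s hs hst).2)
  · intro α β h x hx
    have key : ∀ s t : ℝ, s < t → t < s + 1 → f s = f t →
        x ∈ cIcc (s : UnitAddCircle) (t : UnitAddCircle) → ψ x = ψ s := by
      intro s t h1 h2 h3 hx
      obtain ⟨z, hz1, hz2, rfl⟩ := exists_lift_of_mem_cIcc h1 h2 hx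
      rw [hψ, hψ, le_antisymm (by rw [h3]; exact f.mono hz2) (f.mono hz1)]
    rcases (C.isHole_siegel M le_rfl).1 h with ⟨s, hs, t, ht, hst, hno, rfl, rfl⟩ | ⟨rfl, rfl⟩
    · rw [hplace, hplace] at hx
      rw [hplace]
      refine key _ _ (embInj s hs t ht hst).1 (embInj s hs t ht hst).2 ?_ hx
      rw [hfe s (hS01 hs), hfe t (hS01 ht)]
      refine eq_of_disjoint_supp M.contΨ hst.le fun z h1 h2 hz => ?_
      have hz' : z ∈ S := ⟨⟨by linarith [hs.1.1], by linarith [ht.1.2]⟩, hz⟩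
      rcases hno z hz' with h | h <;> linarith
    · rw [hplace, hplace] at hx
      rw [hplace]
      have h1 := embInj u huS _ hvS (by linarith)
      rw [← coe_add_one (emb q a κ u)] at hx
      refine key _ _ h1.2 (by linarith [h1.1]) ?_ hx
      rw [CircleDeg1Lift.map_add_one, hfe _ (hS01 huS), hfe _ (hS01 hvS), M.psi_right]
  · have core : ∀ s ∈ S, ∀ t ∈ S, s < t → ψ (emb q a κ s : ℝ) = ψ (emb q a κ t : ℝ) →
        IsEdge (place q a κ S) (emb q a κ s : ℝ) (emb q a κ t : ℝ) := by
      intro s hs t ht hst h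
      rw [hψe s (hS01 hs), hψe t (hS01 ht), coe_eq_iff] at h
      obtain ⟨n, hn⟩ := h
      have b1 := Ψ.mono hst.le
      have b2 := Ψ.mono hs.1.1
      have b3 := Ψ.mono ht.1.2
      have b4 := M.psi_right
      have c1 : (n : ℝ) ≤ 1 := by linarith
      have c2 : (0 : ℝ) ≤ n := by linarith
      have d1 : n ≤ 1 := by exact_mod_cast c1
      have d2 : 0 ≤ n := by exact_mod_cast c2
      -- Equal values bound an ordinary hole; a difference of a full turn occurs only at the ends of
      -- the critical edge, which bound the outer hole.
      rcases (by omega : n = 0 ∨ n = 1) with rfl | rfl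
      · left
        refine (C.isHole_siegel M le_rfl).2 (Or.inl ⟨s, hs, t, ht, hst, ?_, (hplace s).symm,
          (hplace t).symm⟩)
        intro z hz
        by_contra hcon
        push Not at hcon
        have := lt_of_mem_supp hz.2 hcon.1 hcon.2
        rw [hn] at this
        simp at this
      · right
        push_cast at hn
        have e1 : s = u := le_antisymm (M.fiber_left (le_antisymm (by linarith) b2)) hs.1.1
        have e2 : t = u + δ := le_antisymm ht.1.2 (M.fiber_outer (le_antisymm b3 (by linarith))).1
        refine (C.isHole_siegel M le_rfl).2 (Or.inr ⟨?_, ?_⟩)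
        · rw [hplace, e2]
        · rw [hplace, e1]
    rintro _ ⟨s, hs, rfl⟩ _ ⟨t, ht, rfl⟩ h
    dsimp only at h ⊢
    rw [hplace, hplace] at h ⊢
    rcases lt_trichotomy s t with hst | hst | hst
    · exact Or.inr (core s hs t ht hst h)
    · exact Or.inl (by rw [hst])
    · exact Or.inr (core t ht s hs hst h.symm).symm
  · rintro _ ⟨t, ht, rfl⟩
    dsimp only
    rw [hplace, sigma_iterate_coe]
    rcases M.siegel_cases ht with h | h
    · rw [← C.emb_mul, hψe _ (hS01 (M.mul_mem ht h.2)), hψe _ (hS01 ht), M.psi_mul h.1 h.2]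
      rfl
    · rw [C.arc_mul_sub C.pos, C.coe_arc, hψe _ (hS01 (M.mul_sub_mem ht h.1)), hψe _ (hS01 ht),
        ← coe_add_one, M.psi_mul_sub h.1 h.2]
      rfl

theorem isGapBasis_siegel (C : Cycle r q a κ) (M : SemiModel (2 ^ q) (halfTurn q) u τ F Ψ)
    (hF : Frame (2 ^ q) (halfTurn q) (Cycle.rel r q a κ) u (u + halfTurn q)) :
    IsGapBasis r (place q a κ (SemiModel.siegel (halfTurn q) u Ψ)) := by
  have hI := hF.pair.rel
  have hu := M.pos
  have hu1 := M.lt_left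
  have hmul := M.mul_lt
  have hN := C.two_le
  refine C.isGapBasis_place C.pos le_rfl (SemiModel.isCompact_siegel _ _ _) inter_subset_left
    hu.le (by linarith) M.left_mem_siegel M.right_mem_siegel
    (M.mul_mem M.left_mem_siegel hu1.le) (by nlinarith) hmul (C.siegel_length le_rfl) hI ?_ ?_
  · intro s hs t ht hst hno
    refine M.rel_of_hole C.ren hF hs ht hst fun z h1 h2 hz => ?_
    rcases hno z hz with h | h <;> linarith
  · intro x y h0 hxy h1 hR s hs hxs hsy t ht
    by_contra hcon
    refine M.not_crosses C.ren hI h0 h1 hR hs hxs hsy ht ?_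
    by_contra hcon'
    push Not at hcon'
    exact hcon hcon'

end Cycle

/-! ### Holes of invariant classes under doubling -/

/-- Every point of a finite set with more than one point begins a hole. -/
theorem exists_hole_left {B : Set UnitAddCircle} (hfin : B.Finite) (hnt : B.Nontrivial) (x : ℝ)  :
    ∃ t : ℝ, x < t ∧ t < x + 1 ∧ (t : UnitAddCircle) ∈ B ∧
      ∀ z : ℝ, x < z → z < t → (z : UnitAddCircle) ∉ B := by
  set L : Set ℝ := {z | (x < z ∧ z < x + 1) ∧ (z : UnitAddCircle) ∈ B} with hL
  have hLfin : L.Finite := by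
    refine Set.Finite.of_finite_image (f := ((↑) : ℝ → UnitAddCircle)) (hfin.subset ?_) ?_
    · rintro _ ⟨z, hz, rfl⟩; exact hz.2
    · intro z hz w hw h
      exact coe_inj_of_lt h (by linarith [hz.1.2, hw.1.1]) (by linarith [hz.1.1, hw.1.2])
  have hLne : L.Nonempty := by
    obtain ⟨b, hb, hbx⟩ := hnt.exists_ne (x : UnitAddCircle)
    obtain ⟨z, h1, h2, rfl⟩ := exists_lift_of_ne hbx
    exact ⟨z, ⟨h1, h2⟩, hb⟩
  obtain ⟨t, ht, hmin⟩ := Set.exists_min_image L id hLfin hLne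
  refine ⟨t, ht.1.1, ht.1.2, ht.2, fun z h1 h2 hz => ?_⟩
  have : t ≤ z := hmin z ⟨⟨h1, by linarith [ht.1.2]⟩, hz⟩
  linarith

/-- A hole of a set, in the coordinate of the line. -/
structure HoleLift (B : Set UnitAddCircle) (s t : ℝ) : Prop where
  lt : s < t
  lt_add_one : t < s + 1
  left : (s : UnitAddCircle) ∈ B
  right : (t : UnitAddCircle) ∈ B
  no : ∀ z : ℝ, s < z → z < t → (z : UnitAddCircle) ∉ B

namespace HoleLift

variable {B : Set UnitAddCircle} {s t s' t' : ℝ}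

theorem isHole (h : HoleLift B s t) : IsHole B s t :=
  (isHole_coe_iff h.lt h.lt_add_one).2 ⟨h.left, h.right, h.no⟩

theorem of_isHole (h1 : s < t) (h2 : t < s + 1) (h : IsHole B s t) : HoleLift B s t := by
  rw [isHole_coe_iff h1 h2] at h
  exact ⟨h1, h2, h.1, h.2.1, h.2.2⟩

theorem sub_int (h : HoleLift B s t) (n : ℤ) : HoleLift B (s - n) (t - n) := by
  have e : ∀ z : ℝ, ((z - n : ℝ) : UnitAddCircle) = z := fun z => by
    rw [← coe_add_int (z - n) n, sub_add_cancel]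
  refine ⟨by linarith [h.lt], by linarith [h.lt_add_one], ?_, ?_, ?_⟩
  · rw [e]; exact h.left
  · rw [e]; exact h.right
  · intro z h1 h2
    have := h.no (z + n) (by linarith) (by linarith)
    rwa [coe_add_int] at this

theorem eq_of_mem (h : HoleLift B s t) (h' : HoleLift B s' t') {z : ℝ} (h1 : s < z) (h2 : z < t)
    (h1' : s' < z) (h2' : z < t') : s = s' ∧ t = t' := by
  constructor
  · rcases lt_trichotomy s s' with hl | hl | hl
    · exact absurd h'.left (h.no s' hl (by linarith))
    · exact hl
    · exact absurd h.left (h'.no s hl (by linarith))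
  · rcases lt_trichotomy t t' with hl | hl | hl
    · exact absurd h.right (h'.no t (by linarith) hl)
    · exact hl
    · exact absurd h'.right (h.no t' (by linarith) hl)

theorem eq_of_coe_mem (h : HoleLift B s t) (h' : HoleLift B s' t') {z z' : ℝ} (h1 : s < z)
    (h2 : z < t) (h1' : s' < z') (h2' : z' < t') (e : (z : UnitAddCircle) = z') :
    ∃ n : ℤ, s' = s + n ∧ t' = t + n := by
  obtain ⟨n, hn⟩ := coe_eq_iff.1 e
  obtain ⟨e1, e2⟩ := h.eq_of_mem (h'.sub_int n) h1 h2 (by linarith) (by linarith)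
  exact ⟨n, by linarith, by linarith⟩

theorem right_unique (h : HoleLift B s t) (h' : HoleLift B s' t')
    (e : (s : UnitAddCircle) = s') : ∃ n : ℤ, s' = s + n ∧ t' = t + n := by
  obtain ⟨n, rfl⟩ := coe_eq_iff.1 e
  have h1 := h.lt
  have h2 := h'.lt
  set z := (s + min t (t' - n)) / 2 with hz
  have a1 : s < min t (t' - n) := lt_min h1 (by linarith)
  have a2 := min_le_left t (t' - n)
  have a3 := min_le_right t (t' - n)
  exact h.eq_of_coe_mem h' (z := z) (z' := z + n) (by linarith) (by linarith) (by linarith)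
    (by linarith) (coe_add_int z n).symm

/-- Two arcs longer than a half circle overlap, and overlapping holes coincide. -/
theorem long_unique (h : HoleLift B s t) (h' : HoleLift B s' t') (hl : 1 / 2 < t - s)
    (hl' : 1 / 2 < t' - s') : ∃ n : ℤ, s' = s + n ∧ t' = t + n := by
  obtain ⟨n, hn1, hn2⟩ : ∃ n : ℤ, s ≤ s' - n ∧ s' - n < s + 1 :=
    ⟨⌊s' - s⌋, by linarith [Int.floor_le (s' - s)], by linarith [Int.lt_floor_add_one (s' - s)]⟩
  rcases lt_or_ge (s' - n) t with hst | hst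
  · set w := min t (t' - n)
    have a1 : s' - n < w := lt_min hst (by linarith)
    have a2 : w ≤ t := min_le_left _ _
    have a3 : w ≤ t' - n := min_le_right _ _
    exact h.eq_of_coe_mem h' (z := (s' - n + w) / 2) (z' := (s' - n + w) / 2 + n) (by linarith)
      (by linarith) (by linarith) (by linarith) (coe_add_int _ n).symm
  · set w := min (t + 1) (t' - n)
    have a1 : s + 1 < w := lt_min (by linarith) (by linarith)
    have a2 : w ≤ t + 1 := min_le_left _ _
    have a3 : w ≤ t' - n := min_le_right _ _
    refine h.eq_of_coe_mem h' (z := (s + 1 + w) / 2 - 1) (z' := (s + 1 + w) / 2 + n)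
      (by linarith) (by linarith) (by linarith) (by linarith) ?_
    rw [coe_add_int, ← coe_add_one ((s + 1 + w) / 2 - 1), sub_add_cancel]

end HoleLift

namespace IsInvariantLamination

variable {r : Setoid UnitAddCircle}

/-- Short holes of an invariant class double. -/
theorem holeLift_two_mul (hr : IsInvariantLamination 2 r) {g : Set UnitAddCircle}
    (hg : g ∈ r.classes) (hgg : sigma 2 '' g = g) {s t : ℝ} (h : HoleLift g s t) :
    (t - s < 1 / 2 ∧ HoleLift g (2 * s) (2 * t)) ∨
      (1 / 2 < t - s ∧ HoleLift g (2 * s) (2 * t - 1)) := by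
  have hinj : InjOn (sigma 2) g := by
    have := hr.injOn_of_invariant hg (n := 1) (by simpa using hgg)
    simpa using this
  have himg := hr.isHole_image hg h.isHole
  rw [hgg, sigma_coe, sigma_coe] at himg
  have hne : ((2 * s : ℝ) : UnitAddCircle) ≠ (2 * t : ℝ) := by
    intro e
    rw [← sigma_coe, ← sigma_coe] at e
    exact coe_ne_of_lt h.lt h.lt_add_one (hinj h.left h.right e)
  have himg := himg.resolve_left hne
  have h1 := h.lt
  have h2 := h.lt_add_one
  rcases lt_trichotomy (t - s) (1 / 2) with hl | hl | hl
  · exact Or.inl ⟨hl, HoleLift.of_isHole (by linarith) (by linarith) himg⟩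
  · exact absurd (coe_eq_iff.2 ⟨1, by push_cast; linarith⟩) hne
  · refine Or.inr ⟨hl, HoleLift.of_isHole (by linarith) (by linarith) ?_⟩
    rw [← coe_add_one (2 * t - 1), sub_add_cancel]
    exact himg

theorem exists_long_hole (hr : IsInvariantLamination 2 r) {g : Set UnitAddCircle}
    (hg : g ∈ r.classes) (hgg : sigma 2 '' g = g) {s t : ℝ} (h : HoleLift g s t) :
    ∃ k : ℕ, 1 / 2 < 2 ^ k * (t - s) ∧ ∀ i ≤ k, HoleLift g (2 ^ i * s) (2 ^ i * t) := by
  have hpos : 0 < t - s := by linarith [h.lt]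
  have hex : ∃ k : ℕ, 1 / 2 ≤ 2 ^ k * (t - s) := by
    obtain ⟨k, hk⟩ := pow_unbounded_of_one_lt (1 / (t - s)) (by norm_num : (1 : ℝ) < 2)
    rw [div_lt_iff₀ hpos] at hk
    exact ⟨k, by linarith⟩
  classical
  have hk := Nat.find_spec hex
  have hmin : ∀ i < Nat.find hex, 2 ^ i * (t - s) < 1 / 2 := fun i hi =>
    not_le.1 (Nat.find_min hex hi)
  set k := Nat.find hex
  have hall : ∀ i ≤ k, HoleLift g (2 ^ i * s) (2 ^ i * t) := by
    intro i
    induction i with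
    | zero => intro _; simpa using h
    | succ i ih =>
      intro hi
      have hlt := hmin i (by omega)
      rcases hr.holeLift_two_mul hg hgg (ih (by omega)) with h1 | h1
      · have := h1.2
        rwa [← mul_assoc, ← mul_assoc, ← pow_succ'] at this
      · linarith [h1.1]
  refine ⟨k, ?_, hall⟩
  rcases hr.holeLift_two_mul hg hgg (hall k le_rfl) with h1 | h1 <;> linarith [h1.1]

/-- The hole that begins at the fixed point would be mapped to a hole that begins there again but
has a different length. -/
theorem eq_zero_of_rel_zero (hr : IsInvariantLamination 2 r) {y : UnitAddCircle}
    (h : r ((0 : ℝ) : UnitAddCircle) y) : y = ((0 : ℝ) : UnitAddCircle) := by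
  by_contra hne
  set g := cls r ((0 : ℝ) : UnitAddCircle) with hg
  have hgc : g ∈ r.classes := cls_mem_classes _ _
  have hgg : sigma 2 '' g = g := by rw [hg, hr.image_cls, sigma_coe, mul_zero]
  have h0 : ((0 : ℝ) : UnitAddCircle) ∈ g := r.refl' _
  obtain ⟨t, h1, h2, h3, h4⟩ := exists_hole_left (hr.finite_cls _) ⟨_, h0, _, h, Ne.symm hne⟩ 0
  have hh : HoleLift g 0 t := ⟨h1, h2, h0, h3, h4⟩
  rcases hr.holeLift_two_mul hgc hgg hh with ⟨a, b⟩ | ⟨a, b⟩ <;>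
  · rw [mul_zero] at b
    obtain ⟨n, hn1, hn2⟩ := hh.right_unique b rfl
    linarith

/-- The fixed point `0` is a cycle of length one. -/
theorem cycle_one (hr : IsInvariantLamination 2 r) : Cycle r 1 0 (1 / 2) where
  inv := hr
  pos := one_pos
  kap := by norm_num
  per := ⟨0, by simp⟩
  ends := by
    have : ((2 * (0 + 1 / 2) : ℝ) : UnitAddCircle) = (2 * 0 : ℝ) := by
      rw [← coe_add_one (2 * 0)]; norm_num
    rw [this]
  stay := by
    intro i hi hi1 t h0 h1 y hy
    obtain rfl : i = 1 := by omega
    have e : ∀ t : ℝ, 2 ^ 1 * (0 + 1 / 2 * t) = t := fun t => by ring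
    rw [e] at hy
    have hne : y ≠ ((0 : ℝ) : UnitAddCircle) := by
      rintro rfl
      exact coe_ne_of_lt h0 (by linarith) (hr.eq_zero_of_rel_zero (r.symm' hy)).symm
    obtain ⟨z, hz1, hz2, hz⟩ := exists_lift_of_ne hne
    exact ⟨z, hz1, by linarith, by rw [e, hz]⟩
  disj := by
    intro i j hi hij hj
    omega

theorem emb_one (t : ℝ) : emb 1 0 (1 / 2) t = t := by unfold emb; ring

theorem halfTurn_one : halfTurn 1 = 1 / 2 := by unfold halfTurn; norm_num

/-- Every non-trivial pair eventually separates `0` from `1 / 2`. -/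
theorem exists_stripPair (hr : IsInvariantLamination 2 r) {x y : UnitAddCircle} (hne : x ≠ y)
    (h : r x y) : ∃ s t, StripPair (halfTurn 1) (Cycle.rel r 1 0 (1 / 2)) s t := by
  have hx : x ≠ ((0 : ℝ) : UnitAddCircle) := by
    rintro rfl; exact hne (hr.eq_zero_of_rel_zero h).symm
  have hy : y ≠ ((0 : ℝ) : UnitAddCircle) := by
    rintro rfl; exact hne (hr.eq_zero_of_rel_zero (r.symm' h))
  obtain ⟨s, hs1, hs2, rfl⟩ := exists_lift_of_ne hx
  obtain ⟨t, ht1, ht2, rfl⟩ := exists_lift_of_ne hy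
  rw [zero_add] at hs2 ht2
  -- The class of `1 / 2` is trivial because it is mapped to the trivial class of `0`; hence no pair
  -- ends at the break point of the induction below.
  have hhalf : ∀ z : ℝ, 0 < z → z < 1 → r ((1 / 2 : ℝ) : UnitAddCircle) z → z = 1 / 2 := by
    intro z h0 h1 hz
    have h2 := hr.rel_two_mul hz
    have e1 : ((2 * (1 / 2) : ℝ) : UnitAddCircle) = (0 : ℝ) := by
      rw [← coe_add_one 0]; norm_num
    rw [e1] at h2
    obtain ⟨n, hn⟩ := coe_eq_iff.1 (hr.eq_zero_of_rel_zero h2).symm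
    have c1 : (0 : ℝ) < n := by linarith
    have c2 : (n : ℝ) < 2 := by linarith
    have d1 : 0 < n := by exact_mod_cast c1
    have d2 : n < 2 := by exact_mod_cast c2
    obtain rfl : n = 1 := by omega
    push_cast at hn
    linarith
  have key : ∀ n : ℕ, ∀ s t : ℝ, 0 < s → s < t → t < 1 → r (s : UnitAddCircle) t →
      1 < 2 ^ n * (t - s) → ∃ s t : ℝ, 0 < s ∧ s < 1 / 2 ∧ 1 / 2 < t ∧ t < 1 ∧
        r (s : UnitAddCircle) t := by
    intro n
    induction n with
    | zero => intro s t h0 h1 h2 _ h3; linarith [pow_zero (2 : ℝ) ▸ h3]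
    | succ n ih =>
      intro s t h0 h1 h2 hst h3
      have h4 : 2 ^ (n + 1) * (t - s) = 2 ^ n * (2 * t - 2 * s) := by ring
      rcases lt_trichotomy t (1 / 2) with h | h | h
      · exact ih (2 * s) (2 * t) (by linarith) (by linarith) (by linarith) (hr.rel_two_mul hst)
          (by rw [← h4]; exact h3)
      · rw [h] at hst
        linarith [hhalf s h0 (by linarith) (r.symm' hst)]
      rcases lt_trichotomy s (1 / 2) with h' | h' | h'
      · exact ⟨s, t, h0, h', h, h2, hst⟩
      · rw [h'] at hst
        linarith [hhalf t (by linarith) h2 hst]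
      · refine ih (2 * s - 1) (2 * t - 1) (by linarith) (by linarith) (by linarith) ?_ ?_
        · have := hr.rel_two_mul hst
          rw [← coe_add_one (2 * s - 1), ← coe_add_one (2 * t - 1), sub_add_cancel,
            sub_add_cancel]
          exact this
        · have : 2 * t - 1 - (2 * s - 1) = 2 * t - 2 * s := by ring
          rw [this, ← h4]; exact h3
  have fin : ∀ s t : ℝ, 0 < s → s < t → t < 1 → r (s : UnitAddCircle) t →
      ∃ s t, StripPair (halfTurn 1) (Cycle.rel r 1 0 (1 / 2)) s t := by
    intro s t h0 h1 h2 hst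
    obtain ⟨n, hn⟩ := pow_unbounded_of_one_lt (1 / (t - s)) (by norm_num : (1 : ℝ) < 2)
    rw [div_lt_iff₀ (by linarith)] at hn
    obtain ⟨s, t, a0, a1, a2, a3, a4⟩ := key n s t h0 h1 h2 hst hn
    refine ⟨s, t, a0, ?_, ?_, a3, ?_⟩
    · rw [halfTurn_one]; linarith
    · rw [halfTurn_one]; exact a2
    · unfold Cycle.rel; rw [emb_one, emb_one]; exact a4
  rcases lt_trichotomy s t with hst | hst | hst
  · exact fin s t hs1 hst ht2 h
  · exact absurd (by rw [hst]) hne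
  · exact fin t s ht1 hst hs2 (r.symm' h)

/-- The holes of an invariant class form a cycle, which is the same for all laminations with that
class. -/
theorem exists_cycle (hr : IsInvariantLamination 2 r) {g : Set UnitAddCircle}
    (hg : g ∈ r.classes) (hgg : sigma 2 '' g = g) (hnt : g.Nontrivial) :
    ∃ q a κ, (∀ s, IsInvariantLamination 2 s → g ∈ s.classes → Cycle s q a κ) ∧ κ < 1 / 2 ∧
      (∀ i, 1 ≤ i → i ≤ q → HoleLift g (2 ^ i * a) (2 ^ i * (a + κ))) ∧
      ∀ s t, HoleLift g s t → ∃ i, 1 ≤ i ∧ i ≤ q ∧ (s : UnitAddCircle) = (2 ^ i * a : ℝ) ∧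
        (t : UnitAddCircle) = (2 ^ i * (a + κ) : ℝ) := by
  have hfin := hr.finite g hg
  obtain ⟨x, hx⟩ := hnt.nonempty
  obtain ⟨x, -, -, rfl⟩ := exists_lift x 0
  -- Some hole is doubled until it exceeds a half circle. The image of this long hole is shorter by
  -- wrapping around once, and its further images return to the same long hole by
  -- `HoleLift.long_unique`.
  obtain ⟨y, y1, y2, y3, y4⟩ := exists_hole_left hfin hnt x
  obtain ⟨k₀, hk₀, hall₀⟩ := hr.exists_long_hole hg hgg ⟨y1, y2, hx, y3, y4⟩
  obtain ⟨a, b, hab, hlong⟩ : ∃ a b, HoleLift g a b ∧ 1 / 2 < b - a :=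
    ⟨_, _, hall₀ k₀ le_rfl, by linarith⟩
  have h1 : HoleLift g (2 * a) (2 * b - 1) := by
    rcases hr.holeLift_two_mul hg hgg hab with h | h
    · linarith [h.1]
    · exact h.2
  obtain ⟨k, hk, hall⟩ := hr.exists_long_hole hg hgg h1
  obtain ⟨n, hn1, hn2⟩ := hab.long_unique (hall k le_rfl) hlong (by linarith)
  -- With this width, `2 * (a + κ)` is the right end `2 * b - 1` of the image of the long hole.
  set κ := b - a - 1 / 2 with hκ
  have harc : ∀ i, 1 ≤ i → i ≤ k + 1 → HoleLift g (2 ^ i * a) (2 ^ i * (a + κ)) := by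
    intro i hi hik
    obtain ⟨j, rfl⟩ : ∃ j, i = j + 1 := ⟨i - 1, by omega⟩
    have := hall j (by omega)
    have e1 : (2 : ℝ) ^ j * (2 * a) = 2 ^ (j + 1) * a := by ring
    have e2 : (2 : ℝ) ^ j * (2 * b - 1) = 2 ^ (j + 1) * (a + κ) := by rw [hκ]; ring
    rwa [e1, e2] at this
  have hκpos : 0 < κ := by linarith
  have hper : (2 : ℝ) ^ (k + 1) * a = a + n := by rw [pow_succ]; linarith
  have C : ∀ r, IsInvariantLamination 2 r → g ∈ r.classes → Cycle r (k + 1) a κ := by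
    intro r hr hg
    have hgc : ∀ x ∈ g, g = cls r x := fun x hx => eq_cls_of_mem_classes hg hx
    have hrelg : ∀ {x y : UnitAddCircle}, x ∈ g → y ∈ g → r x y := fun {x y} hx hy => by
      have := hgc x hx ▸ hy
      exact this
    have hmemg : ∀ {x y : UnitAddCircle}, x ∈ g → r x y → y ∈ g := fun {x y} hx hy => by
      rw [hgc x hx]; exact hy
    refine ⟨hr, by omega, ?_, ⟨n, hper⟩, ?_, ?_, ?_⟩
    · have : 2 ^ k * (2 * b - 1) - 2 ^ k * (2 * a) = b - a := by linarith
      rw [hκ]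
      linear_combination this
    · have := harc 1 le_rfl (by omega)
      rw [pow_one] at this
      exact hrelg this.left this.right
    · intro i hi hik t h0 h1 y hy
      have hh := harc i hi hik
      have hw : 0 < 2 ^ i * κ := by positivity
      have b1 : 2 ^ i * a < 2 ^ i * (a + κ * t) := by
        have := mul_pos hw h0; linarith
      have b2 : 2 ^ i * (a + κ * t) < 2 ^ i * (a + κ) := by
        have := mul_lt_mul_of_pos_left h1 hw; linarith
      have hno := hh.no _ b1 b2
      obtain ⟨z, hz1, hz2, rfl⟩ := exists_lift y (2 ^ i * a)
      have hz1' : 2 ^ i * a < z := by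
        refine lt_of_le_of_ne hz1 fun e => hno ?_
        rw [← e] at hy
        exact hmemg hh.left (r.symm' hy)
      have hz2' : z < 2 ^ i * (a + κ) := by
        by_contra hcon
        rcases (not_lt.1 hcon).eq_or_lt with e | e
        · rw [← e] at hy
          exact hno (hmemg hh.right (r.symm' hy))
        · exact hno (hmemg hh.left (hr.trans_of_linked b1 b2 e hz2 (hrelg hh.left hh.right) hy))
      refine ⟨(z - 2 ^ i * a) / (2 ^ i * κ), div_pos (by linarith) hw, ?_, ?_⟩
      · rw [div_lt_one hw]; linarith
      · rw [Cycle.arc_eq, mul_div_assoc', mul_div_cancel_left₀ _ hw.ne']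
        congr 1; ring
    · intro i j hi hij hj t t' t0 t1 t0' t1' e
      have hwi : 0 < 2 ^ i * κ := by positivity
      have hwj : 0 < 2 ^ j * κ := by positivity
      have m1 := mul_pos hwi t0
      have m2 := mul_lt_mul_of_pos_left t1 hwi
      have m3 := mul_pos hwj t0'
      have m4 := mul_lt_mul_of_pos_left t1' hwj
      obtain ⟨m, hm1, hm2⟩ := (harc i hi (by omega)).eq_of_coe_mem (harc j (by omega) hj)
        (by linarith) (by linarith) (by linarith) (by linarith) e
      have : (2 : ℝ) ^ i * κ = 2 ^ j * κ := by linarith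
      have := mul_right_cancel₀ hκpos.ne' this
      have := pow_right_injective₀ (by norm_num : (0 : ℝ) < 2) (by norm_num) this
      omega
  refine ⟨k + 1, a, κ, C, by linarith [hab.lt_add_one], harc, ?_⟩
  intro s t hst
  obtain ⟨l, hl, hlall⟩ := hr.exists_long_hole hg hgg hst
  obtain ⟨m, hm1, hm2⟩ := hab.long_unique (hlall l le_rfl) hlong (by linarith)
  have hiter : ∀ j : ℕ, (sigma 2)^[j] '' g = g := by
    intro j
    induction j with
    | zero => simp
    | succ j ih => rw [Function.iterate_succ', image_comp, ih, hgg]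
  have hag : ∀ j : ℕ, ((2 ^ j * a : ℝ) : UnitAddCircle) ∈ g := by
    intro j
    rw [← hiter j, ← sigma_iterate_coe]
    exact ⟨_, hab.left, rfl⟩
  have hmul : ∀ j : ℕ, ((2 ^ ((k + 1) * j) * a : ℝ) : UnitAddCircle) = a := by
    intro j
    induction j with
    | zero => simp
    | succ j ih =>
      rw [Nat.mul_succ, pow_add, mul_assoc, ← sigma_iterate_coe, hper, coe_add_int,
        sigma_iterate_coe, ih]
  -- Both points are mapped to `a` by the `l`-th iterate, since `l + k * l` is a multiple of the
  -- period `k + 1`, and that iterate is injective on the class.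
  have hs : (s : UnitAddCircle) = (2 ^ (k * l) * a : ℝ) := by
    refine hr.injOn_of_invariant hg (hiter l) hst.left (hag _) ?_
    rw [sigma_iterate_coe, sigma_iterate_coe, hm1, coe_add_int, ← mul_assoc, ← pow_add,
      show l + k * l = (k + 1) * l by ring, hmul]
  obtain ⟨i, hi1, hi2, hi⟩ : ∃ i, 1 ≤ i ∧ i ≤ k + 1 ∧
      ((2 ^ (k * l) * a : ℝ) : UnitAddCircle) = (2 ^ i * a : ℝ) := by
    have hred : ∀ j : ℕ, ((2 ^ j * a : ℝ) : UnitAddCircle) = (2 ^ (j % (k + 1)) * a : ℝ) := by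
      intro j
      conv_lhs => rw [← Nat.mod_add_div j (k + 1), pow_add, mul_assoc, ← sigma_iterate_coe, hmul,
        sigma_iterate_coe]
    rcases Nat.eq_zero_or_pos ((k * l) % (k + 1)) with h | h
    · refine ⟨k + 1, by omega, le_rfl, ?_⟩
      rw [hred, h, hper, coe_add_int]; simp
    · exact ⟨_, h, (Nat.mod_lt _ (by omega)).le, hred _⟩
  refine ⟨i, hi1, hi2, hs.trans hi, ?_⟩
  obtain ⟨j, hj1, hj2⟩ := hst.right_unique (harc i hi1 hi2) (hs.trans hi)
  rw [hj2, coe_add_int]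

end IsInvariantLamination

/-! ### The gap behind the long edge when there is no strip pair -/

/-- The points whose first `k` images under the return map stay out of the middle. -/
def cantorLevel (N δ : ℝ) : ℕ → Set ℝ
  | 0 => Icc 0 1
  | k + 1 => {t | t ∈ Icc 0 (1 - δ) ∧ N * t ∈ cantorLevel N δ k} ∪
      {t | t ∈ Icc δ 1 ∧ N * (t - δ) ∈ cantorLevel N δ k}

/-- The points whose orbits under the return map stay out of the middle. -/
def cantor (N δ : ℝ) : Set ℝ := ⋂ k, cantorLevel N δ k

namespace Ren

variable {N δ : ℝ} {R : ℝ → ℝ → Prop}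

theorem isClosed_cantorLevel (N δ : ℝ) (k : ℕ) : IsClosed (cantorLevel N δ k) := by
  induction k with
  | zero => exact isClosed_Icc
  | succ k ih =>
    refine IsClosed.union ?_ ?_
    · exact isClosed_Icc.inter (ih.preimage (by fun_prop : Continuous fun t : ℝ => N * t))
    · exact isClosed_Icc.inter (ih.preimage (by fun_prop : Continuous fun t : ℝ => N * (t - δ)))

theorem isCompact_cantor (N δ : ℝ) : IsCompact (cantor N δ) :=
  isCompact_Icc.of_isClosed_subset (isClosed_iInter (isClosed_cantorLevel N δ))
    (iInter_subset (cantorLevel N δ) 0)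

theorem cantor_subset (N δ : ℝ) : cantor N δ ⊆ Icc 0 1 := iInter_subset (cantorLevel N δ) 0

/-- The strict inequality makes the two branch domains disjoint, so a point keeps the same branch at
all levels. -/
theorem mem_cantor_iff (H : Ren N δ R) (hδ : 1 / 2 < δ) {t : ℝ} : t ∈ cantor N δ ↔
    (t ∈ Icc 0 (1 - δ) ∧ N * t ∈ cantor N δ) ∨ (t ∈ Icc δ 1 ∧ N * (t - δ) ∈ cantor N δ) := by
  have hδ1 := H.lt_one
  constructor
  · intro h
    have hk : ∀ k, t ∈ cantorLevel N δ k := mem_iInter.1 h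
    rcases hk 1 with h1 | h1
    · refine Or.inl ⟨h1.1, mem_iInter.2 fun k => ?_⟩
      rcases hk (k + 1) with h2 | h2
      · exact h2.2
      · linarith [h1.1.2, h2.1.1]
    · refine Or.inr ⟨h1.1, mem_iInter.2 fun k => ?_⟩
      rcases hk (k + 1) with h2 | h2
      · linarith [h1.1.1, h2.1.2]
      · exact h2.2
  · intro h
    refine mem_iInter.2 fun k => ?_
    cases k with
    | zero =>
      rcases h with h | h
      · exact ⟨h.1.1, by linarith [h.1.2]⟩
      · exact ⟨by linarith [h.1.1], h.1.2⟩
    | succ k =>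
      rcases h with h | h
      · exact Or.inl ⟨h.1, mem_iInter.1 h.2 k⟩
      · exact Or.inr ⟨h.1, mem_iInter.1 h.2 k⟩

theorem shrink_mem (H : Ren N δ R) {z : ℝ} (hz : z ∈ Icc (0 : ℝ) 1) :
    z * (1 - δ) ∈ Icc 0 (1 - δ) := by
  have hδ1 := H.lt_one
  exact ⟨mul_nonneg hz.1 (by linarith), by nlinarith [hz.2]⟩

theorem cantor_left (H : Ren N δ R) (hδ : 1 / 2 < δ) {z : ℝ} (hz : z ∈ cantor N δ) :
    z * (1 - δ) ∈ cantor N δ :=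
  (H.mem_cantor_iff hδ).2 (Or.inl ⟨H.shrink_mem (cantor_subset _ _ hz), by rwa [H.mul_cancel]⟩)

theorem cantor_right (H : Ren N δ R) (hδ : 1 / 2 < δ) {z : ℝ} (hz : z ∈ cantor N δ) :
    z * (1 - δ) + δ ∈ cantor N δ := by
  have h := H.shrink_mem (cantor_subset _ _ hz)
  exact (H.mem_cantor_iff hδ).2 (Or.inr ⟨⟨by linarith [h.1], by linarith [h.2]⟩, by
    rwa [add_sub_cancel_right, H.mul_cancel]⟩)

theorem zero_mem_cantor (H : Ren N δ R) : (0 : ℝ) ∈ cantor N δ := by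
  have hδ1 := H.lt_one
  refine mem_iInter.2 fun k => ?_
  induction k with
  | zero => exact ⟨le_rfl, zero_le_one⟩
  | succ k ih => exact Or.inl ⟨⟨le_rfl, by linarith⟩, by rwa [mul_zero]⟩

theorem one_mem_cantor (H : Ren N δ R) : (1 : ℝ) ∈ cantor N δ := by
  have hδ1 := H.lt_one
  refine mem_iInter.2 fun k => ?_
  induction k with
  | zero => exact ⟨zero_le_one, le_rfl⟩
  | succ k ih => exact Or.inr ⟨⟨hδ1.le, le_rfl⟩, by rwa [H.mul_one_sub]⟩

theorem cantor_infinite (H : Ren N δ R) (hδ : 1 / 2 < δ) : (cantor N δ).Infinite := by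
  have hδ1 := H.lt_one
  have hmem : ∀ k : ℕ, (1 - δ) ^ k ∈ cantor N δ := by
    intro k
    induction k with
    | zero => rw [pow_zero]; exact H.one_mem_cantor
    | succ k ih => rw [pow_succ]; exact H.cantor_left hδ ih
  refine infinite_of_injective_forall_mem (f := fun k : ℕ => (1 - δ) ^ k) ?_ hmem
  exact (pow_right_strictAnti₀ (by linarith) (by linarith)).injective

/-- Without strip pairs, adjacent points of the Cantor set are equivalent. -/
theorem rel_of_cantor_hole (H : Ren N δ R) (hδ : 1 / 2 < δ) (hno : ∀ x y, ¬ StripPair δ R x y)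
    {s t : ℝ} (hs : s ∈ cantor N δ) (ht : t ∈ cantor N δ) (hst : s < t)
    (hh : ∀ z ∈ cantor N δ, z ≤ s ∨ t ≤ z) : R s t := by
  have hN := H.two_le
  have hδ1 := H.lt_one
  have h1δ := H.cantor_left hδ H.one_mem_cantor
  have hδm := H.cantor_right hδ H.zero_mem_cantor
  rw [one_mul] at h1δ
  rw [zero_mul, zero_add] at hδm
  have key : ∀ n : ℕ, ∀ s ∈ cantor N δ, ∀ t ∈ cantor N δ, s < t →
      (∀ z ∈ cantor N δ, z ≤ s ∨ t ≤ z) → 1 < 2 ^ n * (t - s) → R s t := by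
    intro n
    induction n with
    | zero =>
      intro s hs t ht hst _ h
      rw [pow_zero, one_mul] at h
      linarith [(cantor_subset _ _ hs).1, (cantor_subset _ _ ht).2]
    | succ n ih =>
      intro s hs t ht hst hh hlen
      have hgrow : 1 < 2 ^ n * (N * (t - s)) := by
        have : 2 ^ (n + 1) * (t - s) = 2 ^ n * (2 * (t - s)) := by ring
        rw [this] at hlen
        refine hlen.trans_le (mul_le_mul_of_nonneg_left ?_ (by positivity))
        exact mul_le_mul_of_nonneg_right hN (by linarith)
      rcases (H.mem_cantor_iff hδ).1 hs with ⟨s1, s2⟩ | ⟨s1, s2⟩ <;>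
        rcases (H.mem_cantor_iff hδ).1 ht with ⟨t1, t2⟩ | ⟨t1, t2⟩
      · have hR := ih _ s2 _ t2 (mul_lt_mul_of_pos_left hst (by linarith)) (fun z hz => by
          rcases hh _ (H.cantor_left hδ hz) with h | h
          · left; rwa [← H.mul_le_iff]
          · right; rwa [← H.le_mul_iff]) (by rw [← mul_sub]; exact hgrow)
        -- The wrong preimage would be a strip pair, which does not exist, or one of the two
        -- boundary chords, which do not fit the hole.
        rcases H.pull s1 t1 hR with h | h
        · exact h
        rcases H.strip_cases h s1.1 s1.2 (by linarith [t1.1]) (by linarith [t1.2]) with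
          h | ⟨rfl, h⟩ | ⟨rfl, h⟩
        · exact absurd h (hno _ _)
        · have := hh _ (H.cantor_left hδ h1δ)
          rcases this with h | h <;> nlinarith
        · linarith [s1.1]
      · rcases hh _ h1δ with h | h
        · rcases hh _ hδm with h' | h'
          · linarith [s1.2]
          · rw [le_antisymm s1.2 h, le_antisymm h' t1.1]; exact H.rel_inner
        · linarith [t1.1]
      · linarith [s1.1, t1.2]
      · have hR := ih _ s2 _ t2 (mul_lt_mul_of_pos_left (by linarith) (by linarith))
          (fun z hz => by
          rcases hh _ (H.cantor_right hδ hz) with h | h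
          · left; rw [← H.mul_le_iff]; linarith
          · right; rw [← H.le_mul_iff]; linarith) (by
            rw [← mul_sub]
            rwa [show t - δ - (s - δ) = t - s by ring])
        rcases H.pull ⟨by linarith [s1.1], by linarith [s1.2]⟩
          ⟨by linarith [t1.1], by linarith [t1.2]⟩ hR with h | h
        · have := H.add h
          rwa [sub_add_cancel, sub_add_cancel] at this
        rw [sub_add_cancel] at h
        rcases H.strip_cases h (by linarith [s1.1]) (by linarith [s1.2]) t1.1 t1.2 with
          h | ⟨h, rfl⟩ | ⟨h, rfl⟩
        · exact absurd h (hno _ _)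
        · have := hh _ (H.cantor_right hδ h1δ)
          rcases this with h | h <;> nlinarith
        · linarith [t1.1]
  obtain ⟨n, hn⟩ := pow_unbounded_of_one_lt (1 / (t - s)) (by norm_num : (1 : ℝ) < 2)
  rw [div_lt_iff₀ (by linarith)] at hn
  exact key n s hs t ht hst hh hn

/-- Without strip pairs, equivalent pairs do not separate the Cantor set. -/
theorem cantor_not_crosses (H : Ren N δ R) (hδ : 1 / 2 < δ) (hno : ∀ x y, ¬ StripPair δ R x y)
    {x y s : ℝ} (hx : 0 ≤ x) (hy : y ≤ 1) (hR : R x y) (hs : s ∈ cantor N δ)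
    (hxs : x < s) (hsy : s < y) : x = 0 ∧ y = 1 := by
  have hN := H.two_le
  have hδ1 := H.lt_one
  have key : ∀ n : ℕ, ∀ x y s : ℝ, 0 ≤ x → y ≤ 1 → R x y → s ∈ cantor N δ → x < s → s < y →
      1 < 2 ^ n * (y - x) → x = 0 ∧ y = 1 := by
    intro n
    induction n with
    | zero =>
      intro x y s hx hy _ _ _ _ h
      rw [pow_zero, one_mul] at h
      linarith
    | succ n ih =>
      intro x y s hx hy hR hs hxs hsy hlen
      have hgrow : 1 < 2 ^ n * (N * (y - x)) := by
        have : 2 ^ (n + 1) * (y - x) = 2 ^ n * (2 * (y - x)) := by ring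
        rw [this] at hlen
        refine hlen.trans_le (mul_le_mul_of_nonneg_left ?_ (by positivity))
        exact mul_le_mul_of_nonneg_right hN (by linarith)
      -- A pair with one end in the middle would be linked with the inner edge and thus stay in the
      -- middle, which contains no point of the Cantor set in its interior. So a crossing pair lies
      -- in one branch and expands.
      have hxm : x ≤ 1 - δ ∨ δ ≤ x := by
        by_contra hcon
        push Not at hcon
        rcases (H.mem_cantor_iff hδ).1 hs with ⟨s1, s2⟩ | ⟨s1, s2⟩
        · linarith [s1.2]
        · have := H.linked (by linarith) hcon.1 hcon.2 (by linarith [s1.1]) hy H.rel_inner hR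
          have := SemiModel.mem_of_rel_inner H (by linarith) hy (H.trans this hR)
          linarith [this.2, s1.1]
      have hym : y ≤ 1 - δ ∨ δ ≤ y := by
        by_contra hcon
        push Not at hcon
        rcases (H.mem_cantor_iff hδ).1 hs with ⟨s1, s2⟩ | ⟨s1, s2⟩
        · have := H.linked hx (by linarith [s1.2]) hcon.1 hcon.2 (by linarith) hR H.rel_inner
          have := SemiModel.mem_of_rel_inner H hx (by linarith) (H.symm this)
          linarith [this.1, s1.2]
        · linarith [s1.1]
      rcases hym with hym | hym
      · obtain ⟨s1, s2⟩ | ⟨s1, s2⟩ := (H.mem_cantor_iff hδ).1 hs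
        · have m1 := mul_lt_mul_of_pos_left hxs (by linarith : 0 < N)
          have m2 := mul_lt_mul_of_pos_left hsy (by linarith : 0 < N)
          have m3 := mul_le_mul_of_nonneg_left hym (by linarith : 0 ≤ N)
          rw [H.mul_one_sub] at m3
          obtain ⟨e1, e2⟩ := ih (N * x) (N * y) (N * s) (by positivity) m3 (H.mul hR) s2 m1 m2
            (by rw [← mul_sub]; exact hgrow)
          have e1 : x = 0 := by
            rcases mul_eq_zero.1 e1 with h | h
            · linarith
            · exact h
          rw [e1] at hR
          rcases H.eq_of_rel_zero (by linarith) hy hR with h | h <;> linarith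
        · linarith [s1.1]
      rcases hxm with hxm | hxm
      · rcases H.strip_cases hR hx hxm hym hy with h | h | ⟨h1, h2⟩
        · exact absurd h (hno _ _)
        · exact h
        · rcases (H.mem_cantor_iff hδ).1 hs with ⟨s1, s2⟩ | ⟨s1, s2⟩
          · linarith [s1.2]
          · linarith [s1.1]
      · obtain ⟨s1, s2⟩ | ⟨s1, s2⟩ := (H.mem_cantor_iff hδ).1 hs
        · linarith [s1.2]
        · have m1 := mul_lt_mul_of_pos_left (by linarith : x - δ < s - δ) (by linarith : 0 < N)
          have m2 := mul_lt_mul_of_pos_left (by linarith : s - δ < y - δ) (by linarith : 0 < N)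
          have m3 := mul_le_mul_of_nonneg_left (by linarith : y - δ ≤ 1 - δ) (by linarith : 0 ≤ N)
          rw [H.mul_one_sub] at m3
          obtain ⟨e1, e2⟩ := ih (N * (x - δ)) (N * (y - δ)) (N * (s - δ))
            (mul_nonneg (by linarith) (by linarith)) m3 (H.mul_both hR) s2 m1 m2
            (by rw [← mul_sub]; rwa [show y - δ - (x - δ) = y - x by ring])
          have e2 : y = 1 := by
            have := H.mul_one_sub
            have := mul_left_cancel₀ (by linarith : N ≠ 0) (e2.trans this.symm)
            linarith
          rw [e2] at hR
          rcases H.eq_of_rel_one hx (by linarith) hR with h | h <;> linarith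
  obtain ⟨n, hn⟩ := pow_unbounded_of_one_lt (1 / (y - x)) (by norm_num : (1 : ℝ) < 2)
  rw [div_lt_iff₀ (by linarith)] at hn
  exact key n x y s hx hy hR hs hxs hsy hn

end Ren

namespace Cycle

variable {r : Setoid UnitAddCircle} {q : ℕ} {a κ : ℝ}

theorem half_lt_halfTurn (C : Cycle r q a κ) (hκ : κ < 1 / 2) : 1 / 2 < halfTurn q := by
  have h1 := C.kap
  have h2 := mul_one_sub q
  have h3 := C.kap_pos
  have h4 : (2 : ℝ) < 2 ^ q := by nlinarith
  nlinarith

theorem image_cantor (C : Cycle r q a κ) (hκ : κ < 1 / 2) {i : ℕ} (hi : 1 ≤ i) :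
    (sigma 2)^[i] '' place q a κ (cantor (2 ^ q) (halfTurn q)) =
      place i a κ (cantor (2 ^ q) (halfTurn q)) := by
  have hδ := C.half_lt_halfTurn hκ
  rw [C.place_eq_emb, image_image]
  ext p
  constructor
  · rintro ⟨t, ht, rfl⟩
    dsimp only
    rw [sigma_iterate_coe]
    rcases (C.ren.mem_cantor_iff hδ).1 ht with h | h
    · rw [arc_mul]; exact ⟨_, h.2, rfl⟩
    · rw [C.arc_mul_sub' hi]; exact ⟨_, h.2, rfl⟩
  · rintro ⟨s, hs, rfl⟩
    refine ⟨_, C.ren.cantor_left hδ hs, ?_⟩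
    dsimp only
    rw [sigma_iterate_coe, arc_mul, C.ren.mul_cancel]

theorem exists_place_cantor (C : Cycle r q a κ) (hκ : κ < 1 / 2) (i : ℕ) : ∃ j, 1 ≤ j ∧ j ≤ q ∧
    (sigma 2)^[i] '' place q a κ (cantor (2 ^ q) (halfTurn q)) =
      place j a κ (cantor (2 ^ q) (halfTurn q)) := by
  have hq := C.pos
  induction i with
  | zero => exact ⟨q, C.pos, le_rfl, by simp⟩
  | succ i ih =>
    obtain ⟨j, h1, h2, h3⟩ := ih
    rcases h2.eq_or_lt with rfl | h2
    · refine ⟨1, le_rfl, hq, ?_⟩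
      rw [Function.iterate_succ', image_comp, h3]
      exact C.image_cantor hκ le_rfl
    · refine ⟨j + 1, by omega, h2, ?_⟩
      rw [Function.iterate_succ', image_comp, h3]
      exact image_place j 1 a κ _

theorem width_lt_one (C : Cycle r q a κ) (hκ : κ < 1 / 2) {i : ℕ} (hiq : i ≤ q) :
    2 ^ i * κ * (1 - 0) < 1 := by
  have := C.width_le hiq
  linarith

theorem isFatouGapBasis_cantor (C : Cycle r q a κ) (hκ : κ < 1 / 2)
    (hno : ∀ x y, ¬ StripPair (halfTurn q) (Cycle.rel r q a κ) x y) {i : ℕ} (hi : 1 ≤ i)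
    (hiq : i ≤ q) : IsFatouGapBasis r (place i a κ (cantor (2 ^ q) (halfTurn q))) := by
  have H := C.ren
  have hδ := C.half_lt_halfTurn hκ
  have hδ1 := H.lt_one
  constructor
  · have hm := H.cantor_left hδ H.one_mem_cantor
    rw [one_mul] at hm
    refine C.isGapBasis_place hi hiq (Ren.isCompact_cantor _ _) (Ren.cantor_subset _ _) le_rfl
      le_rfl H.zero_mem_cantor H.one_mem_cantor hm (by linarith) (by linarith)
      (C.width_lt_one hκ hiq) H.zero_one
      (fun s hs t ht hst hh => H.rel_of_cantor_hole hδ hno hs ht hst hh) ?_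
    intro x y hx hxy hy hR s hs hxs hsy t ht
    obtain ⟨rfl, rfl⟩ := H.cantor_not_crosses hδ hno hx hy hR hs hxs hsy
    exact Ren.cantor_subset _ _ ht
  · refine (H.cantor_infinite hδ).image fun s hs t ht h => ?_
    have hs := Ren.cantor_subset _ _ hs
    have ht := Ren.cantor_subset _ _ ht
    have hw := C.width_pos i
    have hl := C.width_lt_one hκ hiq
    have := coe_inj_of_lt h (by nlinarith [hs.1, hs.2, ht.1, ht.2])
      (by nlinarith [hs.1, hs.2, ht.1, ht.2])
    exact mul_left_cancel₀ hw.ne' (by linarith)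

theorem isHole_cantor (C : Cycle r q a κ) (hκ : κ < 1 / 2) {i : ℕ} (hiq : i ≤ q) :
    IsHole (place i a κ (cantor (2 ^ q) (halfTurn q))) (2 ^ i * (a + κ) : ℝ) (2 ^ i * a : ℝ) := by
  refine (isHole_affine_iff (Ren.cantor_subset _ _) C.ren.zero_mem_cantor C.ren.one_mem_cantor
    zero_lt_one (C.width_pos i) (C.width_lt_one hκ hiq)).2 (Or.inr ?_)
  constructor <;> congr 1 <;> ring

/-- Without strip pairs, there is a cycle of Fatou gaps attached to the edges. -/
theorem hasAttachedFatouCycle (C : Cycle r q a κ) (hκ : κ < 1 / 2)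
    (hno : ∀ x y, ¬ StripPair (halfTurn q) (Cycle.rel r q a κ) x y) {g : Set UnitAddCircle}
    (hg : ∀ i, 1 ≤ i → i ≤ q → HoleLift g (2 ^ i * a) (2 ^ i * (a + κ)))
    (hg' : ∀ s t, HoleLift g s t → ∃ i, 1 ≤ i ∧ i ≤ q ∧
      (s : UnitAddCircle) = (2 ^ i * a : ℝ) ∧ (t : UnitAddCircle) = (2 ^ i * (a + κ) : ℝ)) :
    HasAttachedFatouCycle 2 r g := by
  refine ⟨place q a κ (cantor (2 ^ q) (halfTurn q)), q, C.pos, C.image_cantor hκ C.pos,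
    fun i => ?_, fun i => ?_, fun x y h => ?_⟩
  · obtain ⟨j, h1, h2, h3⟩ := C.exists_place_cantor hκ i
    rw [h3]
    exact C.isFatouGapBasis_cantor hκ hno h1 h2
  · obtain ⟨j, h1, h2, h3⟩ := C.exists_place_cantor hκ i
    rw [h3]
    exact ⟨_, _, (hg j h1 h2).isHole, C.isHole_cantor hκ h2⟩
  · obtain ⟨s, t, h1, h2, rfl, rfl⟩ := h.exists_lift
    obtain ⟨i, hi, hiq, e1, e2⟩ := hg' s t (HoleLift.of_isHole h1 h2 h)
    refine ⟨i, ?_⟩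
    rw [C.image_cantor hκ hi, e1, e2]
    exact C.isHole_cantor hκ hiq

end Cycle

/-! ### Strip pairs accumulate on the edge, and what excludes them -/

namespace Ren

variable {N δ : ℝ} {R : ℝ → ℝ → Prop}

/-- If there are strip pairs, then there are strip pairs close to the edge. -/
theorem exists_long_stripPair (H : Ren N δ R) {x y : ℝ} (hS : StripPair δ R x y) {ε : ℝ}
    (hε : 0 < ε) : ∃ x y, StripPair δ R x y ∧ 1 - ε < y - x := by
  by_contra hcon
  push Not at hcon
  have hN := H.two_le
  have hm := H.mul_one_sub
  have hδ := H.half_le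
  have hδ1 := H.lt_one
  set K := ((Icc 0 (1 - δ) ×ˢ Icc δ 1) ∩ {p : ℝ × ℝ | R p.1 p.2}) ∩
    {p : ℝ × ℝ | p.2 - p.1 ≤ 1 - ε}
  have hKc : IsCompact K := H.isCompact_pairs.inter_right
    (isClosed_le (by fun_prop) continuous_const)
  have hK : ∀ c d, StripPair δ R c d → (c, d) ∈ K := fun c d h =>
    ⟨⟨⟨⟨h.pos.le, h.lt_left.le⟩, h.lt_right.le, h.lt_one.le⟩, h.rel⟩, hcon c d h⟩
  obtain ⟨⟨x₁, y₁⟩, ⟨⟨⟨hx, hy⟩, hxy⟩, hle⟩, hmax⟩ := hKc.exists_isMaxOn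
    (f := fun p : ℝ × ℝ => p.2 - p.1) ⟨(x, y), hK x y hS⟩ (by fun_prop)
  replace hx : x₁ ∈ Icc 0 (1 - δ) := hx
  replace hy : y₁ ∈ Icc δ 1 := hy
  replace hxy : R x₁ y₁ := hxy
  replace hle : y₁ - x₁ ≤ 1 - ε := hle
  have hmax' : ∀ c d, StripPair δ R c d → d - c ≤ y₁ - x₁ := fun c d h => hmax (hK c d h)
  -- A strip pair or its half turn image has length at least `δ`, so the longest one does too.
  have hlong : δ ≤ y₁ - x₁ := by
    have h1 := hmax' _ _ hS
    have h2 := hmax' _ _ (StripPair.sib H hS)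
    linarith
  have hp : StripPair δ R x₁ y₁ := by
    rcases H.strip_cases hxy hx.1 hx.2 hy.1 hy.2 with h | ⟨e1, e2⟩ | ⟨e1, e2⟩
    · exact h
    · linarith
    · linarith
  obtain ⟨p0, p1, p2, p3, -⟩ := hp
  have hx01 : x₁ ∈ Icc (0 : ℝ) 1 := ⟨by linarith, by linarith⟩
  have hy01 : y₁ ∈ Icc (0 : ℝ) 1 := ⟨by linarith, by linarith⟩
  have ax : x₁ * (1 - δ) < x₁ := by nlinarith
  have ax0 : 0 < x₁ * (1 - δ) := mul_pos p0 (by linarith)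
  have ay : y₁ < y₁ * (1 - δ) + δ := by nlinarith
  have ay1 : y₁ * (1 - δ) + δ < 1 := by nlinarith
  have bxy : x₁ * (1 - δ) < y₁ * (1 - δ) := by nlinarith
  have left : ¬ R (x₁ * (1 - δ)) y₁ := fun h => by
    have := hmax' _ _ ⟨ax0, by linarith, p2, p3, h⟩
    linarith
  have right : ¬ R x₁ (y₁ * (1 - δ) + δ) := fun h => by
    have := hmax' _ _ ⟨p0, p1, by linarith, ay1, h⟩
    linarith
  -- Pulling the longest pair back through both branches gives a longer strip pair. If the pullback
  -- joins points of the same branch, it or its half turn image is linked with the longest pair and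
  -- again gives a longer one.
  rcases H.pull (H.shrink_mem hx01) (H.shrink_mem hy01)
    (by rw [H.mul_cancel, H.mul_cancel]; exact hxy) with h | h
  · have h' := H.add h
    rcases lt_or_ge x₁ (y₁ * (1 - δ)) with hl | hl
    · exact left (H.trans (H.linked ax0.le ax hl (by nlinarith) p3.le h hxy) hxy)
    · have hl' : x₁ * (1 - δ) + δ < y₁ := by
        have e : N * (y₁ * (1 - δ)) = y₁ := H.mul_cancel _
        nlinarith
      exact right (H.trans (H.linked p0.le (by linarith) hl' ay ay1.le hxy h') h')
  · have := hmax' _ _ ⟨ax0, by linarith, by linarith, ay1, h⟩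
    linarith

end Ren

namespace Cycle

variable {r : Setoid UnitAddCircle} {q : ℕ} {a κ : ℝ}

theorem emb_notMem (C : Cycle r q a κ) {g : Set UnitAddCircle}
    (hg : HoleLift g (2 ^ q * a) (2 ^ q * (a + κ))) {t : ℝ} (h0 : 0 < t) (h1 : t < 1) :
    ((emb q a κ t : ℝ) : UnitAddCircle) ∉ g := by
  rw [← C.coe_arc]
  have hw := C.width_pos q
  have m1 := mul_pos hw h0
  have m2 := mul_lt_mul_of_pos_left h1 hw
  exact hg.no _ (by linarith) (by linarith)

/-- If the invariant class is the only periodic rotational set, then there are no strip pairs. -/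
theorem not_stripPair (C : Cycle r q a κ) {g : Set UnitAddCircle}
    (hg : HoleLift g (2 ^ q * a) (2 ^ q * (a + κ)))
    (hrot : ∀ A, IsPeriodicRotationalGapOrLeaf 2 r A → A = g) (x y : ℝ) :
    ¬ StripPair (halfTurn q) (Cycle.rel r q a κ) x y := by
  intro hS
  have hδ := C.ren.half_le
  rcases C.ren.exists_invariant_or_siegel ⟨x, y, hS⟩ with ⟨z, h0, h1, hz⟩ | ⟨u, τ, F, Ψ, M, hF⟩
  · obtain ⟨h2, h3, -, -⟩ := C.isRotationalSet_cls h0 h1 hz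
    refine C.emb_notMem hg h0 (by linarith) ?_
    rw [← hrot _ ⟨h3, q, h2⟩]
    exact r.refl' _
  · refine C.emb_notMem hg M.pos (by linarith [M.lt_left]) ?_
    rw [← hrot _ ⟨Or.inl (C.isGapBasis_siegel M hF), q, C.isPeriodicLaminational_siegel M,
      Or.inr (C.isSiegel M)⟩, C.place_eq_emb]
    exact ⟨u, M.left_mem_siegel, rfl⟩

/-- A Fatou gap attached to the long edge excludes strip pairs. -/
theorem not_stripPair_of_isFatouGapBasis (C : Cycle r q a κ) (hκ : κ < 1 / 2)
    {W : Set UnitAddCircle} (hW : IsFatouGapBasis r W)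
    (hh : IsHole W (2 ^ q * (a + κ) : ℝ) (2 ^ q * a : ℝ)) (x y : ℝ) :
    ¬ StripPair (halfTurn q) (Cycle.rel r q a κ) x y := by
  intro hS
  have hw := C.width_pos q
  have hw1 := C.width_lt_one hκ (le_refl q)
  have hlift : HoleLift W (2 ^ q * (a + κ)) (2 ^ q * a + 1) := by
    refine HoleLift.of_isHole (by linarith) (by linarith) ?_
    rwa [coe_add_one]
  obtain ⟨p, hpW, hp⟩ := hW.2.exists_notMem_finite
    (toFinite {((2 ^ q * a : ℝ) : UnitAddCircle), ((2 ^ q * (a + κ) : ℝ) : UnitAddCircle)})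
  simp only [mem_insert_iff, mem_singleton_iff, not_or] at hp
  obtain ⟨z, hz1, hz2, rfl⟩ := exists_lift_of_ne hp.1
  have hz3 : z < 2 ^ q * (a + κ) := by
    by_contra hcon
    rcases (not_lt.1 hcon).eq_or_lt with e | e
    · exact hp.2 (by rw [e])
    · exact hlift.no z e hz2 hpW
  obtain ⟨t, ht⟩ : ∃ t, t = (z - 2 ^ q * a) / (2 ^ q * κ) := ⟨_, rfl⟩
  have ht0 : 0 < t := by rw [ht]; exact div_pos (by linarith) hw
  have ht1 : t < 1 := by rw [ht, div_lt_one hw]; linarith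
  have hzt : ((z : ℝ) : UnitAddCircle) = (emb q a κ t : ℝ) := by
    rw [← C.coe_arc]
    congr 1
    rw [arc_eq, ht, mul_div_cancel₀ _ hw.ne']; ring
  -- The gap has a further point behind the edge. A strip pair close enough to the edge separates
  -- that point from an endpoint of the edge, and so crosses the gap.
  obtain ⟨x, y, hxy, hlen⟩ := C.ren.exists_long_stripPair hS
    (lt_min ht0 (by linarith : 0 < 1 - t))
  have l1 := min_le_left t (1 - t)
  have l2 := min_le_right t (1 - t)
  have hδ := C.ren.half_le
  have hδ1 := C.ren.lt_one
  obtain ⟨p0, p1, p2, p3, hR⟩ := hxy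
  have e1 := C.emb_lt (by linarith : x < y)
  have e2 : emb q a κ y < emb q a κ x + 1 := by
    have := C.emb_sub_le (by linarith : x ≤ y)
    linarith
  refine hW.not_crosses (fun x => C.inv.finite_cls x) (coe_ne_of_lt e1 e2) hR
    ((crosses_coe_iff e1 e2).2 ⟨⟨_, C.emb_lt (by linarith : x < t), C.emb_lt (by linarith), ?_⟩,
      emb q a κ 1, C.emb_lt p3, ?_, ?_⟩)
  · rw [← hzt]; exact hpW
  · have := C.emb_sub_le (by linarith : x ≤ 1)
    linarith
  · rw [← C.coe_arc, mul_one]; exact hh.1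

/-- A point outside of the invariant class lies on an arc of the cycle. -/
theorem exists_arc (C : Cycle r q a κ) {g : Set UnitAddCircle} (hcl : IsClosed g)
    (hnt : g.Nontrivial) (hg : ∀ i, 1 ≤ i → i ≤ q → HoleLift g (2 ^ i * a) (2 ^ i * (a + κ)))
    (hg' : ∀ s t, HoleLift g s t → ∃ i, 1 ≤ i ∧ i ≤ q ∧
      (s : UnitAddCircle) = (2 ^ i * a : ℝ) ∧ (t : UnitAddCircle) = (2 ^ i * (a + κ) : ℝ))
    {p : UnitAddCircle} (hp : p ∉ g) : ∃ i, 1 ≤ i ∧ i ≤ q ∧ ∃ t : ℝ, 0 < t ∧ t < 1 ∧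
      p = (2 ^ i * (a + κ * t) : ℝ) := by
  obtain ⟨x, -, -, rfl⟩ := exists_lift p 0
  obtain ⟨s, t, h1, h2, h3, h4, h5, h6⟩ := exists_hole_of_notMem hcl hnt hp
  have hst : HoleLift g s t := ⟨by linarith, h3, h4, h5, h6⟩
  obtain ⟨i, hi, hiq, e, -⟩ := hg' s t hst
  obtain ⟨n, hn1, hn2⟩ := hst.right_unique (hg i hi hiq) e
  have hw := C.width_pos i
  refine ⟨i, hi, hiq, (x - s) / (2 ^ i * κ), div_pos (by linarith) hw, ?_, ?_⟩
  · rw [div_lt_one hw]; linarith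
  · rw [arc_eq, mul_div_cancel₀ _ hw.ne', hn1, ← coe_add_int x n]
    congr 1; ring

end Cycle

/-! ### Uniqueness for a finite invariant class -/

namespace Cycle

variable {r s : Setoid UnitAddCircle} {q : ℕ} {a κ : ℝ}

theorem middle_of_mem (C : Cycle r q a κ) {x y : ℝ} (hy : y ∈ Icc (0 : ℝ) 1)
    (hR : Cycle.rel r q a κ x y) (h1 : 1 - halfTurn q < x)
    (h2 : x < halfTurn q) : y ∈ Icc (1 - halfTurn q) (halfTurn q) := by
  have H := C.ren
  have hδ := H.half_le
  rcases lt_or_ge y (1 - halfTurn q) with hl | hl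
  · refine SemiModel.mem_of_rel_inner H hy.1 hy.2 (H.symm ?_)
    exact H.linked hy.1 hl h1 h2 H.lt_one.le (H.symm hR) H.rel_inner
  rcases lt_or_ge (halfTurn q) y with hr | hr
  · refine SemiModel.mem_of_rel_inner H hy.1 hy.2 ?_
    exact H.trans (H.linked (by linarith [H.lt_one]) h1 h2 hr hy.2 H.rel_inner hR) hR
  · exact ⟨hl, hr⟩

/-- A pair in the middle of the long arc is the half turn image of a pair in the invariant class or
in a shorter arc of the cycle, in which it is at least twice as long. -/
theorem exists_arc_of_middle (C : Cycle r q a κ) {g : Set UnitAddCircle} (hgc : g ∈ r.classes)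
    (hnt : g.Nontrivial) (hg : ∀ i, 1 ≤ i → i ≤ q → HoleLift g (2 ^ i * a) (2 ^ i * (a + κ)))
    (hg' : ∀ s t, HoleLift g s t → ∃ i, 1 ≤ i ∧ i ≤ q ∧
      (s : UnitAddCircle) = (2 ^ i * a : ℝ) ∧ (t : UnitAddCircle) = (2 ^ i * (a + κ) : ℝ))
    {x y : ℝ} (hx : x ∈ Icc (1 - halfTurn q) (halfTurn q))
    (hy : y ∈ Icc (1 - halfTurn q) (halfTurn q)) (hxy : x < y) (hR : Cycle.rel r q a κ x y) :
    (((emb q a κ x + 1 / 2 : ℝ) : UnitAddCircle) ∈ g ∧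
      ((emb q a κ y + 1 / 2 : ℝ) : UnitAddCircle) ∈ g) ∨
    ∃ i, 1 ≤ i ∧ i ≤ q ∧ ∃ t t' : ℝ, 0 < t ∧ t' < 1 ∧ 2 * (y - x) ≤ t' - t ∧
      ((emb q a κ x + 1 / 2 : ℝ) : UnitAddCircle) = (2 ^ i * (a + κ * t) : ℝ) ∧
      ((emb q a κ y + 1 / 2 : ℝ) : UnitAddCircle) = (2 ^ i * (a + κ * t') : ℝ) := by
  have H := C.ren
  have hδ := H.half_le
  have hk := C.kap_pos
  have hN := C.two_le
  have hrel : r ((emb q a κ x + 1 / 2 : ℝ) : UnitAddCircle) (emb q a κ y + 1 / 2 : ℝ) :=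
    C.inv.rel_add_half hR
  by_cases hmem : ((emb q a κ x + 1 / 2 : ℝ) : UnitAddCircle) ∈ g
  · left
    refine ⟨hmem, ?_⟩
    rw [eq_cls_of_mem_classes hgc hmem]
    exact hrel
  right
  have hκδ : (κ + 1 / 2) * (2 * halfTurn q) = 1 := by
    have := mul_delta q
    rw [← C.mul_kap]
    linear_combination 2 * κ * this + 2 * C.kap
  have hx1 : 1 - halfTurn q < x := by
    refine lt_of_le_of_ne hx.1 fun e => hmem ?_
    rw [← C.emb_add_delta, ← e, sub_add_cancel, ← C.coe_arc, mul_one]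
    exact (hg q C.pos le_rfl).right
  have hx2 : x < halfTurn q := by
    refine lt_of_le_of_ne hx.2 fun e => hmem ?_
    have : ((emb q a κ x + 1 / 2 : ℝ) : UnitAddCircle) = (emb q a κ 0 : ℝ) := by
      rw [← coe_add_one (emb q a κ 0), e, C.emb_eq, C.emb_eq]
      congr 1
      linear_combination hκδ / 2
    rw [this, ← C.coe_arc, mul_zero, add_zero]
    exact (hg q C.pos le_rfl).left
  obtain ⟨i, hi, hiq, t, t0, t1, ht⟩ := C.exists_arc (C.inv.finite g hgc).isClosed hnt hg hg' hmem
  rw [ht] at hrel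
  obtain ⟨t', t0', t1', ht'⟩ := C.stay i hi hiq t t0 t1 _ hrel
  refine ⟨i, hi, hiq, t, t', t0, t1', ?_, ht, ht'⟩
  rw [coe_eq_iff] at ht ht'
  obtain ⟨n, hn⟩ := ht
  obtain ⟨m, hm⟩ := ht'
  rw [C.emb_eq] at hn hm
  -- The half turn carries the middle of the long arc out of that arc, so the arc that receives it
  -- is a shorter one, of at most half the width.
  have hiq' : i < q := by
    refine lt_of_le_of_ne hiq fun e => ?_
    subst e
    obtain ⟨l, hl⟩ := C.per
    rw [arc_eq, C.mul_kap, hl] at hn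
    have e : (κ + 1 / 2) * (x + halfTurn i - t) = l - n := by linear_combination hκδ / 2 - hn
    have b1 : 0 < (κ + 1 / 2) * (x + halfTurn i - t) := mul_pos (by linarith) (by linarith)
    have b2 : (κ + 1 / 2) * (x + halfTurn i - t) < 1 :=
      (mul_lt_mul_of_pos_left (by linarith) (by linarith)).trans_eq hκδ
    rw [e] at b1 b2
    have c1 : 0 < l - n := by exact_mod_cast b1
    have c2 : l - n < 1 := by exact_mod_cast b2
    omega
  have hlt := C.kap_lt_of_lt hiq' hi
  have hw := C.width_pos i
  have e : 2 ^ i * κ * (t' - t) = (κ + 1 / 2) * (y - x) + (m - n) := by linear_combination hm - hn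
  have b1 : (κ + 1 / 2) * (y - x) < 1 / 2 := by
    have : (κ + 1 / 2) * (y - x) ≤ (κ + 1 / 2) * (2 * halfTurn q - 1) :=
      mul_le_mul_of_nonneg_left (by linarith [hx.1, hy.2]) (by linarith)
    linarith
  have b0 : 0 < (κ + 1 / 2) * (y - x) := mul_pos (by linarith) (by linarith)
  have b2 : 2 ^ i * κ * (t' - t) < 1 / 2 := by nlinarith
  have b3 : -(1 / 2) < 2 ^ i * κ * (t' - t) := by nlinarith
  have c1 : ((m - n : ℤ) : ℝ) < 1 := by push_cast; linarith
  have c2 : (-1 : ℝ) < ((m - n : ℤ) : ℝ) := by push_cast; linarith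
  have d1 : m - n < 1 := by exact_mod_cast c1
  have d2 : -1 < m - n := by exact_mod_cast c2
  have d3 : m = n := by omega
  rw [d3, sub_self, add_zero] at e
  have hpow : 2 * (2 ^ i * κ) ≤ κ + 1 / 2 := by
    rw [← C.mul_kap, ← mul_assoc, ← pow_succ']
    exact mul_le_mul_of_nonneg_right (pow_le_pow_right₀ (by norm_num) hiq') hk.le
  have hfin : 2 ^ i * κ * (2 * (y - x)) ≤ 2 ^ i * κ * (t' - t) := by
    rw [e]
    have := mul_le_mul_of_nonneg_right hpow (by linarith : 0 ≤ y - x)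
    linarith
  exact le_of_mul_le_mul_left hfin hw

/-- Without strip pairs, the relation is determined by the invariant class. -/
theorem rel_of_rel (Cr : Cycle r q a κ) (Cs : Cycle s q a κ) {g : Set UnitAddCircle}
    (hgr : g ∈ r.classes) (hgs : g ∈ s.classes) (hnt : g.Nontrivial)
    (hg : ∀ i, 1 ≤ i → i ≤ q → HoleLift g (2 ^ i * a) (2 ^ i * (a + κ)))
    (hg' : ∀ s t, HoleLift g s t → ∃ i, 1 ≤ i ∧ i ≤ q ∧
      (s : UnitAddCircle) = (2 ^ i * a : ℝ) ∧ (t : UnitAddCircle) = (2 ^ i * (a + κ) : ℝ))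
    (hnor : ∀ x y, ¬ StripPair (halfTurn q) (Cycle.rel r q a κ) x y)
    (hnos : ∀ x y, ¬ StripPair (halfTurn q) (Cycle.rel s q a κ) x y)
    {x y : ℝ} (hx : 0 ≤ x) (hxy : x < y) (hy : y ≤ 1) (hR : Cycle.rel r q a κ x y) :
    Cycle.rel s q a κ x y := by
  have Hr := Cr.ren
  have Hs := Cs.ren
  have hδ := Hr.half_le
  have hδ1 := Hr.lt_one
  have hN := Cr.two_le
  have hm := mul_one_sub q
  -- Each reduction, by a branch of the return map or by the half turn into a shorter arc, at least
  -- doubles the coordinate length. The result transfers back because the wrong preimage would be a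
  -- strip pair or a boundary chord.
  have key : ∀ n : ℕ, ∀ x y : ℝ, 0 ≤ x → x < y → y ≤ 1 → Cycle.rel r q a κ x y →
      1 < 2 ^ n * (y - x) → Cycle.rel s q a κ x y := by
    intro n
    induction n with
    | zero =>
      intro x y hx _ hy _ h
      rw [pow_zero, one_mul] at h
      linarith
    | succ n ih =>
      intro x y hx hxy hy hR hlen
      have hgrow : ∀ d : ℝ, 2 * (y - x) ≤ d → 1 < 2 ^ n * d := by
        intro d hd
        have : 2 ^ (n + 1) * (y - x) = 2 ^ n * (2 * (y - x)) := by ring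
        rw [this] at hlen
        exact hlen.trans_le (mul_le_mul_of_nonneg_left hd (by positivity))
      have hmul : 2 * (y - x) ≤ 2 ^ q * (y - x) := mul_le_mul_of_nonneg_right hN (by linarith)
      have hmiddle : x ∈ Icc (1 - halfTurn q) (halfTurn q) →
          y ∈ Icc (1 - halfTurn q) (halfTurn q) → Cycle.rel s q a κ x y := by
        intro hxm hym
        have hhalf : s ((emb q a κ x + 1 / 2 : ℝ) : UnitAddCircle) (emb q a κ y + 1 / 2 : ℝ) := by
          rcases Cr.exists_arc_of_middle hgr hnt hg hg' hxm hym hxy hR with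
            ⟨h1, h2⟩ | ⟨i, hi, hiq, t, t', t0, t1, hl, e1, e2⟩
          · rw [eq_cls_of_mem_classes hgs h1] at h2
            exact h2
          · have ht : t ∈ Icc (0 : ℝ) 1 := ⟨t0.le, by linarith⟩
            have ht' : t' ∈ Icc (0 : ℝ) 1 := ⟨by linarith, t1.le⟩
            have hr := Cr.inv.rel_add_half hR
            rw [e1, e2, Cr.rel_arc_iff hi hiq ht ht'] at hr
            rw [e1, e2, Cs.rel_arc_iff hi hiq ht ht']
            exact ih t t' t0.le (by linarith) t1.le hr (hgrow _ hl)
        have := Cs.inv.rel_add_half hhalf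
        have e : ∀ z : ℝ, ((z + 1 / 2 + 1 / 2 : ℝ) : UnitAddCircle) = z := fun z => by
          rw [← coe_add_one z]; congr 1; ring
        rw [e, e] at this
        exact this
      have hx1 : x ∈ Icc (0 : ℝ) 1 := ⟨hx, by linarith⟩
      have hy1 : y ∈ Icc (0 : ℝ) 1 := ⟨by linarith, hy⟩
      rcases le_or_gt y (1 - halfTurn q) with h1 | h1
      · have m1 := mul_lt_mul_of_pos_left hxy (by linarith : (0 : ℝ) < 2 ^ q)
        have m3 := mul_le_mul_of_nonneg_left h1 (by linarith : (0 : ℝ) ≤ 2 ^ q)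
        rw [hm] at m3
        have := ih _ _ (by positivity) m1 m3 (Hr.mul hR) (by rw [← mul_sub]; exact hgrow _ hmul)
        rcases Hs.pull ⟨hx, by linarith⟩ ⟨by linarith, h1⟩ this with h | h
        · exact h
        rcases Hs.strip_cases h hx (by linarith) (by linarith) (by linarith) with
          h | ⟨e1, e2⟩ | ⟨e1, e2⟩
        · exact absurd h (hnos _ _)
        · rw [e1] at hR
          rcases Hr.eq_of_rel_zero (by linarith) hy hR with h | h <;> linarith
        · linarith
      rcases lt_or_ge y (halfTurn q) with h2 | h2
      · exact hmiddle (Cr.middle_of_mem hx1 (Hr.symm hR) h1 h2) ⟨h1.le, h2.le⟩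
      rcases le_or_gt x (1 - halfTurn q) with h3 | h3
      · rcases Hr.strip_cases hR hx h3 h2 hy with h | ⟨rfl, rfl⟩ | ⟨rfl, rfl⟩
        · exact absurd h (hnor _ _)
        · exact Hs.zero_one
        · exact Hs.rel_inner
      rcases lt_or_ge x (halfTurn q) with h4 | h4
      · exact hmiddle ⟨h3.le, h4.le⟩ (Cr.middle_of_mem hy1 hR h3 h4)
      · have m1 := mul_lt_mul_of_pos_left (by linarith : x - halfTurn q < y - halfTurn q)
          (by linarith : (0 : ℝ) < 2 ^ q)
        have m3 := mul_le_mul_of_nonneg_left (by linarith : y - halfTurn q ≤ 1 - halfTurn q)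
          (by linarith : (0 : ℝ) ≤ 2 ^ q)
        rw [hm] at m3
        have := ih _ _ (mul_nonneg (by linarith) (by linarith)) m1 m3 (Hr.mul_both hR) (by
          rw [← mul_sub, show y - halfTurn q - (x - halfTurn q) = y - x by ring]
          exact hgrow _ hmul)
        rcases Hs.pull ⟨by linarith, by linarith⟩ ⟨by linarith, by linarith⟩ this with h | h
        · have := Hs.add h
          rwa [sub_add_cancel, sub_add_cancel] at this
        rw [sub_add_cancel] at h
        rcases Hs.strip_cases h (by linarith) (by linarith) h2 hy with
          h | ⟨e1, e2⟩ | ⟨e1, e2⟩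
        · exact absurd h (hnos _ _)
        · rw [e2] at hR
          rcases Hr.eq_of_rel_one hx (by linarith) hR with h | h <;> linarith
        · linarith
  obtain ⟨n, hn⟩ := pow_unbounded_of_one_lt (1 / (y - x)) (by norm_num : (1 : ℝ) < 2)
  rw [div_lt_iff₀ (by linarith)] at hn
  exact key n x y hx hxy hy hR hn

theorem le_of_not_stripPair (Cr : Cycle r q a κ) (Cs : Cycle s q a κ) {g : Set UnitAddCircle}
    (hgr : g ∈ r.classes) (hgs : g ∈ s.classes) (hnt : g.Nontrivial)
    (hg : ∀ i, 1 ≤ i → i ≤ q → HoleLift g (2 ^ i * a) (2 ^ i * (a + κ)))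
    (hg' : ∀ s t, HoleLift g s t → ∃ i, 1 ≤ i ∧ i ≤ q ∧
      (s : UnitAddCircle) = (2 ^ i * a : ℝ) ∧ (t : UnitAddCircle) = (2 ^ i * (a + κ) : ℝ))
    (hnor : ∀ x y, ¬ StripPair (halfTurn q) (Cycle.rel r q a κ) x y)
    (hnos : ∀ x y, ¬ StripPair (halfTurn q) (Cycle.rel s q a κ) x y) : r ≤ s := by
  intro x y hxy
  by_cases hx : x ∈ g
  · have hy : y ∈ g := by rw [eq_cls_of_mem_classes hgr hx]; exact hxy
    rw [eq_cls_of_mem_classes hgs hx] at hy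
    exact hy
  obtain ⟨i, hi, hiq, t, t0, t1, rfl⟩ := Cr.exists_arc (Cr.inv.finite g hgr).isClosed hnt hg hg' hx
  obtain ⟨t', t0', t1', rfl⟩ := Cr.stay i hi hiq t t0 t1 _ hxy
  have ht : t ∈ Icc (0 : ℝ) 1 := ⟨t0.le, t1.le⟩
  have ht' : t' ∈ Icc (0 : ℝ) 1 := ⟨t0'.le, t1'.le⟩
  have hR := (Cr.rel_arc_iff hi hiq ht ht').1 hxy
  refine (Cs.rel_arc_iff hi hiq ht ht').2 ?_
  rcases lt_trichotomy t t' with h | h | h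
  · exact Cr.rel_of_rel Cs hgr hgs hnt hg hg' hnor hnos t0.le h t1'.le hR
  · rw [h]; exact s.refl' _
  · exact s.symm' (Cr.rel_of_rel Cs hgr hgs hnt hg hg' hnor hnos t0'.le h t1.le (r.symm' hR))

theorem coe_mul_per (C : Cycle r q a κ) (j : ℕ) :
    ((2 ^ (q * j) * a : ℝ) : UnitAddCircle) = a := by
  obtain ⟨n, hn⟩ := C.per
  induction j with
  | zero => simp
  | succ j ih =>
    rw [Nat.mul_succ, pow_add, mul_assoc, ← sigma_iterate_coe, hn, coe_add_int,
      sigma_iterate_coe, ih]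

end Cycle

namespace IsInvariantLamination

variable {s : Setoid UnitAddCircle}

/-- A non-trivial finite invariant set whose adjacent points are equivalent is a class. -/
theorem mem_classes_of_invariant (hs : IsInvariantLamination 2 s) {g : Set UnitAddCircle}
    (hfin : g.Finite) (hnt : g.Nontrivial) (hgg : sigma 2 '' g = g)
    (hh : ∀ x y, IsHole g x y → s x y) : g ∈ s.classes := by
  obtain ⟨p, hp⟩ := hnt.nonempty
  obtain ⟨x, -, -, rfl⟩ := exists_lift p 0
  set K := cls s (x : UnitAddCircle) with hK
  have hgK : g ⊆ K := by
    intro y hy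
    obtain ⟨y, hy1, hy2, rfl⟩ := exists_lift y x
    set L : Set ℝ := {z | z ∈ Icc x y ∧ (z : UnitAddCircle) ∈ g ∧ (z : UnitAddCircle) ∈ K} with hL
    have hLfin : L.Finite := by
      refine Set.Finite.of_finite_image (f := ((↑) : ℝ → UnitAddCircle)) (hfin.subset ?_) ?_
      · rintro _ ⟨z, hz, rfl⟩; exact hz.2.1
      · intro z hz w hw h
        exact coe_inj_of_lt h (by linarith [hz.1.2, hw.1.1]) (by linarith [hz.1.1, hw.1.2])
    obtain ⟨t, ht, hmax⟩ := Set.exists_max_image L id hLfin ⟨x, ⟨le_rfl, hy1⟩, hp, s.refl' _⟩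
    -- The class of `x` is followed along successive holes of `g`; stopping before `y` is impossible
    -- because the next endpoint is equivalent.
    rcases ht.1.2.eq_or_lt with e | hlt
    · rw [← e]; exact ht.2.2
    exfalso
    obtain ⟨t', h1, h2, h3, h4⟩ := exists_hole_left hfin hnt t
    have hle : t' ≤ y := by
      by_contra hcon
      exact h4 y hlt (not_le.1 hcon) hy
    have hrel := hh _ _ (HoleLift.isHole ⟨h1, h2, ht.2.1, h3, h4⟩)
    have := hmax t' ⟨⟨by linarith [ht.1.1], hle⟩, h3, s.trans' ht.2.2 hrel⟩
    simp only [id] at this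
    linarith
  have hKc : K ∈ s.classes := cls_mem_classes _ _
  have hKK : sigma 2 '' K = K := by
    have : sigma 2 (x : UnitAddCircle) ∈ K := hgK (hgg ▸ ⟨_, hp, rfl⟩)
    rw [hK, hs.image_cls, ← cls_eq_of_rel this]
  have hKnt : K.Nontrivial := hnt.mono hgK
  have hKfin := hs.finite K hKc
  obtain ⟨q, a, κ, hC, -, -, hall⟩ := hs.exists_cycle hKc hKK hKnt
  have C := hC s hs hKc
  have horb : ∀ y ∈ K, ∃ i : ℕ, y = (2 ^ i * a : ℝ) := by
    intro y hy
    obtain ⟨y, -, -, rfl⟩ := exists_lift y 0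
    obtain ⟨t, h1, h2, h3, h4⟩ := exists_hole_left hKfin hKnt y
    obtain ⟨i, -, -, e, -⟩ := hall y t ⟨h1, h2, hy, h3, h4⟩
    exact ⟨i, e⟩
  have hiter : ∀ j : ℕ, (sigma 2)^[j] (x : UnitAddCircle) ∈ g := by
    intro j
    induction j with
    | zero => exact hp
    | succ j ih =>
      rw [Function.iterate_succ_apply', ← hgg]
      exact ⟨_, ih, rfl⟩
  have hKg : K ⊆ g := by
    intro y hy
    obtain ⟨i, hi⟩ := horb y hy
    obtain ⟨j, hj⟩ := horb x (s.refl' _)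
    -- Every point of the class lies on the periodic orbit of `a`, as does `x`; the exponent is
    -- chosen so that moving `x` on by this many steps completes full periods and ends at `y`.
    have := hiter (i + (q * j - j))
    rw [hj, sigma_iterate_coe, ← mul_assoc, ← pow_add] at this
    have hq : j ≤ q * j := Nat.le_mul_of_pos_left j C.pos
    rw [show i + (q * j - j) + j = i + q * j by omega, pow_add, mul_assoc, ← sigma_iterate_coe,
      C.coe_mul_per, sigma_iterate_coe, ← hi] at this
    exact this
  rw [hgK.antisymm hKg]
  exact hKc

end IsInvariantLamination

/-- A finite invariant class that is the only periodic rotational set carries an attached cycle of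
Fatou gaps, and determines the lamination. -/
theorem IsInvariantLamination.isCanonicalLamination_of_finite {r : Setoid UnitAddCircle}
    (hr : IsInvariantLamination 2 r) {g : Set UnitAddCircle} (hg : g ∈ r.classes)
    (hgg : sigma 2 '' g = g) (hnt : g.Nontrivial)
    (hrot : ∀ A, IsPeriodicRotationalGapOrLeaf 2 r A → A = g) : IsCanonicalLamination r g := by
  have hfin := hr.finite g hg
  obtain ⟨q, a, κ, hC, hκ, hhole, hall⟩ := hr.exists_cycle hg hgg hnt
  have Cr := hC r hr hg
  have hnor := Cr.not_stripPair (hhole q Cr.pos le_rfl) hrot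
  refine ⟨hr, ⟨fun _ => Cr.hasAttachedFatouCycle hκ hnor hhole hall, fun h => absurd hfin h⟩, ?_⟩
  intro s hs hcar
  obtain ⟨V, n, -, -, hV, -, hatt⟩ := hcar.1 hfin
  -- The attached gaps make adjacent points of `g` equivalent for `s`, so `g` is one of its classes
  -- and both laminations share the same cycle of arcs.
  have hgs : g ∈ s.classes := by
    refine hs.mem_classes_of_invariant hfin hnt hgg fun x y h => ?_
    obtain ⟨i, hi⟩ := hatt x y h
    exact s.symm' ((hV i).1.rel_of_isHole hs.toIsLamination hi)
  have Cs := hC s hs hgs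
  obtain ⟨i, hi⟩ := hatt _ _ (hhole q Cr.pos le_rfl).isHole
  have hnos := Cs.not_stripPair_of_isFatouGapBasis hκ (hV i) hi
  exact le_antisymm (Cs.le_of_not_stripPair Cr hgs hg hnt hhole hall hnos hnor)
    (Cr.le_of_not_stripPair Cs hg hgs hnt hhole hall hnor hnos)

/-! ### Uniqueness for a Siegel gap -/

/-- An infinite invariant laminational set that lies in a half circle and contains its end
points. -/
structure HalfSet (A : Set UnitAddCircle) (u : ℝ) : Prop where
  isLam : IsPeriodicLaminational 2 1 A
  inf : A.Infinite
  left : (u : UnitAddCircle) ∈ A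
  right : ((u + 1 / 2 : ℝ) : UnitAddCircle) ∈ A
  sub : A ⊆ (fun t : ℝ => (t : UnitAddCircle)) '' Icc u (u + 1 / 2)

namespace HalfSet

variable {A : Set UnitAddCircle} {u : ℝ}

theorem le_of_mem (h : HalfSet A u) {z : ℝ} (h0 : u ≤ z) (h1 : z < u + 1)
    (hz : (z : UnitAddCircle) ∈ A) : z ≤ u + 1 / 2 := by
  obtain ⟨w, hw, e⟩ := h.sub hz
  have := coe_inj_of_lt (x := w) (y := z) e (by linarith [hw.2]) (by linarith [hw.1])
  linarith [hw.2]

theorem exists_mem_inner (h : HalfSet A u) : ∃ z : ℝ, u < z ∧ z < u + 1 / 2 ∧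
    (z : UnitAddCircle) ∈ A := by
  obtain ⟨p, hpA, hp⟩ := h.inf.exists_notMem_finite
    (toFinite {(u : UnitAddCircle), ((u + 1 / 2 : ℝ) : UnitAddCircle)})
  simp only [mem_insert_iff, mem_singleton_iff, not_or] at hp
  obtain ⟨z, hz, rfl⟩ := h.sub hpA
  dsimp only at hp hpA
  exact ⟨z, lt_of_le_of_ne hz.1 fun e => hp.1 (by rw [e]),
    lt_of_le_of_ne hz.2 fun e => hp.2 (by rw [e]), hpA⟩

/-- Up to translation, a hole lies in the half circle, or it is the complementary half circle. -/
theorem hole_cases (h : HalfSet A u) {s t : ℝ} (hst : HoleLift A s t) : ∃ n : ℤ,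
    (u ≤ s - n ∧ t - n ≤ u + 1 / 2 ∧ t - s < 1 / 2) ∨ (s - n = u + 1 / 2 ∧ t - n = u + 1) := by
  obtain ⟨n, hn1, hn2⟩ : ∃ n : ℤ, u ≤ s - n ∧ s - n < u + 1 :=
    ⟨⌊s - u⌋, by linarith [Int.floor_le (s - u)], by linarith [Int.lt_floor_add_one (s - u)]⟩
  have hh := hst.sub_int n
  have h1 := hh.lt
  have hle := h.le_of_mem hn1 hn2 hh.left
  refine ⟨n, ?_⟩
  rcases hle.eq_or_lt with e | hlt
  · right
    refine ⟨e, ?_⟩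
    have hu1 : ((u + 1 : ℝ) : UnitAddCircle) ∈ A := by rw [coe_add_one]; exact h.left
    rcases lt_trichotomy (t - n) (u + 1) with hl | hl | hl
    · linarith [h.le_of_mem (by linarith) hl hh.right]
    · exact hl
    · exact absurd hu1 (hh.no _ (by linarith) hl)
  · left
    have ht : t - n ≤ u + 1 / 2 := by
      by_contra hcon
      exact hh.no _ hlt (not_le.1 hcon) h.right
    refine ⟨hn1, ht, ?_⟩
    by_contra hcon
    obtain ⟨z, z1, z2, hz⟩ := h.exists_mem_inner
    exact hh.no z (by linarith) (by linarith) hz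

theorem length_le (h : HalfSet A u) {s t : ℝ} (hst : HoleLift A s t) : t - s ≤ 1 / 2 := by
  obtain ⟨n, ⟨-, -, h1⟩ | ⟨h1, h2⟩⟩ := h.hole_cases hst <;> linarith

theorem holeLift_two_mul (h : HalfSet A u) {s t : ℝ} (hst : HoleLift A s t)
    (hlt : t - s < 1 / 2) : HoleLift A (2 * s) (2 * t) := by
  have h1 := hst.lt
  have := h.isLam.holes 0 s t (by simpa using hst.isHole)
  rw [h.isLam.periodic, sigma_coe, sigma_coe] at this
  refine HoleLift.of_isHole (by linarith) (by linarith) (this.resolve_left ?_)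
  exact coe_ne_of_lt (by linarith) (by linarith)

theorem exists_holeLift (h : HalfSet A u) {x y : ℝ} (hxy : x < y)
    (hno : ∀ z : ℝ, x < z → z < y → (z : UnitAddCircle) ∉ A) :
    ∃ s t, HoleLift A s t ∧ s ≤ x ∧ y ≤ t := by
  obtain ⟨s, t, h1, h2, h3, h4, h5, h6⟩ := exists_hole_of_notMem h.isLam.closed h.inf.nontrivial
    (hno ((x + y) / 2) (by linarith) (by linarith))
  refine ⟨s, t, ⟨by linarith, h3, h4, h5, h6⟩, ?_, ?_⟩
  · by_contra hcon
    exact hno s (not_le.1 hcon) (by linarith) h4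
  · by_contra hcon
    exact hno t (by linarith) (not_le.1 hcon) h5

variable {r s : Setoid UnitAddCircle}

theorem coe_add_half_add_half (z : ℝ) : ((z + 1 / 2 + 1 / 2 : ℝ) : UnitAddCircle) = z := by
  rw [← coe_add_one z]; congr 1; ring

/-- The half turn image of a pair in the long hole lies in a short hole. -/
theorem exists_short_hole (h : HalfSet A u) (hr : IsInvariantLamination 2 r)
    (hA : IsFatouGapBasis r A) {a b : ℝ} (hab : HoleLift A a b) (hlen : b - a = 1 / 2) {x y : ℝ}
    (hx : a ≤ x) (hy : y ≤ b) (hxy : x < y) (hlt : y - x < 1 / 2) (hR : r (x : UnitAddCircle) y) :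
    ∃ a' b', HoleLift A a' b' ∧ b' - a' < 1 / 2 ∧ a' ≤ x + 1 / 2 ∧ y + 1 / 2 ≤ b' := by
  obtain ⟨n, h1 | ⟨h1, h2⟩⟩ := h.hole_cases hab
  · linarith
  have hc := hA.not_crosses (fun x => hr.finite_cls x)
    (coe_ne_of_lt (by linarith : x + 1 / 2 < y + 1 / 2) (by linarith)) (hr.rel_add_half hR)
  rw [crosses_coe_iff (by linarith) (by linarith)] at hc
  have hl : ((u + n + 1 : ℝ) : UnitAddCircle) ∈ A := by
    rw [coe_add_one, coe_add_int]; exact h.left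
  have hl' : ((u + n + 1 + 1 : ℝ) : UnitAddCircle) ∈ A := by rw [coe_add_one]; exact hl
  have hr' : ((u + n + 1 + 1 / 2 : ℝ) : UnitAddCircle) ∈ A := by
    have := h.right
    rw [← coe_add_int _ (n + 1)] at this
    push_cast at this
    rwa [show u + n + 1 + 1 / 2 = u + 1 / 2 + (n + 1) by ring]
  have hout : ∃ z : ℝ, y + 1 / 2 < z ∧ z < x + 1 / 2 + 1 ∧ (z : UnitAddCircle) ∈ A := by
    rcases lt_or_ge (y + 1 / 2) (u + n + 1 + 1 / 2) with hl1 | hl1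
    · exact ⟨_, hl1, by linarith, hr'⟩
    · exact ⟨_, by linarith, by linarith, hl'⟩
  -- The half turn puts the pair into the half circle of the gap. It does not cross the gap, so it
  -- lies over a single hole, which cannot be the complementary half circle.
  obtain ⟨a', b', h3, h4, h5⟩ := h.exists_holeLift (by linarith : x + 1 / 2 < y + 1 / 2)
    fun z z1 z2 hz => hc ⟨⟨z, z1, z2, hz⟩, hout⟩
  refine ⟨a', b', h3, ?_, h4, h5⟩
  obtain ⟨m, ⟨-, -, h6⟩ | ⟨h6, h7⟩⟩ := h.hole_cases h3
  · exact h6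
  · exfalso
    have e1 : (m : ℝ) < n + 1 := by linarith
    have e2 : (n : ℝ) < m := by linarith
    have e3 : m < n + 1 := by exact_mod_cast e1
    have e4 : n < m := by exact_mod_cast e2
    omega

/-- Pairs with equivalent images in a short hole are equivalent. -/
theorem rel_of_rel_two_mul (hs : IsInvariantLamination 2 s)
    (huv : s (u : UnitAddCircle) (u + 1 / 2 : ℝ)) {x y : ℝ} (hx : u ≤ x) (hy : y ≤ u + 1 / 2)
    (hxy : x < y) (hR : s (2 * x : ℝ) (2 * y : ℝ)) : s (x : UnitAddCircle) y := by
  rcases hs.rel_or_rel_of_two_mul hR with h1 | h1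
  · exact h1
  have h2 := hs.rel_add_half h1
  rw [coe_add_half_add_half] at h2
  have hux : s (u : UnitAddCircle) x := by
    rcases hx.eq_or_lt with e | hx
    · rw [e]
    rcases hy.eq_or_lt with e | hy
    · rw [e, coe_add_half_add_half] at h1
      exact s.symm' h1
    · exact hs.trans_of_linked hx (by linarith) (by linarith) (by linarith) huv h1
  exact s.trans' (s.symm' hux) (s.trans' huv (s.trans' (hs.rel_add_half hux) h2))

theorem rel_of_holeLift (hs : IsInvariantLamination 2 s)
    (hA : IsGapBasis s A) {a b x y : ℝ} (hab : HoleLift A a b) (hlen : b - a = 1 / 2) (hx : a ≤ x)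
    (hy : y ≤ b) (hxy : 1 / 2 ≤ y - x) : s (x : UnitAddCircle) y := by
  rw [show x = a by linarith, show y = b by linarith]
  exact hA.rel_of_isHole hs.toIsLamination hab.isHole

/-- A pair over a short hole is doubled. When the image hole is the complementary half circle, the
image pair is either the diameter itself or is brought back over a short hole by the half turn; its
length has doubled, so the induction ends. -/
theorem rel_of_rel_short (h : HalfSet A u) (hr : IsInvariantLamination 2 r)
    (hs : IsInvariantLamination 2 s) (hAr : IsFatouGapBasis r A) (hAs : IsGapBasis s A) {a b : ℝ}
    (hab : HoleLift A a b) (hlen : b - a < 1 / 2) {x y : ℝ} (hx : a ≤ x) (hy : y ≤ b)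
    (hxy : x < y) (hR : r (x : UnitAddCircle) y) : s (x : UnitAddCircle) y := by
  have huv : s (u : UnitAddCircle) (u + 1 / 2 : ℝ) := by
    have hh : HoleLift A (u + 1 / 2) (u + 1) := by
      refine ⟨by linarith, by linarith, h.right, by rw [coe_add_one]; exact h.left, ?_⟩
      intro z h1 h2 hz
      linarith [h.le_of_mem (by linarith) h2 hz]
    have := hAs.rel_of_isHole hs.toIsLamination hh.isHole
    rw [coe_add_one] at this
    exact s.symm' this
  have key : ∀ n : ℕ, ∀ a b x y : ℝ, HoleLift A a b → b - a < 1 / 2 → a ≤ x → y ≤ b → x < y →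
      r (x : UnitAddCircle) y → 1 < 2 ^ n * (y - x) → s (x : UnitAddCircle) y := by
    intro n
    induction n with
    | zero =>
      intro a b x y _ _ _ _ _ _ hn
      rw [pow_zero, one_mul] at hn
      linarith
    | succ n ih =>
      intro a b x y hab hlen hx hy hxy hR hn
      have hn' : 1 < 2 ^ n * (2 * y - 2 * x) := by
        have : 2 ^ (n + 1) * (y - x) = 2 ^ n * (2 * y - 2 * x) := by ring
        rwa [this] at hn
      have hd := h.holeLift_two_mul hab hlen
      have h2 : s (2 * x : ℝ) (2 * y : ℝ) := by
        rcases (h.length_le hd).lt_or_eq with hl | hl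
        · exact ih _ _ _ _ hd hl (by linarith) (by linarith) (by linarith) (hr.rel_two_mul hR) hn'
        rcases lt_or_ge (2 * y - 2 * x) (1 / 2) with hl' | hl'
        · obtain ⟨a', b', h3, h4, h5, h6⟩ := h.exists_short_hole hr hAr hd hl
            (by linarith : 2 * a ≤ 2 * x) (by linarith : 2 * y ≤ 2 * b) (by linarith) hl'
            (hr.rel_two_mul hR)
          have := hs.rel_add_half (ih _ _ _ _ h3 h4 h5 h6 (by linarith)
            (hr.rel_add_half (hr.rel_two_mul hR)) (by
              rwa [show 2 * y + 1 / 2 - (2 * x + 1 / 2) = 2 * y - 2 * x by ring]))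
          rwa [coe_add_half_add_half, coe_add_half_add_half] at this
        · exact rel_of_holeLift hs hAs hd hl (by linarith) (by linarith) hl'
      obtain ⟨m, ⟨c1, c2, -⟩ | ⟨c1, c2⟩⟩ := h.hole_cases hab
      · have e : ∀ z : ℝ, ((2 * (z - m) : ℝ) : UnitAddCircle) = (2 * z : ℝ) := fun z => by
          rw [← coe_add_int (2 * (z - m)) (2 * m)]
          congr 1; push_cast; ring
        have e' : ∀ z : ℝ, ((z - m : ℝ) : UnitAddCircle) = z := fun z => by
          rw [← coe_add_int (z - m) m, sub_add_cancel]
        have := rel_of_rel_two_mul hs huv (x := x - m) (y := y - m) (by linarith) (by linarith)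
          (by linarith) (by rw [e, e]; exact h2)
        rwa [e', e'] at this
      · linarith
  obtain ⟨n, hn⟩ := pow_unbounded_of_one_lt (1 / (y - x)) (by norm_num : (1 : ℝ) < 2)
  rw [div_lt_iff₀ (by linarith)] at hn
  exact key n a b x y hab hlen hx hy hxy hR hn

theorem rel_of_rel (h : HalfSet A u) (hr : IsInvariantLamination 2 r)
    (hs : IsInvariantLamination 2 s) (hAr : IsFatouGapBasis r A) (hAs : IsGapBasis s A) {x y : ℝ}
    (hxy : x < y) (hR : r (x : UnitAddCircle) y)
    (hno : ∀ z : ℝ, x < z → z < y → (z : UnitAddCircle) ∉ A) : s (x : UnitAddCircle) y := by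
  obtain ⟨a, b, hab, hx, hy⟩ := h.exists_holeLift hxy hno
  rcases (h.length_le hab).lt_or_eq with hl | hl
  · exact h.rel_of_rel_short hr hs hAr hAs hab hl hx hy hxy hR
  rcases lt_or_ge (y - x) (1 / 2) with hl' | hl'
  · obtain ⟨a', b', h3, h4, h5, h6⟩ := h.exists_short_hole hr hAr hab hl hx hy hxy hl' hR
    have := hs.rel_add_half (h.rel_of_rel_short hr hs hAr hAs h3 h4 h5 h6 (by linarith)
      (hr.rel_add_half hR))
    rwa [coe_add_half_add_half, coe_add_half_add_half] at this
  · exact rel_of_holeLift hs hAs hab hl hx hy hl'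

/-- A lamination with a given Siegel gap is determined by the gap. -/
theorem le_of_isFatouGapBasis (h : HalfSet A u) (hr : IsInvariantLamination 2 r)
    (hs : IsInvariantLamination 2 s) (hAr : IsFatouGapBasis r A) (hAs : IsGapBasis s A) :
    r ≤ s := by
  intro p p' hR
  by_cases hne : p = p'
  · rw [hne]
  obtain ⟨x, -, -, rfl⟩ := exists_lift p 0
  obtain ⟨y, h1, h2, rfl⟩ := exists_lift_of_ne (Ne.symm hne)
  have hc := hAr.not_crosses (fun x => hr.finite_cls x) hne hR
  rw [crosses_coe_iff h1 h2] at hc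
  by_cases hin : ∃ z : ℝ, x < z ∧ z < y ∧ (z : UnitAddCircle) ∈ A
  · have := h.rel_of_rel hr hs hAr hAs h2 (by rw [coe_add_one]; exact r.symm' hR)
      fun z z1 z2 hz => hc ⟨hin, z, z1, z2, hz⟩
    rw [coe_add_one] at this
    exact s.symm' this
  · exact h.rel_of_rel hr hs hAr hAs h1 hR fun z z1 z2 hz => hin ⟨z, z1, z2, hz⟩

end HalfSet

/-- A Siegel gap in the renormalization at the fixed point determines the lamination. -/
theorem Cycle.isCanonicalLamination_siegel {r : Setoid UnitAddCircle} {u τ : ℝ}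
    {F Ψ : CircleDeg1Lift} (C : Cycle r 1 0 (1 / 2)) (M : SemiModel (2 ^ 1) (halfTurn 1) u τ F Ψ)
    (hF : Frame (2 ^ 1) (halfTurn 1) (Cycle.rel r 1 0 (1 / 2)) u (u + halfTurn 1)) :
    IsCanonicalLamination r (Cycle.place 1 0 (1 / 2) (SemiModel.siegel (halfTurn 1) u Ψ)) := by
  have hgap := C.isGapBasis_siegel M hF
  have hS := C.isSiegel M
  have hlam := C.isPeriodicLaminational_siegel M
  have hset : Cycle.place 1 0 (1 / 2) (SemiModel.siegel (halfTurn 1) u Ψ) =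
      (fun t : ℝ => (t : UnitAddCircle)) '' SemiModel.siegel (halfTurn 1) u Ψ := by
    rw [C.place_eq_emb]
    simp only [IsInvariantLamination.emb_one]
  have hhalf : HalfSet (Cycle.place 1 0 (1 / 2) (SemiModel.siegel (halfTurn 1) u Ψ)) u := by
    refine ⟨hlam, hS.1, ?_, ?_, ?_⟩
    · rw [hset]; exact ⟨_, M.left_mem_siegel, rfl⟩
    · rw [hset, ← IsInvariantLamination.halfTurn_one]; exact ⟨_, M.right_mem_siegel, rfl⟩
    · rw [hset, ← IsInvariantLamination.halfTurn_one]
      exact image_mono inter_subset_left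
  refine ⟨C.inv, ⟨fun h => absurd h hS.1, fun _ => hgap⟩, fun s hs hcar => ?_⟩
  have hgap' := hcar.2 hS.1
  exact le_antisymm (hhalf.le_of_isFatouGapBasis hs C.inv ⟨hgap', hS.1⟩ hgap)
    (hhalf.le_of_isFatouGapBasis C.inv hs ⟨hgap, hS.1⟩ hgap')

/-! ### The dichotomy at the fixed point -/

/-- A non-empty quadratic invariant lamination with at most one periodic rotational gap or leaf is
the canonical lamination of an invariant rotational gap or leaf. -/
theorem IsInvariantLamination.exists_isCanonicalLamination {r : Setoid UnitAddCircle}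
    (hr : IsInvariantLamination 2 r) {x y : UnitAddCircle} (hne : x ≠ y) (hxy : r x y)
    (hrot : ∀ A B : Set UnitAddCircle, IsPeriodicRotationalGapOrLeaf 2 r A →
      IsPeriodicRotationalGapOrLeaf 2 r B → A = B) :
    ∃ A, IsInvariantRotationalGapOrLeaf 2 r A ∧ IsCanonicalLamination r A := by
  have C := hr.cycle_one
  rcases C.ren.exists_invariant_or_siegel (hr.exists_stripPair hne hxy) with
    ⟨z, h0, h1, hz⟩ | ⟨u, τ, F, Ψ, M, hF⟩
  · obtain ⟨h2, h3, h4, -⟩ := C.isRotationalSet_cls h0 h1 hz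
    rw [Function.iterate_one] at h4
    refine ⟨_, ⟨h3, h2⟩, hr.isCanonicalLamination_of_finite (cls_mem_classes _ _) h4 ?_
      fun A hA => hrot _ _ hA ⟨h3, 1, h2⟩⟩
    have hmem : ((emb 1 0 (1 / 2) z : ℝ) : UnitAddCircle) ∈ cls r (emb 1 0 (1 / 2) z : ℝ) :=
      r.refl' _
    -- The class is non-trivial because rotationality leaves no fixed point in it; finiteness rules
    -- out the Siegel alternative.
    rcases h2.2 with h5 | h5
    · refine ⟨_, hmem, _, h4 ▸ mem_image_of_mem (sigma 2) hmem, fun e => h5.2 _ hmem ?_⟩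
      rw [Function.iterate_one, ← e]
    · exact absurd (hr.finite_cls _) h5.1
  · exact ⟨_, ⟨Or.inl (C.isGapBasis_siegel M hF), C.isPeriodicLaminational_siegel M,
      Or.inr (C.isSiegel M)⟩, C.isCanonicalLamination_siegel M hF⟩

end QuadLam

theorem proposition6p1 (r : Setoid UnitAddCircle)
    (hinv : QuadLam.IsInvariantLamination 2 r)
    (hne : ∃ x y : UnitAddCircle, x ≠ y ∧ r x y)
    (hrot : ∀ A B : Set UnitAddCircle,
      QuadLam.IsPeriodicRotationalGapOrLeaf 2 r A →
      QuadLam.IsPeriodicRotationalGapOrLeaf 2 r B → A = B) :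
    ∃ A : Set UnitAddCircle,
      QuadLam.IsInvariantRotationalGapOrLeaf 2 r A ∧ QuadLam.IsCanonicalLamination r A := by
  obtain ⟨x, y, hxy, h⟩ := hne
  exact hinv.exists_isCanonicalLamination hxy h hrot
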